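/- **Setting.** Let $B$ be a smooth surface, $D\subset B$ a finite set, $B_{\mathrm{reg}}=B\setminus D$, $g_B$ a smooth Riemannian metric on $B_{\mathrm{reg}}$ with Riemannian measure $\mu_B$, and $B_0\Subset B_{\mathrm{reg}}$ a precompact open set. For every $t\in(0,t_0]$ let $\Pi_t:X_t\to B_{\mathrm{reg}}$ be a smooth surjective submersion from a smooth Riemannian $4$-manifold $(X_t,g(t))$ with Riemannian measure $\mu_t$, such that $X_{t,0}:=\Pi_t^{-1}(B_0)$ is precompact in $X_t$. *Semi-flat control.* On $X_{t,0}$ there is a product reference metric $g_t^{\Pi}=g_B\oplus g_{F,t}$ with flat $2$-torus fibres $F_{b,t}=\Pi_t^{-1}(b)$: near every point of $B_0$ there are coordinates $U\times(\mathbb R^2/\mathbb Z^2)\cong\Pi_t^{-1}(U)$ over $U$, smooth together with the fibre metric, in which $g_t^\Pi$ is $g_B$ plus a flat metric $h_t(b)$ on $\mathbb R^2/\mathbb Z^2$ depending only on $b$; the directions of $U$ are called horizontal. There are $\varepsilon_t\ge0$ and $s(t)>0$ tending to $0$ as $t\downarrow0$ such that, pointwise on $X_{t,0}$, $|g(t)-g_t^\Pi|_{g_t^\Pi}\le\varepsilon_t$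 (operator norm; in particular this holds if $\|g(t)-g_t^\Pi\|_{C^1(X_{t,0},g_t^\Pi)}\le\varepsilon_t$), and $\operatorname{diam}(F_{b,t},g_{F,t})\le s(t)$ for $b\in B_0$. *Vertical gap.* There is $c>0$ with $\lambda_1(F_{b,t},g_{F,t})\ge c\,s(t)^{-2}$ for all $b\in B_0$ and all $t$, where $\lambda_1$ is the first nonzero eigenvalue of the nonnegative Laplacian of the flat fibre. *Normalized disintegration.* With $\vartheta_{b,t}$ the Haar probability measure of the flat torus $F_{b,t}$, there are positive $C^1$ functions $A_t$ on $B_0$ and $\rho_t$ on $X_{t,0}$ such that $$\int_{X_{t,0}} f\,d\mu_t=\int_{B_0}A_t(b)\Big(\int_{F_{b,t}}f\rho_t\,d\vartheta_{b,t}\Big)d\mu_B(b)\quad(f\in L^1(X_{t,0},\mu_t)),\qquad \int_{F_{b,t}}\rho_t\,d\vartheta_{b,t}=1\quad(b\in B_0),$$ and, with a constant $C$ independent of $t$, each of $\|\rho_t-1\|_\infty$, $\|\nabla_{g_B}\log A_t\|_\infty$, $\|\nabla_B\rho_t\|_\infty$ is at most $C\varepsilon_t$, where $\nabla_B$ is the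 horizontal derivative. Let $L^2$ spaces be complex, and put $$(I_tv)(x)=A_t(\Pi_tx)^{-1/2}v(\Pi_tx),\qquad (P_tu)(b)=A_t(b)^{1/2}\int_{F_{b,t}}u\,\rho_t\,d\vartheta_{b,t}.$$ Let $H_B$ and $H_t$ be the Dirichlet (Friedrichs) realizations of $-\Delta_{g_B}$ on $L^2(B_0,\mu_B)$ and of $-\Delta_{g(t)}$ on $L^2(X_{t,0},\mu_t)$, i.e. the nonnegative self-adjoint operators of the closed forms $\int|\nabla v|^2$ with domains $H^1_0(B_0)$ and $H^1_0(X_{t,0})$. **Theorem.** Then $I_t$ and $P_t$ map between $L^2(B_0,\mu_B)$ and $L^2(X_{t,0},\mu_t)$; the resolvents $(\alpha+H_B)^{-1}$ and $(\alpha+H_t)^{-1}$ exist as bounded operators for every $\alpha>0$; for every $\tau>0$ the operators $e^{-\tau H_B}$ and $e^{-\tau H_t}$ have real symmetric square integrable heat kernels $K_B(\cdot,\cdot;\tau)$ and $K_t(\cdot,\cdot;\tau)$; and: 1. For every $\alpha>0$ and $f\in L^2(B_0)$, $P_t(\alpha+H_t)^{-1}I_tf\to(\alpha+H_B)^{-1}f$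 in $L^2(B_0)$ as $t\downarrow0$. 2. For every $f\in L^2(B_0)$, $P_te^{-\tau H_t}I_tf\to e^{-\tau H_B}f$ in $L^2(B_0)$ as $t\downarrow0$, uniformly for $\tau$ in compact subsets of $(0,\infty)$. 3. For every $\tau>0$ and all $\Phi,\Psi\in L^2(B_0)$, as $t\downarrow0$, $$\iint_{X_{t,0}\times X_{t,0}}K_t(x,y;\tau)(I_t\Phi)(x)(I_t\Psi)(y)\,d\mu_t(x)\,d\mu_t(y)\longrightarrow\iint_{B_0\times B_0}K_B(b,b';\tau)\Phi(b)\Psi(b')\,d\mu_B(b)\,d\mu_B(b').$$ -/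

import Mathlib

open Filter Topology MeasureTheory Set
open scoped Manifold ContDiff ENNReal ComplexConjugate

noncomputable section

namespace SemiFlat

/-- The operator `e^{-τ H}`, `τ > 0`, of a nonnegative self-adjoint operator `H` on a complex
Hilbert space, given its resolvent `R = (1 + H)⁻¹`, by continuous functional calculus. `R` is
bounded and self-adjoint with spectrum in `[0, 1]`, a spectral value `x > 0` of `R` corresponds to
the spectral value `x⁻¹ - 1` of `H`, and `e^{-τ (x⁻¹ - 1)}` extends continuously by `0` to
`x = 0`. -/
def expOfResolvent {E : Type*} [NormedAddCommGroup E] [InnerProductSpace ℂ E] [CompleteSpace E]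
    (R : E →L[ℂ] E) (τ : ℝ) : E →L[ℂ] E :=
  cfc (fun x : ℝ => if x ≤ 0 then 0 else Real.exp (-τ * (x⁻¹ - 1))) R

/-! ### Riemannian measure and Dirichlet Laplacian on a Riemannian manifold -/

section Riemannian

variable {n : ℕ} {M : Type*} [TopologicalSpace M] [ChartedSpace (EuclideanSpace ℝ (Fin n)) M]
  [IsManifold (𝓡 n) ∞ M]

/-- A smooth Riemannian metric on the `n`-manifold `M`. -/
abbrev Metric (n : ℕ) (M : Type*) [TopologicalSpace M]
    [ChartedSpace (EuclideanSpace ℝ (Fin n)) M] [IsManifold (𝓡 n) ∞ M] :=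
  Bundle.ContMDiffRiemannianMetric (𝓡 n) ∞ (EuclideanSpace ℝ (Fin n))
    (fun x : M => TangentSpace (𝓡 n) x)

/-- A basis of the tangent space at `x` (the standard basis of the model space). -/
def frame (x : M) (i : Fin n) : TangentSpace (𝓡 n) x :=
  (EuclideanSpace.single i (1 : ℝ) : EuclideanSpace ℝ (Fin n))

/-- The coordinate vector field `∂_i` of the chart `φ`, at the point with coordinates `y`. -/
def coordVec (φ : OpenPartialHomeomorph M (EuclideanSpace ℝ (Fin n)))
    (y : EuclideanSpace ℝ (Fin n)) (i : Fin n) : TangentSpace (𝓡 n) (φ.symm y) :=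
  mfderiv (𝓡 n) (𝓡 n) φ.symm y (EuclideanSpace.single i (1 : ℝ) : EuclideanSpace ℝ (Fin n))

/-- `√ det (g_{ij})` in the coordinates of the chart `φ`. -/
def volumeDensity (g : Metric n M) (φ : OpenPartialHomeomorph M (EuclideanSpace ℝ (Fin n)))
    (y : EuclideanSpace ℝ (Fin n)) : ℝ :=
  Real.sqrt (Matrix.det (Matrix.of fun i j : Fin n =>
    g.inner (φ.symm y) (coordVec φ y i) (coordVec φ y j)))

/-- The Riemannian measure of `g`. The measures `√ det (g_{ij}) dy` of the charts of the atlas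
agree on overlaps of the chart domains, and the Riemannian measure is the measure obtained by
gluing them, which is their least upper bound. -/
def riemannianMeasure [MeasurableSpace M] (g : Metric n M) : Measure M :=
  ⨆ x : M, Measure.map (chartAt (EuclideanSpace ℝ (Fin n)) x).symm
    ((volume.restrict (chartAt (EuclideanSpace ℝ (Fin n)) x).target).withDensity
      fun y => ENNReal.ofReal (volumeDensity g (chartAt (EuclideanSpace ℝ (Fin n)) x) y))

/-- The Hermitian inner product `⟨a, b⟩_g = ∑ g^{ij} conj(a_i) b_j` of complex covectors at `x`. -/
def covectorInner (g : Metric n M) (x : M) (a b : TangentSpace (𝓡 n) x →L[ℝ] ℂ) : ℂ :=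
  ∑ i : Fin n, ∑ j : Fin n,
    (((Matrix.of fun k l : Fin n => g.inner x (frame x k) (frame x l))⁻¹ i j : ℝ) : ℂ)
      * conj (a (frame x i)) * b (frame x j)

/-- The differential of a complex-valued function. -/
def differential (φ : M → ℂ) (x : M) : TangentSpace (𝓡 n) x →L[ℝ] ℂ :=
  mfderiv (𝓡 n) 𝓘(ℝ, ℂ) φ x

/-- The differential of a real-valued function. -/
def realDifferential (φ : M → ℝ) (x : M) : TangentSpace (𝓡 n) x →L[ℝ] ℝ :=
  mfderiv (𝓡 n) 𝓘(ℝ, ℝ) φ x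

/-- `φ ∈ C_c^∞(U)`. -/
def IsTestFunction (U : Set M) (φ : M → ℂ) : Prop :=
  ContMDiff (𝓡 n) 𝓘(ℝ, ℂ) ∞ φ ∧ HasCompactSupport φ ∧ tsupport φ ⊆ U

variable [MeasurableSpace M]

/-- The Riemannian measure on the open set `U`. -/
abbrev measureOn (g : Metric n M) (U : Set M) : Measure M := (riemannianMeasure g).restrict U

/-- The complex Hilbert space `L²(U, μ_g)`. -/
abbrev L2 (g : Metric n M) (U : Set M) := Lp ℂ 2 (measureOn g U)

/-- The element of `L²` given by a square integrable function (and `0` for other functions). -/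
def toL2 (g : Metric n M) (U : Set M) (f : M → ℂ) : L2 g U :=
  open Classical in if hf : MemLp f 2 (measureOn g U) then hf.toLp f else 0

/-- The Dirichlet energy `∫_U |dφ|²_g dμ_g`. -/
def energy (g : Metric n M) (U : Set M) (φ : M → ℂ) : ℝ≥0∞ :=
  ∫⁻ x, ENNReal.ofReal (covectorInner g x (differential φ x) (differential φ x)).re
    ∂(measureOn g U)

/-- The Dirichlet form `∫_U ⟨dφ, dψ⟩_g dμ_g` on test functions. -/
def dirichletForm (g : Metric n M) (U : Set M) (φ ψ : M → ℂ) : ℂ :=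
  ∫ x, covectorInner g x (differential φ x) (differential ψ x) ∂(measureOn g U)

/-- The sequence `φ` in `C_c^∞(U)` converges to `u` in `L²` and is Cauchy for the Dirichlet
energy, i.e. it converges in the `H¹` norm. The space `H¹₀(U)` consists of the limits `u` of such
sequences. -/
def ApproximatesInH10 (g : Metric n M) (U : Set M) (φ : ℕ → M → ℂ) (u : L2 g U) : Prop :=
  (∀ k, IsTestFunction (n := n) U (φ k)) ∧
  Tendsto (fun k => eLpNorm (fun x => φ k x - u x) 2 (measureOn g U)) atTop (𝓝 0) ∧
  Tendsto (fun p : ℕ × ℕ => energy g U (fun x => φ p.1 x - φ p.2 x)) atTop (𝓝 0)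

/-- The graph of the Dirichlet Laplacian `H = -Δ_g` on `U`, i.e. of the operator associated with
the closure of the Dirichlet form on `C_c^∞(U)`: `u ∈ dom H` and `H u = f` if and only if
`u ∈ H¹₀(U)` and `E(ψ, u) = ⟨ψ, f⟩` for all `ψ ∈ C_c^∞(U)`, where `E(ψ, u)` is the limit of
`E(ψ, φ k)` along test functions `φ k` converging to `u` in `H¹`. -/
def DirichletLaplacian (g : Metric n M) (U : Set M) (u f : L2 g U) : Prop :=
  ∃ φ : ℕ → M → ℂ, ApproximatesInH10 g U φ u ∧
    ∀ ψ : M → ℂ, IsTestFunction (n := n) U ψ →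
      Tendsto (fun k => dirichletForm g U ψ (φ k)) atTop
        (𝓝 (∫ x, conj (ψ x) * f x ∂(measureOn g U)))

/-- `R = (α + H)⁻¹` for the Dirichlet Laplacian `H` of `U`: the vector `R f` is the one and only
solution `u ∈ dom H` of `α u + H u = f`. -/
def IsResolvent (g : Metric n M) (U : Set M) (α : ℝ) (R : L2 g U →L[ℂ] L2 g U) : Prop :=
  ∀ f u : L2 g U, DirichletLaplacian g U u (f - (α : ℂ) • u) ↔ R f = u

/-- The resolvent `(α + H)⁻¹` of the Dirichlet Laplacian `H` of `U`, for `α > 0`. -/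
def resolventOp (g : Metric n M) (U : Set M) (α : ℝ) : L2 g U →L[ℂ] L2 g U :=
  Classical.epsilon (IsResolvent g U α)

/-- The heat operator `e^{-τ H}`, `τ > 0`, of the Dirichlet Laplacian `H` of `U`. -/
def heatOp (g : Metric n M) (U : Set M) (τ : ℝ) : L2 g U →L[ℂ] L2 g U :=
  expOfResolvent (resolventOp g U 1) τ

/-- `K` is a heat kernel of `U` at time `τ`: a real symmetric square integrable integral kernel
of the heat operator `e^{-τ H}`. -/
def IsHeatKernel (g : Metric n M) (U : Set M) (τ : ℝ) (K : M → M → ℝ) : Prop :=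
  (∀ x y, K x y = K y x) ∧
  MemLp (fun p : M × M => K p.1 p.2) 2 ((measureOn g U).prod (measureOn g U)) ∧
  ∀ F G : L2 g U, ∫ x, F x * heatOp g U τ G x ∂(measureOn g U) =
    ∫ p : M × M, (K p.1 p.2 : ℂ) * F p.1 * G p.2 ∂((measureOn g U).prod (measureOn g U))

/-- The pairing `∬ K(x, y) F(x) G(y) dμ_g(x) dμ_g(y)` over `U × U`. -/
def kernelPairing (g : Metric n M) (U : Set M) (K : M → M → ℝ) (F G : L2 g U) : ℂ :=
  ∫ p : M × M, (K p.1 p.2 : ℂ) * F p.1 * G p.2 ∂((measureOn g U).prod (measureOn g U))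

end Riemannian

/-! ### Flat tori `ℝ² / ℤ²` -/

/-- The plane `ℝ²`. -/
abbrev Plane := EuclideanSpace ℝ (Fin 2)

/-- `y` and `y'` represent the same point of `ℝ² / ℤ²`. -/
def SameModLattice (y y' : Plane) : Prop := ∀ i, ∃ k : ℤ, y i - y' i = k

/-- The unit square, a fundamental domain of `ℝ² / ℤ²`. -/
def unitSquare : Set Plane := {y | ∀ i, y i ∈ Ico (0 : ℝ) 1}

/-- The bilinear form with matrix `h`. -/
def matForm (h : Matrix (Fin 2) (Fin 2) ℝ) (v w : Plane) : ℝ := ∑ i, ∑ j, h i j * v i * w j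

/-- The diameter of the torus `ℝ² / ℤ²` with the flat metric `h` is at most `s`. -/
def TorusDiamLE (h : Matrix (Fin 2) (Fin 2) ℝ) (s : ℝ) : Prop :=
  ∀ y y' : Plane, ∃ z : Plane, SameModLattice z y' ∧ Real.sqrt (matForm h (y - z) (y - z)) ≤ s

/-- `ev` is an eigenvalue of the nonnegative Laplacian of `ℝ² / ℤ²` with the flat metric `h`. -/
def IsTorusEigenvalue (h : Matrix (Fin 2) (Fin 2) ℝ) (ev : ℝ) : Prop :=
  ∃ f : Plane → ℝ, ContDiff ℝ ∞ f ∧ (∀ y y', SameModLattice y y' → f y = f y') ∧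
    (∃ y, f y ≠ 0) ∧
    ∀ y, -(∑ i, ∑ j, h⁻¹ i j * iteratedFDeriv ℝ 2 f y
      ![EuclideanSpace.single i 1, EuclideanSpace.single j 1]) = ev * f y

/-! ### Semi-flat torus fibrations -/

section Fibration

variable {S : Type*} [TopologicalSpace S] [ChartedSpace (EuclideanSpace ℝ (Fin 2)) S]
  [IsManifold (𝓡 2) ∞ S]
  {X : Type*} [TopologicalSpace X] [ChartedSpace (EuclideanSpace ℝ (Fin 4)) X]
  [IsManifold (𝓡 4) ∞ X]

/-- Semi-flat coordinates on the part over `U` of a torus fibration `proj : X → S`. The map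
`Ψ : U × ℝ² → proj⁻¹(U)` induces a fibrewise bijection `U × (ℝ² / ℤ²) → proj⁻¹(U)`, and in these
coordinates the reference metric `gRef` is the product `g_B ⊕ h`, where `h b` is a flat metric on
`ℝ² / ℤ²`. In particular `Ψ` is a local diffeomorphism, the directions of `U` are horizontal and
those of `ℝ²` are vertical. -/
structure IsSemiFlatChart (gB : Metric 2 S) (proj : X → S)
    (gRef : ∀ x : X, TangentSpace (𝓡 4) x →L[ℝ] TangentSpace (𝓡 4) x →L[ℝ] ℝ)
    (U : Set S) (Ψ : S × Plane → X) (h : S → Matrix (Fin 2) (Fin 2) ℝ) : Prop where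
  isOpen : IsOpen U
  smooth : ContMDiffOn ((𝓡 2).prod (𝓡 2)) (𝓡 4) ∞ Ψ (U ×ˢ univ)
  proj_eq : ∀ b ∈ U, ∀ y, proj (Ψ (b, y)) = b
  surj : ∀ b ∈ U, ∀ x, proj x = b → ∃ y, Ψ (b, y) = x
  eq_iff : ∀ b ∈ U, ∀ y y', Ψ (b, y) = Ψ (b, y') ↔ SameModLattice y y'
  h_smooth : ∀ i j, ContMDiffOn (𝓡 2) 𝓘(ℝ, ℝ) ∞ (fun b => h b i j) U
  h_posDef : ∀ b ∈ U, (h b).PosDef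
  metric_eq : ∀ b ∈ U, ∀ y : Plane, ∀ ξ ξ' : TangentSpace (𝓡 2) b, ∀ η η' : Plane,
    gRef (Ψ (b, y))
      (mfderiv ((𝓡 2).prod (𝓡 2)) (𝓡 4) Ψ (b, y) ((ξ, η) : EuclideanSpace ℝ (Fin 2) × Plane))
      (mfderiv ((𝓡 2).prod (𝓡 2)) (𝓡 4) Ψ (b, y) ((ξ', η') : EuclideanSpace ℝ (Fin 2) × Plane))
      = gB.inner b ξ ξ' + matForm (h b) η η'

/-- A torus fibration `proj : X → S` with a Riemannian metric `g` on `X`, and, over the open set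
`B₀ ⊆ S`, a product reference metric `gRef = g_B ⊕ g_F` with flat torus fibres, given by semi-flat
coordinates `chart b` on a neighbourhood `nbhd b` of every `b ∈ B₀` (in which the fibre metric
is `fibreMetric b`). -/
structure TorusFibration (gB : Metric 2 S) (B₀ : Set S)
    (X : Type*) [TopologicalSpace X] [ChartedSpace (EuclideanSpace ℝ (Fin 4)) X]
    [IsManifold (𝓡 4) ∞ X] where
  proj : X → S
  proj_smooth : ContMDiff (𝓡 4) (𝓡 2) ∞ proj
  proj_surjective : Function.Surjective proj
  proj_submersion : ∀ x, Function.Surjective (mfderiv (𝓡 4) (𝓡 2) proj x)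
  /-- the part of the total space over `B₀` is precompact -/
  precompact : IsCompact (closure (proj ⁻¹' B₀))
  g : Metric 4 X
  gRef : ∀ x : X, TangentSpace (𝓡 4) x →L[ℝ] TangentSpace (𝓡 4) x →L[ℝ] ℝ
  nbhd : S → Set S
  chart : S → S × Plane → X
  fibreMetric : S → S → Matrix (Fin 2) (Fin 2) ℝ
  mem_nbhd : ∀ b ∈ B₀, b ∈ nbhd b
  nbhd_subset : ∀ b ∈ B₀, nbhd b ⊆ B₀
  isSemiFlatChart : ∀ b ∈ B₀,
    IsSemiFlatChart gB proj gRef (nbhd b) (chart b) (fibreMetric b)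

namespace TorusFibration

variable {gB : Metric 2 S} {B₀ : Set S} (T : TorusFibration gB B₀ X)

/-- The part `X₀ = proj⁻¹(B₀)` of the total space over `B₀`. -/
def total : Set X := T.proj ⁻¹' B₀

/-- The Haar probability measure of the flat torus fibre over `b`, as a measure on `X`: the image
of the Lebesgue measure of the unit square under flat coordinates of the fibre. -/
def haar [MeasurableSpace X] (b : S) : Measure X :=
  Measure.map (fun y : Plane => T.chart b (b, y)) (volume.restrict unitSquare)

/-- Semi-flat control: `|g - gRef|_{gRef} ≤ ε` on the part over `B₀`, and the flat fibres over `B₀`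
have diameter at most `s`. -/
def SemiFlatControl (ε s : ℝ) : Prop :=
  (∀ x ∈ T.total, ∀ v w : TangentSpace (𝓡 4) x,
    |T.g.inner x v w - T.gRef x v w| ≤
      ε * Real.sqrt (T.gRef x v v) * Real.sqrt (T.gRef x w w)) ∧
  ∀ b ∈ B₀, TorusDiamLE (T.fibreMetric b b) s

/-- The first nonzero eigenvalue of each flat fibre over `B₀` is at least `c`. -/
def VerticalGap (c : ℝ) : Prop :=
  ∀ b ∈ B₀, ∀ ev : ℝ, IsTorusEigenvalue (T.fibreMetric b b) ev → ev ≠ 0 → c ≤ ev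

/-- Normalized disintegration of the Riemannian measure of `g` over `B₀`, with positive functions
`A` on `B₀` and `ρ` on the part over `B₀`, differentiable so that their gradients make sense. -/
structure IsDisintegration [MeasurableSpace S] [MeasurableSpace X] (A : S → ℝ) (ρ : X → ℝ) :
    Prop where
  A_pos : ∀ b ∈ B₀, 0 < A b
  ρ_pos : ∀ x ∈ T.total, 0 < ρ x
  A_smooth : ContMDiffOn (𝓡 2) 𝓘(ℝ, ℝ) 1 A B₀
  ρ_smooth : ContMDiffOn (𝓡 4) 𝓘(ℝ, ℝ) 1 ρ T.total
  integral_eq : ∀ f : X → ℝ, Integrable f (measureOn T.g T.total) →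
    ∫ x, f x ∂(measureOn T.g T.total) =
      ∫ b, A b * ∫ x, f x * ρ x ∂(T.haar b) ∂(measureOn gB B₀)
  normalized : ∀ b ∈ B₀, ∫ x, ρ x ∂(T.haar b) = 1

/-- The bounds `|ρ - 1| ≤ δ`, `|∇ log A| ≤ δ` and `|∇_B ρ| ≤ δ` over `B₀`, where `∇_B` is the
derivative in the horizontal directions, the `gRef`-orthogonal complement of the vertical ones. -/
structure DisintegrationBounds (A : S → ℝ) (ρ : X → ℝ) (δ : ℝ) : Prop where
  ρ_near_one : ∀ x ∈ T.total, |ρ x - 1| ≤ δ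
  grad_log_A : ∀ b ∈ B₀, ∀ ξ : TangentSpace (𝓡 2) b,
    |realDifferential (fun b' => Real.log (A b')) b ξ| ≤ δ * Real.sqrt (gB.inner b ξ ξ)
  grad_ρ : ∀ x ∈ T.total, ∀ v : TangentSpace (𝓡 4) x,
    (∀ w : TangentSpace (𝓡 4) x, mfderiv (𝓡 4) (𝓡 2) T.proj x w = 0 → T.gRef x v w = 0) →
    |realDifferential ρ x v| ≤ δ * Real.sqrt (T.gRef x v v)

variable [MeasurableSpace S] [MeasurableSpace X]

/-- The function `x ↦ A(proj x)^{-1/2} v(proj x)`. -/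
def liftFun (A : S → ℝ) (v : S → ℂ) (x : X) : ℂ :=
  ((Real.sqrt (A (T.proj x)))⁻¹ : ℝ) * v (T.proj x)

/-- The function `b ↦ A(b)^{1/2} ∫ u ρ dϑ_b`, where `ϑ_b` is the Haar probability measure of the
fibre over `b`. -/
def averageFun (A : S → ℝ) (ρ : X → ℝ) (u : X → ℂ) (b : S) : ℂ :=
  (Real.sqrt (A b) : ℂ) * ∫ x, u x * (ρ x : ℂ) ∂(T.haar b)

/-- The normalized lift `I : L²(B₀) → L²(X₀)`. -/
def lift (A : S → ℝ) (v : L2 gB B₀) : L2 T.g T.total := toL2 T.g T.total (T.liftFun A v)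

/-- The normalized fibre average `P : L²(X₀) → L²(B₀)`. -/
def average (A : S → ℝ) (ρ : X → ℝ) (u : L2 T.g T.total) : L2 gB B₀ :=
  toL2 gB B₀ (T.averageFun A ρ u)

end TorusFibration

end Fibration

/-- The regular locus `B_reg = B \ D`, an open submanifold of `B`. -/
def regularLocus {B : Type*} [TopologicalSpace B] [T2Space B] (D : Finset B) :
    TopologicalSpace.Opens B :=
  ⟨(D : Set B)ᶜ, D.finite_toSet.isClosed.isOpen_compl⟩

/-- The filter `t ↓ 0` on the parameter set `(0, t₀]`. -/
def toZero (t₀ : ℝ) : Filter (Ioc (0 : ℝ) t₀) := comap Subtype.val (𝓝 0)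

end SemiFlat

end

/-! The normalization makes the lift `I_t` an isometry with adjoint `P_t`, hence `P_t I_t = 1`: the
weight `A^{-1/2}` compensates the base density, and the fibre measures `ρ dϑ` are probability
measures (`IsFibered.lift`, `IsFibered.coeFn_adjoint_lift`). The first two convergence statements
follow from the intertwining property that `(α + H_t)⁻¹ I_t f - I_t (α + H_B)⁻¹ f` tends to zero in
norm (`tendsto_norm_res_sub`).

The intertwining comes from an estimate of forms, for compactly supported `C¹` functions `v` on the
base and `w` on the total space: `|E_t(I_t v, w) - E_B(v, P_t w)| ≤ O(ε_t) ‖v‖ ‖w‖` in `H¹` norms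
(`norm_dirichletForm_sub_le`). Indeed `d(I_t v)` is pulled back from the base. For a product metric
its pairing with `dw` sees only the horizontal part of `dw`, and the fibre average of a horizontal
derivative is the derivative of the fibre average. Replacing `g(t)` by the product metric, and
differentiating `A` and `ρ`, costs `O(ε_t)`. Then `norm_res_sub_le` compares weak solutions: if `v`
approximates `(α + H_B)⁻¹ f` in the form norm, `I_t v` almost solves the equation with right-hand
side `I_t f`, because testing it against `w` amounts to testing the base equation against `P_t w`.

The densities `A` and `ρ` are only `C¹`, so lift and average preserve `C¹` functions of compact
support but not test functions. The forms are therefore taken on the larger core `C1c`, and the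
resolvent is realized as `T T*`, where `T` maps the completion of the core to `L²`. That this is the
resolvent of the Laplacian defined through `C_c^∞` rests on `testFunctionsDense` (partition of unity
and mollification in charts).

The heat operators are continuous functions of the resolvent at `α = 1`, whose spectrum lies in `[0,
1]`. The intertwining passes from the resolvent to its polynomials and, by Weierstrass, to
continuous functions (`tendsto_cfc_comp`). A Lipschitz bound in the time variable, uniform in `t`,
gives local uniformity.

Heat kernels exist by a Weyl type estimate. Poincaré's inequality on small cubes puts the resolvent
`R` within `O(1/N)` of operators of rank `O(N^n)`, so `R^{n+1}` is within `O(N^{-(n+1)})` of such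
operators. Since `e^{-τH} = G R^{n+1}` with `G` bounded, summing over dyadic `N` produces an `L²`
kernel (`exists_hasKernel_expOfResolvent`). Averaging it with its transpose and their complex
conjugates makes it real and symmetric. The pairing of kernels equals `⟨conj Φ, P_t e^{-τ H_t} I_t
Ψ⟩`, so the third statement reduces to the second.

Three facts of measure theory support this: the supremum defining the Riemannian measure coincides
on every chart domain with the chart measure (`riemannianMeasure_apply_of_subset`), the Haar measure
of a fibre is independent of the semi-flat chart (`IsSemiFlatChart.map_eq_map`), and the assumed
identity of integrals is a genuine disintegration along a measurable kernel
(`IsDisintegration.isFibered`). -/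

noncomputable section

namespace SemiFlat

/-! ### Form domains as Hilbert spaces, and the resolvent as `T T*`. -/

section FormCompletion

universe u v

variable {V : Type u} {H : Type v} [AddCommGroup V] [Module ℂ V]
  [NormedAddCommGroup H] [InnerProductSpace ℂ H]

/-- A Hilbert space completion of a vector space `V` with respect to a sesquilinear form `a` that
controls the norm of `ι : V → H`. -/
structure FormCompletion (ι : V →ₗ[ℂ] H) (a : V → V → ℂ) where
  carrier : Type u
  [grp : NormedAddCommGroup carrier]
  [inner : InnerProductSpace ℂ carrier]
  [complete : CompleteSpace carrier]
  /-- the embedding of `V` -/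
  emb : V →ₗ[ℂ] carrier
  /-- the extension of `ι` -/
  ext : carrier →L[ℂ] H
  dense : DenseRange emb
  inner_emb : ∀ u v, (Inner.inner ℂ (emb u) (emb v) : ℂ) = a u v
  ext_emb : ∀ v, ext (emb v) = ι v

attribute [instance] FormCompletion.grp FormCompletion.inner FormCompletion.complete

/-- The bound makes `a` positive semidefinite and `ι` Lipschitz for the resulting seminorm, so `ι`
extends to the Hausdorff completion. Injectivity of the extension (closability of the form) is
neither claimed nor needed: the resolvent only involves `ext` and its adjoint. -/
theorem FormCompletion.nonempty [CompleteSpace H] (ι : V →ₗ[ℂ] H) (a : V → V → ℂ) {α : ℝ}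
    (hα : 0 < α)
    (conj_symm : ∀ u v, conj (a v u) = a u v)
    (add_left : ∀ u v w, a (u + v) w = a u w + a v w)
    (smul_left : ∀ u v (r : ℂ), a (r • u) v = conj r * a u v)
    (bound : ∀ v, α * ‖ι v‖ ^ 2 ≤ (a v v).re) :
    Nonempty (FormCompletion ι a) := by
  let core : PreInnerProductSpace.Core ℂ V :=
    { inner := a
      conj_inner_symm := conj_symm
      re_inner_nonneg := fun v => le_trans (by positivity) (bound v)
      add_left := add_left
      smul_left := smul_left }
  let _ : SeminormedAddCommGroup V := @InnerProductSpace.Core.toSeminormedAddCommGroup ℂ V _ _ _ core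
  let _ : InnerProductSpace ℂ V := InnerProductSpace.ofCore core
  have hinner : ∀ u v : V, (Inner.inner ℂ u v : ℂ) = a u v := fun _ _ => rfl
  have hb : ∀ v : V, ‖ι v‖ ≤ (Real.sqrt α)⁻¹ * ‖v‖ := by
    intro v
    have h1 : ‖v‖ ^ 2 = (a v v).re := by
      rw [← hinner]; exact norm_sq_eq_re_inner (𝕜 := ℂ) v
    have h2 : (Real.sqrt α * ‖ι v‖) ^ 2 ≤ ‖v‖ ^ 2 := by
      rw [h1, mul_pow, Real.sq_sqrt hα.le]; exact bound v
    have h3 := (sq_le_sq₀ (by positivity) (norm_nonneg v)).1 h2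
    rw [inv_mul_eq_div, le_div_iff₀ (Real.sqrt_pos.2 hα), mul_comm]
    exact h3
  let ιc : V →L[ℂ] H := ι.mkContinuous _ hb
  let j : V →L[ℂ] UniformSpace.Completion V := UniformSpace.Completion.toComplL
  have hd : DenseRange j := UniformSpace.Completion.denseRange_coe
  refine ⟨{ carrier := UniformSpace.Completion V
            emb := j.toLinearMap
            ext := ιc.extend j
            dense := hd
            inner_emb := fun u v => ?_
            ext_emb := fun v => ?_ }⟩
  · exact (UniformSpace.Completion.inner_coe u v).trans (hinner u v)
  · exact ContinuousLinearMap.extend_eq (f := ιc) hd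
      (UniformSpace.Completion.isUniformInducing_coe V) v

variable {ι : V →ₗ[ℂ] H} {a : V → V → ℂ} [CompleteSpace H]

/-- The operator associated with the form, as an inverse. -/
def FormCompletion.res (F : FormCompletion ι a) : H →L[ℂ] H := F.ext ∘L F.ext.adjoint

/-- By definition of the adjoint, `ext* f` is the vector `w` with `⟨emb v, w⟩ = ⟨ι v, f⟩` for all
`v`, i.e. the weak solution, and `ext` views it in `H`. In the form `T T*`, self-adjointness and
positivity of the solution operator are immediate. -/
theorem FormCompletion.res_isSelfAdjoint (F : FormCompletion ι a) : IsSelfAdjoint F.res := by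
  rw [ContinuousLinearMap.isSelfAdjoint_iff', FormCompletion.res,
    ContinuousLinearMap.adjoint_comp, ContinuousLinearMap.adjoint_adjoint]

theorem FormCompletion.res_nonneg (F : FormCompletion ι a) : 0 ≤ F.res := by
  rw [ContinuousLinearMap.nonneg_iff_isPositive]
  exact ContinuousLinearMap.isPositive_self_comp_adjoint F.ext

theorem FormCompletion.norm_ext_le (F : FormCompletion ι a) {α : ℝ}
    (bound : ∀ v, α * ‖ι v‖ ^ 2 ≤ (a v v).re) (w : F.carrier) :
    α * ‖F.ext w‖ ^ 2 ≤ ‖w‖ ^ 2 := by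
  refine F.dense.induction_on (p := fun w => α * ‖F.ext w‖ ^ 2 ≤ ‖w‖ ^ 2) w ?_ ?_
  · exact isClosed_le (by fun_prop) (by fun_prop)
  · intro v
    rw [F.ext_emb, norm_sq_eq_re_inner (𝕜 := ℂ) (F.emb v), F.inner_emb]
    exact bound v

theorem FormCompletion.norm_ext_le_one (F : FormCompletion ι a)
    (bound : ∀ v, 1 * ‖ι v‖ ^ 2 ≤ (a v v).re) : ‖F.ext‖ ≤ 1 := by
  refine ContinuousLinearMap.opNorm_le_bound _ zero_le_one fun w => ?_
  have := F.norm_ext_le bound w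
  rw [one_mul] at this ⊢
  exact (sq_le_sq₀ (norm_nonneg _) (norm_nonneg _)).1 this

theorem FormCompletion.norm_res_le_one (F : FormCompletion ι a)
    (bound : ∀ v, 1 * ‖ι v‖ ^ 2 ≤ (a v v).re) : ‖F.res‖ ≤ 1 := by
  have h := F.norm_ext_le_one bound
  calc ‖F.res‖ ≤ ‖F.ext‖ * ‖F.ext.adjoint‖ := ContinuousLinearMap.opNorm_comp_le _ _
    _ ≤ 1 * 1 := by
        gcongr
        rw [LinearIsometryEquiv.norm_map]; exact h
    _ = 1 := one_mul 1

end FormCompletion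

/-! ### The heat operator as a function of the resolvent. -/

section Spectrum

variable {E : Type*} [NormedAddCommGroup E] [InnerProductSpace ℂ E] [CompleteSpace E]

theorem spectrum_subset_Icc {R : E →L[ℂ] E} (h0 : 0 ≤ R) (h1 : ‖R‖ ≤ 1) :
    spectrum ℝ R ⊆ Icc 0 1 := by
  intro x hx
  refine ⟨spectrum_nonneg_of_nonneg h0 hx, ?_⟩
  rcases subsingleton_or_nontrivial E with hE | hE
  -- On the zero space the identity has norm zero and spectral values are not bounded by the norm in
  -- the usual way; the spectrum is empty there.
  · have : Subsingleton (E →L[ℂ] E) := inferInstance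
    exact absurd hx (by simp [spectrum.of_subsingleton])
  · have := spectrum.norm_le_norm_of_mem hx
    exact (le_abs_self x).trans (this.trans h1)

/-- The function `x ↦ exp (-τ (1/x - 1))`, extended by zero. -/
def expFun (τ x : ℝ) : ℝ := if x ≤ 0 then 0 else Real.exp (-τ * (x⁻¹ - 1))

theorem expOfResolvent_eq (R : E →L[ℂ] E) (τ : ℝ) : expOfResolvent R τ = cfc (expFun τ) R := rfl

/-- The function `x ↦ exp (-τ (1/x - 1)) / x ^ m`, extended by zero. -/
def expDivFun (m : ℕ) (τ x : ℝ) : ℝ :=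
  if x ≤ 0 then 0 else Real.exp (-τ * (x⁻¹ - 1)) * (x⁻¹) ^ m

/-- In terms of `y = 1/x → ∞`, the exponential `e^{-τ y}` beats every power `y ^ m`. -/
theorem continuous_expDivFun (m : ℕ) {τ : ℝ} (hτ : 0 < τ) : Continuous (expDivFun m τ) := by
  rw [continuous_iff_continuousAt]
  intro x
  rcases lt_trichotomy x 0 with hx | rfl | hx
  · have : expDivFun m τ =ᶠ[𝓝 x] fun _ => 0 := by
      filter_upwards [Iio_mem_nhds hx] with y hy
      simp [expDivFun, le_of_lt (mem_Iio.1 hy)]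
    exact (continuousAt_const.congr this.symm)
  · have h0 : expDivFun m τ 0 = 0 := by simp [expDivFun]
    rw [ContinuousAt, h0]
    have hlim : Tendsto (fun x : ℝ => Real.exp (-τ * (x⁻¹ - 1)) * (x⁻¹) ^ m) (𝓝[>] 0) (𝓝 0) := by
      have h1 : Tendsto (fun y : ℝ => Real.exp (-τ * (y - 1)) * y ^ m) atTop (𝓝 0) := by
        have h2 := (Real.tendsto_pow_mul_exp_neg_atTop_nhds_zero m).comp
          (tendsto_id.const_mul_atTop hτ)
        -- This factor turns `(τ y)^m e^{-τ y}` into `e^{-τ (y - 1)} y^m`.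
        have h3 := h2.const_mul (Real.exp τ * (τ ^ m)⁻¹)
        rw [mul_zero] at h3
        refine h3.congr fun y => ?_
        have : (τ : ℝ) ^ m ≠ 0 := by positivity
        simp only [Function.comp, id, mul_pow]
        rw [show -τ * (y - 1) = τ + -(τ * y) by ring, Real.exp_add]
        field_simp
      exact h1.comp tendsto_inv_nhdsGT_zero
    suffices key : Tendsto (expDivFun m τ) (𝓝[≤] 0 ⊔ 𝓝[>] 0) (𝓝 0) by
      rwa [nhdsLE_sup_nhdsGT] at key
    refine Tendsto.sup ?_ ?_
    · refine tendsto_const_nhds.congr' ?_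
      filter_upwards [self_mem_nhdsWithin] with y hy
      simp [expDivFun, mem_Iic.1 hy]
    · refine hlim.congr' ?_
      filter_upwards [self_mem_nhdsWithin] with y hy
      simp [expDivFun, not_le.2 (mem_Ioi.1 hy)]
  · have : expDivFun m τ =ᶠ[𝓝 x] fun x => Real.exp (-τ * (x⁻¹ - 1)) * (x⁻¹) ^ m := by
      filter_upwards [Ioi_mem_nhds hx] with y hy
      simp [expDivFun, not_le.2 (mem_Ioi.1 hy)]
    refine ContinuousAt.congr ?_ this.symm
    have := hx.ne'
    fun_prop (disch := assumption)

theorem continuous_expFun {τ : ℝ} (hτ : 0 < τ) : Continuous (expFun τ) := by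
  have := continuous_expDivFun 0 hτ
  have h2 : expFun τ = expDivFun 0 τ := by
    funext x; simp only [expFun, expDivFun, pow_zero, mul_one]
  rwa [h2]

theorem expFun_eq_mul (m : ℕ) (τ x : ℝ) : expFun τ x = expDivFun m τ x * x ^ m := by
  unfold expFun expDivFun
  split_ifs with h
  · simp
  · rw [mul_assoc, ← mul_pow, inv_mul_cancel₀ (by linarith [not_le.1 h] : x ≠ 0), one_pow, mul_one]

/-- The heat operator thus inherits every approximation property that some power of the resolvent
has. -/
theorem expOfResolvent_eq_mul {R : E →L[ℂ] E} (hR : IsSelfAdjoint R) (m : ℕ) {τ : ℝ}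
    (hτ : 0 < τ) : expOfResolvent R τ = cfc (expDivFun m τ) R * R ^ m := by
  have h1 := (continuous_expDivFun m hτ).continuousOn (s := spectrum ℝ R)
  have h2 : ContinuousOn (fun x : ℝ => x ^ m) (spectrum ℝ R) := by fun_prop
  rw [expOfResolvent_eq, ← cfc_pow_id (R := ℝ) R m, ← cfc_mul _ _ R h1 h2]
  exact cfc_congr fun x _ => expFun_eq_mul m τ x

/-- With `y = 1/x - 1 ≥ 0` the function is `e^{-τ y}`, whose derivative in `τ` has modulus `y e^{-τ
y} ≤ 1/τ ≤ 1/m`. The bound does not depend on `x`, hence gives a Lipschitz bound in operator norm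
common to all resolvents. -/
theorem abs_expFun_sub_le {τ τ' m : ℝ} (hm : 0 < m) (h : m ≤ τ) (h' : m ≤ τ') {x : ℝ}
    (hx : x ∈ Icc (0 : ℝ) 1) : |expFun τ x - expFun τ' x| ≤ |τ - τ'| / m := by
  wlog hle : τ ≤ τ' generalizing τ τ'
  · rw [abs_sub_comm, abs_sub_comm τ]; exact this h' h (le_of_not_ge hle)
  unfold expFun
  split_ifs with h0
  · simp; positivity
  · have hx0 : 0 < x := not_le.1 h0
    set y := x⁻¹ - 1 with hy
    have hy0 : 0 ≤ y := by
      have := (one_le_inv₀ hx0).2 hx.2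
      linarith
    have e1 : Real.exp (-τ' * y) ≤ Real.exp (-τ * y) := by
      apply Real.exp_le_exp.2; nlinarith
    rw [abs_of_nonneg (by linarith), abs_sub_comm, abs_of_nonneg (by linarith)]
    have e2 : Real.exp (-τ' * y) = Real.exp (-τ * y) * Real.exp (-(τ' - τ) * y) := by
      rw [← Real.exp_add]; ring_nf
    have e3 : 1 - Real.exp (-(τ' - τ) * y) ≤ (τ' - τ) * y := by
      have := Real.add_one_le_exp (-(τ' - τ) * y); linarith
    have e4 : Real.exp (-τ * y) * (m * y) ≤ 1 := by
      have h1 : m * y ≤ Real.exp (τ * y) := by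
        have := Real.add_one_le_exp (τ * y)
        nlinarith
      calc _ ≤ Real.exp (-τ * y) * Real.exp (τ * y) := by gcongr
        _ = 1 := by rw [← Real.exp_add]; simp
    rw [e2, le_div_iff₀ hm]
    have e5 := Real.exp_pos (-τ * y)
    calc (Real.exp (-τ * y) - Real.exp (-τ * y) * Real.exp (-(τ' - τ) * y)) * m
        = Real.exp (-τ * y) * (1 - Real.exp (-(τ' - τ) * y)) * m := by ring
      _ ≤ Real.exp (-τ * y) * ((τ' - τ) * y) * m := by gcongr
      _ = (τ' - τ) * (Real.exp (-τ * y) * (m * y)) := by ring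
      _ ≤ (τ' - τ) * 1 := by gcongr
      _ = τ' - τ := mul_one _

end Spectrum

/-! ### From intertwined resolvents to intertwined heat operators. -/

section StrongConvergence

theorem aeval_monomial_succ {A : Type*} [Ring A] [Algebra ℝ A] (x : A) (r : ℝ) (n : ℕ) :
    Polynomial.aeval x (Polynomial.C r * Polynomial.X ^ (n + 1)) =
      Polynomial.aeval x (Polynomial.C r * Polynomial.X ^ n) * x := by
  rw [pow_succ, ← mul_assoc, map_mul _ _ Polynomial.X, Polynomial.aeval_X]

theorem norm_cfc_sub_cfc_le {G : Type*} [NormedAddCommGroup G] [InnerProductSpace ℂ G]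
    [CompleteSpace G] {A : G →L[ℂ] G} (hA0 : 0 ≤ A) (hA1 : ‖A‖ ≤ 1) {φ ψ : ℝ → ℝ}
    (hφ : Continuous φ) (hψ : Continuous ψ) {e : ℝ} (he : 0 ≤ e)
    (h : ∀ x ∈ Icc (0 : ℝ) 1, |φ x - ψ x| ≤ e) : ‖cfc φ A - cfc ψ A‖ ≤ e := by
  rw [← cfc_sub φ ψ A hφ.continuousOn hψ.continuousOn]
  exact norm_cfc_le he fun x hx => h x (spectrum_subset_Icc hA0 hA1 hx)

variable {T : Type*} {l : Filter T} {E : Type*} [NormedAddCommGroup E] [InnerProductSpace ℂ E]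
  [CompleteSpace E] {F : T → Type*} [∀ t, NormedAddCommGroup (F t)]
  [∀ t, InnerProductSpace ℂ (F t)] [∀ t, CompleteSpace (F t)]
  {J : ∀ t, E →L[ℂ] F t} {R : E →L[ℂ] E} {S : ∀ t, F t →L[ℂ] F t}

/-- Induction on the degree: for a monomial `p`, `p(S) S J - J p(R) R = (p(S) J - J p(R)) R + p(S)
(S J - J R)`. The first term is the induction hypothesis at `R f`, the second is the assumption,
with `‖p(S)‖` bounded uniformly since `‖S‖ ≤ 1`. -/
theorem tendsto_polynomial_comp (hS : ∀ t, ‖S t‖ ≤ 1)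
    (h : ∀ f, Tendsto (fun t => ‖S t (J t f) - J t (R f)‖) l (𝓝 0)) (p : Polynomial ℝ) (f : E) :
    Tendsto (fun t => ‖Polynomial.aeval (S t) p (J t f) - J t (Polynomial.aeval R p f)‖) l
      (𝓝 0) := by
  induction p using Polynomial.induction_on generalizing f with
  | C r =>
    refine tendsto_const_nhds.congr fun t => Eq.symm ?_
    have h1 : (r : ℝ) • J t f = (r : ℂ) • J t f := rfl
    have h2 : (r : ℝ) • f = (r : ℂ) • f := rfl
    rw [Polynomial.aeval_C, Polynomial.aeval_C, Algebra.algebraMap_eq_smul_one,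
      Algebra.algebraMap_eq_smul_one, smul_apply, smul_apply]
    change ‖r • J t f - J t (r • f)‖ = _
    rw [h1, h2, map_smul, sub_self, norm_zero]
  | add p q hp hq =>
    refine squeeze_zero (fun _ => norm_nonneg _) (fun t => ?_) (by simpa using (hp f).add (hq f))
    simp only [map_add, add_apply]
    rw [add_sub_add_comm]
    exact norm_add_le _ _
  | monomial n r hn =>
    have key := (hn (R f)).add ((h f).const_mul
      (‖r‖))
    simp only [mul_zero, add_zero] at key
    refine squeeze_zero (fun _ => norm_nonneg _) (fun t => ?_) key
    have hpow : ∀ k : ℕ, ‖(S t) ^ k‖ ≤ 1 := by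
      intro k
      induction k with
      | zero => rw [pow_zero]; exact ContinuousLinearMap.norm_id_le
      | succ k ih =>
        rw [pow_succ]
        exact (norm_mul_le _ _).trans (mul_le_one₀ ih (norm_nonneg _) (hS t))
    rw [aeval_monomial_succ, aeval_monomial_succ]
    simp only [mul_apply_eq_comp]
    have e2 : ‖Polynomial.aeval (S t) (Polynomial.C r * Polynomial.X ^ n)‖ ≤ ‖r‖ := by
      simp only [map_mul, Polynomial.aeval_C, map_pow, Polynomial.aeval_X,
        Algebra.algebraMap_eq_smul_one, smul_mul_assoc, one_mul]
      rw [norm_smul]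
      exact mul_le_of_le_one_right (norm_nonneg _) (hpow n)
    calc _ = ‖(Polynomial.aeval (S t) (Polynomial.C r * Polynomial.X ^ n) (J t (R f))
            - J t (Polynomial.aeval R (Polynomial.C r * Polynomial.X ^ n) (R f)))
          + Polynomial.aeval (S t) (Polynomial.C r * Polynomial.X ^ n)
              (S t (J t f) - J t (R f))‖ := by
            rw [map_sub]; congr 1; abel
      _ ≤ _ := by
            refine (norm_add_le _ _).trans ?_
            gcongr
            exact (ContinuousLinearMap.le_opNorm _ _).trans (by gcongr)

/-- All the spectra lie in `[0, 1]`, so one Weierstrass polynomial approximates `φ` in operator norm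
at `R` and at every `S t` simultaneously. -/
theorem tendsto_cfc_comp (hS0 : ∀ t, 0 ≤ S t) (hS : ∀ t, ‖S t‖ ≤ 1) (hR0 : 0 ≤ R) (hR : ‖R‖ ≤ 1)
    (hJ : ∀ t, ‖J t‖ ≤ 1)
    (h : ∀ f, Tendsto (fun t => ‖S t (J t f) - J t (R f)‖) l (𝓝 0)) {φ : ℝ → ℝ}
    (hφ : Continuous φ) (f : E) :
    Tendsto (fun t => ‖cfc φ (S t) (J t f) - J t (cfc φ R f)‖) l (𝓝 0) := by
  rw [Metric.tendsto_nhds]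
  intro e he
  -- Each of the two replacements of `φ` by `p` may cost `e / 4`; dividing by `‖f‖ + 1` instead of
  -- `‖f‖` admits `f = 0`.
  obtain ⟨p, hp⟩ := exists_polynomial_near_of_continuousOn 0 1 φ hφ.continuousOn
    (e / (4 * (‖f‖ + 1))) (by positivity)
  have hp0 : 0 ≤ e / (4 * (‖f‖ + 1)) := by positivity
  have hp' : ∀ x ∈ Icc (0 : ℝ) 1, |φ x - p.eval x| ≤ e / (4 * (‖f‖ + 1)) := fun x hx => by
    rw [abs_sub_comm]; exact (hp x hx).le
  filter_upwards [(Metric.tendsto_nhds.1 (tendsto_polynomial_comp hS h p f)) (e / 4)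
    (by positivity)] with t ht
  rw [Real.dist_eq, sub_zero, abs_of_nonneg (norm_nonneg _)] at ht ⊢
  have hf : e / (4 * (‖f‖ + 1)) * ‖f‖ ≤ e / 4 := by
    rw [div_mul_eq_mul_div, div_le_div_iff₀ (by positivity) (by positivity)]
    nlinarith [norm_nonneg f]
  have h1 : ‖(cfc φ (S t) - Polynomial.aeval (S t) p) (J t f)‖ ≤ e / 4 := by
    refine (ContinuousLinearMap.le_opNorm _ _).trans (le_trans ?_ hf)
    gcongr
    · rw [← cfc_polynomial p _ (IsSelfAdjoint.of_nonneg (hS0 t))]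
      exact norm_cfc_sub_cfc_le (hS0 t) (hS t) hφ p.continuous hp0 hp'
    · exact (ContinuousLinearMap.le_of_opNorm_le _ (hJ t) f).trans (by rw [one_mul])
  have h2 : ‖J t ((cfc φ R - Polynomial.aeval R p) f)‖ ≤ e / 4 := by
    refine (ContinuousLinearMap.le_of_opNorm_le _ (hJ t) _).trans ?_
    rw [one_mul]
    refine (ContinuousLinearMap.le_opNorm _ _).trans (le_trans ?_ hf)
    gcongr
    rw [← cfc_polynomial p _ (IsSelfAdjoint.of_nonneg hR0)]
    exact norm_cfc_sub_cfc_le hR0 hR hφ p.continuous hp0 hp'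
  calc ‖cfc φ (S t) (J t f) - J t (cfc φ R f)‖
      = ‖(cfc φ (S t) - Polynomial.aeval (S t) p) (J t f)
        + (Polynomial.aeval (S t) p (J t f) - J t (Polynomial.aeval R p f))
        - J t ((cfc φ R - Polynomial.aeval R p) f)‖ := by
          simp only [sub_apply, map_sub]; congr 1; abel
    _ ≤ e / 4 + ‖Polynomial.aeval (S t) p (J t f) - J t (Polynomial.aeval R p f)‖ + e / 4 := by
        refine (norm_sub_le _ _).trans (add_le_add ((norm_add_le _ _).trans ?_) h2)
        gcongr
    _ < e := by linarith

/-- Convergence at one time `τ₀` extends to a neighbourhood of `τ₀`, because the dependence on time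
is Lipschitz with a constant independent of `t`; compactness of `K` does the rest. -/
theorem tendstoUniformlyOn_expOfResolvent
    (hS0 : ∀ t, 0 ≤ S t) (hS : ∀ t, ‖S t‖ ≤ 1) (hR0 : 0 ≤ R) (hR : ‖R‖ ≤ 1)
    (hJ : ∀ t, ‖J t‖ ≤ 1) {P : ∀ t, F t →L[ℂ] E} (hP : ∀ t, ‖P t‖ ≤ 1)
    (hPJ : ∀ t f, P t (J t f) = f)
    (h : ∀ f, Tendsto (fun t => ‖S t (J t f) - J t (R f)‖) l (𝓝 0)) (f : E)
    {K : Set ℝ} (hK : IsCompact K) (hK0 : K ⊆ Ioi 0) :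
    TendstoUniformlyOn (fun t τ => P t (expOfResolvent (S t) τ (J t f)))
      (fun τ => expOfResolvent R τ f) l K := by
  rw [← tendstoLocallyUniformlyOn_iff_tendstoUniformlyOn_of_compact hK,
    Metric.tendstoLocallyUniformlyOn_iff]
  intro e he τ₀ hτ₀
  have hτ₀' : 0 < τ₀ := hK0 hτ₀
  set m := τ₀ / 2 with hm
  have hm0 : 0 < m := by positivity
  -- The first entry keeps `τ ≥ τ₀ / 2 = m`; the second makes the Lipschitz error `|τ - τ₀| / m` at
  -- most `e / (4 (‖f‖ + 1))`.
  set d := min m (e * m / (4 * (‖f‖ + 1))) with hd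
  have hd0 : 0 < d := by positivity
  refine ⟨Metric.ball τ₀ d, mem_nhdsWithin_of_mem_nhds (Metric.ball_mem_nhds _ hd0), ?_⟩
  have hconv := tendsto_cfc_comp hS0 hS hR0 hR hJ h (continuous_expFun hτ₀') f
  filter_upwards [(Metric.tendsto_nhds.1 hconv) (e / 4) (by positivity)] with t ht τ hτ
  rw [Real.dist_eq, sub_zero, abs_of_nonneg (norm_nonneg _)] at ht
  rw [Metric.mem_ball, Real.dist_eq] at hτ
  have hτm : m ≤ τ := by
    have := (abs_lt.1 (hτ.trans_le (min_le_left _ _))).1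
    linarith
  have hp0 : 0 ≤ e / (4 * (‖f‖ + 1)) := by positivity
  have hp' : ∀ x ∈ Icc (0 : ℝ) 1, |expFun τ x - expFun τ₀ x| ≤ e / (4 * (‖f‖ + 1)) := by
    intro x hx
    refine (abs_expFun_sub_le hm0 hτm (by linarith) hx).trans ?_
    rw [div_le_iff₀ hm0, div_mul_eq_mul_div]
    exact (hτ.trans_le (min_le_right _ _)).le
  have hc := continuous_expFun (hm0.trans_le hτm)
  have hc₀ := continuous_expFun hτ₀'
  have hf : e / (4 * (‖f‖ + 1)) * ‖f‖ ≤ e / 4 := by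
    rw [div_mul_eq_mul_div, div_le_div_iff₀ (by positivity) (by positivity)]
    nlinarith [norm_nonneg f]
  have hJf : ‖J t f‖ ≤ ‖f‖ := (ContinuousLinearMap.le_of_opNorm_le _ (hJ t) f).trans
    (by rw [one_mul])
  have h1 : ‖(cfc (expFun τ) (S t) - cfc (expFun τ₀) (S t)) (J t f)‖ ≤ e / 4 := by
    refine (ContinuousLinearMap.le_opNorm _ _).trans (le_trans ?_ hf)
    gcongr
    exact norm_cfc_sub_cfc_le (hS0 t) (hS t) hc hc₀ hp0 hp'
  have h2 : ‖(cfc (expFun τ) R - cfc (expFun τ₀) R) f‖ ≤ e / 4 := by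
    refine (ContinuousLinearMap.le_opNorm _ _).trans (le_trans ?_ hf)
    gcongr
    exact norm_cfc_sub_cfc_le hR0 hR hc hc₀ hp0 hp'
  have hP' : ∀ x, ‖P t x‖ ≤ ‖x‖ := fun x =>
    (ContinuousLinearMap.le_of_opNorm_le _ (hP t) x).trans (by rw [one_mul])
  rw [dist_comm, dist_eq_norm, expOfResolvent_eq, expOfResolvent_eq]
  calc ‖P t (cfc (expFun τ) (S t) (J t f)) - cfc (expFun τ) R f‖
      = ‖P t ((cfc (expFun τ) (S t) - cfc (expFun τ₀) (S t)) (J t f))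
        + P t (cfc (expFun τ₀) (S t) (J t f) - J t (cfc (expFun τ₀) R f))
        - (cfc (expFun τ) R - cfc (expFun τ₀) R) f‖ := by
          simp only [sub_apply, map_sub, hPJ]; congr 1; abel
    _ ≤ e / 4 + ‖cfc (expFun τ₀) (S t) (J t f) - J t (cfc (expFun τ₀) R f)‖ + e / 4 := by
        refine (norm_sub_le _ _).trans (add_le_add ((norm_add_le _ _).trans ?_) h2)
        exact add_le_add ((hP' _).trans h1) (hP' _)
    _ < e := by linarith

end StrongConvergence

end SemiFlat
end

noncomputable section

namespace SemiFlat

/-! ### Square integrable kernels of operators that are well approximated by finite rank. -/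

section Kernel

open scoped InnerProductSpace

variable {M : Type*} [MeasurableSpace M] {μ : Measure M} [SFinite μ]

theorem memLp_two_mul_prod {f g : M → ℂ} (hf : MemLp f 2 μ) (hg : MemLp g 2 μ) :
    MemLp (fun p : M × M => f p.1 * g p.2) 2 (μ.prod μ) := by
  have hm : AEStronglyMeasurable (fun p : M × M => f p.1 * g p.2) (μ.prod μ) :=
    hf.1.comp_fst.mul hg.1.comp_snd
  rw [memLp_two_iff_integrable_sq_norm hm]
  simp only [norm_mul, mul_pow]
  exact ((memLp_two_iff_integrable_sq_norm hf.1).1 hf).mul_prod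
    ((memLp_two_iff_integrable_sq_norm hg.1).1 hg)

theorem memLp_star {f : M → ℂ} (hf : MemLp f 2 μ) : MemLp (fun x => conj (f x)) 2 μ :=
  hf.star

/-- The function `(x, y) ↦ F x * conj (G y)`. -/
def tens (F G : Lp ℂ 2 μ) : Lp ℂ 2 (μ.prod μ) :=
  (memLp_two_mul_prod (Lp.memLp F) (memLp_star (Lp.memLp G))).toLp _

theorem tens_coeFn (F G : Lp ℂ 2 μ) :
    tens F G =ᵐ[μ.prod μ] fun p => F p.1 * conj (G p.2) := MemLp.coeFn_toLp _

theorem inner_tens (F G e h : Lp ℂ 2 μ) :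
    ⟪tens F G, tens e h⟫_ℂ = ⟪F, e⟫_ℂ * ⟪h, G⟫_ℂ := by
  rw [L2.inner_def, L2.inner_def, L2.inner_def, ← integral_prod_mul]
  refine integral_congr_ae ?_
  filter_upwards [tens_coeFn F G, tens_coeFn e h] with p h1 h2
  rw [h1, h2]
  simp only [RCLike.inner_apply, map_mul, Complex.conj_conj]
  ring

theorem norm_tens (F G : Lp ℂ 2 μ) : ‖tens F G‖ = ‖F‖ * ‖G‖ := by
  have h : ‖tens F G‖ ^ 2 = (‖F‖ * ‖G‖) ^ 2 := by
    have h1 := inner_tens F G F G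
    rw [inner_self_eq_norm_sq_to_K, inner_self_eq_norm_sq_to_K, inner_self_eq_norm_sq_to_K] at h1
    rw [mul_pow]
    exact_mod_cast h1
  exact (sq_eq_sq₀ (norm_nonneg _) (by positivity)).1 h

/-- `k` is the integral kernel of `T`. -/
def HasKernel (T : Lp ℂ 2 μ →L[ℂ] Lp ℂ 2 μ) (k : Lp ℂ 2 (μ.prod μ)) : Prop :=
  ∀ F G, ⟪F, T G⟫_ℂ = ⟪tens F G, k⟫_ℂ

/-- For an orthonormal basis `b i` of the range, `T G = ∑ ⟨T* b i, G⟩ b i`, so the kernel is the sum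
of the tensors `b i ⊗ conj (T* b i)`, each of norm at most `‖T‖`. The factor `r` is not optimal, but
the geometric decay in its application absorbs it. -/
theorem exists_hasKernel_of_rank_le {T : Lp ℂ 2 μ →L[ℂ] Lp ℂ 2 μ} {r : ℕ}
    (hT : LinearMap.rank T.toLinearMap ≤ r) : ∃ k, HasKernel T k ∧ ‖k‖ ≤ r * ‖T‖ := by
  let W : Submodule ℂ (Lp ℂ 2 μ) := LinearMap.range T.toLinearMap
  have hfin : FiniteDimensional ℂ W :=
    Module.rank_lt_aleph0_iff.1 (lt_of_le_of_lt hT (Cardinal.natCast_lt_aleph0))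
  let b := stdOrthonormalBasis ℂ W
  have hd : Module.finrank ℂ W ≤ r := by
    have h := hT
    rw [LinearMap.rank, ← Module.finrank_eq_rank ℂ W] at h
    exact_mod_cast h
  have hb : ∀ i, ‖((b i : W) : Lp ℂ 2 μ)‖ = 1 := fun i => b.orthonormal.1 i
  refine ⟨∑ i, tens (b i : Lp ℂ 2 μ) (T.adjoint (b i : Lp ℂ 2 μ)), fun F G => ?_, ?_⟩
  · simp only [inner_sum, inner_tens, ContinuousLinearMap.adjoint_inner_left]
    have h1 := b.sum_repr' (⟨T G, ⟨G, rfl⟩⟩ : W)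
    have h2 := congrArg (Subtype.val) h1
    simp only [Submodule.coe_sum, Submodule.coe_smul, Submodule.coe_inner] at h2
    conv_lhs => rw [← h2]
    simp only [inner_sum, inner_smul_right]
    exact Finset.sum_congr rfl fun i _ => mul_comm _ _
  · refine (norm_sum_le _ _).trans ?_
    have : ∀ i ∈ Finset.univ, ‖tens (b i : Lp ℂ 2 μ) (T.adjoint (b i : Lp ℂ 2 μ))‖ ≤ ‖T‖ := by
      intro i _
      rw [norm_tens, hb, one_mul]
      refine (ContinuousLinearMap.le_opNorm _ _).trans ?_
      rw [hb, mul_one, LinearIsometryEquiv.norm_map]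
    refine (Finset.sum_le_sum this).trans ?_
    simp only [Finset.sum_const, Finset.card_univ, Fintype.card_fin, nsmul_eq_mul]
    gcongr

/-- Telescoping: `T = S 0 + ∑ (S (j+1) - S j)`, where the `j`-th difference has rank at most `r j +
r (j+1)` and norm at most `e j + e (j+1)`. The summability assumption makes the series of kernels
converge absolutely in `L²`. -/
theorem exists_hasKernel_of_approx {T : Lp ℂ 2 μ →L[ℂ] Lp ℂ 2 μ}
    {S : ℕ → Lp ℂ 2 μ →L[ℂ] Lp ℂ 2 μ} {r : ℕ → ℕ} {e : ℕ → ℝ}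
    (hr : ∀ j, LinearMap.rank (S j).toLinearMap ≤ r j) (he : ∀ j, ‖T - S j‖ ≤ e j)
    (he0 : Tendsto e atTop (𝓝 0))
    (hs : Summable fun j => ((r j + r (j + 1) : ℕ) : ℝ) * (e j + e (j + 1))) :
    ∃ k, HasKernel T k := by
  obtain ⟨k0, hk0, -⟩ := exists_hasKernel_of_rank_le (hr 0)
  have hdiff : ∀ j, LinearMap.rank (S (j + 1) - S j).toLinearMap ≤ (r j + r (j + 1) : ℕ) := by
    intro j
    have h1 : (S (j + 1) - S j).toLinearMap =
        (S (j + 1)).toLinearMap + (-LinearMap.id) ∘ₗ (S j).toLinearMap := by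
      ext1 x; simp [sub_eq_add_neg]
    rw [h1]
    refine (LinearMap.rank_add_le _ _).trans ?_
    rw [add_comm (r j)]
    push_cast
    exact add_le_add (hr _) ((LinearMap.rank_comp_le_right _ _).trans (hr _))
  choose d hd hdn using fun j => exists_hasKernel_of_rank_le (hdiff j)
  have hsd : Summable d := by
    refine Summable.of_norm_bounded hs fun j => (hdn j).trans ?_
    gcongr
    calc ‖S (j + 1) - S j‖ = ‖(T - S j) - (T - S (j + 1))‖ := by congr 1; abel
      _ ≤ _ := (norm_sub_le _ _).trans (add_le_add (he _) (he _))
  refine ⟨k0 + ∑' j, d j, fun F G => ?_⟩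
  have h1 : ∀ n, ⟪F, S n G⟫_ℂ = ⟪tens F G, k0 + ∑ j ∈ Finset.range n, d j⟫_ℂ := by
    intro n
    induction n with
    | zero => simpa using hk0 F G
    | succ n ih =>
      rw [Finset.sum_range_succ, ← add_assoc, inner_add_right, ← ih, ← hd n F G,
        ← inner_add_right]
      congr 1
      simp
  have h2 : Tendsto (fun n => ⟪F, S n G⟫_ℂ) atTop (𝓝 ⟪F, T G⟫_ℂ) := by
    have hS : Tendsto S atTop (𝓝 T) := by
      rw [tendsto_iff_norm_sub_tendsto_zero]
      refine squeeze_zero (fun _ => norm_nonneg _) (fun j => ?_) he0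
      rw [norm_sub_rev]; exact he j
    have hS' : Tendsto (fun n => S n G) atTop (𝓝 (T G)) :=
      ((ContinuousLinearMap.apply ℂ (Lp ℂ 2 μ) G).continuous.tendsto T).comp hS
    exact tendsto_const_nhds.inner hS'
  have h3 : Tendsto (fun n => ⟪tens F G, k0 + ∑ j ∈ Finset.range n, d j⟫_ℂ) atTop
      (𝓝 ⟪tens F G, k0 + ∑' j, d j⟫_ℂ) :=
    tendsto_const_nhds.inner (tendsto_const_nhds.add hsd.hasSum.tendsto_sum_nat)
  exact tendsto_nhds_unique h2 (h3.congr fun n => (h1 n).symm)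

theorem HasKernel.integral_eq {T : Lp ℂ 2 μ →L[ℂ] Lp ℂ 2 μ} {k : Lp ℂ 2 (μ.prod μ)}
    (h : HasKernel T k) (F G : Lp ℂ 2 μ) :
    ∫ x, F x * T G x ∂μ = ∫ p : M × M, k p * F p.1 * G p.2 ∂(μ.prod μ) := by
  -- The inner product is conjugate linear in its first entry; conjugating `F` yields the bilinear
  -- pairing.
  have h1 := h (star F) G
  rw [L2.inner_def, L2.inner_def] at h1
  have e1 : ∫ x, F x * T G x ∂μ = ∫ x, ⟪(star F : Lp ℂ 2 μ) x, T G x⟫_ℂ ∂μ := by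
    refine integral_congr_ae ?_
    filter_upwards [Lp.coeFn_star F] with x hx
    rw [hx]
    simp [mul_comm]
  rw [e1, h1]
  refine integral_congr_ae ?_
  have h3 : ∀ᵐ p ∂(μ.prod μ), (star F : Lp ℂ 2 μ) p.1 = conj (F p.1) :=
    Measure.quasiMeasurePreserving_fst.ae (Lp.coeFn_star F)
  filter_upwards [tens_coeFn (star F) G, h3] with p hp hp3
  rw [hp, hp3]
  simp
  ring

end Kernel

/-! ### Powers improve the order of approximation by finite rank. -/

section RankPower

variable {H : Type*} [NormedAddCommGroup H] [InnerProductSpace ℂ H]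

/-- Telescoping `R^{m+1} - E^{m+1} = (R^m - E^m) R + E^m (R - E)` adds at most `r` to the rank at
each step. If `E` is the error of a rank `r` approximation of `R`, then `R^m - E^m` approximates
`R^m` with error `‖E‖^m` at the price of rank `m r` only. -/
theorem rank_pow_sub_pow_le (R E : H →L[ℂ] H) {r : ℕ}
    (h : LinearMap.rank (R - E).toLinearMap ≤ r) (m : ℕ) :
    LinearMap.rank (R ^ m - E ^ m).toLinearMap ≤ (m * r : ℕ) := by
  induction m with
  | zero => simp [LinearMap.rank_zero]
  | succ m ih =>
    have h1 : (R ^ (m + 1) - E ^ (m + 1)).toLinearMap =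
        (R ^ m - E ^ m).toLinearMap ∘ₗ R.toLinearMap + (E ^ m).toLinearMap ∘ₗ
          (R - E).toLinearMap := by
      have : R ^ (m + 1) - E ^ (m + 1) = (R ^ m - E ^ m) * R + E ^ m * (R - E) := by
        rw [pow_succ, pow_succ]; noncomm_ring
      rw [this]; rfl
    rw [h1, add_mul, one_mul]
    refine (LinearMap.rank_add_le _ _).trans ?_
    rw [Nat.cast_add]
    exact add_le_add ((LinearMap.rank_comp_le_left _ _).trans ih)
      ((LinearMap.rank_comp_le_right _ _).trans h)

end RankPower

/-! ### Finite rank approximation of the resolvent from small widths of the form domain. -/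

section Weyl

universe u v

variable {V : Type u} {H : Type v} [AddCommGroup V] [Module ℂ V]
  [NormedAddCommGroup H] [InnerProductSpace ℂ H] [CompleteSpace H]
  {ι : V →ₗ[ℂ] H} {a : V → V → ℂ}

/-- A quantitative form of the compactness of the embedding of the form domain: up to
`O(N ^ n)` functionals, the norm of `H` is bounded by `O(1/N)` times the form norm. -/
def HasSmallWidths (ι : V →ₗ[ℂ] H) (a : V → V → ℂ) (n : ℕ) : Prop :=
  ∃ C : ℝ, 0 < C ∧ ∀ N : ℕ, 1 ≤ N → ∃ (I : Type) (_ : Fintype I), (Fintype.card I : ℝ) ≤ C * N ^ n ∧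
    ∃ ψ : I → V →ₗ[ℂ] ℂ, (∃ B, ∀ k v, ‖ψ k v‖ ≤ B * ‖ι v‖) ∧
    ∃ K, ∀ v, ‖ι v‖ ^ 2 ≤ (C / N) ^ 2 * (a v v).re + K * ∑ k, ‖ψ k v‖ ^ 2

/-- Project the form Hilbert space orthogonally onto the span of the Riesz representatives of the
functionals. On the complement all functionals vanish, so the inequality leaves `‖ext w‖ ≤ (C / N)
‖w‖`; inserting the projection between `ext` and its adjoint gives the approximation. -/
theorem FormCompletion.exists_rank_le (F : FormCompletion ι a)
    (bound : ∀ v, 1 * ‖ι v‖ ^ 2 ≤ (a v v).re) {n : ℕ} (h : HasSmallWidths ι a n) :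
    ∃ C : ℝ, 0 < C ∧ ∀ N : ℕ, 1 ≤ N → ∃ r : ℕ, (r : ℝ) ≤ C * N ^ n ∧ ∃ S : H →L[ℂ] H,
      LinearMap.rank S.toLinearMap ≤ r ∧ ‖F.res - S‖ ≤ C / N := by
  obtain ⟨C, hC, h⟩ := h
  refine ⟨C, hC, fun N hN => ?_⟩
  obtain ⟨I, _, hr, ψ, ⟨B, hB⟩, K, hK⟩ := h N hN
  have hN0 : (0 : ℝ) < N := by exact_mod_cast hN
  have hext1 := F.norm_ext_le_one bound
  have hB' : ∀ k v, ‖ψ k v‖ ≤ |B| * ‖F.emb v‖ := by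
    intro k v
    refine (hB k v).trans ?_
    have : ‖ι v‖ ≤ ‖F.emb v‖ := by
      rw [← F.ext_emb]
      exact (ContinuousLinearMap.le_of_opNorm_le _ hext1 _).trans (by rw [one_mul])
    exact mul_le_mul (le_abs_self B) this (norm_nonneg _) (abs_nonneg _)
  let Ψ : I → F.carrier →L[ℂ] ℂ := fun k => (ψ k).extendOfNorm F.emb
  have hΨ : ∀ k v, Ψ k (F.emb v) = ψ k v := fun k v =>
    LinearMap.extendOfNorm_eq F.dense ⟨|B|, hB' k⟩ v
  have hK' : ∀ w, ‖F.ext w‖ ^ 2 ≤ (C / N) ^ 2 * ‖w‖ ^ 2 + K * ∑ k, ‖Ψ k w‖ ^ 2 := by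
    intro w
    refine F.dense.induction_on
      (p := fun w => ‖F.ext w‖ ^ 2 ≤ (C / N) ^ 2 * ‖w‖ ^ 2 + K * ∑ k, ‖Ψ k w‖ ^ 2) w ?_ ?_
    · exact isClosed_le (by fun_prop) (by fun_prop)
    · intro v
      simp only [F.ext_emb, hΨ]
      rw [norm_sq_eq_re_inner (𝕜 := ℂ) (F.emb v), F.inner_emb]
      exact hK v
  let U : Submodule ℂ F.carrier := Submodule.span ℂ
    (Set.range fun k => (InnerProductSpace.toDual ℂ F.carrier).symm (Ψ k))
  have hU : FiniteDimensional ℂ U := FiniteDimensional.span_of_finite ℂ (Set.finite_range _)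
  let Q : F.carrier →L[ℂ] F.carrier := U.starProjection
  have hQ : ∀ w k, Ψ k (w - Q w) = 0 := by
    intro w k
    rw [← InnerProductSpace.toDual_symm_apply (𝕜 := ℂ)]
    have h1 : w - Q w ∈ Uᗮ := U.sub_starProjection_mem_orthogonal w
    exact (Submodule.mem_orthogonal _ _).1 h1 _ (Submodule.subset_span ⟨k, rfl⟩)
  have hsmall : ‖F.ext ∘L (1 - Q)‖ ≤ C / N := by
    refine ContinuousLinearMap.opNorm_le_bound _ (by positivity) fun w => ?_
    have h1 := hK' (w - Q w)
    simp only [hQ, norm_zero, ne_eq, OfNat.ofNat_ne_zero, not_false_eq_true, zero_pow,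
      Finset.sum_const_zero, mul_zero, add_zero] at h1
    have h2 : ‖w - Q w‖ ≤ ‖w‖ := by
      have h3 : w - Q w = Uᗮ.starProjection w := by
        rw [Submodule.starProjection_orthogonal_val]
      rw [h3]
      exact Submodule.norm_starProjection_apply_le _ _
    rw [← mul_pow] at h1
    have h4 := (sq_le_sq₀ (norm_nonneg _) (by positivity)).1 h1
    refine h4.trans ?_
    gcongr
  refine ⟨Fintype.card I, hr, F.ext ∘L Q ∘L F.ext.adjoint, ?_, ?_⟩
  · have h1 : (F.ext ∘L Q ∘L F.ext.adjoint).toLinearMap =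
        F.ext.toLinearMap ∘ₗ Q.toLinearMap ∘ₗ F.ext.adjoint.toLinearMap := rfl
    have h2 : LinearMap.rank (Q.toLinearMap ∘ₗ F.ext.adjoint.toLinearMap) ≤
        (Fintype.card I : Cardinal.{u}) := by
      refine (LinearMap.rank_comp_le_left _ _).trans ?_
      have h3 : LinearMap.range Q.toLinearMap ≤ U := by
        rintro _ ⟨w, rfl⟩
        exact Submodule.starProjection_apply_mem U w
      refine (Submodule.rank_mono h3).trans ?_
      rw [← Module.finrank_eq_rank]
      exact_mod_cast finrank_range_le_card _
    rw [h1]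
    -- The completion and `H` live in different universes, so the ranks can be compared only after
    -- lifting the cardinals.
    have h4 := LinearMap.lift_rank_comp_le_right (Q.toLinearMap ∘ₗ F.ext.adjoint.toLinearMap)
      F.ext.toLinearMap
    have h5 := h4.trans (Cardinal.lift_le.2 h2)
    rw [Cardinal.lift_natCast] at h5
    rwa [Cardinal.lift_le_nat_iff] at h5
  · have h1 : F.res - F.ext ∘L Q ∘L F.ext.adjoint = (F.ext ∘L (1 - Q)) ∘L F.ext.adjoint := by
      ext1 x; simp [FormCompletion.res]
    rw [h1]
    refine (ContinuousLinearMap.opNorm_comp_le _ _).trans ?_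
    rw [LinearIsometryEquiv.norm_map]
    calc _ ≤ C / N * 1 := by gcongr
      _ = _ := mul_one _

end Weyl

/-! ### Existence of the kernel of the heat operator. -/

section Heat

theorem exists_expOfResolvent_eq_mul {E : Type*} [NormedAddCommGroup E] [InnerProductSpace ℂ E]
    [CompleteSpace E] {R : E →L[ℂ] E} (hR : IsSelfAdjoint R) (m : ℕ) {τ : ℝ} (hτ : 0 < τ) :
    ∃ G : E →L[ℂ] E, expOfResolvent R τ = G * R ^ m :=
  ⟨_, expOfResolvent_eq_mul hR m hτ⟩

variable {M : Type*} [MeasurableSpace M] {μ : Measure M} [SFinite μ]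

/-- At `N = 2^j` the resolvent is within `O(2^{-j})` of rank `O(2^{nj})`. Its `m`-th power is then
within `O(2^{-mj})` of rank of the same order, and the heat operator is that power times a bounded
operator. -/
theorem exists_hasKernel_expOfResolvent {V : Type*} [AddCommGroup V] [Module ℂ V]
    {ι : V →ₗ[ℂ] Lp ℂ 2 μ} {a : V → V → ℂ} (F : FormCompletion ι a)
    (bound : ∀ v, 1 * ‖ι v‖ ^ 2 ≤ (a v v).re) {n : ℕ} (h : HasSmallWidths ι a n) {τ : ℝ}
    (hτ : 0 < τ) : ∃ k, HasKernel (expOfResolvent F.res τ) k := by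
  obtain ⟨C, hC, h⟩ := F.exists_rank_le bound h
  choose r hr S hS hSR using fun j : ℕ => h (2 ^ j) (Nat.one_le_two_pow)
  -- The least power for which rank times error, `2^{nj} 2^{-mj} = 2^{-j}`, is summable.
  set m := n + 1 with hm
  obtain ⟨G, hG⟩ := exists_expOfResolvent_eq_mul F.res_isSelfAdjoint m hτ
  set R := F.res with hR
  let E : ℕ → Lp ℂ 2 μ →L[ℂ] Lp ℂ 2 μ := fun j => R - S j
  have hE : ∀ j, ‖E j‖ ≤ C * (1 / 2) ^ j := by
    intro j
    refine (hSR j).trans (le_of_eq ?_)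
    push_cast
    rw [one_div, inv_pow, div_eq_mul_inv]
  have hRE : ∀ j, R - E j = S j := fun j => by simp [E]
  set e : ℕ → ℝ := fun j => ‖G‖ * (C * (1 / 2) ^ j) ^ m with he
  have he' : ∀ j, e j = ‖G‖ * C ^ m * ((1 / 2) ^ m) ^ j := by
    intro j; simp only [he, mul_pow]; rw [← pow_mul, ← pow_mul, mul_comm j m]; ring
  refine exists_hasKernel_of_approx (S := fun j => G * (R ^ m - E j ^ m))
    (r := fun j => m * r j) (e := e) ?_ ?_ ?_ ?_
  · intro j
    have h1 : (G * (R ^ m - E j ^ m)).toLinearMap =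
      G.toLinearMap ∘ₗ (R ^ m - E j ^ m).toLinearMap := rfl
    rw [h1]
    refine (LinearMap.rank_comp_le_right _ _).trans (rank_pow_sub_pow_le R (E j) ?_ m)
    rw [hRE]; exact hS j
  · intro j
    rw [hG, ← mul_sub, sub_sub_cancel]
    refine (norm_mul_le _ _).trans ?_
    simp only [he]
    gcongr
    refine (norm_pow_le' _ (Nat.succ_pos n)).trans ?_
    gcongr
    exact hE j
  · rw [show e = fun j => ‖G‖ * C ^ m * ((1 / 2) ^ m) ^ j from funext he']
    have := tendsto_pow_atTop_nhds_zero_of_lt_one (r := ((1 : ℝ) / 2) ^ m) (by positivity)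
      (pow_lt_one₀ (by norm_num) (by norm_num) (Nat.succ_ne_zero n))
    simpa using this.const_mul (‖G‖ * C ^ m)
  · have hsum : Summable fun j : ℕ => (m * C * (1 + 2 ^ n) * (‖G‖ * C ^ m) * 2) * (1 / 2 : ℝ) ^ j :=
      (summable_geometric_two).mul_left _
    refine Summable.of_nonneg_of_le (fun j => ?_) (fun j => ?_) hsum
    · have : ∀ j, 0 ≤ e j := fun j => by rw [he']; positivity
      have h1 := this j
      have h2 := this (j + 1)
      positivity
    · have hr' : ∀ j, (r j : ℝ) ≤ C * (2 ^ n) ^ j := fun j => by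
        have := hr j
        push_cast at this
        rwa [← pow_mul, mul_comm j n, pow_mul] at this
      have h1 : ((m * r j + m * r (j + 1) : ℕ) : ℝ) ≤ m * C * (1 + 2 ^ n) * (2 ^ n) ^ j := by
        push_cast
        have h1 := hr' j
        have h2 := hr' (j + 1)
        calc (m : ℝ) * r j + m * r (j + 1)
            ≤ m * (C * (2 ^ n) ^ j) + m * (C * (2 ^ n) ^ (j + 1)) := by gcongr
          _ = _ := by ring
      have h2 : e j + e (j + 1) ≤ ‖G‖ * C ^ m * 2 * ((1 / 2) ^ m) ^ j := by
        rw [he', he', pow_succ (((1 : ℝ) / 2) ^ m) j]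
        have h3 : ((1 : ℝ) / 2) ^ m ≤ 1 := pow_le_one₀ (by norm_num) (by norm_num)
        have h4 : 0 ≤ ‖G‖ * C ^ m * (((1 : ℝ) / 2) ^ m) ^ j := by positivity
        nlinarith [mul_le_mul_of_nonneg_left h3 h4]
      calc _ ≤ (m * C * (1 + 2 ^ n) * (2 ^ n) ^ j) * (‖G‖ * C ^ m * 2 * ((1 / 2) ^ m) ^ j) := by
            apply mul_le_mul h1 h2 _ (by positivity)
            rw [he', he']; positivity
        _ = (m * C * (1 + 2 ^ n) * (‖G‖ * C ^ m) * 2) * ((2 ^ n) * ((1 / 2) ^ m)) ^ j := by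
            rw [mul_pow]; ring
        _ = _ := by
            congr 2
            rw [hm, pow_succ, ← mul_assoc, ← mul_pow]; norm_num

end Heat

end SemiFlat
end

noncomputable section

namespace SemiFlat

/-! ### Orthonormal bases of an abstract positive definite form. -/

section LinearAlgebra

theorem exists_orthonormal_basis_of_form {V : Type*} [AddCommGroup V] [Module ℝ V]
    [FiniteDimensional ℝ V] (Q : V → V → ℝ) (symm : ∀ v w, Q v w = Q w v)
    (pos : ∀ v, v ≠ 0 → 0 < Q v v) (add : ∀ u v w, Q (u + v) w = Q u w + Q v w)
    (smul : ∀ (r : ℝ) v w, Q (r • v) w = r * Q v w) {n : ℕ} (hn : Module.finrank ℝ V = n) :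
    ∃ e : Module.Basis (Fin n) ℝ V, ∀ i j, Q (e i) (e j) = if i = j then 1 else 0 := by
  have h0 : Q 0 0 = 0 := by simpa using smul 0 0 0
  let core : InnerProductSpace.Core ℝ V :=
    { inner := Q
      conj_inner_symm := fun v w => symm w v
      re_inner_nonneg := fun v => by
        rcases eq_or_ne v 0 with rfl | hv
        · exact h0.ge
        · exact (pos v hv).le
      add_left := add
      smul_left := fun v w r => smul r v w
      definite := fun v hv => by
        by_contra h
        exact (pos v h).ne' hv }
  let _ : NormedAddCommGroup V := @InnerProductSpace.Core.toNormedAddCommGroup ℝ V _ _ _ core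
  let _ : InnerProductSpace ℝ V := InnerProductSpace.ofCore core.toCore
  let b := (stdOrthonormalBasis ℝ V).reindex (finCongr hn)
  refine ⟨b.toBasis, fun i j => ?_⟩
  have := orthonormal_iff_ite.1 b.orthonormal i j
  rw [OrthonormalBasis.coe_toBasis]
  exact this

end LinearAlgebra

/-! ### Pointwise Riemannian geometry of complex covectors, and its expression in charts. -/

section Riemannian

variable {n : ℕ} {M : Type*} [TopologicalSpace M] [ChartedSpace (EuclideanSpace ℝ (Fin n)) M]
  [IsManifold (𝓡 n) ∞ M]

/-- The Gram matrix of a family of tangent vectors. -/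
def gram (g : Metric n M) (x : M) (e : Fin n → TangentSpace (𝓡 n) x) :
    Matrix (Fin n) (Fin n) ℝ :=
  Matrix.of fun i j => g.inner x (e i) (e j)

theorem eq_sum_frame (x : M) (v : TangentSpace (𝓡 n) x) :
    v = ∑ k, (show EuclideanSpace ℝ (Fin n) from v) k • frame x k := by
  have := (EuclideanSpace.basisFun (Fin n) ℝ).sum_repr (show EuclideanSpace ℝ (Fin n) from v)
  simp only [EuclideanSpace.basisFun_apply] at this
  exact this.symm

/-- The coordinates of a family of tangent vectors in the frame. -/
def frameMatrix (x : M) (e : Fin n → TangentSpace (𝓡 n) x) : Matrix (Fin n) (Fin n) ℝ :=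
  Matrix.of fun k i => (show EuclideanSpace ℝ (Fin n) from e i) k

theorem gram_eq_mul (g : Metric n M) (x : M) (e : Fin n → TangentSpace (𝓡 n) x) :
    gram g x e = (frameMatrix x e).transpose * gram g x (frame x) * frameMatrix x e := by
  ext i j
  simp only [gram, Matrix.mul_apply, Matrix.transpose_apply, Matrix.of_apply, frameMatrix]
  conv_lhs => rw [eq_sum_frame x (e i), eq_sum_frame x (e j)]
  simp only [map_sum, map_smul, sum_apply, smul_apply, smul_eq_mul,
    Finset.sum_mul, Finset.mul_sum]
  refine Finset.sum_congr rfl fun k _ => Finset.sum_congr rfl fun l _ => ?_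
  ring

/-- The inner product is defined through the standard frame of the model space. If `P` is the matrix
of `e` in that frame, the Gram matrix becomes `Pᵀ G P` and the components of covectors are
multiplied by `P`, so the two changes cancel. Nonvanishing of the determinant forces `P` to be
invertible, i.e. `e` to be a basis. -/
theorem covectorInner_eq_of_frame (g : Metric n M) (x : M) (e : Fin n → TangentSpace (𝓡 n) x)
    (he : (gram g x e).det ≠ 0) (a b : TangentSpace (𝓡 n) x →L[ℝ] ℂ) :
    covectorInner g x a b =
      ∑ i, ∑ j, (((gram g x e)⁻¹ i j : ℝ) : ℂ) * conj (a (e i)) * b (e j) := by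
  set P := frameMatrix x e with hP
  set G := gram g x (frame x) with hG
  have hdet : (gram g x e).det = P.det * G.det * P.det := by
    rw [gram_eq_mul, Matrix.det_mul, Matrix.det_mul, Matrix.det_transpose]
  have hPu : IsUnit P.det := by
    rw [isUnit_iff_ne_zero]; intro h; rw [h] at hdet; exact he (by rw [hdet]; simp)
  have hinv : G⁻¹ = P * (gram g x e)⁻¹ * P.transpose := by
    rw [gram_eq_mul, Matrix.mul_inv_rev, Matrix.mul_inv_rev, ← Matrix.mul_assoc, ← Matrix.mul_assoc,
      Matrix.mul_nonsing_inv _ hPu, Matrix.one_mul, Matrix.mul_assoc, ← hG, ← hP,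
      Matrix.nonsing_inv_mul _ (by rwa [Matrix.det_transpose]), Matrix.mul_one]
  have hexp : ∀ (c : TangentSpace (𝓡 n) x →L[ℝ] ℂ) i, c (e i) = ∑ k, (P k i : ℂ) * c (frame x k) := by
    intro c i
    conv_lhs => rw [eq_sum_frame x (e i)]
    simp only [map_sum, map_smul, Complex.real_smul]
    rfl
  have hgoal : covectorInner g x a b =
      ∑ k, ∑ l, ((G⁻¹ k l : ℝ) : ℂ) * conj (a (frame x k)) * b (frame x l) := rfl
  rw [hgoal, hinv]
  simp only [hexp, Matrix.mul_apply, Matrix.transpose_apply, map_sum, map_mul, Complex.conj_ofReal,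
    Complex.ofReal_sum, Complex.ofReal_mul, Finset.sum_mul, Finset.mul_sum]
  calc _ = ∑ k, ∑ l, ∑ i, ∑ j, (P k i : ℂ) * (((gram g x e)⁻¹ i j : ℝ) : ℂ) * (P l j : ℂ) *
        conj (a (frame x k)) * b (frame x l) := by
        refine Finset.sum_congr rfl fun k _ => Finset.sum_congr rfl fun l _ => ?_
        rw [Finset.sum_comm]
    _ = ∑ i, ∑ j, ∑ l, ∑ k, (P k i : ℂ) * (((gram g x e)⁻¹ i j : ℝ) : ℂ) * (P l j : ℂ) *
        conj (a (frame x k)) * b (frame x l) := by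
        simp only [← Finset.sum_product']
        refine Finset.sum_bij' (fun p _ => ((p.2.2.1, p.2.2.2), p.2.1, p.1).1.1 |> fun i =>
          (i, p.2.2.2, p.2.1, p.1)) (fun q _ => (q.2.2.2, q.2.2.1, q.1, q.2.1)) ?_ ?_ ?_ ?_ ?_ <;>
          simp
    _ = _ := by
        refine Finset.sum_congr rfl fun i _ => Finset.sum_congr rfl fun j _ =>
          Finset.sum_congr rfl fun l _ => Finset.sum_congr rfl fun k _ => ?_
        ring

theorem exists_onFrame (g : Metric n M) (x : M) :
    ∃ e : Module.Basis (Fin n) ℝ (TangentSpace (𝓡 n) x),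
      ∀ i j, g.inner x (e i) (e j) = if i = j then 1 else 0 := by
  have : FiniteDimensional ℝ (TangentSpace (𝓡 n) x) :=
    inferInstanceAs (FiniteDimensional ℝ (EuclideanSpace ℝ (Fin n)))
  refine exists_orthonormal_basis_of_form (fun v w => g.inner x v w) (g.symm x) (g.pos x)
    (fun u v w => by simp) (fun r v w => by simp) ?_
  exact finrank_euclideanSpace_fin

/-- A basis of the tangent space at `x` that is orthonormal with respect to `g`. -/
def onFrame (g : Metric n M) (x : M) : Module.Basis (Fin n) ℝ (TangentSpace (𝓡 n) x) :=
  (exists_onFrame g x).choose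

theorem onFrame_inner (g : Metric n M) (x : M) (i j : Fin n) :
    g.inner x (onFrame g x i) (onFrame g x j) = if i = j then 1 else 0 :=
  (exists_onFrame g x).choose_spec i j

theorem covectorInner_eq_of_orthonormal (g : Metric n M) (x : M)
    (e : Fin n → TangentSpace (𝓡 n) x) (he : ∀ i j, g.inner x (e i) (e j) = if i = j then 1 else 0)
    (a b : TangentSpace (𝓡 n) x →L[ℝ] ℂ) :
    covectorInner g x a b = ∑ i, conj (a (e i)) * b (e i) := by
  have h1 : gram g x e = 1 := by
    ext i j; simp [gram, he, Matrix.one_apply]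
  rw [covectorInner_eq_of_frame g x e (by rw [h1]; simp), h1]
  refine Finset.sum_congr rfl fun i _ => ?_
  rw [Finset.sum_eq_single i]
  · simp
  · intro j _ hj; simp [Matrix.one_apply, hj.symm]
  · simp

/-- The components of a covector in the orthonormal frame. -/
def covVec (g : Metric n M) (x : M) :
    (TangentSpace (𝓡 n) x →L[ℝ] ℂ) →ₗ[ℂ] EuclideanSpace ℂ (Fin n) where
  toFun a := WithLp.toLp 2 fun i => a (onFrame g x i)
  map_add' a b := by ext i; simp
  map_smul' r a := by ext i; simp

/-- Components in an orthonormal frame turn the pairing into that of a Euclidean space, from which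
the triangle inequality, sesquilinearity and Hermitian symmetry are inherited. -/
theorem covectorInner_eq_inner (g : Metric n M) (x : M) (a b : TangentSpace (𝓡 n) x →L[ℝ] ℂ) :
    covectorInner g x a b = Inner.inner ℂ (covVec g x a) (covVec g x b) := by
  rw [covectorInner_eq_of_orthonormal g x _ (onFrame_inner g x), PiLp.inner_apply]
  simp [covVec, mul_comm]

/-- The norm of a covector. -/
def cnorm (g : Metric n M) (x : M) (a : TangentSpace (𝓡 n) x →L[ℝ] ℂ) : ℝ := ‖covVec g x a‖

theorem cnorm_nonneg (g : Metric n M) (x : M) (a : TangentSpace (𝓡 n) x →L[ℝ] ℂ) :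
    0 ≤ cnorm g x a := norm_nonneg _

theorem covectorInner_self (g : Metric n M) (x : M) (a : TangentSpace (𝓡 n) x →L[ℝ] ℂ) :
    covectorInner g x a a = ((cnorm g x a ^ 2 : ℝ) : ℂ) := by
  rw [covectorInner_eq_inner, inner_self_eq_norm_sq_to_K]; simp [cnorm]

theorem cnorm_add_le (g : Metric n M) (x : M) (a b : TangentSpace (𝓡 n) x →L[ℝ] ℂ) :
    cnorm g x (a + b) ≤ cnorm g x a + cnorm g x b := by
  unfold cnorm; rw [map_add]; exact norm_add_le _ _

theorem cnorm_smul (g : Metric n M) (x : M) (r : ℂ) (a : TangentSpace (𝓡 n) x →L[ℝ] ℂ) :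
    cnorm g x (r • a) = ‖r‖ * cnorm g x a := by
  unfold cnorm; rw [map_smul, norm_smul]

theorem cnorm_sq_eq_of_orthonormal (g : Metric n M) (x : M)
    (e : Fin n → TangentSpace (𝓡 n) x) (he : ∀ i j, g.inner x (e i) (e j) = if i = j then 1 else 0)
    (a : TangentSpace (𝓡 n) x →L[ℝ] ℂ) :
    cnorm g x a ^ 2 = ∑ i, ‖a (e i)‖ ^ 2 := by
  have h := covectorInner_self g x a
  rw [covectorInner_eq_of_orthonormal g x e he] at h
  have : ∀ i, conj (a (e i)) * a (e i) = ((‖a (e i)‖ ^ 2 : ℝ) : ℂ) := fun i => by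
    rw [Complex.conj_mul']; push_cast; rfl
  simp only [this] at h
  exact_mod_cast h.symm

theorem norm_covector_apply_le (g : Metric n M) (x : M) (a : TangentSpace (𝓡 n) x →L[ℝ] ℂ)
    (v : TangentSpace (𝓡 n) x) : ‖a v‖ ^ 2 ≤ cnorm g x a ^ 2 * g.inner x v v := by
  set e := onFrame g x
  have hv : v = ∑ i, e.repr v i • e i := (e.sum_repr v).symm
  have h1 : g.inner x v v = ∑ i, (e.repr v i) ^ 2 := by
    conv_lhs => rw [hv]
    simp only [map_sum, map_smul, sum_apply, smul_apply, smul_eq_mul, e, onFrame_inner]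
    simp [sq]
  have h2 : ‖a v‖ ≤ ∑ i, ‖a (e i)‖ * |e.repr v i| := by
    conv_lhs => rw [hv]
    rw [map_sum]
    refine (norm_sum_le _ _).trans (le_of_eq (Finset.sum_congr rfl fun i _ => ?_))
    rw [map_smul, norm_smul, Real.norm_eq_abs, mul_comm]
  rw [cnorm_sq_eq_of_orthonormal g x e (onFrame_inner g x), h1]
  calc ‖a v‖ ^ 2 ≤ (∑ i, ‖a (e i)‖ * |e.repr v i|) ^ 2 := by gcongr
    _ ≤ (∑ i, ‖a (e i)‖ ^ 2) * ∑ i, |e.repr v i| ^ 2 := Finset.sum_mul_sq_le_sq_mul_sq _ _ _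
    _ = _ := by simp only [sq_abs]

theorem covectorInner_conj_symm (g : Metric n M) (x : M) (a b : TangentSpace (𝓡 n) x →L[ℝ] ℂ) :
    conj (covectorInner g x b a) = covectorInner g x a b := by
  rw [covectorInner_eq_inner, covectorInner_eq_inner]; exact inner_conj_symm _ _

/-! ### Coordinates -/

variable (x₀ : M)

local notation "φ₀" => chartAt (EuclideanSpace ℝ (Fin n)) x₀

theorem gram_coordVec_posDef (g : Metric n M) {y : EuclideanSpace ℝ (Fin n)}
    (hy : y ∈ (φ₀).target) : (gram g ((φ₀).symm y) (coordVec φ₀ y)).PosDef := by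
  set L := (mdifferentiable_chart (I := 𝓡 n) x₀).symm.mfderiv hy
  refine Matrix.PosDef.of_dotProduct_mulVec_pos ?_ fun v hv => ?_
  · ext i j
    simp only [gram, Matrix.conjTranspose_apply, Matrix.of_apply, star_trivial]
    exact g.symm _ _ _
  · set w : EuclideanSpace ℝ (Fin n) := WithLp.toLp 2 v with hw
    have hw0 : w ≠ 0 := by
      intro h; apply hv; ext i
      have := congrArg (fun u : EuclideanSpace ℝ (Fin n) => u i) h
      simpa [hw] using this
    have hpos := g.pos ((φ₀).symm y) (L w) (by
      intro h; exact hw0 (L.injective (by rw [h]; exact (map_zero L).symm)))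
    have hLw : L w = ∑ i, v i • coordVec φ₀ y i := by
      have h1 := (EuclideanSpace.basisFun (Fin n) ℝ).sum_repr w
      simp only [EuclideanSpace.basisFun_repr, EuclideanSpace.basisFun_apply] at h1
      have h2 : L w = ∑ i, w i • L (EuclideanSpace.single i (1 : ℝ) : EuclideanSpace ℝ (Fin n)) := by
        conv_lhs => rw [← h1]
        refine (map_sum L _ _).trans ?_
        exact Finset.sum_congr rfl fun i _ => map_smul L _ _
      exact h2
    rw [hLw] at hpos
    simp only [map_sum, map_smul, sum_apply, smul_apply, smul_eq_mul] at hpos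
    simp only [dotProduct, Matrix.mulVec, gram, Matrix.of_apply, star_trivial]
    refine hpos.trans_eq ?_
    simp only [Finset.mul_sum]
    refine Finset.sum_congr rfl fun i _ => Finset.sum_congr rfl fun j _ => ?_
    rw [g.symm]; ring

/-- The field is the tangent map of the inverse chart applied to a constant field, and the tangent
map of a `C²` map is `C¹`. -/
theorem contMDiffOn_coordVec (i : Fin n) :
    ContMDiffOn (𝓡 n) (𝓡 n).tangent 1 (fun y => (⟨(φ₀).symm y, coordVec φ₀ y i⟩ :
      TangentBundle (𝓡 n) M)) (φ₀).target := by
  have h1 : ContMDiffOn (𝓡 n) (𝓡 n) 2 (φ₀).symm (φ₀).target :=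
    (contMDiffOn_chart_symm (I := 𝓡 n) (n := ∞)).of_le (by norm_cast)
  have ho := (φ₀).open_target
  have h2 := h1.contMDiffOn_tangentMapWithin (m := 1) (by norm_num) ho.uniqueMDiffOn
  have h3 : ContMDiff (𝓡 n) (𝓡 n).tangent 1 (fun y : EuclideanSpace ℝ (Fin n) =>
      (⟨y, (EuclideanSpace.single i (1 : ℝ) : EuclideanSpace ℝ (Fin n))⟩ :
        TangentBundle (𝓡 n) (EuclideanSpace ℝ (Fin n)))) := by
    exact contMDiff_vectorSpace_iff_contDiff.2 contDiff_const
  have h4 := h2.comp h3.contMDiffOn (s := (φ₀).target) (fun y hy => hy)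
  refine h4.congr fun y hy => ?_
  simp only [Function.comp, tangentMapWithin]
  rw [mfderivWithin_of_isOpen ho hy]
  rfl

theorem continuousOn_gram (g : Metric n M) :
    ContinuousOn (fun y => gram g ((φ₀).symm y) (coordVec φ₀ y)) (φ₀).target := by
  refine continuousOn_pi.2 fun i => continuousOn_pi.2 fun j => ?_
  have hs : ContMDiffOn (𝓡 n) (𝓡 n) 1 (φ₀).symm (φ₀).target :=
    (contMDiffOn_chart_symm (I := 𝓡 n) (n := ∞)).of_le (by norm_cast)
  have hg := (g.contMDiff.of_le (m := 1) (by norm_cast)).comp_contMDiffOn hs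
  intro y hy
  have : ContMDiffWithinAt (𝓡 n) ((𝓡 n).prod 𝓘(ℝ)) 1
      (fun m ↦ Bundle.TotalSpace.mk' ℝ (E := Bundle.Trivial M ℝ) ((φ₀).symm m)
        (g.inner ((φ₀).symm m) (coordVec φ₀ m i) (coordVec φ₀ m j))) (φ₀).target y := by
    apply ContMDiffWithinAt.clm_bundle_apply₂ (F₁ := EuclideanSpace ℝ (Fin n))
      (F₂ := EuclideanSpace ℝ (Fin n))
    · exact hg y hy
    · exact contMDiffOn_coordVec x₀ i y hy
    · exact contMDiffOn_coordVec x₀ j y hy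
  simp only [Bundle.contMDiffWithinAt_totalSpace] at this
  exact this.2.continuousWithinAt

theorem differential_coordVec {F : M → ℂ} {y : EuclideanSpace ℝ (Fin n)} (hy : y ∈ (φ₀).target)
    (hF : MDifferentiableAt (𝓡 n) 𝓘(ℝ, ℂ) F ((φ₀).symm y)) (i : Fin n) :
    differential F ((φ₀).symm y) (coordVec φ₀ y i) =
      fderiv ℝ (F ∘ (φ₀).symm) y (EuclideanSpace.single i (1 : ℝ)) := by
  have h1 := mfderiv_comp (I := 𝓡 n) (I' := 𝓡 n) (I'' := 𝓘(ℝ, ℂ)) y hF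
    ((mdifferentiable_chart (I := 𝓡 n) x₀).mdifferentiableAt_symm hy)
  rw [← mfderiv_eq_fderiv]
  have : mfderiv 𝓘(ℝ, EuclideanSpace ℝ (Fin n)) 𝓘(ℝ, ℂ) (F ∘ (φ₀).symm) y = _ := h1
  rw [this]
  rfl

theorem volumeDensity_pos (g : Metric n M) {y : EuclideanSpace ℝ (Fin n)} (hy : y ∈ (φ₀).target) :
    0 < volumeDensity g φ₀ y :=
  Real.sqrt_pos.2 (gram_coordVec_posDef x₀ g hy).det_pos

theorem continuousOn_volumeDensity (g : Metric n M) :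
    ContinuousOn (volumeDensity g φ₀) (φ₀).target := by
  have := (continuousOn_gram x₀ g)
  exact (Continuous.matrix_det (continuous_id (X := Matrix (Fin n) (Fin n) ℝ))).comp_continuousOn
    this |>.sqrt

end Riemannian

end SemiFlat
end

noncomputable section

namespace SemiFlat

theorem measurableSet_inter_preimage_of_continuousOn {α β : Type*} [TopologicalSpace α]
    [MeasurableSpace α] [OpensMeasurableSpace α] [TopologicalSpace β] [MeasurableSpace β]
    [BorelSpace β] {f : α → β} {s : Set α} {t : Set β} (hf : ContinuousOn f s)
    (hs : MeasurableSet s) (ht : MeasurableSet t) : MeasurableSet (s ∩ f ⁻¹' t) := by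
  have h1 : Measurable (s.domRestrict f) := (continuousOn_iff_continuous_domRestrict.1 hf).measurable
  have h2 := hs.subtype_image (h1 ht)
  convert h2 using 1
  ext x
  simp [Set.domRestrict, and_comm]

/-! ### The Riemannian measure: compatibility of the chart measures and their gluing. -/

section Riemannian

variable {n : ℕ} {M : Type*} [TopologicalSpace M] [ChartedSpace (EuclideanSpace ℝ (Fin n)) M]
  [IsManifold (𝓡 n) ∞ M]

local notation "E" => EuclideanSpace ℝ (Fin n)
local notation "ch" => chartAt (EuclideanSpace ℝ (Fin n))

/-- A change of coordinates. -/
def transition (x₀ x₁ : M) (y : E) : E := ch x₁ ((ch x₀).symm y)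

theorem contDiffOn_transition (x₀ x₁ : M) :
    ContDiffOn ℝ ∞ (transition (n := n) x₀ x₁)
      ((ch x₀).target ∩ (ch x₀).symm ⁻¹' (ch x₁).source) := by
  have h1 : ContMDiffOn (𝓡 n) (𝓡 n) ∞ (ch x₀).symm (ch x₀).target :=
    contMDiffOn_chart_symm (I := 𝓡 n) (n := ∞)
  have h2 : ContMDiffOn (𝓡 n) (𝓡 n) ∞ (ch x₁) (ch x₁).source :=
    contMDiffOn_chart (I := 𝓡 n) (n := ∞)
  exact contMDiffOn_iff_contDiffOn.1
    (h2.comp (h1.mono inter_subset_left) (fun y hy => hy.2))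

theorem isOpen_transition_domain (x₀ x₁ : M) :
    IsOpen ((ch x₀).target ∩ (ch x₀).symm ⁻¹' (ch x₁).source) :=
  (ch x₀).isOpen_inter_preimage_symm (ch x₁).open_source

theorem coordVec_transition (x₀ x₁ : M) {y : E}
    (hy : y ∈ (ch x₀).target ∩ (ch x₀).symm ⁻¹' (ch x₁).source) (i : Fin n) :
    (show E from coordVec (ch x₀) y i) = ∑ k, (fderiv ℝ (transition x₀ x₁) y
        (EuclideanSpace.single i (1 : ℝ))) k •
      (show E from coordVec (ch x₁) (transition x₀ x₁ y) k) := by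
  have ho := isOpen_transition_domain (n := n) x₀ x₁
  have hT : HasFDerivAt (transition x₀ x₁) (fderiv ℝ (transition x₀ x₁) y) y :=
    (((contDiffOn_transition x₀ x₁).contDiffAt (ho.mem_nhds hy)).differentiableAt
      (by simp)).hasFDerivAt
  have ht1 : transition x₀ x₁ y ∈ (ch x₁).target := (ch x₁).map_source hy.2
  have hs : HasMFDerivAt (𝓡 n) (𝓡 n) (ch x₁).symm (transition x₀ x₁ y)
      (mfderiv (𝓡 n) (𝓡 n) (ch x₁).symm (transition x₀ x₁ y)) :=
    ((mdifferentiable_chart (I := 𝓡 n) x₁).mdifferentiableAt_symm ht1).hasMFDerivAt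
  have hc := hs.comp y (hasMFDerivAt_iff_hasFDerivAt.2 hT : HasMFDerivAt (𝓡 n) (𝓡 n)
    (transition x₀ x₁) y (fderiv ℝ (transition x₀ x₁) y))
  have heq : (ch x₀).symm =ᶠ[𝓝 y] (ch x₁).symm ∘ transition x₀ x₁ := by
    filter_upwards [ho.mem_nhds hy] with z hz
    exact ((ch x₁).left_inv hz.2).symm
  have hd := (hc.congr_of_eventuallyEq heq).mfderiv
  have h1 : (show E from coordVec (ch x₀) y i) =
      (show E from mfderiv (𝓡 n) (𝓡 n) (ch x₁).symm (transition x₀ x₁ y)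
        (fderiv ℝ (transition x₀ x₁) y (EuclideanSpace.single i (1 : ℝ)))) := by
    exact congrArg (fun L : E →L[ℝ] E => L (EuclideanSpace.single i (1 : ℝ))) hd
  rw [h1]
  set w := fderiv ℝ (transition x₀ x₁) y (EuclideanSpace.single i (1 : ℝ))
  have h2 := (EuclideanSpace.basisFun (Fin n) ℝ).sum_repr w
  simp only [EuclideanSpace.basisFun_apply] at h2
  have h3 : ∀ L : E →L[ℝ] E, L w = ∑ k, w k • L (EuclideanSpace.single k (1 : ℝ)) := by
    intro L
    conv_lhs => rw [← h2]
    rw [map_sum]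
    exact Finset.sum_congr rfl fun i _ => map_smul L _ _
  exact h3 (mfderiv (𝓡 n) (𝓡 n) (ch x₁).symm (transition x₀ x₁ y))

theorem volumeDensity_transition (g : Metric n M) (x₀ x₁ : M) {y : E}
    (hy : y ∈ (ch x₀).target ∩ (ch x₀).symm ⁻¹' (ch x₁).source) :
    volumeDensity g (ch x₀) y = |(fderiv ℝ (transition x₀ x₁) y).det| *
      volumeDensity g (ch x₁) (transition x₀ x₁ y) := by
  have hpt : (ch x₁).symm (transition x₀ x₁ y) = (ch x₀).symm y := (ch x₁).left_inv hy.2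
  -- The base point has two expressions, equal but not by definition, with formally different
  -- tangent spaces. Viewing the metric as a family of forms on the model space allows one to be
  -- rewritten into the other.
  let gE : M → E →L[ℝ] E →L[ℝ] ℝ := fun x => g.inner x
  let J : Matrix (Fin n) (Fin n) ℝ := Matrix.of fun k i =>
    (fderiv ℝ (transition x₀ x₁) y (EuclideanSpace.single i (1 : ℝ))) k
  let c₀ : Fin n → E := fun i => coordVec (ch x₀) y i
  let c₁ : Fin n → E := fun i => coordVec (ch x₁) (transition x₀ x₁ y) i
  have hc : ∀ i, c₀ i = ∑ k, J k i • c₁ k := fun i => coordVec_transition x₀ x₁ hy i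
  let G₀ : Matrix (Fin n) (Fin n) ℝ := Matrix.of fun i j => gE ((ch x₀).symm y) (c₀ i) (c₀ j)
  let G₁ : Matrix (Fin n) (Fin n) ℝ := Matrix.of fun i j => gE ((ch x₀).symm y) (c₁ i) (c₁ j)
  have hG : G₀ = J.transpose * G₁ * J := by
    ext i j
    simp only [G₀, G₁, Matrix.mul_apply, Matrix.transpose_apply, Matrix.of_apply, hc, map_sum,
      map_smul, sum_apply, smul_apply, smul_eq_mul, Finset.sum_mul, Finset.mul_sum]
    refine Finset.sum_congr rfl fun k _ => Finset.sum_congr rfl fun l _ => ?_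
    ring
  have hJ : J.det = (fderiv ℝ (transition x₀ x₁) y).det := by
    have : J = LinearMap.toMatrix (EuclideanSpace.basisFun (Fin n) ℝ).toBasis
        (EuclideanSpace.basisFun (Fin n) ℝ).toBasis
        (fderiv ℝ (transition x₀ x₁) y).toLinearMap := by
      ext k i
      simp [J, LinearMap.toMatrix_apply]
    rw [this, LinearMap.det_toMatrix]
  have h0 : volumeDensity g (ch x₀) y = Real.sqrt G₀.det := rfl
  have h1 : volumeDensity g (ch x₁) (transition x₀ x₁ y) = Real.sqrt G₁.det := by
    have : volumeDensity g (ch x₁) (transition x₀ x₁ y) = Real.sqrt (Matrix.det (Matrix.of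
      fun i j : Fin n => gE ((ch x₁).symm (transition x₀ x₁ y)) (c₁ i) (c₁ j))) := rfl
    rw [this, hpt]
  rw [h0, h1, hG, Matrix.det_mul, Matrix.det_mul, Matrix.det_transpose, ← hJ,
    ← Real.sqrt_sq_eq_abs, ← Real.sqrt_mul (sq_nonneg _)]
  congr 1; ring

variable [MeasurableSpace M]

/-- The Riemannian measure of the chart domain at `x₀`. -/
def chartMeasure (g : Metric n M) (x₀ : M) : Measure M :=
  Measure.map (ch x₀).symm ((volume.restrict (ch x₀).target).withDensity
    fun y => ENNReal.ofReal (volumeDensity g (ch x₀) y))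

theorem riemannianMeasure_eq_iSup (g : Metric n M) :
    riemannianMeasure g = ⨆ x, chartMeasure g x := rfl

variable [BorelSpace M]

theorem aemeasurable_chart_symm (x₀ : M) :
    AEMeasurable (ch x₀).symm (volume.restrict (ch x₀).target) :=
  (ch x₀).continuousOn_symm.aemeasurable (ch x₀).open_target.measurableSet

theorem aemeasurable_density (g : Metric n M) (x₀ : M) :
    AEMeasurable (fun y => ENNReal.ofReal (volumeDensity g (ch x₀) y))
      (volume.restrict (ch x₀).target) :=
  ((continuousOn_volumeDensity x₀ g).aemeasurable (ch x₀).open_target.measurableSet).ennreal_ofReal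

theorem lintegral_chartMeasure (g : Metric n M) (x₀ : M) {f : M → ℝ≥0∞} (hf : Measurable f) :
    ∫⁻ x, f x ∂(chartMeasure g x₀) = ∫⁻ y in (ch x₀).target,
      ENNReal.ofReal (volumeDensity g (ch x₀) y) * f ((ch x₀).symm y) := by
  have h1 := aemeasurable_chart_symm (n := n) x₀
  have h2 := aemeasurable_density g x₀
  rw [chartMeasure, lintegral_map' hf.aemeasurable
    (h1.mono_ac (withDensity_absolutelyContinuous _ _))]
  exact lintegral_withDensity_eq_lintegral_mul₀ h2 (hf.comp_aemeasurable h1)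

theorem measurableSet_chart_preimage (x₀ : M) {S : Set M} (hS : MeasurableSet S) :
    MeasurableSet ((ch x₀).target ∩ (ch x₀).symm ⁻¹' S) :=
  measurableSet_inter_preimage_of_continuousOn (ch x₀).continuousOn_symm
    (ch x₀).open_target.measurableSet hS

theorem chartMeasure_apply (g : Metric n M) (x₀ : M) {S : Set M} (hS : MeasurableSet S) :
    chartMeasure g x₀ S = ∫⁻ y in (ch x₀).target ∩ (ch x₀).symm ⁻¹' S,
      ENNReal.ofReal (volumeDensity g (ch x₀) y) := by
  have hm := measurableSet_chart_preimage (n := n) x₀ hS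
  rw [← lintegral_indicator_one hS, lintegral_chartMeasure g x₀ (measurable_one.indicator hS),
    ← lintegral_indicator (ch x₀).open_target.measurableSet, ← lintegral_indicator hm]
  refine lintegral_congr fun y => ?_
  by_cases h1 : y ∈ (ch x₀).target <;> by_cases h2 : (ch x₀).symm y ∈ S <;>
    simp [h1, h2, indicator]

/-- Change of variables: the Jacobian of the transition map is the ratio of the two densities. -/
theorem chartMeasure_eq (g : Metric n M) (x₀ x₁ : M) {S : Set M} (hS : MeasurableSet S)
    (h0 : S ⊆ (ch x₀).source) (h1 : S ⊆ (ch x₁).source) :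
    chartMeasure g x₀ S = chartMeasure g x₁ S := by
  rw [chartMeasure_apply g x₀ hS, chartMeasure_apply g x₁ hS]
  set A := (ch x₀).target ∩ (ch x₀).symm ⁻¹' S with hA
  have hAd : A ⊆ (ch x₀).target ∩ (ch x₀).symm ⁻¹' (ch x₁).source :=
    inter_subset_inter_right _ (preimage_mono h1)
  have himg : transition x₀ x₁ '' A = (ch x₁).target ∩ (ch x₁).symm ⁻¹' S := by
    ext z
    constructor
    · rintro ⟨y, hy, rfl⟩
      refine ⟨(ch x₁).map_source (hAd hy).2, ?_⟩
      change (ch x₁).symm (ch x₁ ((ch x₀).symm y)) ∈ S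
      rw [(ch x₁).left_inv (hAd hy).2]
      exact hy.2
    · rintro ⟨hz1, hz2⟩
      refine ⟨ch x₀ ((ch x₁).symm z), ⟨(ch x₀).map_source (h0 hz2), ?_⟩, ?_⟩
      · change (ch x₀).symm (ch x₀ ((ch x₁).symm z)) ∈ S
        rw [(ch x₀).left_inv (h0 hz2)]; exact hz2
      · change (ch x₁) ((ch x₀).symm (ch x₀ ((ch x₁).symm z))) = z
        rw [(ch x₀).left_inv (h0 hz2), (ch x₁).right_inv hz1]
  have hinj : InjOn (transition x₀ x₁) A := by
    intro y hy z hz h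
    have h2 := (ch x₁).injOn (hAd hy).2 (hAd hz).2 h
    exact (ch x₀).symm.injOn hy.1 hz.1 h2
  have ho := isOpen_transition_domain (n := n) x₀ x₁
  rw [← himg, lintegral_image_eq_lintegral_abs_det_fderiv_mul volume
    (measurableSet_chart_preimage x₀ hS) (f' := fderiv ℝ (transition x₀ x₁))
    (fun y hy => ((((contDiffOn_transition x₀ x₁).contDiffAt (ho.mem_nhds (hAd hy))).differentiableAt
      (by simp)).hasFDerivAt).hasFDerivWithinAt) hinj]
  refine setLIntegral_congr_fun (measurableSet_chart_preimage x₀ hS) fun y hy => ?_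
  rw [← ENNReal.ofReal_mul (abs_nonneg _), volumeDensity_transition g x₀ x₁ (hAd hy)]

theorem chartMeasure_inter_source (g : Metric n M) (x₀ : M) {S : Set M} (hS : MeasurableSet S) :
    chartMeasure g x₀ (S ∩ (ch x₀).source) = chartMeasure g x₀ S := by
  rw [chartMeasure_apply g x₀ hS, chartMeasure_apply g x₀ (hS.inter (ch x₀).open_source.measurableSet)]
  congr 2
  ext y
  simp only [mem_inter_iff, mem_preimage]
  exact ⟨fun h => ⟨h.1, h.2.1⟩, fun h => ⟨h.1, h.2, (ch x₀).map_target h.1⟩⟩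

variable [SecondCountableTopology M]

/-- A supremum of measures is not computed set by set, so an explicit majorant is needed.
Restricting the measures of countably many charts to disjoint pieces that cover `M` and adding them
gives a measure `ν`. It agrees with every chart measure inside the domain of that chart, hence
dominates them all, and the supremum is at most `ν`. -/
theorem riemannianMeasure_apply_of_subset (g : Metric n M) (x₀ : M) {S : Set M}
    (hS : MeasurableSet S) (h0 : S ⊆ (ch x₀).source) :
    riemannianMeasure g S = chartMeasure g x₀ S := by
  refine le_antisymm ?_ ((le_iSup (chartMeasure g) x₀) S)
  have : Nonempty M := ⟨x₀⟩
  obtain ⟨s, hs, hcov⟩ := TopologicalSpace.countable_cover_nhds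
    (fun x : M => (ch x).open_source.mem_nhds (mem_chart_source E x))
  have hsne : s.Nonempty := by
    by_contra h
    rw [not_nonempty_iff_eq_empty] at h
    simp [h] at hcov
    exact (univ_nonempty (α := M)).ne_empty hcov.symm
  obtain ⟨u, rfl⟩ := hs.exists_eq_range hsne
  rw [biUnion_range] at hcov
  let D : ℕ → Set M := disjointed fun k => (ch (u k)).source
  have hDm : ∀ k, MeasurableSet (D k) :=
    fun k => MeasurableSet.disjointed (fun k => (ch (u k)).open_source.measurableSet) k
  have hDu : ⋃ k, D k = univ := by rw [iUnion_disjointed, hcov]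
  have hDd : Pairwise (Function.onFun Disjoint D) := disjoint_disjointed _
  have hDs : ∀ k, D k ⊆ (ch (u k)).source := fun k => disjointed_subset _ k
  let ν : Measure M := Measure.sum fun k => (chartMeasure g (u k)).restrict (D k)
  have hν : ∀ x, ∀ S : Set M, MeasurableSet S → S ⊆ (ch x).source →
      ν S = chartMeasure g x S := by
    intro x S hS hsub
    rw [Measure.sum_apply _ hS]
    have h1 : ∀ k, (chartMeasure g (u k)).restrict (D k) S = chartMeasure g x (S ∩ D k) := by
      intro k
      rw [Measure.restrict_apply hS]
      exact chartMeasure_eq g _ _ (hS.inter (hDm k)) (inter_subset_right.trans (hDs k))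
        (inter_subset_left.trans hsub)
    simp only [h1]
    rw [← measure_iUnion (fun i j hij => (hDd hij).mono inter_subset_right inter_subset_right)
      (fun k => hS.inter (hDm k)), ← inter_iUnion, hDu, inter_univ]
  rw [← hν x₀ S hS h0, riemannianMeasure_eq_iSup]
  refine (iSup_le fun x => ?_ : (⨆ x, chartMeasure g x) ≤ ν) S
  refine Measure.le_iff.2 fun S' hS' => ?_
  rw [← chartMeasure_inter_source g x hS', ← hν x _ (hS'.inter (ch x).open_source.measurableSet)
    inter_subset_right]
  exact measure_mono inter_subset_left

theorem riemannianMeasure_restrict_source (g : Metric n M) (x₀ : M) :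
    (riemannianMeasure g).restrict (ch x₀).source = chartMeasure g x₀ := by
  ext S hS
  rw [Measure.restrict_apply hS, riemannianMeasure_apply_of_subset g x₀
    (hS.inter (ch x₀).open_source.measurableSet) inter_subset_right,
    chartMeasure_inter_source g x₀ hS]

theorem setLIntegral_chart_source (g : Metric n M) (x₀ : M) {f : M → ℝ≥0∞} (hf : Measurable f) :
    ∫⁻ x in (ch x₀).source, f x ∂(riemannianMeasure g) = ∫⁻ y in (ch x₀).target,
      ENNReal.ofReal (volumeDensity g (ch x₀) y) * f ((ch x₀).symm y) := by
  rw [riemannianMeasure_restrict_source, lintegral_chartMeasure g x₀ hf]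

instance (g : Metric n M) : IsLocallyFiniteMeasure (riemannianMeasure g) := by
  refine ⟨fun x₀ => ?_⟩
  obtain ⟨K, hK, hKn, hKt⟩ : ∃ K, IsCompact K ∧ K ∈ 𝓝 (ch x₀ x₀) ∧ K ⊆ (ch x₀).target := by
    obtain ⟨K, h1, h2, h3⟩ := local_compact_nhds ((ch x₀).open_target.mem_nhds (mem_chart_target E x₀))
    exact ⟨K, h3, h1, h2⟩
  refine ⟨(ch x₀).source ∩ ch x₀ ⁻¹' interior K, ?_, ?_⟩
  · refine ((ch x₀).isOpen_inter_preimage isOpen_interior).mem_nhds ⟨mem_chart_source E x₀, ?_⟩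
    exact mem_interior_iff_mem_nhds.2 hKn
  · have hm : MeasurableSet ((ch x₀).source ∩ ch x₀ ⁻¹' interior K) :=
      ((ch x₀).isOpen_inter_preimage isOpen_interior).measurableSet
    rw [riemannianMeasure_apply_of_subset g x₀ hm inter_subset_left, chartMeasure_apply g x₀ hm]
    obtain ⟨B, hB⟩ := hK.exists_bound_of_continuousOn ((continuousOn_volumeDensity x₀ g).mono hKt)
    calc _ ≤ ∫⁻ y in (ch x₀).target ∩ (ch x₀).symm ⁻¹' ((ch x₀).source ∩ ch x₀ ⁻¹' interior K),
          ENNReal.ofReal B := by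
          refine setLIntegral_mono' (measurableSet_chart_preimage x₀ hm) fun y hy => ?_
          refine ENNReal.ofReal_le_ofReal ((le_abs_self _).trans (hB y ?_))
          have := hy.2.2
          rw [mem_preimage, (ch x₀).right_inv hy.1] at this
          exact interior_subset this
      _ ≤ ENNReal.ofReal B * volume K := by
          rw [setLIntegral_const]
          gcongr
          intro y hy
          have := hy.2.2
          rw [mem_preimage, (ch x₀).right_inv hy.1] at this
          exact interior_subset this
      _ < ⊤ := ENNReal.mul_lt_top ENNReal.ofReal_lt_top hK.measure_lt_top

end Riemannian

/-! ### Continuity of the integrands of the Dirichlet form. -/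

section Continuity

variable {n : ℕ} {M : Type*} [TopologicalSpace M] [ChartedSpace (EuclideanSpace ℝ (Fin n)) M]
  [IsManifold (𝓡 n) ∞ M]

local notation "E" => EuclideanSpace ℝ (Fin n)
local notation "ch" => chartAt (EuclideanSpace ℝ (Fin n))

theorem contDiffOn_comp_chart_symm {G : Type*} [NormedAddCommGroup G] [NormedSpace ℝ G]
    {F : M → G} {U : Set M} {k : WithTop ℕ∞} (hk : k ≤ (∞ : ℕ∞ω))
    (hF : ContMDiffOn (𝓡 n) 𝓘(ℝ, G) k F U) (x₀ : M) :
    ContDiffOn ℝ k (F ∘ (ch x₀).symm) ((ch x₀).target ∩ (ch x₀).symm ⁻¹' U) := by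
  have h1 : ContMDiffOn (𝓡 n) (𝓡 n) k (ch x₀).symm (ch x₀).target :=
    (contMDiffOn_chart_symm (I := 𝓡 n) (n := ∞)).of_le hk
  exact contMDiffOn_iff_contDiffOn.1
    (hF.comp (h1.mono inter_subset_left) (fun y hy => hy.2))

theorem covectorInner_chart (g : Metric n M) (x₀ : M) {F F' : M → ℂ} {y : E}
    (hy : y ∈ (ch x₀).target) (hF : MDifferentiableAt (𝓡 n) 𝓘(ℝ, ℂ) F ((ch x₀).symm y))
    (hF' : MDifferentiableAt (𝓡 n) 𝓘(ℝ, ℂ) F' ((ch x₀).symm y)) :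
    covectorInner g ((ch x₀).symm y) (differential F ((ch x₀).symm y))
        (differential F' ((ch x₀).symm y)) =
      ∑ i, ∑ j, (((gram g ((ch x₀).symm y) (coordVec (ch x₀) y))⁻¹ i j : ℝ) : ℂ) *
        conj (fderiv ℝ (F ∘ (ch x₀).symm) y (EuclideanSpace.single i (1 : ℝ))) *
        fderiv ℝ (F' ∘ (ch x₀).symm) y (EuclideanSpace.single j (1 : ℝ)) := by
  rw [covectorInner_eq_of_frame g _ _ (gram_coordVec_posDef x₀ g hy).det_pos.ne']
  simp only [differential_coordVec x₀ hy hF, differential_coordVec x₀ hy hF']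

theorem continuousOn_gram_inv (g : Metric n M) (x₀ : M) (i j : Fin n) :
    ContinuousOn (fun y => (gram g ((ch x₀).symm y) (coordVec (ch x₀) y))⁻¹ i j)
      (ch x₀).target := by
  have h := continuousOn_gram x₀ g
  have hdet : ContinuousOn (fun y => (gram g ((ch x₀).symm y) (coordVec (ch x₀) y)).det)
      (ch x₀).target :=
    (Continuous.matrix_det (continuous_id (X := Matrix (Fin n) (Fin n) ℝ))).comp_continuousOn h
  have hadj : ContinuousOn (fun y => (gram g ((ch x₀).symm y) (coordVec (ch x₀) y)).adjugate i j)
      (ch x₀).target :=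
    ((Continuous.matrix_adjugate (continuous_id (X := Matrix (Fin n) (Fin n) ℝ))).matrix_elem
      i j).comp_continuousOn h
  refine ((hdet.inv₀ fun y hy => (gram_coordVec_posDef x₀ g hy).det_pos.ne').mul hadj).congr ?_
  intro y _
  simp [Matrix.inv_def]

theorem continuousOn_covectorInner (g : Metric n M) {U : Set M} (hU : IsOpen U) {F F' : M → ℂ}
    (hF : ContMDiffOn (𝓡 n) 𝓘(ℝ, ℂ) 1 F U) (hF' : ContMDiffOn (𝓡 n) 𝓘(ℝ, ℂ) 1 F' U) :
    ContinuousOn (fun x => covectorInner g x (differential F x) (differential F' x)) U := by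
  intro x₀ hx₀
  refine ContinuousAt.continuousWithinAt ?_
  have h1 : ∀ {F : M → ℂ}, ContMDiffOn (𝓡 n) 𝓘(ℝ, ℂ) 1 F U → ∀ i : Fin n,
      ContinuousOn (fun y => fderiv ℝ (F ∘ (ch x₀).symm) y (EuclideanSpace.single i (1 : ℝ)))
        ((ch x₀).target ∩ (ch x₀).symm ⁻¹' U) := by
    intro F hF i
    have h2 := contDiffOn_comp_chart_symm (by norm_cast) hF x₀
    have h3 := h2.continuousOn_fderiv_of_isOpen ((ch x₀).isOpen_inter_preimage_symm hU) le_rfl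
    exact h3.clm_apply continuousOn_const
  have h2 : ContinuousOn (fun y => ∑ i, ∑ j,
      (((gram g ((ch x₀).symm y) (coordVec (ch x₀) y))⁻¹ i j : ℝ) : ℂ) *
        conj (fderiv ℝ (F ∘ (ch x₀).symm) y (EuclideanSpace.single i (1 : ℝ))) *
        fderiv ℝ (F' ∘ (ch x₀).symm) y (EuclideanSpace.single j (1 : ℝ)))
        ((ch x₀).target ∩ (ch x₀).symm ⁻¹' U) := by
    refine continuousOn_finsetSum _ fun i _ => continuousOn_finsetSum _ fun j _ => ?_
    refine ((Complex.continuous_ofReal.comp_continuousOn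
      ((continuousOn_gram_inv g x₀ i j).mono inter_subset_left)).mul
      (Complex.continuous_conj.comp_continuousOn (h1 hF i))).mul (h1 hF' j)
  have hmem : ch x₀ x₀ ∈ (ch x₀).target ∩ (ch x₀).symm ⁻¹' U :=
    ⟨mem_chart_target E x₀, by rw [mem_preimage, (ch x₀).left_inv (mem_chart_source E x₀)]; exact hx₀⟩
  have h3 := (h2.continuousAt
    (((ch x₀).isOpen_inter_preimage_symm hU).mem_nhds hmem)).comp
    ((ch x₀).continuousAt (mem_chart_source E x₀))
  refine h3.congr ?_
  filter_upwards [(ch x₀).open_source.mem_nhds (mem_chart_source E x₀), hU.mem_nhds hx₀]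
    with x hx hxU
  have hd : ∀ {F : M → ℂ}, ContMDiffOn (𝓡 n) 𝓘(ℝ, ℂ) 1 F U →
      MDifferentiableAt (𝓡 n) 𝓘(ℝ, ℂ) F ((ch x₀).symm (ch x₀ x)) := by
    intro F hF
    rw [(ch x₀).left_inv hx]
    exact (hF.contMDiffAt (hU.mem_nhds hxU)).mdifferentiableAt (by norm_num)
  have h4 := covectorInner_chart g x₀ ((ch x₀).map_source hx) (hd hF) (hd hF')
  simp only [Function.comp]
  rw [(ch x₀).left_inv hx] at h4 ⊢
  rw [h4]

end Continuity

end SemiFlat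
end

noncomputable section

namespace SemiFlat

/-! ### The Dirichlet form on `C¹` functions of compact support, and the resolvent it defines. -/

section C1c

variable {n : ℕ} {M : Type*} [TopologicalSpace M] [ChartedSpace (EuclideanSpace ℝ (Fin n)) M]
  [IsManifold (𝓡 n) ∞ M]

theorem hasMFDerivAt_mul_const {F : M → ℂ} {x : M} (r : ℂ)
    (hF : MDifferentiableAt (𝓡 n) 𝓘(ℝ, ℂ) F x) :
    HasMFDerivAt (𝓡 n) 𝓘(ℝ, ℂ) (r • F) x
      ((r • differential F x : TangentSpace (𝓡 n) x →L[ℝ] ℂ)) := by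
  have h1 : HasMFDerivAt 𝓘(ℝ, ℂ) 𝓘(ℝ, ℂ) (fun z : ℂ => r • z) (F x)
      (r • ContinuousLinearMap.id ℝ ℂ) :=
    hasMFDerivAt_iff_hasFDerivAt.2 ((hasFDerivAt_id (F x)).const_smul r)
  exact h1.comp x hF.hasMFDerivAt

theorem differential_smul {F : M → ℂ} {x : M} (r : ℂ)
    (hF : MDifferentiableAt (𝓡 n) 𝓘(ℝ, ℂ) F x) :
    differential (n := n) (r • F) x = r • differential F x := (hasMFDerivAt_mul_const r hF).mfderiv

theorem differential_add {F G : M → ℂ} {x : M} (hF : MDifferentiableAt (𝓡 n) 𝓘(ℝ, ℂ) F x)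
    (hG : MDifferentiableAt (𝓡 n) 𝓘(ℝ, ℂ) G x) :
    differential (n := n) (F + G) x = differential F x + differential G x :=
  (hF.hasMFDerivAt.add hG.hasMFDerivAt).mfderiv

theorem differential_eq_zero {F : M → ℂ} {x : M} (hx : x ∉ tsupport F) :
    differential (n := n) F x = 0 := by
  have h1 : F =ᶠ[𝓝 x] fun _ => (0 : ℂ) := notMem_tsupport_iff_eventuallyEq.1 hx
  have h2 : HasMFDerivAt (𝓡 n) 𝓘(ℝ, ℂ) F x (0 : TangentSpace (𝓡 n) x →L[ℝ] ℂ) :=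
    (hasMFDerivAt_const (0 : ℂ) x).congr_of_eventuallyEq h1
  exact h2.mfderiv

theorem differential_congr {F G : M → ℂ} {x : M} (h : F =ᶠ[𝓝 x] G) :
    differential (n := n) F x = differential G x := by
  exact h.mfderiv_eq

variable (n) in
/-- Complex valued `C¹` functions with compact support in `U`. -/
def C1c (U : Set M) : Submodule ℂ (M → ℂ) where
  carrier := {φ | ContMDiff (𝓡 n) 𝓘(ℝ, ℂ) 1 φ ∧ HasCompactSupport φ ∧ tsupport φ ⊆ U}
  add_mem' := fun ⟨h1, h2, h3⟩ ⟨h1', h2', h3'⟩ =>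
    ⟨h1.add h1', h2.add h2', (tsupport_add _ _).trans (union_subset h3 h3')⟩
  zero_mem' := ⟨contMDiff_const, HasCompactSupport.zero, by simp [tsupport]⟩
  smul_mem' := fun r φ ⟨h1, h2, h3⟩ => by
    refine ⟨?_, h2.smul_left (f := fun _ => r), (tsupport_smul_subset_right (fun _ => r) φ).trans h3⟩
    exact ((r • ContinuousLinearMap.id ℝ ℂ : ℂ →L[ℝ] ℂ).contMDiff).comp h1

variable {U : Set M}

theorem C1c.mdifferentiableAt (φ : C1c n U) (x : M) :
    MDifferentiableAt (𝓡 n) 𝓘(ℝ, ℂ) (φ : M → ℂ) x :=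
  φ.2.1.mdifferentiable (by norm_num) x

theorem IsTestFunction.mem_C1c {φ : M → ℂ} (h : IsTestFunction (n := n) U φ) : φ ∈ C1c n U :=
  ⟨h.1.of_le (by norm_cast), h.2.1, h.2.2⟩

theorem C1c.continuous_covectorInner (g : Metric n M) (φ ψ : C1c n U) :
    Continuous fun x => covectorInner g x (differential (φ : M → ℂ) x)
      (differential (ψ : M → ℂ) x) :=
  continuousOn_univ.1 (continuousOn_covectorInner g isOpen_univ φ.2.1.contMDiffOn
    ψ.2.1.contMDiffOn)

theorem covectorInner_zero_left (g : Metric n M) (x : M) (b : TangentSpace (𝓡 n) x →L[ℝ] ℂ) :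
    covectorInner g x 0 b = 0 := by
  rw [covectorInner_eq_inner, map_zero, inner_zero_left]

theorem C1c.hasCompactSupport_covectorInner [T2Space M] (g : Metric n M) (φ ψ : C1c n U) :
    HasCompactSupport fun x => covectorInner g x (differential (φ : M → ℂ) x)
      (differential (ψ : M → ℂ) x) := by
  refine HasCompactSupport.of_support_subset_isCompact φ.2.2.1 fun x hx => ?_
  by_contra h
  exact hx (by simp only [differential_eq_zero h]; exact covectorInner_zero_left g x _)

theorem C1c.continuous_cnorm_sq (g : Metric n M) (φ : C1c n U) :
    Continuous fun x => cnorm g x (differential (φ : M → ℂ) x) ^ 2 := by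
  have := Complex.continuous_re.comp (C1c.continuous_covectorInner g φ φ)
  refine this.congr fun x => ?_
  simp only [Function.comp, covectorInner_self, Complex.ofReal_re]

theorem C1c.continuous_cnorm (g : Metric n M) (φ : C1c n U) :
    Continuous fun x => cnorm g x (differential (φ : M → ℂ) x) := by
  have := (C1c.continuous_cnorm_sq g φ).sqrt
  refine this.congr fun x => ?_
  exact Real.sqrt_sq (cnorm_nonneg g x _)

variable [T2Space M] [SecondCountableTopology M] [MeasurableSpace M] [BorelSpace M]

theorem C1c.integrable_covectorInner (g : Metric n M) (φ ψ : C1c n U) :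
    Integrable (fun x => covectorInner g x (differential (φ : M → ℂ) x)
      (differential (ψ : M → ℂ) x)) (measureOn g U) :=
  ((C1c.continuous_covectorInner g φ ψ).integrable_of_hasCompactSupport
    (C1c.hasCompactSupport_covectorInner g φ ψ))

theorem C1c.memLp (g : Metric n M) (φ : C1c n U) : MemLp (φ : M → ℂ) 2 (measureOn g U) :=
  φ.2.1.continuous.memLp_of_hasCompactSupport φ.2.2.1

/-- The inclusion of `C¹` functions with compact support in `L²`. -/
def C1c.toLp (g : Metric n M) (U : Set M) : C1c n U →ₗ[ℂ] L2 g U where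
  toFun φ := (C1c.memLp g φ).toLp φ
  map_add' φ ψ := MemLp.toLp_add (C1c.memLp g φ) (C1c.memLp g ψ)
  map_smul' r φ := MemLp.toLp_const_smul r (C1c.memLp g φ)

theorem C1c.toLp_coeFn (g : Metric n M) (φ : C1c n U) :
    C1c.toLp g U φ =ᵐ[measureOn g U] (φ : M → ℂ) := MemLp.coeFn_toLp (C1c.memLp g φ)

/-- The Dirichlet form shifted by `α`. -/
def C1c.form (g : Metric n M) (U : Set M) (α : ℝ) (φ ψ : C1c n U) : ℂ :=
  dirichletForm g U φ ψ + α * Inner.inner ℂ (C1c.toLp g U φ) (C1c.toLp g U ψ)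

theorem C1c.dirichletForm_conj_symm (g : Metric n M) (φ ψ : C1c n U) :
    conj (dirichletForm g U ψ φ) = dirichletForm g U φ ψ := by
  unfold dirichletForm
  rw [← integral_conj]
  exact integral_congr_ae (Eventually.of_forall fun x => covectorInner_conj_symm g x _ _)

theorem C1c.dirichletForm_add_left (g : Metric n M) (φ φ' ψ : C1c n U) :
    dirichletForm g U (φ + φ' : C1c n U) ψ = dirichletForm g U φ ψ + dirichletForm g U φ' ψ := by
  unfold dirichletForm
  rw [← integral_add (C1c.integrable_covectorInner g φ ψ) (C1c.integrable_covectorInner g φ' ψ)]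
  refine integral_congr_ae (Eventually.of_forall fun x => ?_)
  have := differential_add (C1c.mdifferentiableAt φ x) (C1c.mdifferentiableAt φ' x)
  simp only [Submodule.coe_add, this, covectorInner_eq_inner, map_add, inner_add_left]

theorem C1c.dirichletForm_smul_left (g : Metric n M) (φ ψ : C1c n U) (r : ℂ) :
    dirichletForm g U (r • φ : C1c n U) ψ = conj r * dirichletForm g U φ ψ := by
  unfold dirichletForm
  rw [← integral_const_mul]
  refine integral_congr_ae (Eventually.of_forall fun x => ?_)
  have := differential_smul r (C1c.mdifferentiableAt φ x)
  simp only [Submodule.coe_smul, this, covectorInner_eq_inner, map_smul, inner_smul_left]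

theorem C1c.dirichletForm_self (g : Metric n M) (φ : C1c n U) :
    dirichletForm g U φ φ =
      ((∫ x, cnorm g x (differential (φ : M → ℂ) x) ^ 2 ∂(measureOn g U) : ℝ) : ℂ) := by
  unfold dirichletForm
  rw [← integral_complex_ofReal]
  exact integral_congr_ae (Eventually.of_forall fun x => covectorInner_self g x _)

theorem C1c.integrable_cnorm_sq (g : Metric n M) (φ : C1c n U) :
    Integrable (fun x => cnorm g x (differential (φ : M → ℂ) x) ^ 2) (measureOn g U) := by
  have := (C1c.integrable_covectorInner g φ φ).re
  refine this.congr (Eventually.of_forall fun x => ?_)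
  simp only [covectorInner_self, RCLike.re_to_complex, Complex.ofReal_re]

theorem C1c.energy_eq (g : Metric n M) (φ : C1c n U) :
    energy g U φ = ENNReal.ofReal (dirichletForm g U φ φ).re := by
  rw [C1c.dirichletForm_self, Complex.ofReal_re, ofReal_integral_eq_lintegral_ofReal
    (C1c.integrable_cnorm_sq g φ) (Eventually.of_forall fun x => sq_nonneg _)]
  unfold energy
  refine lintegral_congr fun x => ?_
  rw [covectorInner_self, Complex.ofReal_re]

theorem C1c.dirichletForm_self_nonneg (g : Metric n M) (φ : C1c n U) :
    0 ≤ (dirichletForm g U φ φ).re := by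
  rw [C1c.dirichletForm_self, Complex.ofReal_re]
  exact integral_nonneg fun x => sq_nonneg _

theorem C1c.form_self_re (g : Metric n M) (α : ℝ) (φ : C1c n U) :
    (C1c.form g U α φ φ).re = (dirichletForm g U φ φ).re + α * ‖C1c.toLp g U φ‖ ^ 2 := by
  unfold C1c.form
  rw [inner_self_eq_norm_sq_to_K]
  simp [← Complex.ofReal_pow]

theorem C1c.form_bound (g : Metric n M) (α : ℝ) (φ : C1c n U) :
    α * ‖C1c.toLp g U φ‖ ^ 2 ≤ (C1c.form g U α φ φ).re := by
  rw [C1c.form_self_re]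
  linarith [C1c.dirichletForm_self_nonneg g φ]

theorem C1c.nonempty_formCompletion (g : Metric n M) (U : Set M) {α : ℝ} (hα : 0 < α) :
    Nonempty (FormCompletion (C1c.toLp g U) (C1c.form g U α)) := by
  refine FormCompletion.nonempty _ _ hα (fun φ ψ => ?_) (fun φ φ' ψ => ?_) (fun φ ψ r => ?_)
    (C1c.form_bound g α)
  · simp only [C1c.form, map_add, map_mul, C1c.dirichletForm_conj_symm, Complex.conj_ofReal,
      inner_conj_symm]
  · simp only [C1c.form, C1c.dirichletForm_add_left, map_add, inner_add_left]; ring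
  · simp only [C1c.form, C1c.dirichletForm_smul_left, map_smul, inner_smul_left]; ring

/-- Test functions are dense in the `C¹` functions with compact support, for the `H¹` norm. -/
def TestFunctionsDense (g : Metric n M) (U : Set M) : Prop :=
  ∀ w : C1c n U, ∀ e : ℝ, 0 < e → ∃ φ : C1c n U, IsTestFunction (n := n) U (φ : M → ℂ) ∧
    (dirichletForm g U (φ - w : C1c n U) (φ - w : C1c n U)).re ≤ e ∧
    ‖C1c.toLp g U (φ - w)‖ ^ 2 ≤ e

theorem inner_toLp_left (g : Metric n M) (ψ : C1c n U) (f : L2 g U) :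
    Inner.inner ℂ (C1c.toLp g U ψ) f = ∫ x, conj ((ψ : M → ℂ) x) * f x ∂(measureOn g U) := by
  rw [L2.inner_def]
  refine integral_congr_ae ?_
  filter_upwards [C1c.toLp_coeFn g ψ] with x hx
  rw [hx, RCLike.inner_apply, mul_comm]

theorem TestFunctionsDense.exists_near {g : Metric n M} (h : TestFunctionsDense g U) {α : ℝ}
    (hα : 0 < α)
    (F : FormCompletion (C1c.toLp g U) (C1c.form g U α)) (w : F.carrier) {e : ℝ} (he : 0 < e) :
    ∃ φ : C1c n U, IsTestFunction (n := n) U (φ : M → ℂ) ∧ ‖F.emb φ - w‖ < e := by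
  obtain ⟨v, hv⟩ := F.dense.exists_dist_lt w (half_pos he)
  -- With this tolerance the energy plus `α` times the squared `L²` norm is at most `(e / 4)^2`; the
  -- remaining `e / 2` covers the distance from `emb v` to `w`.
  obtain ⟨φ, hφ, h1, h2⟩ := h v ((e / 4) ^ 2 / (1 + α)) (by positivity)
  refine ⟨φ, hφ, ?_⟩
  have h3 : ‖F.emb φ - F.emb v‖ ^ 2 ≤ (e / 4) ^ 2 := by
    rw [← map_sub, norm_sq_eq_re_inner (𝕜 := ℂ), F.inner_emb]
    change (C1c.form g U α (φ - v) (φ - v)).re ≤ _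
    rw [C1c.form_self_re]
    calc _ ≤ (e / 4) ^ 2 / (1 + α) + α * ((e / 4) ^ 2 / (1 + α)) := by gcongr
      _ = (e / 4) ^ 2 := by field_simp
  have h4 := (sq_le_sq₀ (norm_nonneg _) (by positivity)).1 h3
  rw [dist_comm, dist_eq_norm] at hv
  calc ‖F.emb φ - w‖ = ‖(F.emb φ - F.emb v) + (F.emb v - w)‖ := by congr 1; abel
    _ ≤ e / 4 + ‖F.emb v - w‖ := (norm_add_le _ _).trans (by gcongr)
    _ < e := by linarith

theorem eLpNorm_sub_eq (g : Metric n M) (φ : C1c n U) (u : L2 g U) :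
    eLpNorm (fun x => (φ : M → ℂ) x - u x) 2 (measureOn g U) = ‖C1c.toLp g U φ - u‖ₑ := by
  rw [Lp.enorm_def]
  refine eLpNorm_congr_ae ?_
  filter_upwards [C1c.toLp_coeFn g φ, Lp.coeFn_sub (C1c.toLp g U φ) u] with x h1 h2
  rw [h2, Pi.sub_apply, h1]

/-- An `H¹` Cauchy sequence of test functions is Cauchy for the form norm, so it has a limit `w` in
the completion with `ext w = u`. The equation `α u + H u = f` then says that `w - ext* f` is
orthogonal to all test functions, which by density means `w = ext* f`. Conversely, test functions
converging to `ext* f` exhibit `ext (ext* f)` as a solution. -/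
theorem FormCompletion.isResolvent {g : Metric n M} (h : TestFunctionsDense g U) {α : ℝ}
    (hα : 0 < α) (F : FormCompletion (C1c.toLp g U) (C1c.form g U α)) :
    IsResolvent g U α F.res := by
  have hform : ∀ φ ψ : C1c n U, dirichletForm g U φ ψ =
      Inner.inner ℂ (F.emb φ) (F.emb ψ) - α * Inner.inner ℂ (C1c.toLp g U φ) (C1c.toLp g U ψ) := by
    intro φ ψ
    rw [F.inner_emb, C1c.form]; ring
  intro f u
  constructor
  · rintro ⟨φ, ⟨htest, hL2, hen⟩, hlim⟩
    let Φ : ℕ → C1c n U := fun k => ⟨φ k, (htest k).mem_C1c⟩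
    have hL2' : Tendsto (fun k => C1c.toLp g U (Φ k)) atTop (𝓝 u) := by
      rw [tendsto_iff_edist_tendsto_0]
      refine hL2.congr fun k => ?_
      rw [edist_eq_enorm_sub]
      exact eLpNorm_sub_eq g (Φ k) u
    have hcauchy : CauchySeq fun k => F.emb (Φ k) := by
      have hen' : Tendsto (fun p : ℕ × ℕ => (dirichletForm g U (Φ p.1 - Φ p.2 : C1c n U)
          (Φ p.1 - Φ p.2 : C1c n U)).re) atTop (𝓝 0) := by
        have h1 := (ENNReal.tendsto_toReal ENNReal.zero_ne_top).comp hen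
        refine h1.congr fun p => ?_
        have h2 := C1c.energy_eq g (Φ p.1 - Φ p.2)
        have h3 : energy g U (fun x => φ p.1 x - φ p.2 x) =
          energy g U ((Φ p.1 - Φ p.2 : C1c n U) : M → ℂ) := rfl
        simp only [Function.comp]
        rw [h3, h2, ENNReal.toReal_ofReal (C1c.dirichletForm_self_nonneg g _)]
      have hu : Tendsto (fun p : ℕ × ℕ => ‖C1c.toLp g U (Φ p.1 - Φ p.2)‖ ^ 2) atTop (𝓝 0) := by
        have h1 := hL2'.cauchySeq.tendsto_uniformity
        have h2 : Tendsto (fun p : ℕ × ℕ => dist (C1c.toLp g U (Φ p.1)) (C1c.toLp g U (Φ p.2)))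
            atTop (𝓝 0) := by
          rw [← prod_atTop_atTop_eq] at h1 ⊢
          exact tendsto_uniformity_iff_dist_tendsto_zero.1 h1
        have h3 := h2.pow 2
        rw [zero_pow (by norm_num)] at h3
        refine h3.congr fun p => ?_
        rw [dist_eq_norm, map_sub]
      have hsum := (hen'.add (hu.const_mul α)).sqrt
      rw [mul_zero, add_zero, Real.sqrt_zero] at hsum
      rw [cauchySeq_iff_tendsto_dist_atTop_0]
      refine hsum.congr fun p => ?_
      rw [← C1c.form_self_re, dist_eq_norm, ← map_sub, Real.sqrt_eq_iff_mul_self_eq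
        ((by have := C1c.form_bound g α (Φ p.1 - Φ p.2); exact le_trans (by positivity) this))
        (norm_nonneg _), ← sq, norm_sq_eq_re_inner (𝕜 := ℂ), F.inner_emb]
      rfl
    obtain ⟨w, hw⟩ := cauchySeq_tendsto_of_complete hcauchy
    have hwu : F.ext w = u := by
      refine tendsto_nhds_unique ((F.ext.continuous.tendsto w).comp hw) (hL2'.congr fun k => ?_)
      exact (F.ext_emb _).symm
    have hkey : ∀ ψ : C1c n U, IsTestFunction (n := n) U (ψ : M → ℂ) →
        (Inner.inner ℂ (F.emb ψ) (w - F.ext.adjoint f) : ℂ) = 0 := by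
      intro ψ hψ
      have h1 := hlim ψ hψ
      rw [← inner_toLp_left] at h1
      have h2 : Tendsto (fun k => dirichletForm g U ψ (φ k)) atTop
          (𝓝 (Inner.inner ℂ (F.emb ψ) w - α * Inner.inner ℂ (C1c.toLp g U ψ) u)) := by
        have h3 := (tendsto_const_nhds (x := F.emb ψ)).inner (𝕜 := ℂ) hw
        have h4 := ((tendsto_const_nhds (x := C1c.toLp g U ψ)).inner (𝕜 := ℂ) hL2').const_mul (α : ℂ)
        exact (h3.sub h4).congr fun k => (hform ψ (Φ k)).symm
      have h5 := tendsto_nhds_unique h1 h2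
      rw [inner_sub_right, inner_smul_right] at h5
      rw [inner_sub_right, ContinuousLinearMap.adjoint_inner_right, F.ext_emb]
      linear_combination -h5
    have hw0 : w - F.ext.adjoint f = 0 := by
      by_contra hne
      have hpos := norm_pos_iff.2 hne
      -- A nonzero `z` orthogonal to test functions cannot have one at distance less than `‖z‖`,
      -- since `‖z‖² = ⟨z - emb ψ, z⟩ ≤ ‖z - emb ψ‖ ‖z‖`.
      obtain ⟨ψ, hψ, hnear⟩ := h.exists_near hα F (w - F.ext.adjoint f) hpos
      have h1 := hkey ψ hψ
      set z := w - F.ext.adjoint f with hz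
      have h2 : (Inner.inner ℂ (z - F.emb ψ) z : ℂ) = (‖z‖ : ℂ) ^ 2 := by
        rw [inner_sub_left, h1, sub_zero, inner_self_eq_norm_sq_to_K]; rfl
      have h3 := norm_inner_le_norm (𝕜 := ℂ) (z - F.emb ψ) z
      rw [h2, norm_sub_rev z] at h3
      simp only [norm_pow, Complex.norm_real, norm_norm] at h3
      nlinarith
    rw [FormCompletion.res, ContinuousLinearMap.comp_apply, ← hwu, ← sub_eq_zero.1 hw0]
  · intro hu
    set w := F.ext.adjoint f with hw
    choose Φ hΦ hnear using fun k : ℕ =>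
      h.exists_near hα F w (Nat.one_div_pos_of_nat (α := ℝ) (n := k))
    have hconv : Tendsto (fun k => F.emb (Φ k)) atTop (𝓝 w) := by
      rw [tendsto_iff_norm_sub_tendsto_zero]
      exact squeeze_zero (fun _ => norm_nonneg _) (fun k => (hnear k).le)
        tendsto_one_div_add_atTop_nhds_zero_nat
    have hwu : F.ext w = u := hu
    have hL2' : Tendsto (fun k => C1c.toLp g U (Φ k)) atTop (𝓝 u) := by
      rw [← hwu]
      exact ((F.ext.continuous.tendsto w).comp hconv).congr fun k => F.ext_emb _
    refine ⟨fun k => Φ k, ⟨hΦ, ?_, ?_⟩, ?_⟩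
    · have := tendsto_iff_edist_tendsto_0.1 hL2'
      refine this.congr fun k => ?_
      rw [edist_eq_enorm_sub]
      exact (eLpNorm_sub_eq g (Φ k) u).symm
    · have h1 := cauchySeq_iff_tendsto_dist_atTop_0.1 hconv.cauchySeq
      have h2 := (ENNReal.tendsto_ofReal (h1.pow 2))
      rw [zero_pow (by norm_num), ENNReal.ofReal_zero] at h2
      refine tendsto_of_tendsto_of_tendsto_of_le_of_le tendsto_const_nhds h2 (fun _ => zero_le) ?_
      intro p
      have h2 := C1c.energy_eq g (Φ p.1 - Φ p.2)
      have h3 : energy g U (fun x => (Φ p.1 : M → ℂ) x - (Φ p.2 : M → ℂ) x) =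
          energy g U ((Φ p.1 - Φ p.2 : C1c n U) : M → ℂ) := rfl
      simp only
      rw [h3, h2, dist_eq_norm, ← map_sub, norm_sq_eq_re_inner (𝕜 := ℂ), F.inner_emb]
      refine ENNReal.ofReal_le_ofReal ?_
      have := C1c.form_self_re g α (Φ p.1 - Φ p.2)
      change _ ≤ (C1c.form g U α (Φ p.1 - Φ p.2) (Φ p.1 - Φ p.2)).re
      rw [this]
      have : 0 ≤ α * ‖C1c.toLp g U (Φ p.1 - Φ p.2)‖ ^ 2 := by positivity
      linarith
    · intro ψ hψ
      let Ψ : C1c n U := ⟨ψ, hψ.mem_C1c⟩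
      have h3 := (tendsto_const_nhds (x := F.emb Ψ)).inner (𝕜 := ℂ) hconv
      have h4 := ((tendsto_const_nhds (x := C1c.toLp g U Ψ)).inner (𝕜 := ℂ) hL2').const_mul (α : ℂ)
      have h5 := (h3.sub h4).congr fun k => (hform Ψ (Φ k)).symm
      have h6 := inner_toLp_left g Ψ (f - (α : ℂ) • u)
      have h7 : ∫ x, conj (ψ x) * (f - (α : ℂ) • u) x ∂(measureOn g U) =
          Inner.inner ℂ (F.emb Ψ) w - α * Inner.inner ℂ (C1c.toLp g U Ψ) u := by
        rw [hw, ContinuousLinearMap.adjoint_inner_right, F.ext_emb, ← inner_smul_right,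
          ← inner_sub_right]
        exact h6.symm
      rw [h7]
      exact h5

/-- The relation determines every value `R f`, so the arbitrary choice made in `resolventOp` is
harmless. -/
theorem isResolvent_unique {g : Metric n M} {α : ℝ} {R R' : L2 g U →L[ℂ] L2 g U}
    (h : IsResolvent g U α R) (h' : IsResolvent g U α R') : R = R' := by
  ext1 f
  exact ((h' f (R f)).1 ((h f (R f)).2 rfl)).symm

theorem isResolvent_resolventOp {g : Metric n M} {α : ℝ} {R : L2 g U →L[ℂ] L2 g U}
    (h : IsResolvent g U α R) : IsResolvent g U α (resolventOp g U α) :=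
  Classical.epsilon_spec ⟨R, h⟩

theorem FormCompletion.resolventOp_eq {g : Metric n M} (h : TestFunctionsDense g U) {α : ℝ}
    (hα : 0 < α) (F : FormCompletion (C1c.toLp g U) (C1c.form g U α)) :
    resolventOp g U α = F.res :=
  isResolvent_unique (isResolvent_resolventOp (F.isResolvent h hα)) (F.isResolvent h hα)

end C1c

end SemiFlat
end

noncomputable section

namespace SemiFlat

/-! ### Mollification in Euclidean space, with uniform control of first derivatives. -/

section Mollify

open scoped Convolution

variable {n : ℕ}

local notation "E" => EuclideanSpace ℝ (Fin n)

/-- Convolution with a bump commutes with differentiation, and both `w` and its derivative are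
uniformly continuous because they are continuous with compact support. -/
theorem exists_smooth_approx {w : E → ℂ} (hw : ContDiff ℝ 1 w) (hc : HasCompactSupport w)
    {δ ε : ℝ} (hδ : 0 < δ) (hε : 0 < ε) :
    ∃ v : E → ℂ, ContDiff ℝ ∞ v ∧ tsupport v ⊆ Metric.cthickening δ (tsupport w) ∧
      ∀ x, ‖v x - w x‖ ≤ ε ∧ ‖fderiv ℝ v x - fderiv ℝ w x‖ ≤ ε := by
  have hD : Continuous (fderiv ℝ w) := hw.continuous_fderiv (by norm_num)
  have hu1 : UniformContinuous w :=
    hw.continuous.uniformContinuous_of_tendsto_cocompact hc.is_zero_at_infty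
  have hu2 : UniformContinuous (fderiv ℝ w) :=
    hD.uniformContinuous_of_tendsto_cocompact (hc.fderiv ℝ).is_zero_at_infty
  obtain ⟨d1, hd1, h1⟩ := Metric.uniformContinuous_iff.1 hu1 ε hε
  obtain ⟨d2, hd2, h2⟩ := Metric.uniformContinuous_iff.1 hu2 ε hε
  -- One radius serves the support condition and the moduli of continuity of `w` and of its
  -- derivative.
  set r := min δ (min d1 d2) with hr
  have hr0 : 0 < r := by positivity
  let b : ContDiffBump (0 : E) := ⟨r / 2, r, by positivity, by linarith⟩
  let L : ℝ →L[ℝ] ℂ →L[ℝ] ℂ := ContinuousLinearMap.lsmul ℝ ℝ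
  let v : E → ℂ := b.normed volume ⋆[L, volume] w
  have hfd : ∀ x, fderiv ℝ v x =
      (b.normed volume ⋆[ContinuousLinearMap.lsmul ℝ ℝ, volume] fderiv ℝ w) x := by
    intro x
    refine (hc.hasFDerivAt_convolution_right L
      (b.continuous_normed.locallyIntegrable (μ := volume)) hw x).fderiv.trans ?_
    unfold MeasureTheory.convolution
    refine integral_congr_ae (Eventually.of_forall fun t => ?_)
    ext z
    simp [L, ContinuousLinearMap.precompR]
  refine ⟨v, ?_, ?_, fun x => ⟨?_, ?_⟩⟩
  · exact b.hasCompactSupport_normed.contDiff_convolution_left L b.contDiff_normed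
      (hw.continuous.locallyIntegrable)
  · refine closure_minimal ?_ Metric.isClosed_cthickening
    refine (support_convolution_subset L (μ := volume)).trans ?_
    rintro _ ⟨y, hy, z, hz, rfl⟩
    rw [b.support_normed_eq] at hy
    have hy' : ‖y‖ < r := mem_ball_zero_iff.1 hy
    refine Metric.mem_cthickening_of_dist_le _ z δ _ (subset_tsupport _ hz) ?_
    simp only [dist_eq_norm, add_sub_cancel_right]
    exact hy'.le.trans (min_le_left _ _)
  · rw [← dist_eq_norm]
    refine b.dist_normed_convolution_le hw.continuous.aestronglyMeasurable fun z hz => (h1 ?_).le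
    exact (Metric.mem_ball.1 hz).trans_le ((min_le_right _ _).trans (min_le_left _ _))
  · rw [← dist_eq_norm, hfd]
    refine b.dist_normed_convolution_le hD.aestronglyMeasurable fun z hz => (h2 ?_).le
    exact (Metric.mem_ball.1 hz).trans_le ((min_le_right _ _).trans (min_le_right _ _))

end Mollify

/-! ### Transfer of functions, differentials and integrals between a chart and Euclidean space. -/

section PullPush

variable {n : ℕ} {M : Type*} [TopologicalSpace M] [ChartedSpace (EuclideanSpace ℝ (Fin n)) M]
  [IsManifold (𝓡 n) ∞ M]

local notation "E" => EuclideanSpace ℝ (Fin n)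
local notation "ch" => chartAt (EuclideanSpace ℝ (Fin n))

/-- A function on `M` in the coordinates at `x₀`, extended by zero. -/
def pull (x₀ : M) (w : M → ℂ) : E → ℂ := (ch x₀).target.indicator (w ∘ (ch x₀).symm)

/-- A function of the coordinates at `x₀` as a function on `M`, extended by zero. -/
def push (x₀ : M) (v : E → ℂ) : M → ℂ := (ch x₀).source.indicator (v ∘ ch x₀)

theorem support_pull_subset (x₀ : M) {w : M → ℂ} (hs : tsupport w ⊆ (ch x₀).source) :
    Function.support (pull (n := n) x₀ w) ⊆ ch x₀ '' tsupport w := by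
  intro y hy
  have hyt : y ∈ (ch x₀).target := by
    by_contra h; exact hy (by simp [pull, h])
  refine ⟨(ch x₀).symm y, ?_, (ch x₀).right_inv hyt⟩
  refine subset_tsupport _ ?_
  intro h; exact hy (by simp [pull, hyt, h])

theorem isCompact_image_tsupport (x₀ : M) {w : M → ℂ} (hc : HasCompactSupport w)
    (hs : tsupport w ⊆ (ch x₀).source) : IsCompact (ch x₀ '' tsupport w) :=
  hc.isCompact.image_of_continuousOn ((ch x₀).continuousOn.mono hs)

theorem tsupport_pull_subset (x₀ : M) {w : M → ℂ} (hc : HasCompactSupport w)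
    (hs : tsupport w ⊆ (ch x₀).source) : tsupport (pull (n := n) x₀ w) ⊆ ch x₀ '' tsupport w :=
  closure_minimal (support_pull_subset x₀ hs) (isCompact_image_tsupport x₀ hc hs).isClosed

theorem hasCompactSupport_pull (x₀ : M) {w : M → ℂ} (hc : HasCompactSupport w)
    (hs : tsupport w ⊆ (ch x₀).source) : HasCompactSupport (pull (n := n) x₀ w) :=
  HasCompactSupport.of_support_subset_isCompact (isCompact_image_tsupport x₀ hc hs)
    (support_pull_subset x₀ hs)

theorem contDiff_pull (x₀ : M) {w : M → ℂ} {k : WithTop ℕ∞} (hk : k ≤ (∞ : ℕ∞ω))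
    (hw : ContMDiff (𝓡 n) 𝓘(ℝ, ℂ) k w) (hc : HasCompactSupport w)
    (hs : tsupport w ⊆ (ch x₀).source) : ContDiff ℝ k (pull (n := n) x₀ w) := by
  rw [contDiff_iff_contDiffAt]
  intro y
  by_cases hy : y ∈ (ch x₀).target
  · have h1 := contDiffOn_comp_chart_symm hk (hw.contMDiffOn (s := univ)) x₀
    rw [preimage_univ, inter_univ] at h1
    refine (h1.contDiffAt ((ch x₀).open_target.mem_nhds hy)).congr_of_eventuallyEq ?_
    filter_upwards [(ch x₀).open_target.mem_nhds hy] with z hz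
    simp [pull, hz]
  · have : y ∉ tsupport (pull (n := n) x₀ w) := fun h => by
      obtain ⟨x, hx, rfl⟩ := tsupport_pull_subset x₀ hc hs h
      exact hy ((ch x₀).map_source (hs hx))
    exact contDiffAt_const.congr_of_eventuallyEq (notMem_tsupport_iff_eventuallyEq.1 this)

theorem support_push_subset (x₀ : M) {v : E → ℂ} (hs : tsupport v ⊆ (ch x₀).target) :
    Function.support (push x₀ v) ⊆ (ch x₀).symm '' tsupport v := by
  intro x hx
  have hxs : x ∈ (ch x₀).source := by
    by_contra h; exact hx (by simp [push, h])
  refine ⟨ch x₀ x, subset_tsupport _ ?_, (ch x₀).left_inv hxs⟩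
  intro h; exact hx (by simp [push, hxs, h])

theorem isCompact_symm_image (x₀ : M) {K : Set E} (hK : IsCompact K)
    (hs : K ⊆ (ch x₀).target) : IsCompact ((ch x₀).symm '' K) :=
  hK.image_of_continuousOn ((ch x₀).continuousOn_symm.mono hs)

theorem tsupport_push_subset [T2Space M] (x₀ : M) {v : E → ℂ} (hc : HasCompactSupport v)
    (hs : tsupport v ⊆ (ch x₀).target) : tsupport (push x₀ v) ⊆ (ch x₀).symm '' tsupport v :=
  closure_minimal (support_push_subset x₀ hs) (isCompact_symm_image x₀ hc.isCompact hs).isClosed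

theorem hasCompactSupport_push [T2Space M] (x₀ : M) {v : E → ℂ} (hc : HasCompactSupport v)
    (hs : tsupport v ⊆ (ch x₀).target) : HasCompactSupport (push x₀ v) :=
  HasCompactSupport.of_support_subset_isCompact (isCompact_symm_image x₀ hc.isCompact hs)
    (support_push_subset x₀ hs)

theorem contMDiff_push [T2Space M] (x₀ : M) {v : E → ℂ} {k : WithTop ℕ∞} (hk : k ≤ (∞ : ℕ∞ω))
    (hv : ContDiff ℝ k v) (hc : HasCompactSupport v) (hs : tsupport v ⊆ (ch x₀).target) :
    ContMDiff (𝓡 n) 𝓘(ℝ, ℂ) k (push x₀ v) := by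
  intro x
  by_cases hx : x ∈ (ch x₀).source
  · have h1 : ContMDiffOn (𝓡 n) (𝓡 n) k (ch x₀) (ch x₀).source :=
      (contMDiffOn_chart (I := 𝓡 n) (n := ∞)).of_le hk
    have h2 : ContMDiff (𝓡 n) 𝓘(ℝ, ℂ) k v := hv.contMDiff
    refine ((h2.comp_contMDiffOn h1).contMDiffAt
      ((ch x₀).open_source.mem_nhds hx)).congr_of_eventuallyEq ?_
    filter_upwards [(ch x₀).open_source.mem_nhds hx] with z hz
    simp [push, hz]
  · have : x ∉ tsupport (push x₀ v) := fun h => by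
      obtain ⟨y, hy, rfl⟩ := tsupport_push_subset x₀ hc hs h
      exact hx ((ch x₀).map_target (hs hy))
    exact contMDiffAt_const.congr_of_eventuallyEq (notMem_tsupport_iff_eventuallyEq.1 this)

theorem pull_push (x₀ : M) {v : E → ℂ} (hs : tsupport v ⊆ (ch x₀).target) :
    pull x₀ (push x₀ v) = v := by
  ext y
  by_cases hy : y ∈ (ch x₀).target
  · simp [push, pull, hy, (ch x₀).map_target hy, (ch x₀).right_inv hy]
  · have : v y = 0 := by
      by_contra h; exact hy (hs (subset_tsupport _ h))
    simp [pull, hy, this]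

theorem pull_sub (x₀ : M) (w w' : M → ℂ) : pull (n := n) x₀ (w - w') = pull x₀ w - pull x₀ w' := by
  ext y; by_cases hy : y ∈ (ch x₀).target <;> simp [pull, hy]

theorem fderiv_pull (x₀ : M) (w : M → ℂ) {y : E} (hy : y ∈ (ch x₀).target) :
    fderiv ℝ (pull x₀ w) y = fderiv ℝ (w ∘ (ch x₀).symm) y := by
  refine Filter.EventuallyEq.fderiv_eq ?_
  filter_upwards [(ch x₀).open_target.mem_nhds hy] with z hz
  simp [pull, hz]

theorem norm_sq_le_sum_single {T : E →L[ℝ] ℂ} :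
    ‖T‖ ^ 2 ≤ ∑ i, ‖T (EuclideanSpace.single i (1 : ℝ))‖ ^ 2 := by
  set S := ∑ i, ‖T (EuclideanSpace.single i (1 : ℝ))‖ ^ 2 with hS
  have hS0 : 0 ≤ S := by positivity
  have : ‖T‖ ≤ Real.sqrt S := by
    refine ContinuousLinearMap.opNorm_le_bound _ (Real.sqrt_nonneg _) fun w => ?_
    have h2 := (EuclideanSpace.basisFun (Fin n) ℝ).sum_repr w
    simp only [EuclideanSpace.basisFun_apply, EuclideanSpace.basisFun_repr] at h2
    have h3 : ‖T w‖ ≤ ∑ i, ‖T (EuclideanSpace.single i (1 : ℝ))‖ * ‖w i‖ := by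
      conv_lhs => rw [← h2]
      rw [map_sum]
      refine (norm_sum_le _ _).trans (le_of_eq (Finset.sum_congr rfl fun i _ => ?_))
      rw [map_smul, norm_smul, mul_comm]
    rw [EuclideanSpace.norm_eq, ← Real.sqrt_mul hS0]
    exact Real.le_sqrt_of_sq_le ((pow_le_pow_left₀ (norm_nonneg _) h3 2).trans
      (Finset.sum_mul_sq_le_sq_mul_sq _ _ _))
  calc ‖T‖ ^ 2 ≤ Real.sqrt S ^ 2 := by gcongr
    _ = S := Real.sq_sqrt hS0

/-- On compact sets of coordinates, the norm of the differential is comparable to the norm of the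
Euclidean derivative. -/
theorem exists_cnorm_le (g : Metric n M) (x₀ : M) {K : Set E} (hK : IsCompact K)
    (hKt : K ⊆ (ch x₀).target) : ∃ C : ℝ, 0 < C ∧ ∀ w : M → ℂ, ∀ y ∈ K,
      MDifferentiableAt (𝓡 n) 𝓘(ℝ, ℂ) w ((ch x₀).symm y) →
      cnorm g ((ch x₀).symm y) (differential w ((ch x₀).symm y)) ^ 2 ≤
        C * ‖fderiv ℝ (pull x₀ w) y‖ ^ 2 ∧
      ‖fderiv ℝ (pull x₀ w) y‖ ^ 2 ≤
        C * cnorm g ((ch x₀).symm y) (differential w ((ch x₀).symm y)) ^ 2 := by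
  choose B hB using fun p : Fin n × Fin n => hK.exists_bound_of_continuousOn
    ((continuousOn_gram_inv g x₀ p.1 p.2).mono hKt)
  choose B' hB' using fun i : Fin n => hK.exists_bound_of_continuousOn
    ((((continuousOn_pi.1 (continuousOn_pi.1 (continuousOn_gram x₀ g) i)) i)).mono hKt)
  set C := 1 + ∑ p, |B p| + ∑ i, |B' i| with hC
  have h0 : 0 ≤ ∑ p, |B p| := by positivity
  have h0' : 0 ≤ ∑ i, |B' i| := by positivity
  refine ⟨C, by positivity, fun w y hy hw => ⟨?_, ?_⟩⟩
  · have h1 := covectorInner_chart g x₀ (hKt hy) hw hw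
    rw [covectorInner_self] at h1
    rw [fderiv_pull x₀ w (hKt hy)]
    set T := fderiv ℝ (w ∘ (ch x₀).symm) y
    have hT : ∀ i : Fin n, ‖T (EuclideanSpace.single i (1 : ℝ))‖ ≤ ‖T‖ := fun i => by
      simpa using T.le_opNorm (EuclideanSpace.single i (1 : ℝ))
    have h2 := congrArg norm h1
    rw [Complex.norm_real, Real.norm_of_nonneg (sq_nonneg _)] at h2
    rw [h2]
    calc _ ≤ ∑ i, ∑ j, |B (i, j)| * ‖T‖ ^ 2 := by
          refine (norm_sum_le _ _).trans (Finset.sum_le_sum fun i _ => (norm_sum_le _ _).trans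
            (Finset.sum_le_sum fun j _ => ?_))
          rw [norm_mul, norm_mul, Complex.norm_real, RCLike.norm_conj, mul_assoc, sq]
          gcongr
          · exact (hB (i, j) y hy).trans (le_abs_self _)
          · exact hT i
          · exact hT j
      _ = (∑ p, |B p|) * ‖T‖ ^ 2 := by
          rw [Finset.sum_mul, Fintype.sum_prod_type]
      _ ≤ C * ‖T‖ ^ 2 := by gcongr; linarith
  · have h2 : ‖fderiv ℝ (pull x₀ w) y‖ ^ 2 ≤ _ := norm_sq_le_sum_single
    refine h2.trans ?_
    set c := cnorm g ((ch x₀).symm y) (differential w ((ch x₀).symm y))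
    calc _ ≤ ∑ i, c ^ 2 * |B' i| := by
          refine Finset.sum_le_sum fun i _ => ?_
          rw [fderiv_pull x₀ w (hKt hy), ← differential_coordVec x₀ (hKt hy) hw]
          refine (norm_covector_apply_le g _ _ _).trans ?_
          gcongr
          exact (le_abs_self _).trans ((hB' i y hy).trans (le_abs_self _))
      _ = (∑ i, |B' i|) * c ^ 2 := by rw [← Finset.mul_sum, mul_comm]
      _ ≤ C * c ^ 2 := by gcongr; linarith

variable [MeasurableSpace M] [BorelSpace M] [SecondCountableTopology M]

/-- On compact sets of coordinates, the Riemannian measure is comparable to Lebesgue measure. -/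
theorem exists_lintegral_le (g : Metric n M) (x₀ : M) {K : Set E} (hK : IsCompact K)
    (hKt : K ⊆ (ch x₀).target) : ∃ C : ℝ≥0∞, C ≠ ⊤ ∧ ∀ f : M → ℝ≥0∞, Measurable f →
      (∀ x, f x ≠ 0 → x ∈ (ch x₀).symm '' K) →
      ∫⁻ x, f x ∂(riemannianMeasure g) ≤ C * ∫⁻ y in K, f ((ch x₀).symm y) ∧
      ∫⁻ y in K, f ((ch x₀).symm y) ≤ C * ∫⁻ x, f x ∂(riemannianMeasure g) := by
  obtain ⟨B, hB⟩ := hK.exists_bound_of_continuousOn ((continuousOn_volumeDensity x₀ g).mono hKt)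
  have hinv : ContinuousOn (fun y => (volumeDensity g (ch x₀) y)⁻¹) K :=
    ((continuousOn_volumeDensity x₀ g).mono hKt).inv₀
      fun y hy => (volumeDensity_pos x₀ g (hKt hy)).ne'
  obtain ⟨B', hB'⟩ := hK.exists_bound_of_continuousOn hinv
  refine ⟨ENNReal.ofReal (max B B'), ENNReal.ofReal_ne_top, fun f hf hfK => ?_⟩
  have h1 : ∫⁻ x, f x ∂(riemannianMeasure g) = ∫⁻ y in K,
      ENNReal.ofReal (volumeDensity g (ch x₀) y) * f ((ch x₀).symm y) := by
    have h2 := setLIntegral_chart_source g x₀ hf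
    have h3 : ∫⁻ x in (ch x₀).source, f x ∂(riemannianMeasure g) =
        ∫⁻ x, f x ∂(riemannianMeasure g) := by
      rw [← lintegral_indicator (ch x₀).open_source.measurableSet]
      refine lintegral_congr fun x => ?_
      by_cases hx : x ∈ (ch x₀).source
      · simp [hx]
      · have : f x = 0 := by
          by_contra h
          obtain ⟨y, hy, rfl⟩ := hfK x h
          exact hx ((ch x₀).map_target (hKt hy))
        simp [hx, this]
    rw [← h3, h2, ← lintegral_indicator (ch x₀).open_target.measurableSet,
      ← lintegral_indicator hK.measurableSet]
    refine lintegral_congr fun y => ?_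
    by_cases hy : y ∈ K
    · simp [hy, hKt hy]
    · by_cases hyt : y ∈ (ch x₀).target
      · have : f ((ch x₀).symm y) = 0 := by
          by_contra h
          obtain ⟨z, hz, hzy⟩ := hfK _ h
          exact hy ((ch x₀).symm.injOn (hKt hz) hyt hzy ▸ hz)
        simp [hy, this]
      · simp [hy, hyt]
  rw [h1, ← lintegral_const_mul' _ _ ENNReal.ofReal_ne_top,
    ← lintegral_const_mul' _ _ ENNReal.ofReal_ne_top]
  constructor
  · refine setLIntegral_mono' hK.measurableSet fun y hy => ?_
    gcongr
    exact (le_abs_self _).trans ((hB y hy).trans (le_max_left _ _))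
  · refine setLIntegral_mono' hK.measurableSet fun y hy => ?_
    rw [← mul_assoc, ← ENNReal.ofReal_mul' (volumeDensity_pos x₀ g (hKt hy)).le]
    refine le_mul_of_one_le_left zero_le ?_
    rw [ENNReal.one_le_ofReal]
    have h2 := (le_abs_self _).trans ((hB' y hy).trans (le_max_right B B'))
    have h3 := volumeDensity_pos x₀ g (hKt hy)
    rwa [inv_le_iff_one_le_mul₀ h3] at h2

end PullPush

end SemiFlat
end

noncomputable section

namespace SemiFlat

/-! ### Density of test functions for the `H¹` norm. -/

section Density

variable {n : ℕ} {M : Type*} [TopologicalSpace M] [ChartedSpace (EuclideanSpace ℝ (Fin n)) M]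
  [IsManifold (𝓡 n) ∞ M] [T2Space M] [SecondCountableTopology M]

local notation "E" => EuclideanSpace ℝ (Fin n)
local notation "ch" => chartAt (EuclideanSpace ℝ (Fin n))

-- Only finitely many members of a locally finite partition of unity meet a compact set.
-- Subordination to relatively compact sets whose closures lie in chart domains gives each member
-- compact support inside its chart.
variable (n) in
theorem exists_chart_partition {K : Set M} (hK : IsCompact K) :
    ∃ (s : Finset M) (η : M → M → ℝ), (∀ x ∈ s, ContMDiff (𝓡 n) 𝓘(ℝ, ℝ) ∞ (η x) ∧
      HasCompactSupport (η x) ∧ tsupport (η x) ⊆ (ch x).source) ∧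
      ∀ y ∈ K, ∑ x ∈ s, η x y = 1 := by
  have : LocallyCompactSpace M := ChartedSpace.locallyCompactSpace E M
  have h1 : ∀ x : M, ∃ V : Set M, IsOpen V ∧ {x} ⊆ V ∧ closure V ⊆ (ch x).source ∧
      IsCompact (closure V) := fun x =>
    exists_open_between_and_isCompact_closure isCompact_singleton (ch x).open_source
      (singleton_subset_iff.2 (mem_chart_source E x))
  choose V hVo hxV hVs hVc using h1
  obtain ⟨f, hf⟩ := SmoothPartitionOfUnity.exists_isSubordinate (𝓡 n) hK.isClosed V hVo
    (fun x _ => mem_iUnion.2 ⟨x, singleton_subset_iff.1 (hxV x)⟩)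
  have hfin := f.locallyFinite.finite_nonempty_inter_compact hK
  refine ⟨hfin.toFinset, fun x => f x, fun x _ => ⟨(f x).contMDiff, ?_, ?_⟩, fun y hy => ?_⟩
  · exact HasCompactSupport.of_support_subset_isCompact (hVc x)
      ((subset_tsupport _).trans ((hf x).trans subset_closure))
  · exact (hf x).trans (subset_closure.trans (hVs x))
  · rw [← f.sum_eq_one hy]
    refine (finsum_eq_sum_of_support_subset _ fun x hx => ?_).symm
    simp only [Finite.coe_toFinset, mem_ofPred_eq]
    exact ⟨y, hx, hy⟩

variable [MeasurableSpace M] [BorelSpace M] {U : Set M}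

theorem C1c.norm_toLp_sq (g : Metric n M) (φ : C1c n U) :
    ‖C1c.toLp g U φ‖ ^ 2 = ∫ x, ‖(φ : M → ℂ) x‖ ^ 2 ∂(measureOn g U) := by
  have h := inner_toLp_left g φ (C1c.toLp g U φ)
  rw [inner_self_eq_norm_sq_to_K] at h
  have h2 : ∫ x, conj ((φ : M → ℂ) x) * (C1c.toLp g U φ) x ∂(measureOn g U) =
      ((∫ x, ‖(φ : M → ℂ) x‖ ^ 2 ∂(measureOn g U) : ℝ) : ℂ) := by
    rw [← integral_complex_ofReal]
    refine integral_congr_ae ?_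
    filter_upwards [C1c.toLp_coeFn g φ] with x hx
    rw [hx, Complex.conj_mul', Complex.ofReal_pow]
  rw [h2] at h
  exact Complex.ofReal_injective (by rw [Complex.ofReal_pow]; exact h)

theorem C1c.dirichletForm_self_re (g : Metric n M) (φ : C1c n U) :
    (dirichletForm g U φ φ).re =
      ∫ x, cnorm g x (differential (φ : M → ℂ) x) ^ 2 ∂(measureOn g U) := by
  rw [C1c.dirichletForm_self, Complex.ofReal_re]

theorem exists_integral_le (g : Metric n M) (x₀ : M) {K : Set E} (hK : IsCompact K)
    (hKt : K ⊆ (ch x₀).target) : ∃ C : ℝ, 0 < C ∧ ∀ f : M → ℝ, Continuous f → (∀ x, 0 ≤ f x) →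
      (∀ x, f x ≠ 0 → x ∈ (ch x₀).symm '' K) →
      ∫ x, f x ∂(riemannianMeasure g) ≤ C * ∫ y in K, f ((ch x₀).symm y) ∧
      ∫ y in K, f ((ch x₀).symm y) ≤ C * ∫ x, f x ∂(riemannianMeasure g) := by
  obtain ⟨C, hC, h⟩ := exists_lintegral_le g x₀ hK hKt
  refine ⟨C.toReal + 1, by positivity, fun f hf hf0 hfK => ?_⟩
  have hcs : HasCompactSupport f :=
    HasCompactSupport.of_support_subset_isCompact (isCompact_symm_image x₀ hK hKt) hfK
  have hi1 : Integrable f (riemannianMeasure g) := hf.integrable_of_hasCompactSupport hcs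
  have hi2 : Integrable (fun y => f ((ch x₀).symm y)) (volume.restrict K) :=
    (hf.comp_continuousOn ((ch x₀).continuousOn_symm.mono hKt)).integrableOn_compact hK
  have h1 := ofReal_integral_eq_lintegral_ofReal hi1 (Eventually.of_forall hf0)
  have h2 := ofReal_integral_eq_lintegral_ofReal hi2 (Eventually.of_forall fun y => hf0 _)
  have h3 := h (fun x => ENNReal.ofReal (f x)) hf.measurable.ennreal_ofReal
    (fun x hx => hfK x fun h0 => hx (by simp [h0]))
  have hn1 : 0 ≤ ∫ x, f x ∂(riemannianMeasure g) := integral_nonneg hf0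
  have hn2 : 0 ≤ ∫ y in K, f ((ch x₀).symm y) := integral_nonneg fun y => hf0 _
  have key : ∀ a b : ℝ, 0 ≤ b → ENNReal.ofReal a ≤ C * ENNReal.ofReal b →
      a ≤ (C.toReal + 1) * b := by
    intro a b hb hab
    rw [← ENNReal.ofReal_toReal hC, ← ENNReal.ofReal_mul ENNReal.toReal_nonneg,
      ENNReal.ofReal_le_ofReal_iff (by positivity)] at hab
    nlinarith
  rw [← h1, ← h2] at h3
  exact ⟨key _ _ hn2 h3.1, key _ _ hn1 h3.2⟩

theorem C1c.integral_measureOn {f : M → ℝ} (g : Metric n M) (hf : ∀ x, f x ≠ 0 → x ∈ U) :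
    ∫ x, f x ∂(measureOn g U) = ∫ x, f x ∂(riemannianMeasure g) :=
  setIntegral_eq_integral_of_forall_compl_eq_zero fun x hx => by
    by_contra h; exact hx (hf x h)

/-- In a chart, the `L²` norm and the Dirichlet energy are comparable to the Euclidean ones. -/
theorem exists_chart_bounds (g : Metric n M) (x₀ : M) {K : Set E} (hK : IsCompact K)
    (hKt : K ⊆ (ch x₀).target) : ∃ C : ℝ, 0 < C ∧ ∀ φ : C1c n U,
      tsupport (φ : M → ℂ) ⊆ (ch x₀).symm '' K →
      (‖C1c.toLp g U φ‖ ^ 2 ≤ C * ∫ y in K, ‖pull x₀ φ y‖ ^ 2) ∧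
      (∫ y in K, ‖pull x₀ φ y‖ ^ 2 ≤ C * ‖C1c.toLp g U φ‖ ^ 2) ∧
      ((dirichletForm g U φ φ).re ≤ C * ∫ y in K, ‖fderiv ℝ (pull x₀ φ) y‖ ^ 2) ∧
      (∫ y in K, ‖fderiv ℝ (pull x₀ φ) y‖ ^ 2 ≤ C * (dirichletForm g U φ φ).re) := by
  obtain ⟨C1, hC1, h1⟩ := exists_integral_le g x₀ hK hKt
  obtain ⟨C2, hC2, h2⟩ := exists_cnorm_le g x₀ hK hKt
  refine ⟨C1 + C1 * C2, by positivity, fun φ hφ => ?_⟩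
  have hdz : ∀ x, cnorm g x (differential (φ : M → ℂ) x) ^ 2 ≠ 0 → x ∈ tsupport (φ : M → ℂ) := by
    intro x hx
    by_contra h
    apply hx
    have := covectorInner_self g x (differential (φ : M → ℂ) x)
    rw [differential_eq_zero h, covectorInner_zero_left] at this
    rw [differential_eq_zero h]
    exact_mod_cast this.symm
  have hz : ∀ x, ‖(φ : M → ℂ) x‖ ^ 2 ≠ 0 → x ∈ tsupport (φ : M → ℂ) := by
    intro x hx
    refine subset_tsupport _ fun h => hx ?_
    simp [h]
  have ha := h1 (fun x => ‖(φ : M → ℂ) x‖ ^ 2) (by have := φ.2.1.continuous; fun_prop)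
    (fun x => by positivity) fun x hx => hφ (hz x hx)
  have hb := h1 (fun x => cnorm g x (differential (φ : M → ℂ) x) ^ 2)
    (C1c.continuous_cnorm_sq g φ) (fun x => by positivity) fun x hx => hφ (hdz x hx)
  rw [← C1c.integral_measureOn (U := U) g fun x hx => φ.2.2.2 (hz x hx),
    ← C1c.norm_toLp_sq] at ha
  rw [← C1c.integral_measureOn (U := U) g fun x hx => φ.2.2.2 (hdz x hx),
    ← C1c.dirichletForm_self_re] at hb
  have hp : ∫ y in K, ‖(φ : M → ℂ) ((ch x₀).symm y)‖ ^ 2 = ∫ y in K, ‖pull x₀ φ y‖ ^ 2 :=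
    setIntegral_congr_fun hK.measurableSet fun y hy => by simp [pull, hKt hy]
  rw [hp] at ha
  have hsrc : tsupport (φ : M → ℂ) ⊆ (ch x₀).source := by
    refine hφ.trans ?_
    rintro _ ⟨y, hy, rfl⟩
    exact (ch x₀).map_target (hKt hy)
  have hpc : ContDiff ℝ 1 (pull (n := n) x₀ φ) :=
    contDiff_pull x₀ (by norm_cast) φ.2.1 φ.2.2.1 hsrc
  have hi1 : Integrable (fun y => ‖fderiv ℝ (pull x₀ φ) y‖ ^ 2) (volume.restrict K) := by
    refine ContinuousOn.integrableOn_compact hK (Continuous.continuousOn ?_)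
    have := hpc.continuous_fderiv (by norm_num)
    fun_prop
  have hi2 : Integrable (fun y => cnorm g ((ch x₀).symm y)
      (differential (φ : M → ℂ) ((ch x₀).symm y)) ^ 2) (volume.restrict K) :=
    ((C1c.continuous_cnorm_sq g φ).comp_continuousOn
      ((ch x₀).continuousOn_symm.mono hKt)).integrableOn_compact hK
  have hc : ∫ y in K, cnorm g ((ch x₀).symm y)
      (differential (φ : M → ℂ) ((ch x₀).symm y)) ^ 2 ≤
      C2 * ∫ y in K, ‖fderiv ℝ (pull x₀ φ) y‖ ^ 2 := by
    rw [← integral_const_mul]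
    exact setIntegral_mono_on hi2 (hi1.const_mul _) hK.measurableSet fun y hy =>
      (h2 φ y hy (C1c.mdifferentiableAt φ _)).1
  have hd : ∫ y in K, ‖fderiv ℝ (pull x₀ φ) y‖ ^ 2 ≤ C2 * ∫ y in K, cnorm g ((ch x₀).symm y)
      (differential (φ : M → ℂ) ((ch x₀).symm y)) ^ 2 := by
    rw [← integral_const_mul]
    exact setIntegral_mono_on hi1 (hi2.const_mul _) hK.measurableSet fun y hy =>
      (h2 φ y hy (C1c.mdifferentiableAt φ _)).2
  have n1 : 0 ≤ ∫ y in K, ‖pull (n := n) x₀ φ y‖ ^ 2 := by positivity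
  have n2 : 0 ≤ ∫ y in K, ‖fderiv ℝ (pull (n := n) x₀ φ) y‖ ^ 2 := by positivity
  have n3 := C1c.dirichletForm_self_nonneg g φ
  have hCC : 0 < C1 * C2 := by positivity
  refine ⟨ha.1.trans ?_, ha.2.trans ?_, ?_, ?_⟩
  · gcongr; linarith
  · gcongr; linarith
  · calc _ ≤ C1 * (C2 * ∫ y in K, ‖fderiv ℝ (pull (n := n) x₀ φ) y‖ ^ 2) := hb.1.trans (by gcongr)
      _ ≤ _ := by rw [← mul_assoc]; gcongr; linarith
  · calc _ ≤ C2 * (C1 * (dirichletForm g U φ φ).re) := hd.trans (by gcongr; exact hb.2)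
      _ ≤ _ := by rw [← mul_assoc, mul_comm C2]; gcongr; linarith

theorem FormCompletion.norm_emb_sq {g : Metric n M} {α : ℝ}
    (F : FormCompletion (C1c.toLp g U) (C1c.form g U α)) (φ : C1c n U) :
    ‖F.emb φ‖ ^ 2 = (dirichletForm g U φ φ).re + α * ‖C1c.toLp g U φ‖ ^ 2 := by
  rw [norm_sq_eq_re_inner (𝕜 := ℂ), F.inner_emb, ← C1c.form_self_re]; rfl

variable (n) in
/-- Test functions as a space of `C¹` functions. -/
def testFunctions (U : Set M) : Submodule ℂ (C1c n U) where
  carrier := {φ | ContMDiff (𝓡 n) 𝓘(ℝ, ℂ) ∞ (φ : M → ℂ)}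
  add_mem' := fun h1 h2 => h1.add h2
  zero_mem' := contMDiff_const
  smul_mem' := fun r _ h =>
    ((r • ContinuousLinearMap.id ℝ ℂ : ℂ →L[ℝ] ℂ).contMDiff).comp h

/-- Read `w` in the chart, mollify, and push back. The supports stay in a fixed compact thickening
`K` inside both the chart and `U`, where uniform closeness of values and derivatives bounds the `H¹`
distance. -/
theorem exists_test_near (g : Metric n M) (hU : IsOpen U) (x₀ : M) (w : C1c n U)
    (hw : tsupport (w : M → ℂ) ⊆ (ch x₀).source) {e : ℝ} (he : 0 < e) :
    ∃ φ ∈ testFunctions n U, (dirichletForm g U (φ - w : C1c n U) (φ - w : C1c n U)).re ≤ e ∧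
      ‖C1c.toLp g U (φ - w)‖ ^ 2 ≤ e := by
  set v := pull (n := n) x₀ w with hv
  have hvc : HasCompactSupport v := hasCompactSupport_pull x₀ w.2.2.1 hw
  have hO : IsOpen ((ch x₀).target ∩ (ch x₀).symm ⁻¹' U) :=
    (ch x₀).isOpen_inter_preimage_symm hU
  have hvO : tsupport v ⊆ (ch x₀).target ∩ (ch x₀).symm ⁻¹' U := by
    refine (tsupport_pull_subset x₀ w.2.2.1 hw).trans ?_
    rintro _ ⟨x, hx, rfl⟩
    refine ⟨(ch x₀).map_source (hw hx), ?_⟩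
    rw [mem_preimage, (ch x₀).left_inv (hw hx)]
    exact w.2.2.2 hx
  obtain ⟨δ, hδ, hKO⟩ := hvc.isCompact.exists_cthickening_subset_open hO hvO
  set K := Metric.cthickening δ (tsupport v) with hKdef
  have hK : IsCompact K := hvc.isCompact.cthickening
  have hKt : K ⊆ (ch x₀).target := hKO.trans inter_subset_left
  obtain ⟨C, hC, hbound⟩ := exists_chart_bounds (U := U) g x₀ hK hKt
  set V := (volume.restrict K).real univ with hV
  have hV0 : 0 ≤ V := measureReal_nonneg
  -- Chosen so that `C r² V ≤ e`, where `V` is the volume of `K`; the summand `1` avoids division by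
  -- zero.
  set r := Real.sqrt (e / (C * (V + 1))) with hr
  have hr0 : 0 < r := Real.sqrt_pos.2 (by positivity)
  obtain ⟨v', hv', hsupp, hnear⟩ := exists_smooth_approx
    (contDiff_pull x₀ (by norm_cast) w.2.1 w.2.2.1 hw) hvc hδ hr0
  have hv'c : HasCompactSupport v' := HasCompactSupport.of_support_subset_isCompact hK
    ((subset_tsupport _).trans hsupp)
  have hv't : tsupport v' ⊆ (ch x₀).target := hsupp.trans hKt
  have hpt := tsupport_push_subset x₀ hv'c hv't
  have hsm : ContMDiff (𝓡 n) 𝓘(ℝ, ℂ) ∞ (push x₀ v') := contMDiff_push x₀ le_rfl hv' hv'c hv't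
  let φ : C1c n U := ⟨push x₀ v', hsm.of_le (by norm_cast), hasCompactSupport_push x₀ hv'c hv't, by
    refine hpt.trans ?_
    rintro _ ⟨y, hy, rfl⟩
    exact (hKO (hsupp hy)).2⟩
  have hpull : pull (n := n) x₀ ((φ - w : C1c n U) : M → ℂ) = v' - v := by
    change pull x₀ (push x₀ v' - (w : M → ℂ)) = _
    rw [pull_sub, pull_push x₀ hv't]
  have hsub : tsupport ((φ - w : C1c n U) : M → ℂ) ⊆ (ch x₀).symm '' K := by
    refine (tsupport_sub (push x₀ v') (w : M → ℂ)).trans (union_subset ?_ ?_)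
    · exact hpt.trans (image_mono hsupp)
    · refine closure_minimal (fun x hx => ?_) (isCompact_symm_image x₀ hK hKt).isClosed
      have hxs := hw (subset_tsupport _ hx)
      refine ⟨ch x₀ x, Metric.self_subset_cthickening _ (subset_tsupport _ ?_),
        (ch x₀).left_inv hxs⟩
      simpa [hv, pull, (ch x₀).map_source hxs, (ch x₀).left_inv hxs] using hx
  obtain ⟨b1, -, b2, -⟩ := hbound (φ - w) hsub
  rw [hpull] at b1 b2
  have hrV : C * (r ^ 2 * V) ≤ e := by
    rw [hr, Real.sq_sqrt (by positivity)]
    have : C * (e / (C * (V + 1)) * V) = e * (V / (V + 1)) := by field_simp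
    rw [this]
    exact mul_le_of_le_one_right he.le ((div_le_one (by positivity)).2 (by linarith))
  have hfin : IsFiniteMeasure (volume.restrict K) := ⟨by simpa using hK.measure_lt_top⟩
  have hint : ∀ F : E → ℝ, (∀ y, 0 ≤ F y) → (∀ y, F y ≤ r) →
      C * ∫ y in K, F y ^ 2 ≤ e := by
    intro F h0 h1
    refine le_trans ?_ hrV
    gcongr
    have := integral_mono_of_nonneg (μ := volume.restrict K) (f := fun y => F y ^ 2)
      (g := fun _ => r ^ 2) (Eventually.of_forall fun y => sq_nonneg _) (integrable_const _)
      (Eventually.of_forall fun y => pow_le_pow_left₀ (h0 y) (h1 y) 2)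
    rw [integral_const, smul_eq_mul, mul_comm] at this
    exact this
  refine ⟨φ, hsm, b2.trans (hint _ (fun y => norm_nonneg _) fun y => ?_),
    b1.trans (hint _ (fun y => norm_nonneg _) fun y => (hnear y).1)⟩
  rw [fderiv_sub (hv'.differentiable (by simp) y)
    ((contDiff_pull x₀ (k := 1) (by norm_cast) w.2.1 w.2.2.1 hw).differentiable (by norm_num) y)]
  exact (hnear y).2

/-- The product of a smooth real function and a `C¹` function with compact support. -/
def C1c.mulSmooth (η : M → ℝ) (hη : ContMDiff (𝓡 n) 𝓘(ℝ, ℝ) ∞ η) (w : C1c n U) : C1c n U :=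
  ⟨fun x => η x • (w : M → ℂ) x, by
    have h1 : ContMDiff (𝓡 n) 𝓘(ℝ, ℝ) 1 η := hη.of_le (by norm_cast)
    exact h1.smul w.2.1, by
    have h2 : HasCompactSupport (w : M → ℂ) := w.2.2.1
    exact h2.smul_left (f := η),
    (tsupport_smul_subset_right η (w : M → ℂ)).trans w.2.2.2⟩

theorem C1c.tsupport_mulSmooth (η : M → ℝ) (hη : ContMDiff (𝓡 n) 𝓘(ℝ, ℝ) ∞ η) (w : C1c n U) :
    tsupport (C1c.mulSmooth η hη w : M → ℂ) ⊆ tsupport η :=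
  tsupport_smul_subset_left η (w : M → ℂ)

/-- A partition of unity writes `w` as a finite sum of pieces, each supported in one chart and
approximable there. Phrased as membership in the closure of a subspace of the form completion, the
sum requires no bookkeeping of tolerances. -/
theorem testFunctionsDense (g : Metric n M) (hU : IsOpen U) : TestFunctionsDense g U := by
  obtain ⟨F⟩ := C1c.nonempty_formCompletion g U one_pos
  have hclos : ∀ w : C1c n U,
      F.emb w ∈ ((testFunctions n U).map F.emb).topologicalClosure := by
    intro w
    obtain ⟨s, η, hη, hsum⟩ := exists_chart_partition n w.2.2.1.isCompact
    have hw : w = ∑ x : s, C1c.mulSmooth (η x) (hη x x.2).1 w := by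
      ext y
      rw [AddSubmonoidClass.coe_finsetSum, Finset.sum_apply]
      change _ = ∑ x : s, η x y • (w : M → ℂ) y
      rw [← Finset.sum_smul, Finset.sum_coe_sort s (fun x => η x y)]
      by_cases hy : y ∈ tsupport (w : M → ℂ)
      · rw [hsum y hy, one_smul]
      · rw [image_eq_zero_of_notMem_tsupport hy, smul_zero]
    rw [hw, map_sum]
    refine Submodule.sum_mem _ fun x _ => ?_
    rw [← SetLike.mem_coe, Submodule.topologicalClosure_coe, Metric.mem_closure_iff]
    intro e he
    obtain ⟨φ, hφ, h1, h2⟩ := exists_test_near g hU x (C1c.mulSmooth (η x) (hη x x.2).1 w)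
      ((C1c.tsupport_mulSmooth _ _ w).trans (hη x x.2).2.2) (e := (e / 2) ^ 2 / 2) (by positivity)
    refine ⟨F.emb φ, Submodule.mem_map_of_mem hφ, ?_⟩
    rw [dist_comm, dist_eq_norm, ← map_sub]
    have h3 := F.norm_emb_sq (φ - C1c.mulSmooth (η x) (hη x x.2).1 w)
    have h4 : ‖F.emb (φ - C1c.mulSmooth (η x) (hη x x.2).1 w)‖ ^ 2 ≤ (e / 2) ^ 2 := by
      rw [h3]; linarith
    have := (sq_le_sq₀ (norm_nonneg _) (by positivity)).1 h4
    linarith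
  intro w e he
  have h1 := hclos w
  rw [← SetLike.mem_coe, Submodule.topologicalClosure_coe, Metric.mem_closure_iff] at h1
  obtain ⟨_, ⟨φ, hφ, rfl⟩, hd⟩ := h1 (Real.sqrt e) (Real.sqrt_pos.2 he)
  rw [dist_comm, dist_eq_norm, ← map_sub] at hd
  have h2 := F.norm_emb_sq (φ - w)
  have h3 : ‖F.emb (φ - w)‖ ^ 2 ≤ e := by
    rw [← Real.sq_sqrt he.le]; gcongr
  have h4 := C1c.dirichletForm_self_nonneg g (φ - w)
  have h5 : 0 ≤ ‖C1c.toLp g U (φ - w)‖ ^ 2 := by positivity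
  exact ⟨φ, ⟨hφ, φ.2.2⟩, by linarith, by linarith⟩

end Density

end SemiFlat
end

noncomputable section

namespace SemiFlat

/-! ### Poincaré's inequality on a cubical grid. -/

section Poincare

theorem enorm_integral_sq_le {Ω : Type*} [MeasurableSpace Ω] (μ : Measure Ω) {f : Ω → ℂ}
    (hf : AEStronglyMeasurable f μ) : ‖∫ x, f x ∂μ‖ₑ ^ 2 ≤ μ univ * ∫⁻ x, ‖f x‖ₑ ^ 2 ∂μ := by
  have h1 := ENNReal.lintegral_mul_le_Lp_mul_Lq μ (p := 2) (q := 2) (Real.HolderConjugate.two_two)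
    (f := fun _ => 1) (g := fun x => ‖f x‖ₑ) aemeasurable_const hf.enorm
  simp only [Pi.mul_apply, one_mul, ENNReal.one_rpow, lintegral_const] at h1
  have h2 := (enorm_integral_le_lintegral_enorm (μ := μ) f).trans h1
  have h3 : ∀ a : ℝ≥0∞, (a ^ (1 / 2 : ℝ)) ^ 2 = a := fun a => by
    rw [← ENNReal.rpow_natCast, ← ENNReal.rpow_mul]; norm_num
  calc _ ≤ _ := pow_le_pow_left' h2 2
    _ = _ := by
      rw [mul_pow, h3, h3]
      simp

theorem le_of_ofReal_le_two_mul {x y z : ℝ} (hy : 0 ≤ y) (hz : 0 ≤ z)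
    (h : ENNReal.ofReal x ≤ 2 * ENNReal.ofReal y + 2 * ENNReal.ofReal z) :
    x ≤ 2 * y + 2 * z := by
  rw [← ENNReal.ofReal_ofNat 2, ← ENNReal.ofReal_mul (by norm_num),
    ← ENNReal.ofReal_mul (by norm_num), ← ENNReal.ofReal_add (by positivity) (by positivity),
    ENNReal.ofReal_le_ofReal_iff (by positivity)] at h
  exact h

variable {n : ℕ}

local notation "E" => EuclideanSpace ℝ (Fin n)

theorem enorm_add_sq_le (a b : ℂ) : ‖a + b‖ₑ ^ 2 ≤ 2 * ‖a‖ₑ ^ 2 + 2 * ‖b‖ₑ ^ 2 := by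
  have h : ‖a + b‖ ^ 2 ≤ 2 * ‖a‖ ^ 2 + 2 * ‖b‖ ^ 2 := by
    have := norm_add_le a b
    nlinarith [sq_nonneg (‖a‖ - ‖b‖), norm_nonneg (a + b)]
  have h2 := ENNReal.ofReal_le_ofReal h
  rw [ENNReal.ofReal_add (by positivity) (by positivity), ENNReal.ofReal_mul (by norm_num),
    ENNReal.ofReal_mul (by norm_num)] at h2
  simpa [ENNReal.ofReal_pow, ofReal_norm] using h2

/-- Integrate the derivative along the segment from `x` to `x + z`, apply Cauchy–Schwarz on `[0,
1]`, exchange the integrals, and use translation invariance of Lebesgue measure. -/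
theorem lintegral_translate_sub_sq_le {w : E → ℂ} (hw : ContDiff ℝ 1 w) (z : E) :
    ∫⁻ x, ‖w x - w (x + z)‖ₑ ^ 2 ≤ ‖z‖ₑ ^ 2 * ∫⁻ x, ‖fderiv ℝ w x‖ₑ ^ 2 := by
  have hD : Continuous (fderiv ℝ w) := hw.continuous_fderiv (by norm_num)
  have hpt : ∀ x, ‖w x - w (x + z)‖ₑ ^ 2 ≤
      ‖z‖ₑ ^ 2 * ∫⁻ t in Ioc (0 : ℝ) 1, ‖fderiv ℝ w (x + t • z)‖ₑ ^ 2 := by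
    intro x
    have hder : ∀ t ∈ uIcc (0 : ℝ) 1,
        HasDerivAt (fun t : ℝ => w (x + t • z)) (fderiv ℝ w (x + t • z) z) t := by
      intro t _
      have h1 : HasDerivAt (fun t : ℝ => x + t • z) z t := by
        simpa using ((hasDerivAt_id t).smul_const z).const_add x
      exact (hw.differentiable (by norm_num) _).hasFDerivAt.comp_hasDerivAt t h1
    have hcont : Continuous fun t : ℝ => fderiv ℝ w (x + t • z) z := by fun_prop
    have h1 := intervalIntegral.integral_eq_sub_of_hasDerivAt hder
      (hcont.intervalIntegrable 0 1)
    simp only [one_smul, zero_smul, add_zero] at h1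
    rw [intervalIntegral.integral_of_le zero_le_one] at h1
    have h2 := enorm_integral_sq_le (volume.restrict (Ioc (0 : ℝ) 1)) hcont.aestronglyMeasurable
    rw [h1, enorm_sub_rev] at h2
    refine h2.trans ?_
    simp only [Measure.restrict_apply_univ, Real.volume_Ioc, sub_zero, ENNReal.ofReal_one, one_mul]
    rw [← lintegral_const_mul' _ _ (by simp)]
    refine lintegral_mono fun t => ?_
    rw [← mul_pow, mul_comm]
    gcongr
    exact (fderiv ℝ w (x + t • z)).le_opENorm z
  refine (lintegral_mono hpt).trans ?_
  rw [lintegral_const_mul' _ _ (by simp), lintegral_lintegral_swap]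
  · gcongr
    calc _ = ∫⁻ t in Ioc (0 : ℝ) 1, ∫⁻ x, ‖fderiv ℝ w x‖ₑ ^ 2 := by
          refine lintegral_congr fun t => ?_
          exact lintegral_add_right_eq_self (fun x => ‖fderiv ℝ w x‖ₑ ^ 2) (t • z)
      _ ≤ _ := by simp
  · refine Measurable.aemeasurable ?_
    refine Continuous.measurable ?_
    unfold Function.uncurry
    fun_prop

/-- Start from `|Q| w(x) = ∫_Q (w(x) - w(y)) dy + ∫_Q w`, square, apply Cauchy–Schwarz to the first
term, and integrate over `x ∈ Q`; one factor `|Q|` cancels. -/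
theorem volume_mul_lintegral_sq_le {w : E → ℂ} (hw : Continuous w) {Q : Set E}
    (hQ : MeasurableSet Q) (hQ0 : volume Q ≠ 0) (hQt : volume Q ≠ ⊤)
    (hi : IntegrableOn w Q) :
    volume Q * ∫⁻ x in Q, ‖w x‖ₑ ^ 2 ≤
      2 * (∫⁻ x in Q, ∫⁻ y in Q, ‖w x - w y‖ₑ ^ 2) + 2 * ‖∫ x in Q, w x‖ₑ ^ 2 := by
  set V := volume Q
  have hfin : IsFiniteMeasure (volume.restrict Q) := ⟨by simpa using hQt.lt_top⟩
  have hpt : ∀ x, V ^ 2 * ‖w x‖ₑ ^ 2 ≤ 2 * (V * ∫⁻ y in Q, ‖w x - w y‖ₑ ^ 2) +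
      2 * ‖∫ x in Q, w x‖ₑ ^ 2 := by
    intro x
    have h1 : (V.toReal : ℂ) * w x = (∫ y in Q, (w x - w y)) + ∫ y in Q, w y := by
      rw [integral_sub (integrable_const _) hi, integral_const]
      simp [V, Measure.real]
    have h2 : V ^ 2 * ‖w x‖ₑ ^ 2 = ‖(V.toReal : ℂ) * w x‖ₑ ^ 2 := by
      rw [enorm_mul, mul_pow]
      congr 2
      rw [← ofReal_norm, Complex.norm_real, Real.norm_of_nonneg ENNReal.toReal_nonneg,
        ENNReal.ofReal_toReal hQt]
    rw [h2, h1]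
    refine (enorm_add_sq_le _ _).trans ?_
    gcongr
    have := enorm_integral_sq_le (volume.restrict Q) (f := fun y => w x - w y)
      (by fun_prop)
    simpa using this
  have h3 := lintegral_mono (μ := volume.restrict Q) hpt
  rw [lintegral_const_mul' _ _ (by simp [hQt]), lintegral_add_right _ measurable_const,
    lintegral_const_mul' _ _ (by simp), lintegral_const_mul' _ _ hQt, lintegral_const] at h3
  simp only [Measure.restrict_apply_univ] at h3
  refine (ENNReal.mul_le_mul_iff_right hQ0 hQt).1 ?_
  calc _ = V ^ 2 * ∫⁻ x in Q, ‖w x‖ₑ ^ 2 := by ring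
    _ ≤ _ := h3
    _ = _ := by ring

/-- Substituting `y = x + z` with `‖z‖ ≤ r` replaces the cell by a ball independent of the cell. The
disjoint cells then add up to at most the whole space in `x`, where the translation estimate applies
for each `z`. -/
theorem lintegral_cells_le {w : E → ℂ} (hw : ContDiff ℝ 1 w) {I : Type*} (s : Finset I)
    (Q : I → Set E) (hQ : ∀ k, MeasurableSet (Q k)) (hdisj : Pairwise (Function.onFun Disjoint Q))
    {r : ℝ} (hr : ∀ k, ∀ x ∈ Q k, ∀ y ∈ Q k, ‖y - x‖ ≤ r) :
    ∑ k ∈ s, ∫⁻ x in Q k, ∫⁻ y in Q k, ‖w x - w y‖ₑ ^ 2 ≤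
      volume (Metric.closedBall (0 : E) r) *
        (ENNReal.ofReal r ^ 2 * ∫⁻ x, ‖fderiv ℝ w x‖ₑ ^ 2) := by
  have hc := hw.continuous
  set Z := Metric.closedBall (0 : E) r
  have h1 : ∀ k ∈ s, ∫⁻ x in Q k, ∫⁻ y in Q k, ‖w x - w y‖ₑ ^ 2 ≤
      ∫⁻ x in Q k, ∫⁻ z in Z, ‖w x - w (x + z)‖ₑ ^ 2 := by
    intro k _
    refine setLIntegral_mono' (hQ k) fun x hx => ?_
    rw [← lintegral_indicator (hQ k), ← lintegral_indicator Metric.isClosed_closedBall.measurableSet,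
      ← lintegral_add_left_eq_self _ x]
    refine lintegral_mono fun z => ?_
    by_cases hz : x + z ∈ Q k
    · have : z ∈ Z := by
        have := hr k x hx _ hz
        simpa [Z] using this
      rw [indicator_of_mem hz, indicator_of_mem this]
    · simp [hz]
  refine (Finset.sum_le_sum h1).trans ?_
  rw [← lintegral_biUnion_finset (fun i _ j _ hij => hdisj hij) (fun k _ => hQ k)]
  refine (setLIntegral_le_lintegral _ _).trans ?_
  rw [lintegral_lintegral_swap]
  · calc _ ≤ ∫⁻ z in Z, ENNReal.ofReal r ^ 2 * ∫⁻ x, ‖fderiv ℝ w x‖ₑ ^ 2 := by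
          refine setLIntegral_mono' Metric.isClosed_closedBall.measurableSet fun z hz => ?_
          refine (lintegral_translate_sub_sq_le hw z).trans ?_
          gcongr
          rw [← ofReal_norm]
          exact ENNReal.ofReal_le_ofReal (mem_closedBall_zero_iff.1 hz)
      _ = _ := by rw [setLIntegral_const, mul_comm]
  · refine Measurable.aemeasurable ?_
    refine Continuous.measurable ?_
    unfold Function.uncurry
    fun_prop

variable (n) in
/-- The cells of the cubical grid of mesh `1 / N`. -/
def gridCell (N : ℕ) (k : Fin n → ℤ) : Set (EuclideanSpace ℝ (Fin n)) :=
  {x | ∀ i, ⌊(N : ℝ) * x i⌋ = k i}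

theorem gridCell_eq {N : ℕ} (hN : 1 ≤ N) (k : Fin n → ℤ) : gridCell n N k =
    (MeasurableEquiv.toLp 2 (Fin n → ℝ)).symm ⁻¹'
      (univ.pi fun i => Ico ((k i : ℝ) / N) ((k i : ℝ) / N + 1 / N)) := by
  have hN0 : (0 : ℝ) < N := by exact_mod_cast hN
  ext x
  simp only [gridCell, mem_ofPred_eq, mem_preimage, mem_univ_pi, mem_Ico]
  refine forall_congr' fun i => ?_
  rw [Int.floor_eq_iff, div_le_iff₀' hN0, ← add_div, lt_div_iff₀' hN0]
  rfl

theorem measurableSet_gridCell {N : ℕ} (hN : 1 ≤ N) (k : Fin n → ℤ) :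
    MeasurableSet (gridCell n N k) := by
  rw [gridCell_eq hN]
  exact (MeasurableEquiv.measurable _) (MeasurableSet.univ_pi fun i => measurableSet_Ico)

theorem volume_gridCell {N : ℕ} (hN : 1 ≤ N) (k : Fin n → ℤ) :
    volume (gridCell n N k) = ENNReal.ofReal (1 / N) ^ n := by
  rw [gridCell_eq hN, (EuclideanSpace.volume_preserving_symm_measurableEquiv_toLp
    (Fin n)).measure_preimage (MeasurableSet.univ_pi fun i => measurableSet_Ico).nullMeasurableSet,
    Real.volume_pi_Ico]
  simp

theorem norm_sub_le_of_mem_gridCell {N : ℕ} (hN : 1 ≤ N) {k : Fin n → ℤ}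
    {x y : E} (hx : x ∈ gridCell n N k) (hy : y ∈ gridCell n N k) : ‖y - x‖ ≤ n * (1 / N) := by
  have hN0 : (0 : ℝ) < N := by exact_mod_cast hN
  have h1 : ∀ i, |(y - x) i| ≤ 1 / N := fun i => by
    have ha := Int.floor_eq_iff.1 (hx i)
    have hb := Int.floor_eq_iff.1 (hy i)
    rw [le_div_iff₀ hN0, ← abs_of_pos hN0, ← abs_mul, PiLp.sub_apply, abs_le]
    constructor <;> nlinarith
  calc ‖y - x‖ = ‖∑ i, EuclideanSpace.single i ((y - x) i)‖ := by
        congr 1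
        have h2 := (EuclideanSpace.basisFun (Fin n) ℝ).sum_repr (y - x)
        simp only [EuclideanSpace.basisFun_apply, EuclideanSpace.basisFun_repr] at h2
        conv_lhs => rw [← h2]
        refine Finset.sum_congr rfl fun i _ => ?_
        ext j; by_cases h : j = i <;> simp [h]
    _ ≤ ∑ i : Fin n, (1 / N : ℝ) := (norm_sum_le _ _).trans
        (Finset.sum_le_sum fun i _ => by simpa using h1 i)
    _ = _ := by simp

/-- Indices of the cells of mesh `1 / N` which meet the cube of side `2 R`. -/
abbrev GridIndex (n R N : ℕ) : Type := Fin n → ↥(Finset.Icc (-(R * N : ℤ)) (R * N))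

theorem card_gridIndex_le (n : ℕ) {R N : ℕ} (hR : 1 ≤ R) (hN : 1 ≤ N) :
    (Fintype.card (GridIndex n R N) : ℝ) ≤ (3 * R) ^ n * N ^ n := by
  have h1 : Fintype.card (GridIndex n R N) = (2 * (R * N) + 1) ^ n := by
    simp only [Fintype.card_pi, Fintype.card_coe, Int.card_Icc, Finset.prod_const,
      Finset.card_univ, Fintype.card_fin]
    congr 1
    omega
  rw [h1, ← mul_pow]
  push_cast
  gcongr
  have : (1 : ℝ) ≤ R * N := by exact_mod_cast Nat.mul_pos hR hN
  nlinarith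

-- Sum the cell inequality over the grid. The differences contribute the volume of a ball of radius
-- `n / N` times `(n / N)²` times the energy; dividing by the cell volume `N^{-n}` leaves
-- `O(N^{-2})` times the energy. The constant depends neither on the size `R` of the support nor on
-- `N`.
variable (n) in
theorem exists_integral_sq_le_grid : ∃ C : ℝ, 0 < C ∧ ∀ R N : ℕ, 1 ≤ N →
    ∀ w : EuclideanSpace ℝ (Fin n) → ℂ, ContDiff ℝ 1 w → HasCompactSupport w →
      (∀ x, w x ≠ 0 → ‖x‖ ≤ R) →
      ∫ x, ‖w x‖ ^ 2 ≤ C / N ^ 2 * (∫ x, ‖fderiv ℝ w x‖ ^ 2) +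
        2 * N ^ n * ∑ k : GridIndex n R N, ‖∫ x in gridCell n N (fun i => k i), w x‖ ^ 2 := by
  set c := (volume (Metric.ball (0 : E) 1)).toReal with hc
  have hc0 : 0 ≤ c := ENNReal.toReal_nonneg
  -- Here `c n^n` comes from the ball of radius `n / N` and `n²` from the squared diameter bound of
  -- a cell; adding `1` ensures positivity.
  refine ⟨2 * (c * n ^ n * n ^ 2) + 1, by positivity, fun R N hN w hw hcs hR => ?_⟩
  have hN0 : (0 : ℝ) < N := by exact_mod_cast hN
  set Q : GridIndex n R N → Set E := fun k => gridCell n N (fun i => k i) with hQdef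
  have hQ : ∀ k, MeasurableSet (Q k) := fun k => measurableSet_gridCell hN _
  have hdisj : Pairwise (Function.onFun Disjoint Q) := by
    intro k k' hkk'
    refine Set.disjoint_left.2 fun x hx hx' => hkk' ?_
    funext i
    exact Subtype.ext ((hx i).symm.trans (hx' i))
  have hcov : ∀ x, w x ≠ 0 → x ∈ ⋃ k ∈ (Finset.univ : Finset (GridIndex n R N)), Q k := by
    intro x hx
    have h1 := hR x hx
    have h2 : ∀ i, ⌊(N : ℝ) * x i⌋ ∈ Finset.Icc (-(R * N : ℤ)) (R * N) := fun i => by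
      have h3 : |x i| ≤ R := (PiLp.norm_apply_le x i).trans h1
      rw [abs_le] at h3
      rw [Finset.mem_Icc]
      constructor
      · rw [Int.le_floor]; push_cast; nlinarith
      · have : (⌊(N : ℝ) * x i⌋ : ℝ) ≤ ((R * N : ℤ) : ℝ) :=
          (Int.floor_le _).trans (by push_cast; nlinarith)
        exact_mod_cast this
    simp only [Finset.mem_univ, iUnion_true, mem_iUnion]
    exact ⟨fun i => ⟨_, h2 i⟩, fun i => rfl⟩
  have hwi : Integrable w := hw.continuous.integrable_of_hasCompactSupport hcs
  set V := ENNReal.ofReal (1 / N) ^ n with hV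
  have hV' : V = ENNReal.ofReal ((1 / N) ^ n) := by rw [hV, ENNReal.ofReal_pow (by positivity)]
  have hV0 : V ≠ 0 := by rw [hV', ne_eq, ENNReal.ofReal_eq_zero, not_le]; positivity
  have hVt : V ≠ ⊤ := by rw [hV']; exact ENNReal.ofReal_ne_top
  have h1 : V * ∫⁻ x, ‖w x‖ₑ ^ 2 ≤ 2 * (volume (Metric.closedBall (0 : E) (n * (1 / N))) *
      (ENNReal.ofReal (n * (1 / N)) ^ 2 * ∫⁻ x, ‖fderiv ℝ w x‖ₑ ^ 2)) +
      2 * ∑ k, ‖∫ x in Q k, w x‖ₑ ^ 2 := by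
    have h2 : ∫⁻ x, ‖w x‖ₑ ^ 2 = ∑ k, ∫⁻ x in Q k, ‖w x‖ₑ ^ 2 := by
      rw [← lintegral_biUnion_finset (fun i _ j _ hij => hdisj hij) (fun k _ => hQ k),
        ← lintegral_indicator (Finset.measurableSet_biUnion _ fun k _ => hQ k)]
      refine lintegral_congr fun x => ?_
      by_cases hx : w x = 0
      · by_cases h : x ∈ ⋃ k ∈ (Finset.univ : Finset (GridIndex n R N)), Q k
        · rw [indicator_of_mem h]
        · rw [indicator_of_notMem h, hx]; simp
      · rw [indicator_of_mem (hcov x hx)]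
    rw [h2, Finset.mul_sum]
    calc _ ≤ ∑ k, (2 * (∫⁻ x in Q k, ∫⁻ y in Q k, ‖w x - w y‖ₑ ^ 2) +
          2 * ‖∫ x in Q k, w x‖ₑ ^ 2) := by
          refine Finset.sum_le_sum fun k _ => ?_
          have hvol := volume_gridCell hN (fun i => (k i : ℤ))
          have := volume_mul_lintegral_sq_le hw.continuous (hQ k) (hvol ▸ hV0) (hvol ▸ hVt)
            hwi.integrableOn
          rwa [hvol] at this
      _ ≤ _ := by
          rw [Finset.sum_add_distrib, ← Finset.mul_sum, ← Finset.mul_sum]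
          gcongr
          exact lintegral_cells_le hw _ Q hQ hdisj fun k x hx y hy =>
            norm_sub_le_of_mem_gridCell hN hx hy
  have hball : volume (Metric.closedBall (0 : E) (n * (1 / N))) =
      ENNReal.ofReal ((n * (1 / N)) ^ n * c) := by
    rw [Measure.addHaar_closedBall _ _ (by positivity), finrank_euclideanSpace_fin,
      ENNReal.ofReal_mul (by positivity), hc, ENNReal.ofReal_toReal]
    exact measure_ball_lt_top.ne
  have hconv : ∀ {F : Type _} [NormedAddCommGroup F] (f : E → F), Continuous f →
      HasCompactSupport f → ∫⁻ x, ‖f x‖ₑ ^ 2 = ENNReal.ofReal (∫ x, ‖f x‖ ^ 2) := by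
    intro F _ f hf hfc
    rw [ofReal_integral_eq_lintegral_ofReal]
    · refine lintegral_congr fun x => ?_
      rw [ENNReal.ofReal_pow (norm_nonneg _), ofReal_norm]
    · exact Continuous.integrable_of_hasCompactSupport (by fun_prop)
        (hfc.comp_left (g := fun z => ‖z‖ ^ 2) (by simp))
    · exact Eventually.of_forall fun x => by positivity
  have hs : ∑ k, ‖∫ x in Q k, w x‖ₑ ^ 2 = ENNReal.ofReal (∑ k, ‖∫ x in Q k, w x‖ ^ 2) := by
    rw [ENNReal.ofReal_sum_of_nonneg fun k _ => by positivity]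
    refine Finset.sum_congr rfl fun k _ => ?_
    rw [ENNReal.ofReal_pow (norm_nonneg _), ofReal_norm]
  set S := ∑ k, ‖∫ x in Q k, w x‖ ^ 2 with hSdef
  have hS0 : 0 ≤ S := by positivity
  set a := ∫ x, ‖w x‖ ^ 2 with ha
  set d := ∫ x, ‖fderiv ℝ w x‖ ^ 2 with hd
  have ha0 : 0 ≤ a := by positivity
  have hd0 : 0 ≤ d := by positivity
  rw [hconv w hw.continuous hcs, hconv (fderiv ℝ w) (hw.continuous_fderiv (by norm_num))
    (hcs.fderiv ℝ), hs, hball, hV', ← ENNReal.ofReal_pow (by positivity),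
    ← ENNReal.ofReal_mul (by positivity), ← ENNReal.ofReal_mul (by positivity),
    ← ENNReal.ofReal_mul (by positivity)] at h1
  replace h1 := le_of_ofReal_le_two_mul (by positivity) (by positivity) h1
  have h2 : a = N ^ n * ((1 / N) ^ n * a) := by
    rw [← mul_assoc, ← mul_pow]; field_simp; simp
  rw [h2]
  calc _ ≤ N ^ n * (2 * ((n * (1 / N)) ^ n * c * ((n * (1 / N)) ^ 2 * d)) + 2 * S) := by gcongr
    _ = 2 * (c * n ^ n * n ^ 2) / N ^ 2 * d + 2 * N ^ n * S := by
        rw [mul_pow, one_div, inv_pow]; field_simp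
    _ ≤ _ := by gcongr; linarith

end Poincare

end SemiFlat
end

noncomputable section

namespace SemiFlat

/-- Collect the functionals of all the pieces; Cauchy–Schwarz over the finitely many pieces bounds
the square of the sum by `m` times the sum of the squares. -/
theorem HasSmallWidths.of_sum {V H : Type*} [AddCommGroup V] [Module ℂ V] [NormedAddCommGroup H]
    [InnerProductSpace ℂ H] {ι : V →ₗ[ℂ] H} {a : V → V → ℂ} {n : ℕ} (ha : ∀ v, 0 ≤ (a v v).re)
    {J : Type*} [Fintype J] (T : J → V →ₗ[ℂ] V) (hT : ∀ v, v = ∑ j, T j v)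
    (hw : ∀ j, HasSmallWidths (ι ∘ₗ T j) a n) (hb : ∀ j, ∃ B, ∀ v, ‖ι (T j v)‖ ≤ B * ‖ι v‖) :
    HasSmallWidths ι a n := by
  classical
  choose C hC hw using hw
  choose B hB using hb
  set m : ℝ := ((Fintype.card J : ℕ) : ℝ) with hm
  set S := ∑ j, C j with hS
  have hS0 : 0 ≤ S := Finset.sum_nonneg fun j _ => (hC j).le
  have hCS : ∀ j, C j ≤ S := fun j =>
    Finset.single_le_sum (f := C) (fun j _ => (hC j).le) (Finset.mem_univ j)
  -- The square of this constant must dominate `m S²`, and the constant itself the total count `S`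
  -- of functionals.
  refine ⟨m * S + S + 1, by positivity, fun N hN => ?_⟩
  have hN0 : (0 : ℝ) < N := by exact_mod_cast hN
  choose I fI hcard ψ hψ K hK using fun j => hw j N hN
  choose B' hB' using hψ
  -- The definition of small widths asks for index types in the lowest universe, so the pieces are
  -- renumbered.
  let e := Fintype.equivFin J
  refine ⟨Σ k : Fin (Fintype.card J), I (e.symm k), inferInstance, ?_,
    fun p => ψ (e.symm p.1) p.2, ⟨∑ j, |B' j| * |B j|, fun p v => ?_⟩, m * ∑ j, |K j|, fun v => ?_⟩
  · rw [Fintype.card_sigma, Nat.cast_sum, e.symm.sum_comp (fun j => (Fintype.card (I j) : ℝ))]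
    calc _ ≤ ∑ j, C j * N ^ n := Finset.sum_le_sum fun j _ => hcard j
      _ = S * N ^ n := by rw [Finset.sum_mul]
      _ ≤ _ := by gcongr; nlinarith [(Nat.cast_nonneg (Fintype.card J) : (0 : ℝ) ≤ _)]
  · set j := e.symm p.1
    calc _ ≤ B' j * ‖ι (T j v)‖ := hB' j p.2 v
      _ ≤ |B' j| * (|B j| * ‖ι v‖) := by
          refine mul_le_mul (le_abs_self _) ((hB j v).trans ?_) (norm_nonneg _) (abs_nonneg _)
          gcongr; exact le_abs_self _
      _ ≤ _ := by
          rw [← mul_assoc]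
          gcongr
          exact Finset.single_le_sum (f := fun j => |B' j| * |B j|) (fun j _ => by positivity)
            (Finset.mem_univ j)
  · have h1 : ‖ι v‖ ^ 2 ≤ m * ∑ j, ‖ι (T j v)‖ ^ 2 := by
      calc ‖ι v‖ ^ 2 ≤ (∑ j, ‖ι (T j v)‖) ^ 2 := by
            conv_lhs => rw [hT v, map_sum]
            gcongr
            exact norm_sum_le _ _
        _ ≤ _ := by
            have := sq_sum_le_card_mul_sum_sq (s := Finset.univ) (f := fun j => ‖ι (T j v)‖)
            simpa using this
    have hm0 : 0 ≤ m := Nat.cast_nonneg _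
    have h2 : ∀ j, ‖ι (T j v)‖ ^ 2 ≤ C j * S / N ^ 2 * (a v v).re +
        (∑ j, |K j|) * ∑ k, ‖ψ j k v‖ ^ 2 := by
      intro j
      refine (hK j v).trans ?_
      have h3 := ha v
      rw [div_pow, sq (C j)]
      gcongr
      · exact (hC j).le
      · exact hCS j
      · exact (le_abs_self _).trans (Finset.single_le_sum (f := fun j => |K j|)
          (fun j _ => abs_nonneg _) (Finset.mem_univ j))
    have h4 : ∑ p : (Σ k : Fin (Fintype.card J), I (e.symm k)), ‖ψ (e.symm p.1) p.2 v‖ ^ 2 =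
        ∑ j, ∑ k, ‖ψ j k v‖ ^ 2 := by
      rw [Fintype.sum_sigma, e.symm.sum_comp (fun j => ∑ k, ‖ψ j k v‖ ^ 2)]
    rw [h4]
    calc _ ≤ m * ∑ j, (C j * S / N ^ 2 * (a v v).re + (∑ j, |K j|) * ∑ k, ‖ψ j k v‖ ^ 2) :=
          h1.trans (by gcongr with j; exact h2 j)
      _ = (m * S) * S / N ^ 2 * (a v v).re + m * (∑ j, |K j|) * ∑ j, ∑ k, ‖ψ j k v‖ ^ 2 := by
          rw [Finset.sum_add_distrib, ← Finset.sum_mul, ← Finset.sum_div, ← Finset.sum_mul,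
            ← Finset.mul_sum]
          ring
      _ ≤ _ := by
          have h3 := ha v
          rw [div_pow]
          gcongr
          nlinarith [mul_nonneg hm0 hS0]

/-! ### Small widths of the form domain of a relatively compact set. -/

section Weyl

variable {n : ℕ} {M : Type*} [TopologicalSpace M] [ChartedSpace (EuclideanSpace ℝ (Fin n)) M]
  [IsManifold (𝓡 n) ∞ M]

local notation "E" => EuclideanSpace ℝ (Fin n)
local notation "ch" => chartAt (EuclideanSpace ℝ (Fin n))

theorem differential_real_smul {η : M → ℝ} {F : M → ℂ} {x : M}
    (hη : MDifferentiableAt (𝓡 n) 𝓘(ℝ, ℝ) η x) (hF : MDifferentiableAt (𝓡 n) 𝓘(ℝ, ℂ) F x) :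
    differential (n := n) (fun y => η y • F y) x = (η x : ℂ) • differential F x +
      F x • differential (fun y => (η y : ℂ)) x := by
  have h1 : HasMFDerivAt (𝓡 n) 𝓘(ℝ, ℂ) (fun y => (η y : ℂ)) x
      (Complex.ofRealCLM.comp (realDifferential η x)) := by
    have h2 : HasMFDerivAt 𝓘(ℝ, ℝ) 𝓘(ℝ, ℂ) (fun z : ℝ => (z : ℂ)) (η x) Complex.ofRealCLM :=
      hasMFDerivAt_iff_hasFDerivAt.2 Complex.ofRealCLM.hasFDerivAt
    exact h2.comp x hη.hasMFDerivAt
  have h3 := h1.mul hF.hasMFDerivAt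
  have h4 : (fun y => η y • F y) = (fun y => (η y : ℂ)) * F := by
    ext y; simp
  rw [h4]
  refine h3.mfderiv.trans ?_
  rw [show differential (fun y => (η y : ℂ)) x = _ from h1.mfderiv]
  rfl

variable [T2Space M] [SecondCountableTopology M] [MeasurableSpace M] [BorelSpace M] {U : Set M}

variable (U) in
/-- Multiplication by a smooth real function on `C¹` functions with compact support. -/
def C1c.mulSmoothₗ (η : M → ℝ) (hη : ContMDiff (𝓡 n) 𝓘(ℝ, ℝ) ∞ η) : C1c n U →ₗ[ℂ] C1c n U where
  toFun := C1c.mulSmooth η hη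
  map_add' φ ψ := Subtype.ext (funext fun x => smul_add (η x) ((φ : M → ℂ) x) ((ψ : M → ℂ) x))
  map_smul' r φ := Subtype.ext (funext fun x => smul_comm (η x) r ((φ : M → ℂ) x))

theorem exists_norm_toLp_mulSmooth_le (g : Metric n M) (η : M → ℝ)
    (hη : ContMDiff (𝓡 n) 𝓘(ℝ, ℝ) ∞ η) (hc : HasCompactSupport η) :
    ∃ B : ℝ, 0 < B ∧ ∀ φ : C1c n U, ‖C1c.toLp g U (C1c.mulSmooth η hη φ)‖ ≤
      B * ‖C1c.toLp g U φ‖ := by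
  obtain ⟨B, hB⟩ := hc.exists_bound_of_continuous hη.continuous
  refine ⟨|B| + 1, by positivity, fun φ => ?_⟩
  rw [← sq_le_sq₀ (norm_nonneg _) (by positivity), mul_pow, C1c.norm_toLp_sq, C1c.norm_toLp_sq,
    ← integral_const_mul]
  refine integral_mono_of_nonneg (Eventually.of_forall fun x => by positivity)
    ((C1c.memLp g φ).integrable_norm_pow (by norm_num) |>.const_mul _)
    (Eventually.of_forall fun x => ?_)
  change ‖η x • (φ : M → ℂ) x‖ ^ 2 ≤ _
  simp only [norm_smul, mul_pow]
  gcongr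
  exact (hB x).trans ((le_abs_self B).trans (by linarith))

/-- By the Leibniz rule `|d(ηφ)|² ≤ 2 η² |dφ|² + 2 |φ|² |dη|²`, and both `η` and `|dη|` are bounded.
-/
theorem exists_dirichletForm_mulSmooth_le (g : Metric n M) (η : M → ℝ)
    (hη : ContMDiff (𝓡 n) 𝓘(ℝ, ℝ) ∞ η) (hc : HasCompactSupport η) :
    ∃ B : ℝ, 0 < B ∧ ∀ φ : C1c n U,
      (dirichletForm g U (C1c.mulSmooth η hη φ) (C1c.mulSmooth η hη φ)).re ≤
      B * (C1c.form g U 1 φ φ).re := by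
  have hη' : ContMDiff (𝓡 n) 𝓘(ℝ, ℂ) 1 (fun x => (η x : ℂ)) :=
    (Complex.ofRealCLM.contMDiff).comp (hη.of_le (by norm_cast))
  have hc' : HasCompactSupport (fun x => (η x : ℂ)) := hc.comp_left (g := Complex.ofReal) (by simp)
  -- The support of `η` need not lie in `U`, so `η` is treated as an element of the space over all
  -- of `M`.
  let ηc : C1c n (univ : Set M) := ⟨fun x => (η x : ℂ), hη', hc', subset_univ _⟩
  obtain ⟨B, hB⟩ := hc.exists_bound_of_continuous hη.continuous
  have hcn : HasCompactSupport fun x => cnorm g x (differential (ηc : M → ℂ) x) ^ 2 := by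
    have := C1c.hasCompactSupport_covectorInner g ηc ηc
    have h2 := this.comp_left (g := Complex.re) (by simp)
    simpa only [Function.comp_def, covectorInner_self, Complex.ofReal_re] using h2
  obtain ⟨B', hB'⟩ := hcn.exists_bound_of_continuous (C1c.continuous_cnorm_sq g ηc)
  refine ⟨2 * B ^ 2 + 2 * |B'| + 1, by positivity, fun φ => ?_⟩
  rw [C1c.form_self_re, C1c.dirichletForm_self_re, C1c.dirichletForm_self_re, C1c.norm_toLp_sq,
    one_mul, ← integral_add (C1c.integrable_cnorm_sq g φ)
      ((C1c.memLp g φ).integrable_norm_pow (by norm_num)), ← integral_const_mul]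
  refine integral_mono_of_nonneg (Eventually.of_forall fun x => by positivity)
    (((C1c.integrable_cnorm_sq g φ).add
      ((C1c.memLp g φ).integrable_norm_pow (by norm_num))).const_mul _)
    (Eventually.of_forall fun x => ?_)
  have h1 : differential (C1c.mulSmooth η hη φ : M → ℂ) x = (η x : ℂ) • differential (φ : M → ℂ) x +
      (φ : M → ℂ) x • differential (ηc : M → ℂ) x :=
    differential_real_smul (hη.mdifferentiable (by simp) x) (C1c.mdifferentiableAt φ x)
  simp only [h1]
  have h2 := cnorm_add_le g x ((η x : ℂ) • differential (φ : M → ℂ) x)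
    ((φ : M → ℂ) x • differential (ηc : M → ℂ) x)
  rw [cnorm_smul, cnorm_smul] at h2
  have h3 : ‖(η x : ℂ)‖ ≤ B := by rw [Complex.norm_real]; exact hB x
  have h4 : cnorm g x (differential (ηc : M → ℂ) x) ^ 2 ≤ |B'| :=
    (le_abs_self _).trans ((hB' x).trans (le_abs_self _))
  set p := cnorm g x (differential (φ : M → ℂ) x)
  set q := cnorm g x (differential (ηc : M → ℂ) x)
  set z := ‖(φ : M → ℂ) x‖
  set y := ‖(η x : ℂ)‖
  have hy : y ^ 2 ≤ B ^ 2 := pow_le_pow_left₀ (norm_nonneg _) h3 2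
  calc _ ≤ (y * p + z * q) ^ 2 := pow_le_pow_left₀ (cnorm_nonneg g x _) h2 2
    _ ≤ 2 * (y ^ 2 * p ^ 2) + 2 * (q ^ 2 * z ^ 2) := by nlinarith [sq_nonneg (y * p - z * q)]
    _ ≤ 2 * (B ^ 2 * p ^ 2) + 2 * (|B'| * z ^ 2) := by gcongr
    _ ≤ _ := by nlinarith [sq_nonneg p, sq_nonneg z, sq_nonneg B, abs_nonneg B',
      mul_nonneg (sq_nonneg B) (sq_nonneg z), mul_nonneg (abs_nonneg B') (sq_nonneg p)]

/-- The cut-off function is moved to Euclidean space by the chart, where the functionals are the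
integrals over the grid cells and the grid inequality applies; norms and energies change only by
constants. -/
theorem hasSmallWidths_chart (g : Metric n M) (x₀ : M) (η : M → ℝ)
    (hη : ContMDiff (𝓡 n) 𝓘(ℝ, ℝ) ∞ η) (hc : HasCompactSupport η)
    (hs : tsupport η ⊆ (ch x₀).source) :
    HasSmallWidths (C1c.toLp g U ∘ₗ C1c.mulSmoothₗ U η hη) (C1c.form g U 1) n := by
  set K := ch x₀ '' tsupport η with hKdef
  have hK : IsCompact K := hc.isCompact.image_of_continuousOn ((ch x₀).continuousOn.mono hs)
  have hKt : K ⊆ (ch x₀).target := by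
    rintro _ ⟨x, hx, rfl⟩; exact (ch x₀).map_source (hs hx)
  obtain ⟨R, hR⟩ : ∃ R : ℕ, ∀ y ∈ K, ‖y‖ ≤ R := by
    obtain ⟨r, hr⟩ := hK.isBounded.exists_norm_le
    exact ⟨⌈r⌉₊, fun y hy => (hr y hy).trans (Nat.le_ceil r)⟩
  obtain ⟨C1, hC1, hch⟩ := exists_chart_bounds (U := U) g x₀ hK hKt
  obtain ⟨C2, hC2, hgrid⟩ := exists_integral_sq_le_grid n
  obtain ⟨C3, hC3, hdir⟩ := exists_dirichletForm_mulSmooth_le (U := U) g η hη hc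
  set T := C1c.mulSmoothₗ U η hη with hT
  have hts : ∀ φ : C1c n U, tsupport (T φ : M → ℂ) ⊆ tsupport η := fun φ =>
    C1c.tsupport_mulSmooth η hη φ
  have hsymm : ∀ φ : C1c n U, tsupport (T φ : M → ℂ) ⊆ (ch x₀).symm '' K := fun φ x hx =>
    ⟨ch x₀ x, mem_image_of_mem _ (hts φ hx), (ch x₀).left_inv (hs (hts φ hx))⟩
  have hpc : ∀ φ : C1c n U, ContDiff ℝ 1 (pull (n := n) x₀ (T φ)) := fun φ =>
    contDiff_pull x₀ (by norm_cast) (T φ).2.1 (T φ).2.2.1 ((hts φ).trans hs)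
  have hps : ∀ φ : C1c n U, HasCompactSupport (pull (n := n) x₀ (T φ)) := fun φ =>
    hasCompactSupport_pull x₀ (T φ).2.2.1 ((hts φ).trans hs)
  have hpK : ∀ φ : C1c n U, tsupport (pull (n := n) x₀ (T φ)) ⊆ K := fun φ =>
    (tsupport_pull_subset x₀ (T φ).2.2.1 ((hts φ).trans hs)).trans (image_mono (hts φ))
  have hint : ∀ φ : C1c n U, Integrable (pull (n := n) x₀ (T φ)) := fun φ =>
    (hpc φ).continuous.integrable_of_hasCompactSupport (hps φ)
  have hsetK : ∀ {F : E → ℝ}, (∀ y, y ∉ K → F y = 0) → ∫ y in K, F y = ∫ y, F y := fun h =>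
    setIntegral_eq_integral_of_forall_compl_eq_zero h
  -- The first term counts the cells; with the other terms `C²` dominates the constant `C1 C2 C1 C3`
  -- of the energy term.
  set C := (3 * (R + 1)) ^ n + C1 * C2 * C1 * C3 + 1 with hC
  have hCpos : 0 < C := by positivity
  refine ⟨C, hCpos, fun N hN => ?_⟩
  have hN0 : (0 : ℝ) < N := by exact_mod_cast hN
  have hQm : ∀ k, MeasurableSet (gridCell n N k) := measurableSet_gridCell hN
  refine ⟨GridIndex n (R + 1) N, inferInstance, ?_, fun k =>
    { toFun := fun φ => ∫ y in gridCell n N (fun i => k i), pull x₀ (T φ) y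
      map_add' := fun φ ψ => ?_
      map_smul' := fun r φ => ?_ }, ⟨?_, fun k φ => ?_⟩, C1 * (2 * N ^ n), fun φ => ?_⟩
  -- The size is `R + 1` because `R` may be `0`, while the count of cells needs a positive size.
  · refine (card_gridIndex_le n (R := R + 1) (by omega) hN).trans ?_
    gcongr
    push_cast
    rw [hC]
    have : 0 < C1 * C2 * C1 * C3 := by positivity
    linarith
  · rw [← integral_add (hint φ).integrableOn (hint ψ).integrableOn, map_add]
    refine integral_congr_ae (Eventually.of_forall fun y => ?_)
    by_cases hy : y ∈ (ch x₀).target <;> simp [pull, hy]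
  · rw [RingHom.id_apply, smul_eq_mul, ← integral_const_mul, map_smul]
    refine integral_congr_ae (Eventually.of_forall fun y => ?_)
    by_cases hy : y ∈ (ch x₀).target <;> simp [pull, hy]
  · exact Real.sqrt ((volume (gridCell n N 0)).toReal * C1)
  · have hv : (volume (gridCell n N fun i => (k i : ℤ))) = volume (gridCell n N 0) := by
      rw [volume_gridCell hN, volume_gridCell hN]
    have hvt : volume (gridCell n N 0) ≠ ⊤ := by rw [volume_gridCell hN]; simp
    change ‖∫ y in gridCell n N (fun i => k i), pull x₀ (T φ) y‖ ≤ _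
    have h1 := enorm_integral_sq_le (volume.restrict (gridCell n N (fun i => (k i : ℤ))))
      (f := pull (n := n) x₀ (T φ)) (hpc φ).continuous.aestronglyMeasurable
    rw [Measure.restrict_apply_univ, hv] at h1
    have h2 : ∫⁻ y in gridCell n N (fun i => (k i : ℤ)), ‖pull (n := n) x₀ (T φ) y‖ₑ ^ 2 ≤
        ENNReal.ofReal (∫ y, ‖pull (n := n) x₀ (T φ) y‖ ^ 2) := by
      rw [ofReal_integral_eq_lintegral_ofReal]
      · refine (setLIntegral_le_lintegral _ _).trans (lintegral_mono fun y => ?_)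
        rw [ENNReal.ofReal_pow (norm_nonneg _), ofReal_norm]
      · exact Continuous.integrable_of_hasCompactSupport
          (by have := (hpc φ).continuous; fun_prop)
          ((hps φ).comp_left (g := fun z => ‖z‖ ^ 2) (by simp))
      · exact Eventually.of_forall fun x => by positivity
    have h3 := (hch (T φ) (hsymm φ)).2.1
    rw [hsetK fun y hy => by
      rw [image_eq_zero_of_notMem_tsupport fun h => hy (hpK φ h)]; simp] at h3
    have h4 := h1.trans (mul_le_mul' le_rfl (h2.trans (ENNReal.ofReal_le_ofReal h3)))
    rw [← ofReal_norm, ← ENNReal.ofReal_pow (norm_nonneg _), ← ENNReal.ofReal_toReal hvt,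
      ← ENNReal.ofReal_mul ENNReal.toReal_nonneg, ENNReal.ofReal_le_ofReal_iff (by positivity),
      ← mul_assoc] at h4
    calc _ ≤ Real.sqrt ((volume (gridCell n N 0)).toReal * C1 * ‖C1c.toLp g U (T φ)‖ ^ 2) :=
          Real.le_sqrt_of_sq_le h4
      _ = Real.sqrt ((volume (gridCell n N 0)).toReal * C1) * ‖C1c.toLp g U (T φ)‖ := by
          rw [Real.sqrt_mul (by positivity), Real.sqrt_sq (norm_nonneg _)]
  · obtain ⟨h1, -, -, h2⟩ := hch (T φ) (hsymm φ)
    have h3 := hgrid (R + 1) N hN _ (hpc φ) (hps φ) fun y hy =>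
      (hR y (hpK φ (subset_tsupport _ hy))).trans (by push_cast; linarith)
    rw [hsetK fun y hy => by
      rw [image_eq_zero_of_notMem_tsupport fun h => hy (hpK φ h)]; simp] at h1
    rw [hsetK fun y hy => by
      rw [image_eq_zero_of_notMem_tsupport fun h => hy (hpK φ (tsupport_fderiv_subset ℝ h))];
      simp] at h2
    have h4 := hdir φ
    have h5 : 0 ≤ (C1c.form g U 1 φ φ).re :=
      le_trans (by positivity) (C1c.form_bound g 1 φ)
    have h6 : C1 * C2 * C1 * C3 ≤ C ^ 2 := by
      have h7 : (0 : ℝ) ≤ (3 * (R + 1)) ^ n := by positivity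
      have h8 : 0 < C1 * C2 * C1 * C3 := by positivity
      nlinarith
    change ‖C1c.toLp g U (T φ)‖ ^ 2 ≤ _
    calc _ ≤ C1 * (C2 / N ^ 2 * (C1 * (C3 * (C1c.form g U 1 φ φ).re)) +
          2 * N ^ n * ∑ k : GridIndex n (R + 1) N,
            ‖∫ x in gridCell n N (fun i => k i), pull x₀ (T φ) x‖ ^ 2) := by
          refine h1.trans ?_
          gcongr
          refine h3.trans ?_
          gcongr
          refine h2.trans ?_
          gcongr
          exact h4
      _ = (C1 * C2 * C1 * C3) / N ^ 2 * (C1c.form g U 1 φ φ).re + C1 * (2 * N ^ n) *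
          ∑ k : GridIndex n (R + 1) N,
            ‖∫ x in gridCell n N (fun i => k i), pull x₀ (T φ) x‖ ^ 2 := by ring
      _ ≤ _ := by
          rw [div_pow]
          gcongr
          exact le_rfl

theorem hasSmallWidths (g : Metric n M) (hU : IsCompact (closure U)) :
    HasSmallWidths (C1c.toLp g U) (C1c.form g U 1) n := by
  obtain ⟨s, η, hη, hsum⟩ := exists_chart_partition n hU
  refine HasSmallWidths.of_sum (fun φ => le_trans (by positivity) (C1c.form_bound g 1 φ))
    (fun x : s => C1c.mulSmoothₗ U (η x) (hη x x.2).1) (fun φ => ?_)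
    (fun x => hasSmallWidths_chart g x (η x) (hη x x.2).1 (hη x x.2).2.1 (hη x x.2).2.2)
    (fun x => ?_)
  · ext y
    rw [AddSubmonoidClass.coe_finsetSum, Finset.sum_apply]
    change _ = ∑ x : s, η x y • (φ : M → ℂ) y
    rw [← Finset.sum_smul, Finset.sum_coe_sort s (fun x => η x y)]
    by_cases hy : y ∈ tsupport (φ : M → ℂ)
    · rw [hsum y (subset_closure (φ.2.2.2 hy)), one_smul]
    · rw [image_eq_zero_of_notMem_tsupport hy, smul_zero]
  · obtain ⟨B, -, hB⟩ := exists_norm_toLp_mulSmooth_le (U := U) g (η x) (hη x x.2).1 (hη x x.2).2.1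
    exact ⟨B, hB⟩

end Weyl

end SemiFlat
end

noncomputable section

namespace SemiFlat

/-! ### Heat operators commute with an antiunitary involution that commutes with the resolvent. -/

section Conjugation

variable {E : Type*} [NormedAddCommGroup E] [InnerProductSpace ℂ E] [CompleteSpace E]

/-- Conjugation of operators by an antiunitary involution. -/
def conjHom (J : E →L⋆[ℂ] E) (hJJ : ∀ x, J (J x) = x)
    (hJ : ∀ x y, Inner.inner ℂ (J x) (J y) = Inner.inner ℂ y x) :
    (E →L[ℂ] E) →⋆ₐ[ℝ] (E →L[ℂ] E) where
  toFun T := J.comp (T.comp J)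
  map_one' := by ext x; exact hJJ x
  map_mul' S T := by
    ext x
    change J (S (T (J x))) = J (S (J (J (T (J x)))))
    rw [hJJ]
  map_zero' := by ext x; exact map_zero J
  map_add' S T := by ext x; exact map_add J _ _
  commutes' r := by
    ext x
    change J ((algebraMap ℝ (E →L[ℂ] E) r) (J x)) = (algebraMap ℝ (E →L[ℂ] E) r) x
    rw [Algebra.algebraMap_eq_smul_one, smul_apply, smul_apply]
    change J (r • J x) = r • x
    rw [← Complex.coe_smul, map_smulₛₗ, hJJ, Complex.conj_ofReal, Complex.coe_smul]
  map_star' T := by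
    rw [ContinuousLinearMap.star_eq_adjoint, ContinuousLinearMap.star_eq_adjoint,
      ContinuousLinearMap.eq_adjoint_iff]
    intro x y
    change Inner.inner ℂ (J (T.adjoint (J x))) y = Inner.inner ℂ x (J (T (J y)))
    conv_lhs => rw [← hJJ y]
    conv_rhs => rw [← hJJ x]
    rw [hJ, hJ, ContinuousLinearMap.adjoint_inner_right]

theorem continuous_conjHom (J : E →L⋆[ℂ] E) (hJJ : ∀ x, J (J x) = x)
    (hJ : ∀ x y, Inner.inner ℂ (J x) (J y) = Inner.inner ℂ y x) :
    Continuous (conjHom J hJJ hJ) := by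
  have hn : ∀ x, ‖J x‖ = ‖x‖ := fun x => by
    rw [← sq_eq_sq₀ (norm_nonneg _) (norm_nonneg _), norm_sq_eq_re_inner (𝕜 := ℂ), hJ,
      ← norm_sq_eq_re_inner (𝕜 := ℂ)]
  refine AddMonoidHomClass.continuous_of_bound (conjHom J hJJ hJ) 1 fun T => ?_
  refine ContinuousLinearMap.opNorm_le_bound _ (by positivity) fun x => ?_
  change ‖J (T (J x))‖ ≤ _
  rw [hn, one_mul, ← hn x]
  exact T.le_opNorm _

/-- Conjugation by `J` is a continuous star homomorphism of real algebras fixing `R`, and the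
calculus of a real function is preserved by such maps. -/
theorem expOfResolvent_conj (J : E →L⋆[ℂ] E) (hJJ : ∀ x, J (J x) = x)
    (hJ : ∀ x y, Inner.inner ℂ (J x) (J y) = Inner.inner ℂ y x) {R : E →L[ℂ] E}
    (hR : IsSelfAdjoint R) (hRJ : ∀ x, J (R x) = R (J x)) {τ : ℝ} (hτ : 0 < τ) (x : E) :
    J (expOfResolvent R τ x) = expOfResolvent R τ (J x) := by
  have h1 : conjHom J hJJ hJ R = R := by
    ext x
    change J (R (J x)) = R x
    rw [hRJ, hJJ]
  have h2 := StarAlgHomClass.map_cfc (S := ℝ) (conjHom J hJJ hJ) (expFun τ) R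
    (continuous_expFun hτ).continuousOn (continuous_conjHom J hJJ hJ) hR (h1.symm ▸ hR : IsSelfAdjoint (conjHom J hJJ hJ R))
  rw [h1] at h2
  have h3 := congrArg (fun T : E →L[ℂ] E => T (J x)) h2
  change J (expOfResolvent R τ (J (J x))) = expOfResolvent R τ (J x) at h3
  rwa [hJJ] at h3

theorem isSelfAdjoint_expOfResolvent (R : E →L[ℂ] E) (τ : ℝ) :
    IsSelfAdjoint (expOfResolvent R τ) := cfc_predicate _ _

end Conjugation

/-! ### Complex conjugation as an antiunitary involution of `L²`. -/

section StarLp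

variable {Ω : Type*} [MeasurableSpace Ω] (μ : Measure Ω)

/-- Complex conjugation on `L²`. -/
def starL2 : Lp ℂ 2 μ →L⋆[ℂ] Lp ℂ 2 μ :=
  LinearMap.mkContinuous
    { toFun := fun f => star f
      map_add' := fun f g => by
        refine Lp.ext ?_
        filter_upwards [Lp.coeFn_star (f + g), Lp.coeFn_add f g, Lp.coeFn_add (star f) (star g),
          Lp.coeFn_star f, Lp.coeFn_star g] with x h1 h2 h3 h4 h5
        rw [h1, h3, Pi.star_apply, h2, Pi.add_apply, Pi.add_apply, h4, h5, star_add]; rfl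
      map_smul' := fun r f => by
        refine Lp.ext ?_
        filter_upwards [Lp.coeFn_star (r • f), Lp.coeFn_smul r f,
          Lp.coeFn_smul (starRingEnd ℂ r) (star f), Lp.coeFn_star f] with x h1 h2 h3 h4
        rw [h1, h3, Pi.star_apply, h2, Pi.smul_apply, Pi.smul_apply, h4, star_smul]; rfl } 1
    fun f => by
      rw [one_mul]
      refine le_of_eq ?_
      refine congrArg ENNReal.toReal (eLpNorm_congr_norm_ae ?_)
      filter_upwards [Lp.coeFn_star f] with x h
      change ‖(star f : Lp ℂ 2 μ) x‖ = _
      rw [h, Pi.star_apply, norm_star]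

theorem starL2_coeFn (f : Lp ℂ 2 μ) : starL2 μ f =ᵐ[μ] fun x => conj (f x) := Lp.coeFn_star f

theorem starL2_starL2 (f : Lp ℂ 2 μ) : starL2 μ (starL2 μ f) = f := star_star f

theorem inner_starL2 (f g : Lp ℂ 2 μ) :
    (Inner.inner ℂ (starL2 μ f) (starL2 μ g) : ℂ) = Inner.inner ℂ g f := by
  rw [L2.inner_def, L2.inner_def]
  refine integral_congr_ae ?_
  filter_upwards [starL2_coeFn μ f, starL2_coeFn μ g] with x h1 h2
  rw [h1, h2]
  simp [mul_comm]

end StarLp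

/-! ### Reality of the Dirichlet Laplacian, and real symmetric heat kernels. -/

section HeatKernel

variable {n : ℕ} {M : Type*} [TopologicalSpace M] [ChartedSpace (EuclideanSpace ℝ (Fin n)) M]
  [IsManifold (𝓡 n) ∞ M]

theorem differential_conj {F : M → ℂ} {x : M} (hF : MDifferentiableAt (𝓡 n) 𝓘(ℝ, ℂ) F x) :
    differential (n := n) (fun y => conj (F y)) x =
      ((Complex.conjCLE : ℂ →L[ℝ] ℂ).comp (differential F x) : TangentSpace (𝓡 n) x →L[ℝ] ℂ) := by
  have h2 : HasMFDerivAt 𝓘(ℝ, ℂ) 𝓘(ℝ, ℂ) (fun z : ℂ => conj z) (F x) (Complex.conjCLE : ℂ →L[ℝ] ℂ) :=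
    hasMFDerivAt_iff_hasFDerivAt.2 Complex.conjCLE.hasFDerivAt
  exact (h2.comp x hF.hasMFDerivAt).mfderiv

theorem covectorInner_conj (g : Metric n M) (x : M) (a b : TangentSpace (𝓡 n) x →L[ℝ] ℂ) :
    covectorInner g x ((Complex.conjCLE : ℂ →L[ℝ] ℂ).comp a)
      ((Complex.conjCLE : ℂ →L[ℝ] ℂ).comp b) = conj (covectorInner g x a b) := by
  unfold covectorInner
  simp only [map_sum, map_mul, Complex.conj_ofReal]
  rfl

theorem IsTestFunction.conj {U : Set M} {φ : M → ℂ} (h : IsTestFunction (n := n) U φ) :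
    IsTestFunction (n := n) U (fun x => conj (φ x)) := by
  have h1 : tsupport (fun x => (starRingEnd ℂ) (φ x)) ⊆ tsupport φ :=
    closure_mono fun x hx h0 => hx (by simp [h0])
  exact ⟨(Complex.conjCLE : ℂ →L[ℝ] ℂ).contMDiff.comp h.1,
    h.2.1.comp_left (g := fun z => (starRingEnd ℂ) z) (by simp), h1.trans h.2.2⟩

theorem IsTestFunction.mdifferentiableAt {U : Set M} {φ : M → ℂ}
    (h : IsTestFunction (n := n) U φ) (x : M) : MDifferentiableAt (𝓡 n) 𝓘(ℝ, ℂ) φ x :=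
  h.1.mdifferentiable (by simp) x

theorem dirichletForm_conj [MeasurableSpace M] (g : Metric n M) (U : Set M) {φ ψ : M → ℂ}
    (hφ : IsTestFunction (n := n) U φ) (hψ : IsTestFunction (n := n) U ψ) :
    dirichletForm g U (fun x => conj (φ x)) (fun x => conj (ψ x)) =
      conj (dirichletForm g U φ ψ) := by
  unfold dirichletForm
  rw [← integral_conj]
  refine integral_congr_ae (Eventually.of_forall fun x => ?_)
  simp only [differential_conj (hφ.mdifferentiableAt x), differential_conj (hψ.mdifferentiableAt x)]
  exact covectorInner_conj g x _ _

variable [T2Space M] [SecondCountableTopology M] [MeasurableSpace M] [BorelSpace M] {U : Set M}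

theorem DirichletLaplacian.conj {g : Metric n M} {u f : L2 g U} (h : DirichletLaplacian g U u f) :
    DirichletLaplacian g U (starL2 _ u) (starL2 _ f) := by
  obtain ⟨φ, ⟨h1, h2, h3⟩, h4⟩ := h
  refine ⟨fun k x => conj (φ k x), ⟨fun k => (h1 k).conj, ?_, ?_⟩, fun ψ hψ => ?_⟩
  · refine h2.congr fun k => eLpNorm_congr_norm_ae ?_
    filter_upwards [starL2_coeFn _ u] with x hx
    rw [hx, ← map_sub, RCLike.norm_conj]
  · refine h3.congr fun p => lintegral_congr fun x => ?_
    have hm : MDifferentiableAt (𝓡 n) 𝓘(ℝ, ℂ) (fun x => φ p.1 x - φ p.2 x) x :=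
      ((h1 p.1).mdifferentiableAt x).sub ((h1 p.2).mdifferentiableAt x)
    have hd := differential_conj hm
    simp only [map_sub] at hd
    rw [hd, covectorInner_conj, Complex.conj_re]
  · have h5 := (Complex.continuous_conj.tendsto _).comp (h4 _ hψ.conj)
    have h6 : conj (∫ x, conj (conj (ψ x)) * f x ∂(measureOn g U)) =
        ∫ x, conj (ψ x) * (starL2 _ f : L2 g U) x ∂(measureOn g U) := by
      rw [← integral_conj]
      refine integral_congr_ae ?_
      filter_upwards [starL2_coeFn _ f] with x hx
      rw [hx, map_mul, Complex.conj_conj]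
    rw [h6] at h5
    refine h5.congr fun k => ?_
    have := dirichletForm_conj g U hψ.conj (h1 k)
    simp only [Complex.conj_conj] at this
    exact this.symm

/-- The metric and `α` are real, so the conjugate of a solution solves the equation with conjugate
right-hand side; uniqueness of solutions concludes. -/
theorem IsResolvent.conj {g : Metric n M} {α : ℝ} {R : L2 g U →L[ℂ] L2 g U}
    (h : IsResolvent g U α R) (f : L2 g U) : starL2 _ (R f) = R (starL2 _ f) := by
  refine ((h _ _).1 ?_).symm
  have h1 := ((h f (R f)).2 rfl).conj
  rwa [map_sub, map_smulₛₗ, Complex.conj_ofReal] at h1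

theorem isFiniteMeasure_measureOn (g : Metric n M) (hU : IsCompact (closure U)) :
    IsFiniteMeasure (measureOn g U) :=
  ⟨by
    rw [Measure.restrict_apply_univ]
    exact (measure_mono subset_closure).trans_lt hU.measure_lt_top⟩

/-- The heat operator is self-adjoint and commutes with complex conjugation. Hence if `k` represents
it, so do the transpose of `k` and the conjugates of both. -/
theorem exists_isHeatKernel (g : Metric n M) (hU : IsOpen U) (hUc : IsCompact (closure U))
    {τ : ℝ} (hτ : 0 < τ) : ∃ K, IsHeatKernel g U τ K := by
  have hfin := isFiniteMeasure_measureOn g hUc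
  set μ := measureOn g U with hμ
  obtain ⟨F⟩ := C1c.nonempty_formCompletion g U one_pos
  have hRes := F.resolventOp_eq (testFunctionsDense g hU) one_pos
  have hconj := (F.isResolvent (testFunctionsDense g hU) one_pos).conj
  obtain ⟨k, hk⟩ := exists_hasKernel_expOfResolvent F (C1c.form_bound g 1) (hasSmallWidths g hUc) hτ
  set S : L2 g U →L[ℂ] L2 g U := expOfResolvent F.res τ with hS
  have hSJ : ∀ G, starL2 μ (S G) = S (starL2 μ G) := fun G =>
    expOfResolvent_conj (starL2 μ) (starL2_starL2 μ) (inner_starL2 μ) F.res_isSelfAdjoint hconj hτ G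
  have hSs : ∀ f g : L2 g U, (Inner.inner ℂ (S f) g : ℂ) = Inner.inner ℂ f (S g) := by
    intro f g
    have := isSelfAdjoint_expOfResolvent F.res τ
    rw [ContinuousLinearMap.isSelfAdjoint_iff'] at this
    rw [← ContinuousLinearMap.adjoint_inner_left, this]
  have hb : ∀ F G : L2 g U, ∫ x, F x * G x ∂μ = Inner.inner ℂ (starL2 μ F) G := by
    intro F G
    rw [L2.inner_def]
    refine integral_congr_ae ?_
    filter_upwards [starL2_coeFn μ F] with x hx
    rw [hx]; simp [mul_comm]
  have hsymm : ∀ F G : L2 g U, ∫ x, F x * S G x ∂μ = ∫ x, G x * S F x ∂μ := by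
    intro F G
    have h := inner_starL2 μ (S F) (starL2 μ G)
    rw [starL2_starL2] at h
    rw [hb, hb, ← hSs, ← hSJ, h]
  have hreal : ∀ F G : L2 g U,
      ∫ x, F x * S G x ∂μ = conj (∫ x, starL2 μ F x * S (starL2 μ G) x ∂μ) := by
    intro F G
    have h := inner_starL2 μ (S G) (starL2 μ F)
    rw [starL2_starL2] at h
    rw [hb, hb, starL2_starL2, ← hSJ, inner_conj_symm, h]
  have hki : ∀ F G : L2 g U, Integrable (fun p : M × M => k p * (F p.1 * G p.2)) (μ.prod μ) :=
    fun F G => (Lp.memLp k).integrable_mul (memLp_two_mul_prod (Lp.memLp F) (Lp.memLp G))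
  have hk' : ∀ F G : L2 g U, ∫ x, F x * S G x ∂μ = ∫ p : M × M, k p * (F p.1 * G p.2) ∂(μ.prod μ) :=
    fun F G => (hk.integral_eq F G).trans (by simp only [mul_assoc]; rfl)
  have hmp : MeasurePreserving (Prod.swap : M × M → M × M) (μ.prod μ) (μ.prod μ) :=
    Measure.measurePreserving_swap
  have hswapL : MemLp (fun p : M × M => k p.swap) 2 (μ.prod μ) :=
    (Lp.memLp k).comp_measurePreserving hmp
  -- The average of the four kernels `k`, `kᵀ`, `conj k`, `conj kᵀ`; it is real and symmetric at
  -- every point, not merely almost everywhere.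
  refine ⟨fun x y => ((k (x, y)).re + (k (y, x)).re) / 2, fun x y => by ring, ?_, fun F G => ?_⟩
  · have := ((Lp.memLp k).re.add hswapL.re).const_mul (1 / 2)
    convert this using 2 with p
    change ((k p).re + (k p.swap).re) / 2 = 1 / 2 * ((k p).re + (k p.swap).re)
    ring
  · have hheat : heatOp g U τ = S := by rw [heatOp, hRes]
    rw [hheat]
    have i1 := hki F G
    have i2 : Integrable (fun p : M × M => k p.swap * (F p.1 * G p.2)) (μ.prod μ) :=
      hswapL.integrable_mul (memLp_two_mul_prod (Lp.memLp F) (Lp.memLp G))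
    have i3 : Integrable (fun p : M × M => conj (k p) * (F p.1 * G p.2)) (μ.prod μ) :=
      (Lp.memLp k).star.integrable_mul (memLp_two_mul_prod (Lp.memLp F) (Lp.memLp G))
    have i4 : Integrable (fun p : M × M => conj (k p.swap) * (F p.1 * G p.2)) (μ.prod μ) :=
      hswapL.star.integrable_mul (memLp_two_mul_prod (Lp.memLp F) (Lp.memLp G))
    have i12 : Integrable (fun p : M × M => k p * (F p.1 * G p.2) +
        k p.swap * (F p.1 * G p.2)) (μ.prod μ) := i1.add i2
    have i34 : Integrable (fun p : M × M => conj (k p) * (F p.1 * G p.2) +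
        conj (k p.swap) * (F p.1 * G p.2)) (μ.prod μ) := i3.add i4
    have sw : ∀ f : M × M → ℂ, ∫ p, f p.swap ∂(μ.prod μ) = ∫ p, f p ∂(μ.prod μ) := fun f =>
      hmp.integral_comp MeasurableEquiv.prodComm.measurableEmbedding f
    have e2 : ∀ F G : L2 g U, ∫ p : M × M, k p.swap * (F p.1 * G p.2) ∂(μ.prod μ) =
        ∫ x, F x * S G x ∂μ := by
      intro F G
      rw [hsymm, hk', ← sw]
      refine integral_congr_ae (Eventually.of_forall fun p => ?_)
      simp only [Prod.fst_swap, Prod.snd_swap, Prod.swap_swap]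
      ring
    have cc : ∀ (F G : L2 g U) (h : M × M → ℂ),
        conj (∫ p : M × M, h p * (starL2 μ F p.1 * starL2 μ G p.2) ∂(μ.prod μ)) =
        ∫ p : M × M, conj (h p) * (F p.1 * G p.2) ∂(μ.prod μ) := by
      intro F G h
      rw [← integral_conj]
      refine integral_congr_ae ?_
      filter_upwards [Measure.quasiMeasurePreserving_fst.ae (starL2_coeFn μ F),
        Measure.quasiMeasurePreserving_snd.ae (starL2_coeFn μ G)] with p h1 h2
      rw [h1, h2]; simp
    have e3 : ∫ p : M × M, conj (k p) * (F p.1 * G p.2) ∂(μ.prod μ) = ∫ x, F x * S G x ∂μ := by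
      rw [hreal, hk', cc]
    have e4 : ∫ p : M × M, conj (k p.swap) * (F p.1 * G p.2) ∂(μ.prod μ) =
        ∫ x, F x * S G x ∂μ := by
      rw [hreal, ← e2, cc]
    calc ∫ x, F x * S G x ∂μ = (1 / 4) * ((∫ x, F x * S G x ∂μ + ∫ x, F x * S G x ∂μ) +
          (∫ x, F x * S G x ∂μ + ∫ x, F x * S G x ∂μ)) := by ring
      _ = (1 / 4) * ((∫ p : M × M, k p * (F p.1 * G p.2) ∂(μ.prod μ) +
          ∫ p : M × M, k p.swap * (F p.1 * G p.2) ∂(μ.prod μ)) +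
          (∫ p : M × M, conj (k p) * (F p.1 * G p.2) ∂(μ.prod μ) +
          ∫ p : M × M, conj (k p.swap) * (F p.1 * G p.2) ∂(μ.prod μ))) := by
          rw [e2, e3, e4, ← hk']
      _ = _ := by
          rw [← integral_add i1 i2, ← integral_add i3 i4, ← integral_add i12 i34,
            ← integral_const_mul]
          refine integral_congr_ae (Eventually.of_forall fun p => ?_)
          have h1 := Complex.add_conj (k p)
          have h2 := Complex.add_conj (k p.swap)
          push_cast at h1 h2 ⊢
          change _ = (((k p).re : ℂ) + (k p.swap).re) / 2 * F p.1 * G p.2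
          linear_combination (F p.1 * G p.2) / 4 * (h1 + h2)

end HeatKernel

end SemiFlat
end

noncomputable section

namespace SemiFlat

/-! ### Semi-flat coordinates: local inverses and transitions along a fibre. -/

section SemiFlatChart

variable {S : Type*} [TopologicalSpace S] [ChartedSpace (EuclideanSpace ℝ (Fin 2)) S]
  [IsManifold (𝓡 2) ∞ S]
  {X : Type*} [TopologicalSpace X] [ChartedSpace (EuclideanSpace ℝ (Fin 4)) X]
  [IsManifold (𝓡 4) ∞ X]
  {gB : Metric 2 S} {proj : X → S}
  {gRef : ∀ x : X, TangentSpace (𝓡 4) x →L[ℝ] TangentSpace (𝓡 4) x →L[ℝ] ℝ}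
  {U : Set S} {Ψ : S × Plane → X} {h : S → Matrix (Fin 2) (Fin 2) ℝ}

theorem matForm_pos {m : Matrix (Fin 2) (Fin 2) ℝ} (hm : m.PosDef) {v : Plane} (hv : v ≠ 0) :
    0 < matForm m v v := by
  have hv' : (v : Fin 2 → ℝ) ≠ 0 := fun h0 => hv (by ext i; exact congrFun h0 i)
  have := hm.dotProduct_mulVec_pos hv'
  refine this.trans_eq ?_
  simp only [matForm, dotProduct, Matrix.mulVec, Finset.mul_sum, star_trivial]
  refine Finset.sum_congr rfl fun i _ => Finset.sum_congr rfl fun j _ => ?_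
  ring

theorem matForm_nonneg {m : Matrix (Fin 2) (Fin 2) ℝ} (hm : m.PosDef) (v : Plane) :
    0 ≤ matForm m v v := by
  by_cases hv : v = 0
  · simp [hv, matForm]
  · exact (matForm_pos hm hv).le

namespace IsSemiFlatChart

variable (H : IsSemiFlatChart gB proj gRef U Ψ h)
include H

theorem contMDiffAt {b : S} (hb : b ∈ U) (y : Plane) :
    ContMDiffAt ((𝓡 2).prod (𝓡 2)) (𝓡 4) ∞ Ψ (b, y) :=
  H.smooth.contMDiffAt ((H.isOpen.prod isOpen_univ).mem_nhds ⟨hb, mem_univ _⟩)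

theorem mdifferentiableAt {b : S} (hb : b ∈ U) (y : Plane) :
    MDifferentiableAt ((𝓡 2).prod (𝓡 2)) (𝓡 4) Ψ (b, y) :=
  (H.contMDiffAt hb y).mdifferentiableAt (by simp)

/-- A vector in the kernel has zero length for the product metric `g_B ⊕ h`, which is definite; no
definiteness of `gRef` itself is assumed. Since both sides have dimension four, the differential is
then an isomorphism. -/
theorem mfderiv_injective {b : S} (hb : b ∈ U) (y : Plane) :
    Function.Injective (mfderiv ((𝓡 2).prod (𝓡 2)) (𝓡 4) Ψ (b, y)) := by
  refine (injective_iff_map_eq_zero _).2 ?_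
  rintro ⟨ξ, η⟩ h0
  have h1 := H.metric_eq b hb y ξ ξ η η
  have h2 : gRef (Ψ (b, y)) (mfderiv ((𝓡 2).prod (𝓡 2)) (𝓡 4) Ψ (b, y) (ξ, η))
      (mfderiv ((𝓡 2).prod (𝓡 2)) (𝓡 4) Ψ (b, y) (ξ, η)) = 0 := by
    rw [h0, map_zero]
  rw [h2] at h1
  have h3 := matForm_nonneg (H.h_posDef b hb) η
  have hξ : ξ = 0 := by
    by_contra hne
    have := gB.pos b ξ hne
    linarith
  have hη : η = 0 := by
    by_contra hne
    have h4 := matForm_pos (H.h_posDef b hb) hne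
    have : 0 ≤ gB.inner b ξ ξ := by
      have h5 : gB.inner b ξ ξ = gB.inner b (0 : TangentSpace (𝓡 2) b) 0 := by rw [hξ]; rfl
      rw [h5, map_zero]
    linarith
  rw [hξ, hη]; rfl

theorem mfderiv_bijective {b : S} (hb : b ∈ U) (y : Plane) :
    Function.Bijective (mfderiv ((𝓡 2).prod (𝓡 2)) (𝓡 4) Ψ (b, y)) := by
  refine ⟨H.mfderiv_injective hb y, ?_⟩
  let L : EuclideanSpace ℝ (Fin 2) × EuclideanSpace ℝ (Fin 2) →ₗ[ℝ] EuclideanSpace ℝ (Fin 4) :=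
    (mfderiv ((𝓡 2).prod (𝓡 2)) (𝓡 4) Ψ (b, y)).toLinearMap
  exact (LinearMap.injective_iff_surjective_of_finrank_eq_finrank (f := L) (by simp)).1
    (H.mfderiv_injective hb y)

/-- The inverse function theorem: local inverses of semi-flat coordinates. -/
theorem exists_localInverse {b : S} (hb : b ∈ U) (y : Plane) :
    ∃ L : EuclideanSpace ℝ (Fin 4) → EuclideanSpace ℝ (Fin 2) × Plane,
      ContDiffAt ℝ 1 L (chartAt (EuclideanSpace ℝ (Fin 4)) (Ψ (b, y)) (Ψ (b, y))) ∧
      L (chartAt (EuclideanSpace ℝ (Fin 4)) (Ψ (b, y)) (Ψ (b, y))) =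
        (chartAt (EuclideanSpace ℝ (Fin 2)) b b, y) ∧
      ∀ᶠ x in 𝓝 (Ψ (b, y)), Ψ ((chartAt (EuclideanSpace ℝ (Fin 2)) b).symm
          (L (chartAt (EuclideanSpace ℝ (Fin 4)) (Ψ (b, y)) x)).1,
        (L (chartAt (EuclideanSpace ℝ (Fin 4)) (Ψ (b, y)) x)).2) = x := by
  set x₀ := Ψ (b, y) with hx₀
  set cX := chartAt (EuclideanSpace ℝ (Fin 4)) x₀ with hcX
  set cB := chartAt (EuclideanSpace ℝ (Fin 2)) b with hcB
  set a : EuclideanSpace ℝ (Fin 2) × Plane := (cB b, y) with ha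
  let G : EuclideanSpace ℝ (Fin 2) × Plane → EuclideanSpace ℝ (Fin 4) :=
    fun p => cX (Ψ (cB.symm p.1, p.2))
  have hG : ContDiffAt ℝ ∞ G a := by
    have h1 := (contMDiffAt_iff.1 (H.contMDiffAt hb y)).2
    simp only [ModelWithCorners.range_eq_univ, contDiffWithinAt_univ] at h1
    exact h1
  have hGd : HasFDerivAt G (mfderiv ((𝓡 2).prod (𝓡 2)) (𝓡 4) Ψ (b, y) :
      EuclideanSpace ℝ (Fin 2) × Plane →L[ℝ] EuclideanSpace ℝ (Fin 4)) a := by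
    have h1 := (H.mdifferentiableAt hb y).hasMFDerivAt.2
    simp only [ModelWithCorners.range_eq_univ] at h1
    exact hasFDerivWithinAt_univ.1 h1
  let Df : EuclideanSpace ℝ (Fin 2) × Plane →L[ℝ] EuclideanSpace ℝ (Fin 4) :=
    mfderiv ((𝓡 2).prod (𝓡 2)) (𝓡 4) Ψ (b, y)
  let A : (EuclideanSpace ℝ (Fin 2) × Plane) ≃L[ℝ] EuclideanSpace ℝ (Fin 4) :=
    ContinuousLinearEquiv.ofBijective Df
      (LinearMap.ker_eq_bot.2 (H.mfderiv_bijective hb y).1)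
      (LinearMap.range_eq_top.2 (H.mfderiv_bijective hb y).2)
  have hGA : HasFDerivAt G (A : EuclideanSpace ℝ (Fin 2) × Plane →L[ℝ] EuclideanSpace ℝ (Fin 4)) a := by
    have hAD : (A : EuclideanSpace ℝ (Fin 2) × Plane →L[ℝ] EuclideanSpace ℝ (Fin 4)) = Df := by
      ext v <;> rfl
    rw [hAD]
    exact hGd
  have hstrict : HasStrictFDerivAt G
      (A : EuclideanSpace ℝ (Fin 2) × Plane →L[ℝ] EuclideanSpace ℝ (Fin 4)) a :=
    hG.hasStrictFDerivAt' hGA (by simp)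
  have hGa : G a = cX x₀ := by
    simp only [G, ha, hx₀]
    rw [cB.left_inv (mem_chart_source _ b)]
  have hLc : ContinuousAt (hstrict.localInverse G A a) (cX x₀) := hGa ▸ hstrict.localInverse_continuousAt
  have hLa : hstrict.localInverse G A a (cX x₀) = a := by
    rw [← hGa]; exact hstrict.localInverse_apply_image
  refine ⟨hstrict.localInverse G A a, ?_, hLa, ?_⟩
  · rw [← hGa]
    exact (hG.of_le (by norm_cast)).to_localInverse hGA (by simp)
  · have h1 : ∀ᶠ w in 𝓝 (cX x₀), G (hstrict.localInverse G A a w) = w :=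
      hGa ▸ hstrict.eventually_right_inverse
    have hcX : ContinuousAt cX x₀ := cX.continuousAt (mem_chart_source _ x₀)
    have h2 := hcX.eventually h1
    have h3 : ContinuousAt (fun p : EuclideanSpace ℝ (Fin 2) × Plane => Ψ (cB.symm p.1, p.2)) a := by
      have hs : ContinuousAt (fun p : EuclideanSpace ℝ (Fin 2) × Plane => (cB.symm p.1, p.2)) a :=
        (ContinuousAt.comp (g := cB.symm) (f := Prod.fst) (x := a)
          (cB.symm.continuousAt (cB.map_source (mem_chart_source _ b)))
          continuousAt_fst).prodMk continuousAt_snd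
      have hΨ : ContinuousAt Ψ (cB.symm a.1, a.2) := by
        simp only [ha]
        rw [cB.left_inv (mem_chart_source _ b)]
        exact (H.contMDiffAt hb y).continuousAt
      exact ContinuousAt.comp (f := fun p : EuclideanSpace ℝ (Fin 2) × Plane =>
        (cB.symm p.1, p.2)) hΨ hs
    have h4 : ContinuousAt (fun x => Ψ (cB.symm (hstrict.localInverse G A a (cX x)).1,
        (hstrict.localInverse G A a (cX x)).2)) x₀ := by
      have h5 : ContinuousAt (fun x => hstrict.localInverse G A a (cX x)) x₀ :=
        ContinuousAt.comp (f := cX) hLc hcX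
      refine ContinuousAt.comp (g := fun p : EuclideanSpace ℝ (Fin 2) × Plane =>
        Ψ (cB.symm p.1, p.2)) (f := fun x => hstrict.localInverse G A a (cX x)) ?_ h5
      rw [hLa]; exact h3
    have h5 : Ψ (cB.symm (hstrict.localInverse G A a (cX x₀)).1,
        (hstrict.localInverse G A a (cX x₀)).2) = x₀ := by
      rw [hLa]; simp only [ha]; rw [cB.left_inv (mem_chart_source _ b)]
    -- The right inverse property only compares chart values. The chart is injective on its source
    -- alone, so nearby points must first be shown to be mapped into it.
    have h6 := h4.eventually (cX.open_source.mem_nhds (by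
      beta_reduce; rw [h5]; exact mem_chart_source _ x₀))
    filter_upwards [h2, h6, cX.open_source.mem_nhds (mem_chart_source _ x₀)] with x hx hx6 hxs
    exact cX.injOn hx6 hxs hx

/-- Fibre coordinates of a semi-flat chart as functions of those of another one. -/
theorem exists_transition {U' : Set S} {Ψ' : S × Plane → X} {h' : S → Matrix (Fin 2) (Fin 2) ℝ}
    (H' : IsSemiFlatChart gB proj gRef U' Ψ' h') {b : S} (hb : b ∈ U) (hb' : b ∈ U')
    (y : Plane) : ∃ θ : Plane → Plane,
      ∀ᶠ z in 𝓝 y, DifferentiableAt ℝ θ z ∧ Ψ' (b, θ z) = Ψ (b, z) := by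
  obtain ⟨y', hy'⟩ := H'.surj b hb' (Ψ (b, y)) (H.proj_eq b hb y)
  obtain ⟨L, hL, hLa, hLinv⟩ := H'.exists_localInverse hb' y'
  rw [hy'] at hL hLa hLinv
  set cX := chartAt (EuclideanSpace ℝ (Fin 4)) (Ψ (b, y))
  set cB := chartAt (EuclideanSpace ℝ (Fin 2)) b
  have hsec : ContMDiffAt (𝓡 2) (𝓡 4) ∞ (fun z : Plane => Ψ (b, z)) y :=
    ContMDiffAt.comp (I' := (𝓡 2).prod (𝓡 2)) y (H.contMDiffAt hb y)
      (contMDiffAt_const.prodMk contMDiffAt_id)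
  have hsc : ContDiffAt ℝ 1 (fun z : Plane => cX (Ψ (b, z))) y := by
    have h1 := (contMDiffAt_iff.1 hsec).2
    simp only [ModelWithCorners.range_eq_univ, contDiffWithinAt_univ] at h1
    exact ContDiffAt.of_le h1 (by norm_cast)
  have hcomp : ContDiffAt ℝ 1 (fun z : Plane => L (cX (Ψ (b, z)))) y :=
    ContDiffAt.comp (g := L) (f := fun z : Plane => cX (Ψ (b, z))) y hL hsc
  refine ⟨fun z => (L (cX (Ψ (b, z)))).2, ?_⟩
  have hU : ∀ᶠ z in 𝓝 y, cB.symm (L (cX (Ψ (b, z)))).1 ∈ U' := by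
    have h1 : ContinuousAt (fun z => cB.symm (L (cX (Ψ (b, z)))).1) y := by
      refine ContinuousAt.comp (g := cB.symm) (f := fun z => (L (cX (Ψ (b, z)))).1) ?_
        (continuousAt_fst.comp hcomp.continuousAt)
      rw [hLa]
      exact cB.symm.continuousAt (cB.map_source (mem_chart_source _ b))
    refine h1.eventually (H'.isOpen.mem_nhds ?_)
    change cB.symm (L (cX (Ψ (b, y)))).1 ∈ U'
    rw [hLa]
    simpa [cB] using hb'
  have hd : ∀ᶠ z in 𝓝 y, DifferentiableAt ℝ (fun z : Plane => L (cX (Ψ (b, z)))) z := by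
    filter_upwards [hcomp.eventually (by simp)] with z hz
    exact hz.differentiableAt (by norm_num)
  filter_upwards [hU, hd, hsec.continuousAt.eventually hLinv] with z hz hdz hinv
  refine ⟨hdz.snd, ?_⟩
  -- The local inverse may move in all four directions; applying `proj` shows that its base
  -- component stays equal to `b`.
  have h1 := H'.proj_eq _ hz (L (cX (Ψ (b, z)))).2
  rw [hinv, H.proj_eq b hb] at h1
  rw [← h1] at hinv
  exact hinv

theorem hasMFDerivAt_section {b : S} (hb : b ∈ U) {γ : Plane → Plane} {γ' : Plane →L[ℝ] Plane}
    {y : Plane} (hγ : HasFDerivAt γ γ' y) :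
    HasMFDerivAt (𝓡 2) (𝓡 4) (fun z => Ψ (b, γ z)) y
      ((mfderiv ((𝓡 2).prod (𝓡 2)) (𝓡 4) Ψ (b, γ y)).comp
        ((0 : Plane →L[ℝ] EuclideanSpace ℝ (Fin 2)).prod γ')) := by
  have h1 : HasMFDerivAt (𝓡 2) ((𝓡 2).prod (𝓡 2)) (fun z => (b, γ z)) y
      ((0 : Plane →L[ℝ] EuclideanSpace ℝ (Fin 2)).prod γ') :=
    (hasMFDerivAt_const b y).prodMk hγ.hasMFDerivAt
  exact (H.mdifferentiableAt hb (γ y)).hasMFDerivAt.comp y h1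

/-- A transition along the fibre carries the constant metric `h b` to the constant metric `h' b`, so
the square of its determinant is the ratio of their determinants. This is constant along the fibre,
which is all that is needed; affinity of the transition plays no role. -/
theorem abs_det_transition {U' : Set S} {Ψ' : S × Plane → X} {h' : S → Matrix (Fin 2) (Fin 2) ℝ}
    (H' : IsSemiFlatChart gB proj gRef U' Ψ' h') {b : S} (hb : b ∈ U) (hb' : b ∈ U')
    {θ : Plane → Plane} {θ' : Plane →L[ℝ] Plane} {y : Plane} (hθ : HasFDerivAt θ θ' y)
    (heq : ∀ᶠ z in 𝓝 y, Ψ' (b, θ z) = Ψ (b, z)) :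
    |θ'.det| = Real.sqrt ((h b).det / (h' b).det) := by
  have h1 := (H'.hasMFDerivAt_section hb' hθ).mfderiv
  have h2 := (H.hasMFDerivAt_section hb (hasFDerivAt_id y)).mfderiv
  have h3 : mfderiv (𝓡 2) (𝓡 4) (fun z => Ψ' (b, θ z)) y =
      mfderiv (𝓡 2) (𝓡 4) (fun z => Ψ (b, z)) y := Filter.EventuallyEq.mfderiv_eq heq
  have hy : Ψ' (b, θ y) = Ψ (b, y) := heq.self_of_nhds
  have key : ∀ η η' : Plane, matForm (h' b) (θ' η) (θ' η') = matForm (h b) η η' := by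
    intro η η'
    have e1 := H'.metric_eq b hb' (θ y) 0 0 (θ' η) (θ' η')
    have e2 := H.metric_eq b hb y 0 0 η η'
    have e3 : ∀ ζ : Plane, (mfderiv ((𝓡 2).prod (𝓡 2)) (𝓡 4) Ψ' (b, θ y)
        ((0, θ' ζ) : EuclideanSpace ℝ (Fin 2) × Plane) : EuclideanSpace ℝ (Fin 4)) =
        mfderiv ((𝓡 2).prod (𝓡 2)) (𝓡 4) Ψ (b, y) ((0, ζ) : EuclideanSpace ℝ (Fin 2) × Plane) :=
      fun ζ => by
        have f1 := congrArg (fun L : Plane →L[ℝ] EuclideanSpace ℝ (Fin 4) => L ζ) h1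
        have f2 := congrArg (fun L : Plane →L[ℝ] EuclideanSpace ℝ (Fin 4) => L ζ) h2
        have f3 := congrArg (fun L : Plane →L[ℝ] EuclideanSpace ℝ (Fin 4) => L ζ) h3
        exact f1.symm.trans (f3.trans f2)
    have e4 : ∀ x x' : X, x = x' → ∀ v w : EuclideanSpace ℝ (Fin 4), gRef x v w = gRef x' v w := by
      rintro x _ rfl v w; rfl
    have e5 : gB.inner b (0 : TangentSpace (𝓡 2) b) (0 : TangentSpace (𝓡 2) b) = 0 := by simp
    rw [e5, zero_add] at e1 e2
    rw [← e1, ← e2]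
    refine (e4 _ _ hy _ _).trans ?_
    exact congrArg₂ (fun v w : EuclideanSpace ℝ (Fin 4) => gRef (Ψ (b, y)) v w) (e3 η) (e3 η')
  set M : Matrix (Fin 2) (Fin 2) ℝ := Matrix.of fun i j => θ' (EuclideanSpace.single j 1) i with hM
  have hmat : ∀ (m : Matrix (Fin 2) (Fin 2) ℝ) i j,
      matForm m (EuclideanSpace.single i 1) (EuclideanSpace.single j 1) = m i j := by
    intro m i j
    fin_cases i <;> fin_cases j <;> simp [matForm]
  have hMh : M.transpose * h' b * M = h b := by
    ext i j
    rw [← hmat (h b), ← key]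
    simp only [matForm, Matrix.mul_apply, Matrix.transpose_apply, hM, Matrix.of_apply,
      Fin.sum_univ_two]
    try ring
  have hdetM : θ'.det = M.det := by
    rw [ContinuousLinearMap.det, ← LinearMap.det_toMatrix
      (EuclideanSpace.basisFun (Fin 2) ℝ).toBasis]
    congr 1
  have hd := congrArg Matrix.det hMh
  rw [Matrix.det_mul, Matrix.det_mul, Matrix.det_transpose] at hd
  have hpos := (H'.h_posDef b hb').det_pos
  rw [hdetM, ← Real.sqrt_sq_eq_abs]
  congr 1
  rw [eq_div_iff hpos.ne']
  linarith

end IsSemiFlatChart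

end SemiFlatChart

end SemiFlat
end

noncomputable section

namespace SemiFlat

/-! ### The unit square as a fundamental domain of the lattice. -/

section UnitSquare

theorem measurableSet_unitSquare : MeasurableSet unitSquare := by
  have : unitSquare = ⋂ i : Fin 2, (fun y : Plane => y i) ⁻¹' Ico (0 : ℝ) 1 := by
    ext y; simp [unitSquare]
  rw [this]
  exact MeasurableSet.iInter fun i => (by fun_prop : Measurable fun y : Plane => y i) measurableSet_Ico

theorem volume_unitSquare : volume unitSquare = 1 := by
  have : unitSquare = gridCell 2 1 0 := by
    ext y
    simp [unitSquare, gridCell, Int.floor_eq_zero_iff]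
  rw [this, volume_gridCell le_rfl]
  simp

theorem unitSquare_subset_closedBall : unitSquare ⊆ Metric.closedBall (0 : Plane) 2 := by
  have : unitSquare = gridCell 2 1 0 := by
    ext y
    simp [unitSquare, gridCell, Int.floor_eq_zero_iff]
  intro y hy
  have h0 : (0 : Plane) ∈ unitSquare := fun i => by simp
  rw [this] at hy h0
  have := norm_sub_le_of_mem_gridCell le_rfl h0 hy
  simpa using this

instance : IsProbabilityMeasure ((volume : Measure Plane).restrict unitSquare) :=
  ⟨by rw [Measure.restrict_apply_univ, volume_unitSquare]⟩

/-- The lattice point with integral coordinates `k`. -/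
def latticePoint (k : Fin 2 → ℤ) : Plane := WithLp.toLp 2 fun i => (k i : ℝ)

theorem sameModLattice_sub_latticePoint (y : Plane) (k : Fin 2 → ℤ) :
    SameModLattice (y - latticePoint k) y := fun i => ⟨-k i, by simp [latticePoint]⟩

theorem SameModLattice.exists_eq {y y' : Plane} (h : SameModLattice y y') :
    ∃ k, y' = y - latticePoint k := by
  choose k hk using h
  refine ⟨k, ?_⟩
  ext i
  simp [latticePoint, ← hk]

theorem exists_sub_latticePoint_mem (y : Plane) : ∃ k, y - latticePoint k ∈ unitSquare :=
  ⟨fun i => ⌊y i⌋, fun i => by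
    simp only [latticePoint, PiLp.sub_apply]
    exact ⟨Int.fract_nonneg _, Int.fract_lt_one _⟩⟩

theorem SameModLattice.eq_of_mem {y y' : Plane} (h : SameModLattice y y') (hy : y ∈ unitSquare)
    (hy' : y' ∈ unitSquare) : y = y' := by
  ext i
  obtain ⟨k, hk⟩ := h i
  have h1 := hy i
  have h2 := hy' i
  have h3 : (-1 : ℝ) < k := by rw [← hk]; linarith [h1.1, h2.2]
  have h4 : (k : ℝ) < 1 := by rw [← hk]; linarith [h1.2, h2.1]
  have h5 : k = 0 := by
    have h6 : (-1 : ℤ) < k := by exact_mod_cast h3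
    have h7 : k < 1 := by exact_mod_cast h4
    omega
  rw [h5] at hk
  simpa [sub_eq_zero] using hk

end UnitSquare

/-! ### Independence of the Haar measure of a fibre from the coordinates. -/

section HaarIndependence

variable {S : Type*} [TopologicalSpace S] [ChartedSpace (EuclideanSpace ℝ (Fin 2)) S]
  [IsManifold (𝓡 2) ∞ S]
  {X : Type*} [TopologicalSpace X] [ChartedSpace (EuclideanSpace ℝ (Fin 4)) X]
  [IsManifold (𝓡 4) ∞ X]
  {gB : Metric 2 S} {proj : X → S}
  {gRef : ∀ x : X, TangentSpace (𝓡 4) x →L[ℝ] TangentSpace (𝓡 4) x →L[ℝ] ℝ}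
  {U : Set S} {Ψ : S × Plane → X} {h : S → Matrix (Fin 2) (Fin 2) ℝ}

namespace IsSemiFlatChart

variable (H : IsSemiFlatChart gB proj gRef U Ψ h)
include H

theorem continuous_section {b : S} (hb : b ∈ U) : Continuous fun y => Ψ (b, y) :=
  continuous_iff_continuousAt.2 fun y => ContinuousAt.comp (f := fun y => (b, y))
    (H.contMDiffAt hb y).continuousAt (by fun_prop)

theorem exists_mem_unitSquare {b : S} (hb : b ∈ U) {x : X} (hx : proj x = b) :
    ∃ y ∈ unitSquare, Ψ (b, y) = x := by
  obtain ⟨y, hy⟩ := H.surj b hb x hx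
  obtain ⟨k, hk⟩ := exists_sub_latticePoint_mem y
  exact ⟨_, hk, by rw [← hy, H.eq_iff b hb]; exact sameModLattice_sub_latticePoint y k⟩

variable [MeasurableSpace X] [BorelSpace X]

/-- The Haar measure of the fibre does not depend on the semi-flat chart. -/
theorem map_eq_map {U' : Set S} {Ψ' : S × Plane → X} {h' : S → Matrix (Fin 2) (Fin 2) ℝ}
    (H' : IsSemiFlatChart gB proj gRef U' Ψ' h') {b : S} (hb : b ∈ U) (hb' : b ∈ U') :
    Measure.map (fun y => Ψ (b, y)) ((volume : Measure Plane).restrict unitSquare) =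
      Measure.map (fun y => Ψ' (b, y)) ((volume : Measure Plane).restrict unitSquare) := by
  have hp := H.continuous_section hb
  have hp' := H'.continuous_section hb'
  -- The change of coordinates normalized to take values in the unit square. It is a bijection of
  -- the square but may be discontinuous, because of the reduction modulo the lattice.
  choose Θ hΘs hΘ using fun y => H'.exists_mem_unitSquare hb' (H.proj_eq b hb y)
  have hinj : InjOn Θ unitSquare := by
    intro y hy z hz hyz
    have h1 : Ψ (b, y) = Ψ (b, z) := by rw [← hΘ y, ← hΘ z, hyz]
    exact ((H.eq_iff b hb y z).1 h1).eq_of_mem hy hz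
  have huniq : ∀ y z, z ∈ unitSquare → Ψ' (b, z) = Ψ (b, y) → Θ y = z := fun y z hz hzy =>
    ((H'.eq_iff b hb' _ _).1 ((hΘ y).trans hzy.symm)).eq_of_mem (hΘs y) hz
  choose θ hθ using H.exists_transition H' hb hb'
  choose N hN hNo hyN using fun y => mem_nhds_iff.1 (hθ y)
  obtain ⟨Y, hYc, hY⟩ := TopologicalSpace.countable_cover_nhds fun y => (hNo y).mem_nhds (hyN y)
  -- On such a piece `Θ` is one smooth local transition shifted by one lattice vector, hence
  -- differentiable with `|det| = c`. Countably many pieces cover the square.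
  let s : Y × (Fin 2 → ℤ) → Set Plane := fun p => unitSquare ∩ (N p.1 ∩
    (fun z => θ p.1 z - latticePoint p.2) ⁻¹' unitSquare)
  have hcont : ∀ y, ContinuousOn (θ y) (N y) := fun y z hz =>
    (hN y hz).1.continuousAt.continuousWithinAt
  have hsm : ∀ p, MeasurableSet (s p) := fun p => measurableSet_unitSquare.inter
    (measurableSet_inter_preimage_of_continuousOn 
      ((hcont _).sub continuousOn_const) (hNo _).measurableSet measurableSet_unitSquare)
  have hs : ∀ p, ∀ z ∈ s p, Θ z = θ p.1 z - latticePoint p.2 := by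
    rintro p z ⟨-, hz1, hz2⟩
    refine huniq z _ hz2 ?_
    rw [← (hN _ hz1).2, H'.eq_iff b hb']
    exact sameModLattice_sub_latticePoint _ _
  set c := Real.sqrt ((h b).det / (h' b).det)
  have hder : ∀ p, ∀ z ∈ s p, HasFDerivWithinAt Θ (fderiv ℝ (θ p.1) z) (s p) z := by
    intro p z hz
    have h1 := ((hN _ hz.2.1).1.hasFDerivAt.sub_const (latticePoint p.2)).hasFDerivWithinAt (s := s p)
    exact h1.congr (hs p) (hs p z hz)
  have hdet : ∀ p, ∀ z ∈ s p, |(fderiv ℝ (θ p.1) z).det| = c := by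
    intro p z hz
    refine H.abs_det_transition H' hb hb' (hN _ hz.2.1).1.hasFDerivAt ?_
    filter_upwards [(hNo p.1).mem_nhds hz.2.1] with z' hz'
    exact (hN _ hz').2
  have himg : ∀ p, ∀ t ⊆ s p, MeasurableSet t →
      volume (Θ '' t) = ENNReal.ofReal c * volume t ∧ MeasurableSet (Θ '' t) := by
    intro p t hts ht
    have hd : ∀ z ∈ t, HasFDerivWithinAt Θ (fderiv ℝ (θ p.1) z) t z := fun z hz =>
      (hder p z (hts hz)).mono hts
    have hi : InjOn Θ t := hinj.mono (hts.trans inter_subset_left)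
    refine ⟨?_, measurable_image_of_fderivWithin ht hd hi⟩
    rw [← lintegral_abs_det_fderiv_eq_addHaar_image volume ht hd hi,
      setLIntegral_congr_fun ht fun z hz => by rw [hdet p z (hts hz)], setLIntegral_const]
  have : Nonempty Y := by
    have h0 : (0 : Plane) ∈ ⋃ x ∈ Y, N x := hY ▸ mem_univ _
    obtain ⟨y, hy, -⟩ := mem_iUnion₂.1 h0
    exact ⟨⟨y, hy⟩⟩
  have : Countable Y := hYc.to_subtype
  obtain ⟨e, he⟩ := exists_surjective_nat (Y × (Fin 2 → ℤ))
  let D : ℕ → Set Plane := disjointed fun n => s (e n)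
  have hDm : ∀ n, MeasurableSet (D n) := MeasurableSet.disjointed fun n => hsm _
  have hDs : ∀ n, D n ⊆ s (e n) := fun n => disjointed_subset _ n
  have hDu : ⋃ n, D n = unitSquare := by
    rw [iUnion_disjointed]
    refine subset_antisymm (iUnion_subset fun n => inter_subset_left) fun z hz => ?_
    have h0 : z ∈ ⋃ x ∈ Y, N x := hY ▸ mem_univ _
    obtain ⟨y, hy, hzy⟩ := mem_iUnion₂.1 h0
    have h1 : Ψ' (b, θ y z) = Ψ' (b, Θ z) := ((hN _ hzy).2).trans (hΘ z).symm
    obtain ⟨k, hk⟩ := ((H'.eq_iff b hb' _ _).1 h1).exists_eq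
    obtain ⟨n, hn⟩ := he (⟨y, hy⟩, k)
    refine mem_iUnion.2 ⟨n, hz, ?_⟩
    rw [hn]
    exact ⟨hzy, by rw [mem_preimage, ← hk]; exact hΘs z⟩
  have hDd : Pairwise (Function.onFun Disjoint D) := disjoint_disjointed _
  have hmain : ∀ F : Set X, MeasurableSet F →
      volume ((fun y => Ψ' (b, y)) ⁻¹' F ∩ unitSquare) =
        ENNReal.ofReal c * volume ((fun y => Ψ (b, y)) ⁻¹' F ∩ unitSquare) := by
    intro F hF
    have hpF : MeasurableSet ((fun y => Ψ (b, y)) ⁻¹' F) := hp.measurable hF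
    have h1 : (fun y => Ψ (b, y)) ⁻¹' F ∩ unitSquare =
        ⋃ n, (fun y => Ψ (b, y)) ⁻¹' F ∩ D n := by rw [← inter_iUnion, hDu]
    have h2 : (fun y => Ψ' (b, y)) ⁻¹' F ∩ unitSquare =
        ⋃ n, Θ '' ((fun y => Ψ (b, y)) ⁻¹' F ∩ D n) := by
      rw [← image_iUnion, ← h1]
      ext z
      constructor
      · rintro ⟨hzF, hz⟩
        obtain ⟨y, hy, hyz⟩ := H.exists_mem_unitSquare hb (H'.proj_eq b hb' z)
        refine ⟨y, ⟨?_, hy⟩, huniq y z hz hyz.symm⟩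
        rw [mem_preimage, hyz]; exact hzF
      · rintro ⟨y, ⟨hyF, -⟩, rfl⟩
        refine ⟨?_, hΘs y⟩
        rw [mem_preimage, hΘ]; exact hyF
    have hsub : ∀ n, (fun y => Ψ (b, y)) ⁻¹' F ∩ D n ⊆ s (e n) := fun n =>
      inter_subset_right.trans (hDs n)
    have hd1 : Pairwise (Function.onFun Disjoint fun n => (fun y => Ψ (b, y)) ⁻¹' F ∩ D n) :=
      fun i j hij => (hDd hij).mono inter_subset_right inter_subset_right
    rw [h1, h2, measure_iUnion hd1 fun n => hpF.inter (hDm n), measure_iUnion, ← ENNReal.tsum_mul_left]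
    · exact tsum_congr fun n => (himg _ _ (hsub n) (hpF.inter (hDm n))).1
    · intro i j hij
      refine Set.disjoint_left.2 ?_
      rintro _ ⟨y, hy, rfl⟩ ⟨z, hz, hzy⟩
      have h3 := hinj ((hDs j).trans inter_subset_left hz.2)
        ((hDs i).trans inter_subset_left hy.2) hzy
      exact Set.disjoint_left.1 (hd1 hij) hy (h3 ▸ hz)
    · exact fun n => (himg _ _ (hsub n) (hpF.inter (hDm n))).2
  -- The two measures are proportional and both have total mass one, which determines the factor.
  have hc : ENNReal.ofReal c = 1 := by
    have := hmain univ MeasurableSet.univ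
    simpa [volume_unitSquare] using this.symm
  ext F hF
  rw [Measure.map_apply hp.measurable hF, Measure.map_apply hp'.measurable hF,
    Measure.restrict_apply (hp.measurable hF), Measure.restrict_apply (hp'.measurable hF),
    hmain F hF, hc, one_mul]

end IsSemiFlatChart

end HaarIndependence

end SemiFlat
end

noncomputable section
namespace SemiFlat

/-! ### Abstract lift and average for a measure disintegrated into fibre probability measures. -/

open ProbabilityTheory

/-- The measure `μ` is the superposition, with weight `a` with respect to `m`, of probability
measures `κ b` on the fibres `p = b`. -/
structure IsFibered {S X : Type*} [MeasurableSpace S] [MeasurableSpace X] (m : Measure S)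
    (κ : Kernel S X) (a : S → ℝ) (p : X → S) (μ : Measure X) : Prop where
  aemeasurable : AEMeasurable a m
  pos : ∀ᵐ b ∂m, 0 < a b
  prob : ∀ᵐ b ∂m, IsProbabilityMeasure (κ b)
  measurable : Measurable p
  fibre : ∀ᵐ b ∂m, ∀ᵐ x ∂κ b, p x = b
  eq_bind : μ = (m.withDensity fun b => ENNReal.ofReal (a b)).bind κ

namespace IsFibered

variable {S X : Type*} [MeasurableSpace S] [MeasurableSpace X] {m : Measure S}
  {κ : Kernel S X} {a : S → ℝ} {p : X → S} {μ : Measure X} (H : IsFibered m κ a p μ)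
include H

theorem aemeasurable_ofReal : AEMeasurable (fun b => ENNReal.ofReal (a b)) m :=
  H.aemeasurable.ennreal_ofReal

theorem absolutelyContinuous : m ≪ m.withDensity fun b => ENNReal.ofReal (a b) :=
  withDensity_absolutelyContinuous' H.aemeasurable_ofReal
    (H.pos.mono fun b hb => (ENNReal.ofReal_pos.2 hb).ne')

theorem lintegral_eq {f : X → ℝ≥0∞} (hf : AEMeasurable f μ) :
    ∫⁻ x, f x ∂μ = ∫⁻ b, ENNReal.ofReal (a b) * ∫⁻ x, f x ∂κ b ∂m := by
  have h1 := hf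
  rw [H.eq_bind] at h1
  rw [H.eq_bind, Measure.lintegral_bind κ.measurable.aemeasurable h1,
    lintegral_withDensity_eq_lintegral_mul₀' H.aemeasurable_ofReal]
  · rfl
  · obtain ⟨f', hf', hff⟩ := h1
    refine ⟨fun b => ∫⁻ x, f' x ∂κ b, hf'.lintegral_kernel, ?_⟩
    filter_upwards [Measure.ae_ae_of_ae_comp hff] with b hb
    exact lintegral_congr_ae hb

theorem ae_ae {q : X → Prop} (hq : ∀ᵐ x ∂μ, q x) : ∀ᵐ b ∂m, ∀ᵐ x ∂κ b, q x := by
  rw [H.eq_bind] at hq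
  exact H.absolutelyContinuous.ae_le (Measure.ae_ae_of_ae_comp hq)

/-- Composition with `p` is therefore well defined on almost everywhere classes, as the lift of an
`L²` class requires. -/
theorem quasiMeasurePreserving : Measure.QuasiMeasurePreserving p μ m := by
  refine ⟨H.measurable, Measure.AbsolutelyContinuous.mk fun s hs h0 => ?_⟩
  rw [Measure.map_apply H.measurable hs, ← lintegral_indicator_one (H.measurable hs),
    H.lintegral_eq (measurable_one.indicator (H.measurable hs)).aemeasurable]
  refine (lintegral_eq_zero_iff' ?_).2 ?_
  · exact H.aemeasurable_ofReal.mul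
      (measurable_one.indicator (H.measurable hs)).lintegral_kernel.aemeasurable
  · have h1 : ∀ᵐ b ∂m, b ∉ s := measure_eq_zero_iff_ae_notMem.1 h0
    filter_upwards [h1, H.fibre] with b hb hp
    have : ∫⁻ x, (p ⁻¹' s).indicator 1 x ∂κ b = ∫⁻ _, 0 ∂κ b := by
      refine lintegral_congr_ae ?_
      filter_upwards [hp] with x hx
      simp [hx, hb]
    simp only [Pi.zero_apply]
    rw [this]
    simp

theorem aestronglyMeasurable_lift {v : S → ℂ} (hv : AEStronglyMeasurable v m) :
    AEStronglyMeasurable (fun x => (((Real.sqrt (a (p x)))⁻¹ : ℝ) : ℂ) * v (p x)) μ := by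
  have h1 : AEStronglyMeasurable (fun b => (((Real.sqrt (a b))⁻¹ : ℝ) : ℂ) * v b) m :=
    (Complex.measurable_ofReal.comp_aemeasurable
      (H.aemeasurable.sqrt.inv)).aestronglyMeasurable.mul hv
  exact h1.comp_quasiMeasurePreserving H.quasiMeasurePreserving

/-- On a fibre the integrand is constant, the fibre has mass one, and the factor `a⁻¹` cancels the
weight `a`. -/
theorem lintegral_lift {v : S → ℂ} (hv : AEStronglyMeasurable v m) :
    ∫⁻ x, ‖(((Real.sqrt (a (p x)))⁻¹ : ℝ) : ℂ) * v (p x)‖ₑ ^ 2 ∂μ = ∫⁻ b, ‖v b‖ₑ ^ 2 ∂m := by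
  rw [H.lintegral_eq ((H.aestronglyMeasurable_lift hv).enorm.pow_const _)]
  refine lintegral_congr_ae ?_
  filter_upwards [H.pos, H.prob, H.fibre] with b hb hP hp
  have h1 : ∫⁻ x, ‖(((Real.sqrt (a (p x)))⁻¹ : ℝ) : ℂ) * v (p x)‖ₑ ^ 2 ∂κ b =
      ∫⁻ _, ‖(((Real.sqrt (a b))⁻¹ : ℝ) : ℂ) * v b‖ₑ ^ 2 ∂κ b := by
    refine lintegral_congr_ae ?_
    filter_upwards [hp] with x hx
    rw [hx]
  rw [h1, lintegral_const, measure_univ, mul_one, enorm_mul, mul_pow, ← mul_assoc]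
  have h2 : ENNReal.ofReal (a b) * ‖(((Real.sqrt (a b))⁻¹ : ℝ) : ℂ)‖ₑ ^ 2 = 1 := by
    rw [← ofReal_norm, Complex.norm_real, ← ENNReal.ofReal_pow (norm_nonneg _),
      ← ENNReal.ofReal_mul hb.le, Real.norm_eq_abs, sq_abs, inv_pow, Real.sq_sqrt hb.le,
      mul_inv_cancel₀ hb.ne', ENNReal.ofReal_one]
  rw [h2, one_mul]

theorem memLp_lift {v : S → ℂ} (hv : MemLp v 2 m) :
    MemLp (fun x => (((Real.sqrt (a (p x)))⁻¹ : ℝ) : ℂ) * v (p x)) 2 μ := by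
  have h2 := (memLp_two_iff_integrable_sq_norm hv.1).1 hv
  rw [memLp_two_iff_integrable_sq_norm (H.aestronglyMeasurable_lift hv.1)]
  refine ⟨(H.aestronglyMeasurable_lift hv.1).norm.pow _, ?_⟩
  have h3 := h2.2
  simp only [hasFiniteIntegral_iff_enorm, enorm_pow, enorm_norm] at h3 ⊢
  rwa [H.lintegral_lift hv.1]

theorem ae_aestronglyMeasurable {u : X → ℂ} (hu : AEStronglyMeasurable u μ) :
    ∀ᵐ b ∂m, AEStronglyMeasurable u (κ b) := by
  obtain ⟨u', hu', huu⟩ := hu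
  filter_upwards [H.ae_ae huu] with b hb
  exact ⟨u', hu', hb⟩

theorem aestronglyMeasurable_average {u : X → ℂ} (hu : AEStronglyMeasurable u μ) :
    AEStronglyMeasurable (fun b => (Real.sqrt (a b) : ℂ) * ∫ x, u x ∂κ b) m := by
  refine AEStronglyMeasurable.mul ?_ ?_
  · exact (Complex.measurable_ofReal.comp_aemeasurable
      H.aemeasurable.sqrt).aestronglyMeasurable
  · obtain ⟨u', hu', huu⟩ := hu
    refine ⟨fun b => ∫ x, u' x ∂κ b, ?_, ?_⟩
    · exact hu'.integral_kernel
    · filter_upwards [H.ae_ae huu] with b hb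
      exact integral_congr_ae hb

theorem lintegral_average_le {u : X → ℂ} (hu : AEStronglyMeasurable u μ) :
    ∫⁻ b, ‖(Real.sqrt (a b) : ℂ) * ∫ x, u x ∂κ b‖ₑ ^ 2 ∂m ≤ ∫⁻ x, ‖u x‖ₑ ^ 2 ∂μ := by
  rw [H.lintegral_eq (hu.enorm.pow_const _)]
  refine lintegral_mono_ae ?_
  filter_upwards [H.pos, H.prob, H.ae_aestronglyMeasurable hu] with b hb hP hm
  rw [enorm_mul, mul_pow]
  refine mul_le_mul' (le_of_eq ?_) ?_
  · rw [← ofReal_norm, Complex.norm_real, ← ENNReal.ofReal_pow (norm_nonneg _),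
      Real.norm_eq_abs, sq_abs, Real.sq_sqrt hb.le]
  · refine (enorm_integral_sq_le _ hm).trans_eq ?_
    rw [measure_univ, one_mul]

theorem memLp_average {u : X → ℂ} (hu : MemLp u 2 μ) :
    MemLp (fun b => (Real.sqrt (a b) : ℂ) * ∫ x, u x ∂κ b) 2 m := by
  have h2 := (memLp_two_iff_integrable_sq_norm hu.1).1 hu
  rw [memLp_two_iff_integrable_sq_norm (H.aestronglyMeasurable_average hu.1)]
  refine ⟨(H.aestronglyMeasurable_average hu.1).norm.pow _, ?_⟩
  have h3 := h2.2
  simp only [hasFiniteIntegral_iff_enorm, enorm_pow, enorm_norm] at h3 ⊢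
  exact (H.lintegral_average_le hu.1).trans_lt h3

theorem integral_eq {f : X → ℂ} (hf : Integrable f μ) :
    ∫ x, f x ∂μ = ∫ b, (a b : ℂ) * ∫ x, f x ∂κ b ∂m := by
  have h1 := hf
  rw [H.eq_bind, Measure.comp_eq_comp_const_apply] at h1
  have h2 := ProbabilityTheory.Kernel.integral_comp h1
  rw [Kernel.const_apply] at h2
  rw [H.eq_bind, Measure.comp_eq_comp_const_apply, h2,
    integral_withDensity_eq_integral_toReal_smul₀ H.aemeasurable_ofReal
      (Eventually.of_forall fun _ => ENNReal.ofReal_lt_top)]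
  refine integral_congr_ae ?_
  filter_upwards [H.pos] with b hb
  rw [ENNReal.toReal_ofReal hb.le]
  simp

theorem integral_conj_lift_mul {v : S → ℂ} (hv : MemLp v 2 m) {u : X → ℂ} (hu : MemLp u 2 μ) :
    ∫ x, conj ((((Real.sqrt (a (p x)))⁻¹ : ℝ) : ℂ) * v (p x)) * u x ∂μ =
      ∫ b, conj (v b) * ((Real.sqrt (a b) : ℂ) * ∫ x, u x ∂κ b) ∂m := by
  refine (H.integral_eq ((H.memLp_lift hv).star.integrable_mul hu)).trans (integral_congr_ae ?_)
  filter_upwards [H.pos, H.fibre] with b hb hp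
  have h1 : ∫ x, conj ((((Real.sqrt (a (p x)))⁻¹ : ℝ) : ℂ) * v (p x)) * u x ∂κ b =
      ∫ x, conj ((((Real.sqrt (a b))⁻¹ : ℝ) : ℂ) * v b) * u x ∂κ b := by
    refine integral_congr_ae ?_
    filter_upwards [hp] with x hx
    rw [hx]
  refine (congrArg _ h1).trans ?_
  rw [integral_const_mul, map_mul, Complex.conj_ofReal]
  have h2 : (a b : ℂ) = (Real.sqrt (a b) : ℂ) * (Real.sqrt (a b) : ℂ) := by
    rw [← Complex.ofReal_mul, Real.mul_self_sqrt hb.le]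
  have h3 : (Real.sqrt (a b) : ℂ) ≠ 0 := by
    exact Complex.ofReal_ne_zero.2 (Real.sqrt_pos.2 hb).ne'
  rw [h2, Complex.ofReal_inv]
  field_simp

/-- The isometry `v ↦ a(p ·)^{-1/2} v(p ·)`. -/
def lift : Lp ℂ 2 m →ₗᵢ[ℂ] Lp ℂ 2 μ where
  toFun v := (H.memLp_lift (Lp.memLp v)).toLp _
  map_add' v w := by
    rw [← MemLp.toLp_add]
    refine MemLp.toLp_congr _ _ ?_
    filter_upwards [H.quasiMeasurePreserving.ae (Lp.coeFn_add v w)] with x hx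
    rw [hx]
    simp [mul_add]
  map_smul' r v := by
    rw [RingHom.id_apply, ← MemLp.toLp_const_smul]
    refine MemLp.toLp_congr _ _ ?_
    filter_upwards [H.quasiMeasurePreserving.ae (Lp.coeFn_smul r v)] with x hx
    rw [hx]
    simp only [Pi.smul_apply, smul_eq_mul]
    ring
  norm_map' v := by
    have h1 := H.lintegral_lift (Lp.aestronglyMeasurable v)
    change ‖(H.memLp_lift (Lp.memLp v)).toLp _‖ = ‖v‖
    rw [Lp.norm_toLp, Lp.norm_def, eLpNorm_eq_lintegral_rpow_enorm_toReal (by simp) (by simp),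
      eLpNorm_eq_lintegral_rpow_enorm_toReal (by simp) (by simp)]
    simp only [ENNReal.toReal_ofNat, ENNReal.rpow_ofNat]
    rw [h1]

theorem coeFn_lift (v : Lp ℂ 2 m) :
    H.lift v =ᵐ[μ] fun x => (((Real.sqrt (a (p x)))⁻¹ : ℝ) : ℂ) * v (p x) :=
  MemLp.coeFn_toLp (H.memLp_lift (Lp.memLp v))

/-- On each fibre the weight `a` meets the factor `a^{-1/2}` of the lift and leaves the factor
`a^{1/2}` of the average. Identified as the adjoint of an isometry, the average is a contraction and
a left inverse of the lift. -/
theorem coeFn_adjoint_lift (u : Lp ℂ 2 μ) :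
    H.lift.toContinuousLinearMap.adjoint u =ᵐ[m]
      fun b => (Real.sqrt (a b) : ℂ) * ∫ x, u x ∂κ b := by
  have h1 := H.memLp_average (Lp.memLp u)
  have h2 : H.lift.toContinuousLinearMap.adjoint u = h1.toLp _ := by
    refine ext_inner_left ℂ fun v => ?_
    rw [ContinuousLinearMap.adjoint_inner_right, L2.inner_def, L2.inner_def]
    have h3 := H.integral_conj_lift_mul (Lp.memLp v) (Lp.memLp u)
    have h4 : ∫ x, Inner.inner ℂ ((H.lift v : Lp ℂ 2 μ) x) (u x) ∂μ =
        ∫ x, conj ((((Real.sqrt (a (p x)))⁻¹ : ℝ) : ℂ) * v (p x)) * u x ∂μ := by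
      refine integral_congr_ae ?_
      filter_upwards [H.coeFn_lift v] with x hx
      rw [hx, RCLike.inner_apply, mul_comm]
    refine (h4.trans h3).trans (integral_congr_ae ?_)
    filter_upwards [MemLp.coeFn_toLp h1] with b hb
    rw [hb, RCLike.inner_apply, mul_comm]
  rw [h2]
  exact MemLp.coeFn_toLp h1

end IsFibered
end SemiFlat
end

noncomputable section
namespace SemiFlat

open ProbabilityTheory

/-! ### The disintegration of the total space as a kernel of fibre measures. -/

namespace TorusFibration

variable {S : Type*} [TopologicalSpace S] [ChartedSpace (EuclideanSpace ℝ (Fin 2)) S]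
  [IsManifold (𝓡 2) ∞ S]
  {X : Type*} [TopologicalSpace X] [ChartedSpace (EuclideanSpace ℝ (Fin 4)) X]
  [IsManifold (𝓡 4) ∞ X] {gB : Metric 2 S} {B₀ : Set S} (T : TorusFibration gB B₀ X)

theorem continuous_proj : Continuous T.proj := T.proj_smooth.continuous

theorem isOpen_total (hB₀ : IsOpen B₀) : IsOpen T.total := hB₀.preimage T.continuous_proj

theorem chart_mem_total {b₀ b : S} (h0 : b₀ ∈ B₀) (hb : b ∈ T.nbhd b₀) (y : Plane) :
    T.chart b₀ (b, y) ∈ T.total := by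
  change T.proj _ ∈ B₀
  rw [(T.isSemiFlatChart b₀ h0).proj_eq b hb y]
  exact T.nbhd_subset b₀ h0 hb

variable [MeasurableSpace X] [BorelSpace X]

/-- The measure over `b` is defined by the chart attached to `b`, with no regularity in `b`.
Independence of the chart lets one chart serve a whole neighbourhood, which makes measurability and
differentiation in `b` possible. -/
theorem haar_eq [T2Space X] {b₀ b : S} (h0 : b₀ ∈ B₀) (hb : b ∈ T.nbhd b₀) :
    T.haar b = Measure.map (fun y => T.chart b₀ (b, y)) (volume.restrict unitSquare) := by
  have hb' := T.nbhd_subset b₀ h0 hb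
  exact (T.isSemiFlatChart b hb').map_eq_map (T.isSemiFlatChart b₀ h0) (T.mem_nbhd b hb') hb

theorem lintegral_haar [T2Space X] {b₀ b : S} (h0 : b₀ ∈ B₀) (hb : b ∈ T.nbhd b₀) {f : X → ℝ≥0∞}
    (hf : Measurable f) :
    ∫⁻ x, f x ∂T.haar b = ∫⁻ y in unitSquare, f (T.chart b₀ (b, y)) := by
  rw [T.haar_eq h0 hb, lintegral_map hf
    ((T.isSemiFlatChart b₀ h0).continuous_section hb).measurable]

theorem integral_haar [T2Space X] {b₀ b : S} (h0 : b₀ ∈ B₀) (hb : b ∈ T.nbhd b₀) {f : X → ℂ}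
    (hf : AEStronglyMeasurable f (T.haar b)) :
    ∫ x, f x ∂T.haar b = ∫ y in unitSquare, f (T.chart b₀ (b, y)) := by
  rw [T.haar_eq h0 hb] at hf ⊢
  rw [integral_map ((T.isSemiFlatChart b₀ h0).continuous_section hb).measurable.aemeasurable hf]

theorem ae_haar [T1Space S] {b : S} (hb : b ∈ B₀) : ∀ᵐ x ∂T.haar b, T.proj x = b ∧ x ∈ T.total := by
  have h1 : ∀ᵐ x ∂T.haar b, T.proj x = b := by
    refine (ae_map_iff ((T.isSemiFlatChart b hb).continuous_section
      (T.mem_nbhd b hb)).measurable.aemeasurable ?_).2 (Eventually.of_forall fun y =>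
        (T.isSemiFlatChart b hb).proj_eq b (T.mem_nbhd b hb) y)
    exact ((isClosed_singleton (x := b)).preimage T.continuous_proj).measurableSet
  filter_upwards [h1] with x hx
  exact ⟨hx, by change T.proj x ∈ B₀; rwa [hx]⟩

variable [MeasurableSpace S] [BorelSpace S] [T2Space X] [SecondCountableTopology S]

/-- Over one chart neighbourhood the integral is a parametric integral over the fixed unit square.
Countably many such neighbourhoods cover `B₀`, and the function is the supremum of its restrictions
extended by zero. -/
theorem measurable_lintegral_haar (hB₀ : IsOpen B₀) {f : X → ℝ≥0∞} (hf : Measurable f) :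
    Measurable (B₀.indicator fun b => ∫⁻ x, f x ∂T.haar b) := by
  obtain ⟨c, hc, hcov⟩ := TopologicalSpace.isOpen_iUnion_countable
    (fun b : B₀ => T.nbhd b) fun b => (T.isSemiFlatChart b b.2).isOpen
  have hcov' : ⋃ b ∈ c, T.nbhd b = B₀ := by
    rw [hcov]
    refine Subset.antisymm (iUnion_subset fun b => T.nbhd_subset b b.2) fun b hb => ?_
    exact mem_iUnion.2 ⟨⟨b, hb⟩, T.mem_nbhd b hb⟩
  have hloc : ∀ b₀ : B₀, Measurable ((T.nbhd b₀).indicator fun b => ∫⁻ x, f x ∂T.haar b) := by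
    intro b₀
    have hC := T.isSemiFlatChart b₀ b₀.2
    have h1 : Measurable (((T.nbhd b₀) ×ˢ (univ : Set Plane)).indicator
        fun q => f (T.chart b₀ q)) := by
      have hm : MeasurableSet ((T.nbhd b₀) ×ˢ (univ : Set Plane)) :=
        hC.isOpen.measurableSet.prod MeasurableSet.univ
      refine measurable_of_restrict_of_restrict_compl hm ?_ ?_
      · have h2 : Measurable (((T.nbhd b₀) ×ˢ (univ : Set Plane)).domRestrict (T.chart b₀)) :=
          (continuousOn_iff_continuous_domRestrict.1 hC.smooth.continuousOn).measurable
        have h3 : ((T.nbhd b₀) ×ˢ (univ : Set Plane)).domRestrict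
            (((T.nbhd b₀) ×ˢ (univ : Set Plane)).indicator fun q => f (T.chart b₀ q)) =
            f ∘ ((T.nbhd b₀) ×ˢ (univ : Set Plane)).domRestrict (T.chart b₀) := by
          ext q
          exact indicator_of_mem q.2 _
        rw [h3]
        exact hf.comp h2
      · have h3 : ((T.nbhd b₀) ×ˢ (univ : Set Plane))ᶜ.domRestrict
            (((T.nbhd b₀) ×ˢ (univ : Set Plane)).indicator fun q => f (T.chart b₀ q)) =
            fun _ => 0 := by
          ext q
          exact indicator_of_notMem q.2 _
        rw [h3]
        exact measurable_const
    have h2 := h1.lintegral_prod_right' (ν := volume.restrict unitSquare)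
    have h3 : ((T.nbhd b₀).indicator fun b => ∫⁻ x, f x ∂T.haar b) =
        fun b => ∫⁻ y in unitSquare, ((T.nbhd b₀) ×ˢ (univ : Set Plane)).indicator
          (fun q => f (T.chart b₀ q)) (b, y) := by
      ext b
      by_cases hb : b ∈ T.nbhd b₀
      · rw [indicator_of_mem hb, T.lintegral_haar b₀.2 hb hf]
        simp [indicator, hb]
      · simp [indicator, hb]
    rw [h3]
    exact h2
  have : (B₀.indicator fun b => ∫⁻ x, f x ∂T.haar b) =
      fun b => ⨆ b₀ ∈ c, (T.nbhd b₀).indicator (fun b => ∫⁻ x, f x ∂T.haar b) b := by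
    ext b
    refine le_antisymm ?_ (iSup₂_le fun b₀ _ => ?_)
    · refine indicator_apply_le' (fun hb => ?_) fun _ => zero_le
      rw [← hcov'] at hb
      obtain ⟨b₀, h0, hb⟩ := mem_iUnion₂.1 hb
      refine le_trans ?_ (le_iSup₂ b₀ h0)
      rw [indicator_of_mem hb]
    · exact indicator_le_indicator_of_subset (T.nbhd_subset b₀ b₀.2) (fun _ => zero_le) b
  rw [this]
  exact Measurable.biSup c hc fun b₀ _ => hloc b₀

/-- The density `ρ`, extended by zero. -/
def density (ρ : X → ℝ) : X → ℝ≥0∞ := T.total.indicator fun x => ENNReal.ofReal (ρ x)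

theorem measurable_density (hB₀ : IsOpen B₀) {ρ : X → ℝ} (hρ : ContinuousOn ρ T.total) :
    Measurable (T.density ρ) := by
  have hm := (T.isOpen_total hB₀).measurableSet
  refine measurable_of_restrict_of_restrict_compl hm ?_ ?_
  · have h3 : T.total.domRestrict (T.density ρ) =
        fun x => ENNReal.ofReal (T.total.domRestrict ρ x) := by
      ext q
      exact indicator_of_mem q.2 fun x => ENNReal.ofReal (ρ x)
    rw [h3]
    exact (continuousOn_iff_continuous_domRestrict.1 hρ).measurable.ennreal_ofReal
  · have h3 : T.totalᶜ.domRestrict (T.density ρ) = fun _ => 0 := by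
      ext q
      exact indicator_of_notMem (s := T.total) q.2 fun x => ENNReal.ofReal (ρ x)
    rw [h3]
    exact measurable_const

/-- The probability measures `ρ dϑ_b` on the fibres. -/
def fibreMeasure (ρ : X → ℝ) (b : S) : Measure X :=
  open Classical in if b ∈ B₀ then (T.haar b).withDensity (T.density ρ) else 0

theorem fibreMeasure_of_mem (ρ : X → ℝ) {b : S} (hb : b ∈ B₀) :
    T.fibreMeasure ρ b = (T.haar b).withDensity (T.density ρ) := if_pos hb

theorem measurable_fibreMeasure (hB₀ : IsOpen B₀) {ρ : X → ℝ} (hρ : ContinuousOn ρ T.total) :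
    Measurable (T.fibreMeasure ρ) := by
  refine Measure.measurable_of_measurable_coe _ fun s hs => ?_
  have h1 := T.measurable_lintegral_haar hB₀ ((T.measurable_density hB₀ hρ).indicator hs)
  have h2 : (fun b => T.fibreMeasure ρ b s) =
      B₀.indicator fun b => ∫⁻ x, s.indicator (T.density ρ) x ∂T.haar b := by
    ext b
    by_cases hb : b ∈ B₀
    · rw [indicator_of_mem hb, T.fibreMeasure_of_mem ρ hb, withDensity_apply _ hs,
        lintegral_indicator hs]
    · simp [fibreMeasure, hb]
  rw [h2]
  exact h1

/-- The fibre measures `ρ dϑ_b` as a kernel. -/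
def fibreKernel (hB₀ : IsOpen B₀) {ρ : X → ℝ} (hρ : ContinuousOn ρ T.total) : Kernel S X :=
  ⟨T.fibreMeasure ρ, T.measurable_fibreMeasure hB₀ hρ⟩

variable [T2Space S] [SecondCountableTopology X] {A : S → ℝ} {ρ : X → ℝ}

theorem integral_fibreMeasure (hB₀ : IsOpen B₀) (hρ : ContinuousOn ρ T.total)
    (hpos : ∀ x ∈ T.total, 0 < ρ x) {b : S} (hb : b ∈ B₀) (f : X → ℂ) :
    ∫ x, f x ∂T.fibreMeasure ρ b = ∫ x, f x * (ρ x : ℂ) ∂T.haar b := by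
  rw [T.fibreMeasure_of_mem ρ hb, integral_withDensity_eq_integral_toReal_smul
    (T.measurable_density hB₀ hρ)]
  · refine integral_congr_ae ?_
    filter_upwards [T.ae_haar hb] with x hx
    rw [density, indicator_of_mem hx.2, ENNReal.toReal_ofReal (hpos x hx.2).le, Complex.real_smul,
      mul_comm]
  · refine Eventually.of_forall fun x => ?_
    change T.total.indicator (fun x => ENNReal.ofReal (ρ x)) x < ⊤
    by_cases hx : x ∈ T.total
    · rw [indicator_of_mem hx]
      exact ENNReal.ofReal_lt_top
    · rw [indicator_of_notMem hx]
      exact ENNReal.zero_lt_top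

theorem IsDisintegration.continuousOn_ρ (h : T.IsDisintegration A ρ) : ContinuousOn ρ T.total :=
  h.ρ_smooth.continuousOn

theorem IsDisintegration.isProbabilityMeasure (h : T.IsDisintegration A ρ) {b : S}
    (hb : b ∈ B₀) : IsProbabilityMeasure (T.fibreMeasure ρ b) := by
  have h1 : Integrable ρ (T.haar b) := by
    by_contra h1
    have := h.normalized b hb
    rw [integral_undef h1] at this
    exact zero_ne_one this
  constructor
  rw [T.fibreMeasure_of_mem ρ hb, withDensity_apply _ MeasurableSet.univ, Measure.restrict_univ]
  have h2 : ∫⁻ x, T.density ρ x ∂T.haar b = ∫⁻ x, ENNReal.ofReal (ρ x) ∂T.haar b := by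
    refine lintegral_congr_ae ?_
    filter_upwards [T.ae_haar hb] with x hx
    exact indicator_of_mem hx.2 _
  rw [h2, ← ofReal_integral_eq_lintegral_ofReal h1, h.normalized b hb, ENNReal.ofReal_one]
  filter_upwards [T.ae_haar hb] with x hx
  exact (h.ρ_pos x hx.2).le

/-- The assumed identity concerns Bochner integrals, which vanish by convention when the integrand
is not integrable; it becomes an identity of measures only if the right-hand side is known to be
finite. As `A` is not assumed bounded, this is secured by restricting to sets over which `A ≤ N`. -/
theorem IsDisintegration.measure_inter_eq (hB₀ : IsOpen B₀) (hB₀c : IsCompact (closure B₀))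
    (h : T.IsDisintegration A ρ) {s : Set X} (hs : MeasurableSet s) {N : ℝ}
    (hsN : ∀ b ∈ B₀, N < A b → ∀ x ∈ s, T.proj x ≠ b) :
    measureOn T.g T.total s =
      ∫⁻ b, ENNReal.ofReal (A b) * T.fibreMeasure ρ b s ∂(measureOn gB B₀) := by
  have hf1 := isFiniteMeasure_measureOn T.g T.precompact
  have hf1' : IsFiniteMeasure (measureOn T.g T.total) := hf1
  have hf2 := isFiniteMeasure_measureOn gB hB₀c
  have hA : AEMeasurable A (measureOn gB B₀) :=
    h.A_smooth.continuousOn.aemeasurable hB₀.measurableSet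
  have h1 := h.integral_eq (s.indicator 1) ((integrable_const (1 : ℝ)).indicator hs)
  rw [integral_indicator_one hs] at h1
  have hfib : ∀ b ∈ B₀, ∫ x, s.indicator 1 x * ρ x ∂T.haar b = (T.fibreMeasure ρ b).real s := by
    intro b hb
    have h2 := T.integral_fibreMeasure hB₀ h.continuousOn_ρ h.ρ_pos hb
      (fun x => ((s.indicator 1 x : ℝ) : ℂ))
    rw [integral_complex_ofReal, integral_indicator_one hs] at h2
    refine Complex.ofReal_injective ?_
    rw [h2, ← integral_complex_ofReal]
    simp
  have hprob : ∀ b ∈ B₀, T.fibreMeasure ρ b s ≤ 1 := fun b hb => by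
    have := h.isProbabilityMeasure T hb
    exact prob_le_one
  have hmeas : AEMeasurable (fun b => T.fibreMeasure ρ b s) (measureOn gB B₀) :=
    ((Measure.measurable_coe hs).comp (T.measurable_fibreMeasure hB₀ h.continuousOn_ρ)).aemeasurable
  have hmem : ∀ᵐ b ∂(measureOn gB B₀), b ∈ B₀ := ae_restrict_mem hB₀.measurableSet
  have h3 : ∫ b, A b * ∫ x, s.indicator 1 x * ρ x ∂T.haar b ∂(measureOn gB B₀) =
      ∫ b, (ENNReal.ofReal (A b) * T.fibreMeasure ρ b s).toReal ∂(measureOn gB B₀) := by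
    refine integral_congr_ae ?_
    filter_upwards [hmem] with b hb
    rw [hfib b hb, ENNReal.toReal_mul, ENNReal.toReal_ofReal (h.A_pos b hb).le]
    rfl
  have hm2 : AEMeasurable (fun b => ENNReal.ofReal (A b) * T.fibreMeasure ρ b s)
      (measureOn gB B₀) := hA.ennreal_ofReal.mul hmeas
  rw [h3, integral_toReal hm2] at h1
  · refine (ENNReal.toReal_eq_toReal_iff' (measure_ne_top _ _) ?_).1 h1
    refine ne_of_lt ((lintegral_mono_ae (g := fun _ => ENNReal.ofReal N) ?_).trans_lt ?_)
    · filter_upwards [hmem] with b hb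
      by_cases hAb : A b ≤ N
      · exact (mul_le_mul' (ENNReal.ofReal_le_ofReal hAb) (hprob b hb)).trans_eq (mul_one _)
      · have h0 : T.fibreMeasure ρ b s = 0 := by
          rw [T.fibreMeasure_of_mem ρ hb]
          refine withDensity_absolutelyContinuous _ _ (measure_eq_zero_iff_ae_notMem.2 ?_)
          filter_upwards [T.ae_haar hb] with x hx hxs
          exact hsN b hb (not_le.1 hAb) x hxs hx.1
        rw [h0, mul_zero]
        exact zero_le
    · rw [lintegral_const]
      exact ENNReal.mul_lt_top ENNReal.ofReal_lt_top (measure_lt_top _ _)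
  · filter_upwards [hmem] with b hb
    exact ENNReal.mul_lt_top ENNReal.ofReal_lt_top ((hprob b hb).trans_lt ENNReal.one_lt_top)

theorem IsDisintegration.isFibered (hB₀ : IsOpen B₀) (hB₀c : IsCompact (closure B₀))
    (h : T.IsDisintegration A ρ) :
    IsFibered (measureOn gB B₀) (T.fibreKernel hB₀ h.continuousOn_ρ) A T.proj
      (measureOn T.g T.total) := by
  have hmem : ∀ᵐ b ∂(measureOn gB B₀), b ∈ B₀ := ae_restrict_mem hB₀.measurableSet
  have hA : AEMeasurable A (measureOn gB B₀) :=
    h.A_smooth.continuousOn.aemeasurable hB₀.measurableSet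
  refine ⟨hA, hmem.mono h.A_pos, hmem.mono fun b hb => h.isProbabilityMeasure T hb,
    T.continuous_proj.measurable, ?_, ?_⟩
  · filter_upwards [hmem] with b hb
    change ∀ᵐ x ∂T.fibreMeasure ρ b, T.proj x = b
    rw [T.fibreMeasure_of_mem ρ hb]
    exact (withDensity_absolutelyContinuous _ _).ae_le ((T.ae_haar hb).mono fun x hx => hx.1)
  -- The sets where `A ∘ proj ≤ n` (together with the complement of the total space) exhaust `X`; on
  -- each of them the restricted identity applies.
  · set Y : ℕ → Set X := fun n => T.proj ⁻¹' (B₀ ∩ A ⁻¹' Ioi (n : ℝ))ᶜ with hY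
    have hYm : ∀ n, MeasurableSet (Y n) := fun n =>
      T.continuous_proj.measurable ((h.A_smooth.continuousOn.isOpen_inter_preimage hB₀
        isOpen_Ioi).measurableSet.compl)
    refine (Measure.ext_iff_of_iUnion_eq_univ (s := Y) ?_).2 fun n => ?_
    · refine eq_univ_of_forall fun x => ?_
      obtain ⟨n, hn⟩ := exists_nat_ge (A (T.proj x))
      exact mem_iUnion.2 ⟨n, fun hx => not_lt.2 hn hx.2⟩
    · ext s hs
      rw [Measure.restrict_apply hs, Measure.restrict_apply hs,
        h.measure_inter_eq T hB₀ hB₀c (hs.inter (hYm n))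
          (fun b hb hAb x hx hxb => hx.2 ⟨by rwa [hxb], by change (n : ℝ) < A (T.proj x); rwa [hxb]⟩),
        Measure.bind_apply (hs.inter (hYm n)) (Kernel.measurable _).aemeasurable,
        lintegral_withDensity_eq_lintegral_mul₀ hA.ennreal_ofReal]
      · rfl
      · exact (Kernel.measurable_coe _ (hs.inter (hYm n))).aemeasurable

theorem IsDisintegration.averageFun_ae (hB₀ : IsOpen B₀) (h : T.IsDisintegration A ρ) (u : X → ℂ) :
    T.averageFun A ρ u =ᵐ[measureOn gB B₀] fun b => (Real.sqrt (A b) : ℂ) *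
      ∫ x, u x ∂(T.fibreKernel hB₀ h.continuousOn_ρ b) := by
  filter_upwards [ae_restrict_mem hB₀.measurableSet] with b hb
  exact congrArg _ (T.integral_fibreMeasure hB₀ h.continuousOn_ρ h.ρ_pos hb u).symm

theorem IsDisintegration.memLp_liftFun (hB₀ : IsOpen B₀) (hB₀c : IsCompact (closure B₀))
    (h : T.IsDisintegration A ρ) (v : L2 gB B₀) :
    MemLp (T.liftFun A v) 2 (measureOn T.g T.total) :=
  (h.isFibered T hB₀ hB₀c).memLp_lift (Lp.memLp v)

theorem IsDisintegration.memLp_averageFun (hB₀ : IsOpen B₀) (hB₀c : IsCompact (closure B₀))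
    (h : T.IsDisintegration A ρ) (u : L2 T.g T.total) :
    MemLp (T.averageFun A ρ u) 2 (measureOn gB B₀) :=
  ((h.isFibered T hB₀ hB₀c).memLp_average (Lp.memLp u)).ae_eq (h.averageFun_ae T hB₀ u).symm

theorem IsDisintegration.lift_eq (hB₀ : IsOpen B₀) (hB₀c : IsCompact (closure B₀))
    (h : T.IsDisintegration A ρ) (v : L2 gB B₀) :
    T.lift A v = (h.isFibered T hB₀ hB₀c).lift v := by
  rw [TorusFibration.lift, toL2, dif_pos (h.memLp_liftFun T hB₀ hB₀c v)]
  rfl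

theorem IsDisintegration.average_eq (hB₀ : IsOpen B₀) (hB₀c : IsCompact (closure B₀))
    (h : T.IsDisintegration A ρ) (u : L2 T.g T.total) :
    T.average A ρ u = (h.isFibered T hB₀ hB₀c).lift.toContinuousLinearMap.adjoint u := by
  rw [TorusFibration.average, toL2, dif_pos (h.memLp_averageFun T hB₀ hB₀c u)]
  refine Lp.ext ?_
  exact (MemLp.coeFn_toLp _).trans ((h.averageFun_ae T hB₀ u).trans
    ((h.isFibered T hB₀ hB₀c).coeFn_adjoint_lift u).symm)

end TorusFibration
end SemiFlat
end

noncomputable section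
namespace SemiFlat

/-! ### Integrals over the unit square depending on a parameter. -/

section ParametricIntegral

variable {E G : Type*} [NormedAddCommGroup E] [NormedSpace ℝ E] [FiniteDimensional ℝ E]
  [NormedAddCommGroup G] [NormedSpace ℝ G] [CompleteSpace G]

theorem integrableOn_unitSquare {f : Plane → G} (hf : Continuous f) :
    Integrable f (volume.restrict unitSquare) :=
  (hf.continuousOn.integrableOn_compact (isCompact_closedBall (0 : Plane) 2)).mono_set
    unitSquare_subset_closedBall

/-- The unit square is not closed, but it lies in a compact ball, so continuity gives bounds uniform
in nearby parameters; these constants are the dominating functions used below. -/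
theorem exists_ball_norm_le {f : E × Plane → G} {O : Set E} (hO : IsOpen O)
    (hf : ContinuousOn f (O ×ˢ univ)) {c : E} (hc : c ∈ O) :
    ∃ r : ℝ, 0 < r ∧ Metric.closedBall c r ⊆ O ∧
      ∃ C : ℝ, ∀ c' ∈ Metric.closedBall c r, ∀ y ∈ unitSquare, ‖f (c', y)‖ ≤ C := by
  have : ProperSpace E := FiniteDimensional.proper ℝ E
  obtain ⟨r, hr, hrO⟩ := Metric.nhds_basis_closedBall.mem_iff.1 (hO.mem_nhds hc)
  obtain ⟨C, hC⟩ := ((isCompact_closedBall c r).prod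
    (isCompact_closedBall (0 : Plane) 2)).exists_bound_of_continuousOn
      (hf.mono (prod_mono hrO (subset_univ _)))
  exact ⟨r, hr, hrO, C, fun c' hc' y hy => hC _ ⟨hc', unitSquare_subset_closedBall hy⟩⟩

theorem continuous_slice {f : E × Plane → G} {O : Set E}
    (hf : ContinuousOn f (O ×ˢ univ)) {c : E} (hc : c ∈ O) : Continuous fun y => f (c, y) :=
  hf.comp_continuous (by fun_prop) fun _ => ⟨hc, mem_univ _⟩

theorem continuousOn_integral_unitSquare {f : E × Plane → G} {O : Set E} (hO : IsOpen O)
    (hf : ContinuousOn f (O ×ˢ univ)) :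
    ContinuousOn (fun c => ∫ y in unitSquare, f (c, y)) O := by
  intro c hc
  obtain ⟨r, hr, hrO, C, hC⟩ := exists_ball_norm_le hO hf hc
  refine ContinuousAt.continuousWithinAt (continuousAt_of_dominated (bound := fun _ => C) ?_ ?_
    (integrable_const _) ?_)
  · filter_upwards [hO.mem_nhds hc] with c' hc'
    exact (continuous_slice hf hc').aestronglyMeasurable
  · filter_upwards [Metric.closedBall_mem_nhds c hr] with c' hc'
    filter_upwards [ae_restrict_mem measurableSet_unitSquare] with y hy using hC c' hc' y hy
  · refine Eventually.of_forall fun y => ?_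
    exact ContinuousAt.comp (f := fun c' => (c', y))
      (hf.continuousAt ((hO.prod isOpen_univ).mem_nhds ⟨hc, mem_univ _⟩)) (by fun_prop)

theorem hasFDerivAt_integral_unitSquare {f : E × Plane → G} {O : Set E} (hO : IsOpen O)
    (hf : ContDiffOn ℝ 1 f (O ×ˢ univ)) {c : E} (hc : c ∈ O) :
    HasFDerivAt (fun c => ∫ y in unitSquare, f (c, y))
      (∫ y in unitSquare, (fderiv ℝ f (c, y)).comp (ContinuousLinearMap.inl ℝ E Plane)) c := by
  have hd : ContinuousOn (fun p => (fderiv ℝ f p).comp (ContinuousLinearMap.inl ℝ E Plane))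
      (O ×ˢ univ) := by
    have h1 := hf.continuousOn_fderiv_of_isOpen (hO.prod isOpen_univ) le_rfl
    fun_prop
  obtain ⟨r, hr, hrO, C, hC⟩ := exists_ball_norm_le hO hd hc
  refine hasFDerivAt_integral_of_dominated_of_fderiv_le (bound := fun _ => C)
    (F := fun c y => f (c, y))
    (F' := fun c y => (fderiv ℝ f (c, y)).comp (ContinuousLinearMap.inl ℝ E Plane))
    (Metric.closedBall_mem_nhds c hr) ?_ ?_ ?_ ?_ (integrable_const _) ?_
  · filter_upwards [hO.mem_nhds hc] with c' hc'
    exact (continuous_slice hf.continuousOn hc').aestronglyMeasurable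
  · exact integrableOn_unitSquare (continuous_slice hf.continuousOn hc)
  · exact (continuous_slice hd hc).aestronglyMeasurable
  · filter_upwards [ae_restrict_mem measurableSet_unitSquare] with y hy c' hc' using hC c' hc' y hy
  · refine Eventually.of_forall fun y c' hc' => ?_
    have h1 : HasFDerivAt f (fderiv ℝ f (c', y)) (c', y) :=
      ((hf.contDiffAt ((hO.prod isOpen_univ).mem_nhds ⟨hrO hc', mem_univ y⟩)).differentiableAt
        (by norm_num)).hasFDerivAt
    have h2 : HasFDerivAt (fun c'' : E => (c'', y)) (ContinuousLinearMap.inl ℝ E Plane) c' :=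
      hasFDerivAt_prodMk_left c' y
    exact HasFDerivAt.comp (g := f) (f := fun c'' : E => (c'', y)) c' h1 h2

theorem contDiffOn_integral_unitSquare {f : E × Plane → G} {O : Set E} (hO : IsOpen O)
    (hf : ContDiffOn ℝ 1 f (O ×ˢ univ)) :
    ContDiffOn ℝ 1 (fun c => ∫ y in unitSquare, f (c, y)) O := by
  have hd : ContinuousOn (fun p => (fderiv ℝ f p).comp (ContinuousLinearMap.inl ℝ E Plane))
      (O ×ˢ univ) := by
    have h1 := hf.continuousOn_fderiv_of_isOpen (hO.prod isOpen_univ) le_rfl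
    fun_prop
  intro c hc
  refine ContDiffAt.contDiffWithinAt (contDiffAt_one_iff.2 ⟨_, O, hO.mem_nhds hc,
    continuousOn_integral_unitSquare hO hd, fun c' hc' =>
      hasFDerivAt_integral_unitSquare hO hf hc'⟩)

end ParametricIntegral

variable {S : Type*} [TopologicalSpace S] [ChartedSpace (EuclideanSpace ℝ (Fin 2)) S]
  [IsManifold (𝓡 2) ∞ S]
  {X : Type*} [TopologicalSpace X] [ChartedSpace (EuclideanSpace ℝ (Fin 4)) X]
  [IsManifold (𝓡 4) ∞ X]

namespace IsSemiFlatChart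

variable {gB : Metric 2 S} {proj : X → S}
  {gRef : ∀ x : X, TangentSpace (𝓡 4) x →L[ℝ] TangentSpace (𝓡 4) x →L[ℝ] ℝ}
  {U : Set S} {Ψ : S × Plane → X} {h : S → Matrix (Fin 2) (Fin 2) ℝ}
  (H : IsSemiFlatChart gB proj gRef U Ψ h)
include H

theorem isOpen_chart (b : S) : IsOpen ((chartAt (EuclideanSpace ℝ (Fin 2)) b).target ∩
    (chartAt (EuclideanSpace ℝ (Fin 2)) b).symm ⁻¹' U) :=
  (chartAt (EuclideanSpace ℝ (Fin 2)) b).symm.isOpen_inter_preimage H.isOpen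

variable {G : Type*} [NormedAddCommGroup G] [NormedSpace ℝ G] {f : X → G} {V : Set X}

theorem contDiffOn_comp (hV : IsOpen V) (hf : ContMDiffOn (𝓡 4) 𝓘(ℝ, G) 1 f V)
    (hΨ : ∀ b ∈ U, ∀ y, Ψ (b, y) ∈ V) (b : S) :
    ContDiffOn ℝ 1 (fun p : EuclideanSpace ℝ (Fin 2) × Plane =>
      f (Ψ ((chartAt (EuclideanSpace ℝ (Fin 2)) b).symm p.1, p.2)))
      (((chartAt (EuclideanSpace ℝ (Fin 2)) b).target ∩
        (chartAt (EuclideanSpace ℝ (Fin 2)) b).symm ⁻¹' U) ×ˢ univ) := by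
  rintro ⟨c, y⟩ ⟨⟨hc, hcU⟩, -⟩
  set cB := chartAt (EuclideanSpace ℝ (Fin 2)) b with hcB
  have h1 : ContMDiffAt (𝓡 2) (𝓡 2) 1 cB.symm c :=
    ((contMDiffOn_chart_symm (I := 𝓡 2) (n := ∞) (x := b)).contMDiffAt
      (cB.open_target.mem_nhds hc)).of_le (by norm_cast)
  have h2 : ContMDiffAt ((𝓡 2).prod (𝓡 2)) ((𝓡 2).prod (𝓡 2)) 1
      (fun p : EuclideanSpace ℝ (Fin 2) × Plane => (cB.symm p.1, p.2)) (c, y) :=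
    (ContMDiffAt.comp (f := Prod.fst) (c, y) h1 contMDiffAt_fst).prodMk contMDiffAt_snd
  have h3 : ContMDiffAt ((𝓡 2).prod (𝓡 2)) 𝓘(ℝ, G) 1
      (fun p : EuclideanSpace ℝ (Fin 2) × Plane => f (Ψ (cB.symm p.1, p.2))) (c, y) := by
    refine ContMDiffAt.comp (g := f) (f := fun p : EuclideanSpace ℝ (Fin 2) × Plane =>
      Ψ (cB.symm p.1, p.2)) (c, y) (hf.contMDiffAt (hV.mem_nhds (hΨ _ hcU y))) ?_
    exact ContMDiffAt.comp (g := Ψ) (f := fun p : EuclideanSpace ℝ (Fin 2) × Plane =>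
      (cB.symm p.1, p.2)) (c, y) ((H.contMDiffAt hcU y).of_le (by norm_cast)) h2
  have h4 := (contMDiffAt_iff.1 h3).2
  simp only [ModelWithCorners.range_eq_univ, contDiffWithinAt_univ] at h4
  exact ContDiffAt.contDiffWithinAt h4

theorem fderiv_comp {b : S} (hb : b ∈ U) (y : Plane)
    (hf : MDifferentiableAt (𝓡 4) 𝓘(ℝ, G) f (Ψ (b, y))) (ζ : EuclideanSpace ℝ (Fin 2) × Plane) :
    fderiv ℝ (fun p : EuclideanSpace ℝ (Fin 2) × Plane =>
      f (Ψ ((chartAt (EuclideanSpace ℝ (Fin 2)) b).symm p.1, p.2)))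
      (chartAt (EuclideanSpace ℝ (Fin 2)) b b, y) ζ =
    mfderiv (𝓡 4) 𝓘(ℝ, G) f (Ψ (b, y)) (mfderiv ((𝓡 2).prod (𝓡 2)) (𝓡 4) Ψ (b, y) ζ) := by
  have h1 := (hf.hasMFDerivAt.comp (b, y) (H.mdifferentiableAt hb y).hasMFDerivAt).2
  simp only [ModelWithCorners.range_eq_univ] at h1
  let D : EuclideanSpace ℝ (Fin 2) × Plane →L[ℝ] G :=
    (mfderiv (𝓡 4) 𝓘(ℝ, G) f (Ψ (b, y))).comp (mfderiv ((𝓡 2).prod (𝓡 2)) (𝓡 4) Ψ (b, y))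
  have h2 : HasFDerivAt (fun p : EuclideanSpace ℝ (Fin 2) × Plane =>
      f (Ψ ((chartAt (EuclideanSpace ℝ (Fin 2)) b).symm p.1, p.2))) D
      (chartAt (EuclideanSpace ℝ (Fin 2)) b b, y) := hasFDerivWithinAt_univ.1 h1
  exact DFunLike.congr_fun h2.fderiv ζ

end IsSemiFlatChart

/-! ### Differentiation of fibre averages. -/

namespace TorusFibration

variable {gB : Metric 2 S} {B₀ : Set S} (T : TorusFibration gB B₀ X)
  [MeasurableSpace X] [BorelSpace X] [T2Space X] {f : X → ℂ}

theorem aestronglyMeasurable_haar [T1Space S] (hB₀ : IsOpen B₀) (hf : ContinuousOn f T.total)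
    {b : S} (hb : b ∈ B₀) : AEStronglyMeasurable f (T.haar b) := by
  have h1 : (T.haar b).restrict T.total = T.haar b :=
    Measure.restrict_eq_self_of_ae_mem ((T.ae_haar hb).mono fun x hx => hx.2)
  rw [← h1]
  have : SecondCountableTopologyEither X ℂ := inferInstance
  exact hf.aestronglyMeasurable (T.isOpen_total hB₀).measurableSet

/-- In the chart at `b` the averages over all nearby fibres are integrals over the same square, so
one differentiates under the integral sign; a base direction acts as its horizontal lift `(ξ, 0)`.
-/
theorem contMDiffAt_integral_haar [T1Space S] (hB₀ : IsOpen B₀)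
    (hf : ContMDiffOn (𝓡 4) 𝓘(ℝ, ℂ) 1 f T.total) {b : S} (hb : b ∈ B₀) :
    ContMDiffAt (𝓡 2) 𝓘(ℝ, ℂ) 1 (fun b => ∫ x, f x ∂T.haar b) b ∧
    ∀ ξ : TangentSpace (𝓡 2) b, differential (fun b => ∫ x, f x ∂T.haar b) b ξ =
      ∫ y in unitSquare, differential f (T.chart b (b, y))
        (mfderiv ((𝓡 2).prod (𝓡 2)) (𝓡 4) (T.chart b) (b, y)
          ((ξ, 0) : EuclideanSpace ℝ (Fin 2) × Plane)) := by
  have H := T.isSemiFlatChart b hb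
  have hbU := T.mem_nbhd b hb
  set cB := chartAt (EuclideanSpace ℝ (Fin 2)) b with hcB
  set O := cB.target ∩ cB.symm ⁻¹' T.nbhd b with hO
  have hOo : IsOpen O := H.isOpen_chart b
  have hcb : cB b ∈ O := ⟨cB.map_source (mem_chart_source _ b), by
    rw [mem_preimage, cB.left_inv (mem_chart_source _ b)]; exact hbU⟩
  have hC := H.contDiffOn_comp (T.isOpen_total hB₀) hf
    (fun b' hb' y => T.chart_mem_total hb hb' y) b
  have hD := hasFDerivAt_integral_unitSquare hOo hC hcb
  have hD1 := (contDiffOn_integral_unitSquare hOo hC).contDiffAt (hOo.mem_nhds hcb)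
  have heq : ∀ c ∈ O, ∫ x, f x ∂T.haar (cB.symm c) =
      ∫ y in unitSquare, f (T.chart b (cB.symm c, y)) := fun c hc =>
    T.integral_haar hb hc.2 (T.aestronglyMeasurable_haar hB₀ hf.continuousOn
      (T.nbhd_subset b hb hc.2))
  have heq' : (fun c => ∫ x, f x ∂T.haar (cB.symm c)) =ᶠ[𝓝 (cB b)]
      fun c => ∫ y in unitSquare, f (T.chart b (cB.symm c, y)) :=
    eventually_of_mem (hOo.mem_nhds hcb) heq
  have hM : ContMDiffAt (𝓡 2) 𝓘(ℝ, ℂ) 1 (fun b => ∫ x, f x ∂T.haar b) b := by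
    have h1 : ContMDiffAt (𝓡 2) 𝓘(ℝ, ℂ) 1
        (fun b' => ∫ y in unitSquare, f (T.chart b (cB.symm (cB b'), y))) b :=
      ContMDiffAt.comp (f := cB) (g := fun c => ∫ y in unitSquare, f (T.chart b (cB.symm c, y)))
        (I' := 𝓡 2) b hD1.contMDiffAt ((contMDiffAt_extChartAt (I := 𝓡 2) (n := 1) (x := b)))
    refine h1.congr_of_eventuallyEq ?_
    have h2 := (cB.continuousAt (mem_chart_source _ b)).eventually heq'
    filter_upwards [h2, cB.open_source.mem_nhds (mem_chart_source _ b)] with b' hb' hs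
    rw [cB.left_inv hs] at hb' ⊢
    exact hb'
  refine ⟨hM, fun ξ => ?_⟩
  let D : EuclideanSpace ℝ (Fin 2) →L[ℝ] ℂ :=
    ∫ y in unitSquare, (fderiv ℝ (fun p : EuclideanSpace ℝ (Fin 2) × Plane =>
        f (T.chart b (cB.symm p.1, p.2))) (cB b, y)).comp
          (ContinuousLinearMap.inl ℝ (EuclideanSpace ℝ (Fin 2)) Plane)
  have hmf : HasMFDerivAt (𝓡 2) 𝓘(ℝ, ℂ) (fun b => ∫ x, f x ∂T.haar b) b D := by
    refine ⟨hM.continuousAt, ?_⟩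
    simp only [ModelWithCorners.range_eq_univ]
    exact hasFDerivWithinAt_univ.2 (hD.congr_of_eventuallyEq heq')
  have hslice : Continuous fun y => (fderiv ℝ (fun p : EuclideanSpace ℝ (Fin 2) × Plane =>
        f (T.chart b (cB.symm p.1, p.2))) (cB b, y)).comp
          (ContinuousLinearMap.inl ℝ (EuclideanSpace ℝ (Fin 2)) Plane) := by
    have h1 := continuous_slice
      (hC.continuousOn_fderiv_of_isOpen (hOo.prod isOpen_univ) le_rfl) hcb
    fun_prop
  have h3 : differential (fun b => ∫ x, f x ∂T.haar b) b = D := hmf.mfderiv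
  have h4 := ContinuousLinearMap.integral_apply (integrableOn_unitSquare hslice)
    (show EuclideanSpace ℝ (Fin 2) from ξ)
  refine (DFunLike.congr_fun h3 ξ).trans (h4.trans ?_)
  refine integral_congr_ae (Eventually.of_forall fun y => ?_)
  have h5 := H.fderiv_comp hbU y ((hf.contMDiffAt ((T.isOpen_total hB₀).mem_nhds
    (T.chart_mem_total hb hbU y))).mdifferentiableAt (by norm_num))
  exact h5 ((ξ, 0) : EuclideanSpace ℝ (Fin 2) × Plane)

theorem continuous_differential_chart (hB₀ : IsOpen B₀)
    (hf : ContMDiffOn (𝓡 4) 𝓘(ℝ, ℂ) 1 f T.total) {b : S} (hb : b ∈ B₀)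
    (ζ : EuclideanSpace ℝ (Fin 2) × Plane) :
    Continuous fun y => differential f (T.chart b (b, y))
        (mfderiv ((𝓡 2).prod (𝓡 2)) (𝓡 4) (T.chart b) (b, y) ζ) := by
  have H := T.isSemiFlatChart b hb
  have hbU := T.mem_nbhd b hb
  set cB := chartAt (EuclideanSpace ℝ (Fin 2)) b with hcB
  have hcb : cB b ∈ cB.target ∩ cB.symm ⁻¹' T.nbhd b :=
    ⟨cB.map_source (mem_chart_source _ b), by
    rw [mem_preimage, cB.left_inv (mem_chart_source _ b)]; exact hbU⟩
  have hC := H.contDiffOn_comp (T.isOpen_total hB₀) hf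
    (fun b' hb' y => T.chart_mem_total hb hb' y) b
  have h1 := (continuous_slice (hC.continuousOn_fderiv_of_isOpen
    ((H.isOpen_chart b).prod isOpen_univ) le_rfl) hcb).clm_apply (continuous_const (y := ζ))
  refine h1.congr fun y => ?_
  have h5 := H.fderiv_comp hbU y ((hf.contMDiffAt ((T.isOpen_total hB₀).mem_nhds
    (T.chart_mem_total hb hbU y))).mdifferentiableAt (by norm_num))
  exact h5 ζ

end TorusFibration
end SemiFlat
end

noncomputable section
namespace SemiFlat

/-! ### Gram matrices close to the identity. -/

section NearIdentity

variable {G : Matrix (Fin 4) (Fin 4) ℝ} {ε : ℝ}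

/-- The operator norm of a `4 × 4` matrix is at most four times its largest entry. -/
theorem norm_mulVec_le {M : Matrix (Fin 4) (Fin 4) ℝ} (hε : 0 ≤ ε) (hM : ∀ i j, |M i j| ≤ ε)
    (z : EuclideanSpace ℂ (Fin 4)) :
    ‖(WithLp.toLp 2 fun i => ∑ j, (M i j : ℂ) * z j : EuclideanSpace ℂ (Fin 4))‖ ≤
      4 * ε * ‖z‖ := by
  rw [← sq_le_sq₀ (norm_nonneg _) (by positivity), EuclideanSpace.norm_sq_eq, mul_pow,
    EuclideanSpace.norm_sq_eq]
  have h1 : ∀ i, ‖∑ j, (M i j : ℂ) * z j‖ ^ 2 ≤ ε ^ 2 * (4 * ∑ j, ‖z j‖ ^ 2) := by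
    intro i
    have h2 : ‖∑ j, (M i j : ℂ) * z j‖ ≤ ε * ∑ j, ‖z j‖ := by
      rw [Finset.mul_sum]
      refine (norm_sum_le _ _).trans (Finset.sum_le_sum fun j _ => ?_)
      rw [norm_mul, Complex.norm_real]
      exact mul_le_mul_of_nonneg_right (hM i j) (norm_nonneg _)
    have h3 := sq_sum_le_card_mul_sum_sq (s := Finset.univ) (f := fun j => ‖z j‖)
    simp only [Finset.card_univ, Fintype.card_fin, Nat.cast_ofNat] at h3
    calc _ ≤ (ε * ∑ j, ‖z j‖) ^ 2 := by gcongr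
      _ = ε ^ 2 * (∑ j, ‖z j‖) ^ 2 := mul_pow _ _ _
      _ ≤ _ := by gcongr
  refine (Finset.sum_le_sum fun i _ => h1 i).trans (le_of_eq ?_)
  rw [Finset.sum_const, Finset.card_univ, Fintype.card_fin, nsmul_eq_mul]
  push_cast
  ring

theorem norm_sub_le_of_near_one (hε : 0 ≤ ε)
    (hG : ∀ i j, |G i j - (1 : Matrix (Fin 4) (Fin 4) ℝ) i j| ≤ ε)
    (z : EuclideanSpace ℂ (Fin 4)) :
    ‖(WithLp.toLp 2 fun i => ∑ j, (G i j : ℂ) * z j : EuclideanSpace ℂ (Fin 4)) - z‖ ≤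
      4 * ε * ‖z‖ := by
  refine le_of_eq_of_le (congrArg _ ?_) (norm_mulVec_le (M := G - 1) hε hG z)
  ext i
  simp only [PiLp.sub_apply, Matrix.sub_apply, Complex.ofReal_sub, sub_mul,
    Finset.sum_sub_distrib]
  congr 1
  simp [Matrix.one_apply, apply_ite (Complex.ofReal)]

theorem det_ne_zero_of_near_one (hε : 0 ≤ ε) (hε8 : ε ≤ 1 / 8)
    (hG : ∀ i j, |G i j - (1 : Matrix (Fin 4) (Fin 4) ℝ) i j| ≤ ε) : G.det ≠ 0 := by
  intro h0
  obtain ⟨v, hv, hGv⟩ := Matrix.exists_mulVec_eq_zero_iff.2 h0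
  have h1 := norm_sub_le_of_near_one hε hG (WithLp.toLp 2 fun i => (v i : ℂ))
  have h2 : (WithLp.toLp 2 fun i => ∑ j, (G i j : ℂ) *
      (WithLp.toLp 2 fun i => (v i : ℂ) : EuclideanSpace ℂ (Fin 4)) j :
        EuclideanSpace ℂ (Fin 4)) = 0 := by
    ext i
    have := congrFun hGv i
    simp only [Matrix.mulVec, dotProduct, Pi.zero_apply] at this
    simp only [PiLp.zero_apply]
    rw [← Complex.ofReal_zero, ← this]
    push_cast
    rfl
  rw [h2, zero_sub, norm_neg] at h1
  have h3 : (WithLp.toLp 2 fun i => (v i : ℂ) : EuclideanSpace ℂ (Fin 4)) = 0 := by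
    rw [← norm_le_zero_iff]
    nlinarith [norm_nonneg (WithLp.toLp 2 fun i => (v i : ℂ) : EuclideanSpace ℂ (Fin 4))]
  refine hv (funext fun i => ?_)
  have := congrArg (fun u : EuclideanSpace ℂ (Fin 4) => u i) h3
  simpa using this

/-- For a Gram matrix close to the identity, the dual inner product is close to the standard one. -/
theorem dual_inner_near (hε : 0 ≤ ε) (hε8 : ε ≤ 1 / 8)
    (hG : ∀ i j, |G i j - (1 : Matrix (Fin 4) (Fin 4) ℝ) i j| ≤ ε)
    (p a : EuclideanSpace ℂ (Fin 4)) :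
    ‖a‖ ^ 2 ≤ 9 * (∑ i, ∑ j, ((G⁻¹ i j : ℝ) : ℂ) * conj (a i) * a j).re ∧
    ‖∑ i, ∑ j, ((G⁻¹ i j : ℝ) : ℂ) * conj (p i) * a j - ∑ i, conj (p i) * a i‖ ≤
      8 * ε * ‖p‖ * ‖a‖ := by
  have hdet := det_ne_zero_of_near_one hε hε8 hG
  -- With `z = G⁻¹ a` one has `a = G z`, so `‖a - z‖ ≤ 4 ε ‖z‖ ≤ ‖z‖ / 2`, the last step by `ε ≤
  -- 1/8`. Hence `‖z‖` and `‖a‖` are comparable, which yields both the lower bound and the factor `8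
  -- ε = 4 ε · 2`.
  set z : EuclideanSpace ℂ (Fin 4) := WithLp.toLp 2 fun i => ∑ j, ((G⁻¹ i j : ℝ) : ℂ) * a j with hz
  have ha : (WithLp.toLp 2 fun i => ∑ j, (G i j : ℂ) * z j : EuclideanSpace ℂ (Fin 4)) = a := by
    ext i
    have h1 : (G.map Complex.ofRealHom) * (G⁻¹.map Complex.ofRealHom) = 1 := by
      have := congrArg (fun M : Matrix (Fin 4) (Fin 4) ℝ => M.map Complex.ofRealHom)
        (Matrix.mul_nonsing_inv G (isUnit_iff_ne_zero.2 hdet))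
      simpa [Matrix.map_mul] using this
    have h2 : (G.map Complex.ofRealHom).mulVec ((G⁻¹.map Complex.ofRealHom).mulVec a.ofLp) = a.ofLp := by
      rw [Matrix.mulVec_mulVec, h1, Matrix.one_mulVec]
    exact congrFun h2 i
  have h1 := norm_sub_le_of_near_one hε hG z
  rw [ha] at h1
  have hzn := norm_nonneg z
  have h1' : ‖a - z‖ ≤ 1 / 2 * ‖z‖ := h1.trans (by nlinarith)
  have hza : ‖z‖ ≤ 2 * ‖a‖ := by
    have := norm_sub_norm_le z a
    rw [norm_sub_rev] at this
    linarith
  have haz : ‖a‖ ≤ 3 / 2 * ‖z‖ := by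
    have := norm_sub_norm_le a z
    linarith
  have hsum : ∀ q : EuclideanSpace ℂ (Fin 4),
      ∑ i, ∑ j, ((G⁻¹ i j : ℝ) : ℂ) * conj (q i) * a j = Inner.inner ℂ q z := by
    intro q
    rw [PiLp.inner_apply]
    refine Finset.sum_congr rfl fun i _ => ?_
    rw [RCLike.inner_apply, hz]
    simp only [Finset.sum_mul]
    exact Finset.sum_congr rfl fun j _ => by ring
  have hsum' : ∑ i, conj (p i) * a i = Inner.inner ℂ p a := by
    rw [PiLp.inner_apply]
    exact Finset.sum_congr rfl fun i _ => by rw [RCLike.inner_apply, mul_comm]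
  constructor
  · rw [hsum]
    have h2 : (Inner.inner ℂ a z : ℂ) = Inner.inner ℂ z z + Inner.inner ℂ (a - z) z := by
      rw [← inner_add_left]; simp
    have h3 : (Inner.inner ℂ z z : ℂ).re = ‖z‖ ^ 2 := (norm_sq_eq_re_inner (𝕜 := ℂ) z).symm
    have h4 : |(Inner.inner ℂ (a - z) z : ℂ).re| ≤ ‖a - z‖ * ‖z‖ :=
      (Complex.abs_re_le_norm _).trans (norm_inner_le_norm _ _)
    rw [h2, Complex.add_re, h3]
    have h5 := (abs_le.1 h4).1
    have h6 : ‖a‖ ^ 2 ≤ (3 / 2 * ‖z‖) ^ 2 := by gcongr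
    nlinarith
  · rw [hsum, hsum', ← inner_sub_right]
    refine (norm_inner_le_norm _ _).trans ?_
    rw [norm_sub_rev]
    calc ‖p‖ * ‖a - z‖ ≤ ‖p‖ * (4 * ε * (2 * ‖a‖)) := by
          refine mul_le_mul_of_nonneg_left (h1.trans ?_) (norm_nonneg _)
          gcongr
      _ = _ := by ring

end NearIdentity

variable {S : Type*} [TopologicalSpace S] [ChartedSpace (EuclideanSpace ℝ (Fin 2)) S]
  [IsManifold (𝓡 2) ∞ S]
  {X : Type*} [TopologicalSpace X] [ChartedSpace (EuclideanSpace ℝ (Fin 4)) X]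
  [IsManifold (𝓡 4) ∞ X]

/-! ### Comparison of covector pairings on the total space and on the base. -/

namespace IsSemiFlatChart

variable {gB : Metric 2 S} {proj : X → S}
  {gRef : ∀ x : X, TangentSpace (𝓡 4) x →L[ℝ] TangentSpace (𝓡 4) x →L[ℝ] ℝ}
  {U : Set S} {Ψ : S × Plane → X} {h : S → Matrix (Fin 2) (Fin 2) ℝ}
  (H : IsSemiFlatChart gB proj gRef U Ψ h)
include H

theorem mfderiv_proj_mfderiv {b : S} (hb : b ∈ U) (y : Plane)
    (hproj : MDifferentiableAt (𝓡 4) (𝓡 2) proj (Ψ (b, y)))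
    (ζ : EuclideanSpace ℝ (Fin 2) × Plane) :
    mfderiv (𝓡 4) (𝓡 2) proj (Ψ (b, y))
      (mfderiv ((𝓡 2).prod (𝓡 2)) (𝓡 4) Ψ (b, y) ζ) = ζ.1 := by
  have h1 := hproj.hasMFDerivAt.comp (b, y) (H.mdifferentiableAt hb y).hasMFDerivAt
  have h2 : HasMFDerivAt ((𝓡 2).prod (𝓡 2)) (𝓡 2) (proj ∘ Ψ) (b, y)
      (ContinuousLinearMap.fst ℝ (TangentSpace (𝓡 2) b) (TangentSpace (𝓡 2) y)) := by
    refine (hasMFDerivAt_fst (x := ((b, y) : S × Plane))).congr_of_eventuallyEq ?_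
    filter_upwards [(H.isOpen.prod isOpen_univ).mem_nhds (⟨hb, mem_univ y⟩ : (b, y) ∈ U ×ˢ univ)]
      with p hp
    exact H.proj_eq p.1 hp.1 p.2
  exact DFunLike.congr_fun (hasMFDerivAt_unique h1 h2) ζ

/-- Vectors `(ξ, 0)` in semi-flat coordinates are horizontal in the sense in which the gradient of
`ρ` is bounded. -/
theorem gRef_horizontal {b : S} (hb : b ∈ U) (y : Plane)
    (hproj : MDifferentiableAt (𝓡 4) (𝓡 2) proj (Ψ (b, y))) (ξ : TangentSpace (𝓡 2) b)
    (w : TangentSpace (𝓡 4) (Ψ (b, y))) (hw : mfderiv (𝓡 4) (𝓡 2) proj (Ψ (b, y)) w = 0) :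
    gRef (Ψ (b, y)) (mfderiv ((𝓡 2).prod (𝓡 2)) (𝓡 4) Ψ (b, y)
      ((ξ, 0) : EuclideanSpace ℝ (Fin 2) × Plane)) w = 0 := by
  obtain ⟨⟨ξ', η⟩, rfl⟩ := (H.mfderiv_bijective hb y).2 w
  have h1 : ξ' = 0 := (H.mfderiv_proj_mfderiv hb y hproj (ξ', η)).symm.trans hw
  subst h1
  refine (H.metric_eq b hb y ξ 0 0 η).trans ?_
  simp [matForm]

theorem gRef_horizontal_self {b : S} (hb : b ∈ U) (y : Plane) (ξ : TangentSpace (𝓡 2) b) :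
    gRef (Ψ (b, y)) (mfderiv ((𝓡 2).prod (𝓡 2)) (𝓡 4) Ψ (b, y)
      ((ξ, 0) : EuclideanSpace ℝ (Fin 2) × Plane)) (mfderiv ((𝓡 2).prod (𝓡 2)) (𝓡 4) Ψ (b, y)
      ((ξ, 0) : EuclideanSpace ℝ (Fin 2) × Plane)) = gB.inner b ξ ξ := by
  refine (H.metric_eq b hb y ξ ξ 0 0).trans ?_
  simp [matForm]

/-- Adapted orthonormal frames of the reference metric. -/
theorem exists_adapted_frame {b : S} (hb : b ∈ U) (y : Plane) (e : Fin 2 → TangentSpace (𝓡 2) b)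
    (he : ∀ i j, gB.inner b (e i) (e j) = if i = j then 1 else 0) :
    ∃ ζ : Fin 4 → EuclideanSpace ℝ (Fin 2) × Plane, ζ 0 = (e 0, 0) ∧ ζ 1 = (e 1, 0) ∧
      (ζ 2).1 = 0 ∧ (ζ 3).1 = 0 ∧ ∀ i j, gRef (Ψ (b, y))
        (mfderiv ((𝓡 2).prod (𝓡 2)) (𝓡 4) Ψ (b, y) (ζ i))
        (mfderiv ((𝓡 2).prod (𝓡 2)) (𝓡 4) Ψ (b, y) (ζ j)) = if i = j then 1 else 0 := by
  obtain ⟨f, hf⟩ := exists_orthonormal_basis_of_form (V := Plane) (n := 2) (matForm (h b))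
    (fun v w => by
      have hs : ∀ i j, h b i j = h b j i := fun i j => by
        simpa using (congrFun (congrFun (H.h_posDef b hb).isHermitian i) j).symm
      simp only [matForm, Fin.sum_univ_two]
      rw [hs 0 1]
      ring) (fun v hv => matForm_pos (H.h_posDef b hb) hv)
    (fun u v w => by simp only [matForm, Fin.sum_univ_two, PiLp.add_apply]; ring)
    (fun r v w => by simp only [matForm, Fin.sum_univ_two, PiLp.smul_apply, smul_eq_mul]; ring)
    finrank_euclideanSpace_fin
  refine ⟨![(e 0, 0), (e 1, 0), (0, f 0), (0, f 1)], rfl, rfl, rfl, rfl, fun i j => ?_⟩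
  refine (H.metric_eq b hb y _ _ _ _).trans ?_
  have h0 : ∀ v, matForm (h b) 0 v = 0 := fun v => by simp [matForm]
  have h0' : ∀ v, matForm (h b) v 0 = 0 := fun v => by simp [matForm]
  have g0 : ∀ v, gB.inner b (0 : EuclideanSpace ℝ (Fin 2)) v = 0 := fun v => by
    change gB.inner b (0 : TangentSpace (𝓡 2) b) v = 0
    rw [map_zero]; rfl
  have g0' : ∀ v, gB.inner b v (0 : EuclideanSpace ℝ (Fin 2)) = 0 := fun v => by
    change gB.inner b v (0 : TangentSpace (𝓡 2) b) = 0
    rw [map_zero]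
  have hee : ∀ i j, gB.inner b (e i) (e j) + matForm (h b) 0 0 = if i = j then 1 else 0 :=
    fun i j => by rw [he, h0, add_zero]
  have hef : ∀ i j, gB.inner b (e i) (0 : EuclideanSpace ℝ (Fin 2)) + matForm (h b) 0 (f j) = 0 :=
    fun i j => by rw [h0, add_zero]; exact g0' _
  have hfe : ∀ i j, gB.inner b (0 : EuclideanSpace ℝ (Fin 2)) (e j) + matForm (h b) (f i) 0 = 0 :=
    fun i j => by rw [h0', add_zero]; exact g0 _
  have hff : ∀ i j, gB.inner b (0 : EuclideanSpace ℝ (Fin 2)) (0 : EuclideanSpace ℝ (Fin 2)) +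
      matForm (h b) (f i) (f j) = if i = j then 1 else 0 :=
    fun i j => by
      rw [hf]
      exact (congrArg (· + _) (g0 _)).trans (zero_add _)
  fin_cases i <;> fin_cases j
  exacts [(hee 0 0).trans (by simp), (hee 0 1).trans (by simp), (hef 0 0).trans (by simp),
    (hef 0 1).trans (by simp), (hee 1 0).trans (by simp), (hee 1 1).trans (by simp),
    (hef 1 0).trans (by simp), (hef 1 1).trans (by simp), (hfe 0 0).trans (by simp),
    (hfe 0 1).trans (by simp), (hff 0 0).trans (by simp), (hff 0 1).trans (by simp),
    (hfe 1 0).trans (by simp), (hfe 1 1).trans (by simp), (hff 1 0).trans (by simp),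
    (hff 1 1).trans (by simp)]

/-- Comparison of the inner product of covectors for a metric close to the reference metric with
the one on the base. -/
theorem covectorInner_near {b : S} (hb : b ∈ U) (y : Plane)
    (hproj : MDifferentiableAt (𝓡 4) (𝓡 2) proj (Ψ (b, y))) (g : Metric 4 X) {ε : ℝ} (hε : 0 ≤ ε)
    (hε8 : ε ≤ 1 / 8)
    (hg : ∀ v w : TangentSpace (𝓡 4) (Ψ (b, y)),
      |g.inner (Ψ (b, y)) v w - gRef (Ψ (b, y)) v w| ≤
        ε * Real.sqrt (gRef (Ψ (b, y)) v v) * Real.sqrt (gRef (Ψ (b, y)) w w))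
    (e : Fin 2 → TangentSpace (𝓡 2) b)
    (he : ∀ i j, gB.inner b (e i) (e j) = if i = j then 1 else 0)
    (β : TangentSpace (𝓡 2) b →L[ℝ] ℂ) (π : TangentSpace (𝓡 4) (Ψ (b, y)) →L[ℝ] ℂ)
    (hπ : ∀ v, π v = β (mfderiv (𝓡 4) (𝓡 2) proj (Ψ (b, y)) v))
    (a : TangentSpace (𝓡 4) (Ψ (b, y)) →L[ℝ] ℂ) (a' : Fin 2 → ℂ)
    (ha' : ∀ i, a' i = a (mfderiv ((𝓡 2).prod (𝓡 2)) (𝓡 4) Ψ (b, y)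
      ((e i, 0) : EuclideanSpace ℝ (Fin 2) × Plane))) :
    ∑ i, ‖a' i‖ ^ 2 ≤ 9 * cnorm g (Ψ (b, y)) a ^ 2 ∧
    ‖covectorInner g (Ψ (b, y)) π a - ∑ i, conj (β (e i)) * a' i‖ ≤
      24 * ε * cnorm gB b β * cnorm g (Ψ (b, y)) a := by
  obtain ⟨ζ, hζ0, hζ1, hζ2, hζ3, hζ⟩ := H.exists_adapted_frame hb y e he
  set u : Fin 4 → TangentSpace (𝓡 4) (Ψ (b, y)) := fun i =>
    mfderiv ((𝓡 2).prod (𝓡 2)) (𝓡 4) Ψ (b, y) (ζ i) with hu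
  have hζ' : ∀ i j, gRef (Ψ (b, y)) (u i) (u j) = if i = j then 1 else 0 := hζ
  have hG : ∀ i j, |gram g (Ψ (b, y)) u i j - (1 : Matrix (Fin 4) (Fin 4) ℝ) i j| ≤ ε := by
    intro i j
    have h1 := hg (u i) (u j)
    rw [hζ', hζ', hζ'] at h1
    simpa [gram, Matrix.one_apply] using h1
  have hfr := covectorInner_eq_of_frame g (Ψ (b, y)) u (det_ne_zero_of_near_one hε hε8 hG)
  have hπu : ∀ i, π (u i) = β ((ζ i).1 : EuclideanSpace ℝ (Fin 2)) := fun i => by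
    rw [hπ]
    exact congrArg _ (H.mfderiv_proj_mfderiv hb y hproj (ζ i))
  have hp0 : π (u 0) = β (e 0) := by rw [hπu, hζ0]
  have hp1 : π (u 1) = β (e 1) := by rw [hπu, hζ1]
  -- A covector pulled back from the base vanishes on the vertical frame vectors, so the vertical
  -- components of `a` drop out of the leading term. They survive only in the error, through the
  -- full norm of `a`; the bound `‖a‖ ≤ 3 cnorm` turns `8 ε` into `24 ε`.
  have hp2 : π (u 2) = 0 := by rw [hπu, hζ2]; exact map_zero β
  have hp3 : π (u 3) = 0 := by rw [hπu, hζ3]; exact map_zero β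
  have ha0 : a (u 0) = a' 0 := by rw [ha', hu]; simp only [hζ0]; rfl
  have ha1 : a (u 1) = a' 1 := by rw [ha', hu]; simp only [hζ1]; rfl
  obtain ⟨h1, h2⟩ := dual_inner_near hε hε8 hG (WithLp.toLp 2 fun i => π (u i))
    (WithLp.toLp 2 fun i => a (u i))
  simp only at h1 h2
  rw [← hfr] at h1 h2
  rw [covectorInner_self, Complex.ofReal_re] at h1
  have hpn : ‖(WithLp.toLp 2 fun i => π (u i) : EuclideanSpace ℂ (Fin 4))‖ = cnorm gB b β := by
    rw [← sq_eq_sq₀ (norm_nonneg _) (cnorm_nonneg _ _ _), EuclideanSpace.norm_sq_eq,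
      cnorm_sq_eq_of_orthonormal gB b e he, Fin.sum_univ_four, Fin.sum_univ_two]
    simp only [hp0, hp1, hp2, hp3]
    simp
  have han : ‖(WithLp.toLp 2 fun i => a (u i) : EuclideanSpace ℂ (Fin 4))‖ ≤ 3 * cnorm g (Ψ (b, y)) a := by
    rw [← sq_le_sq₀ (norm_nonneg _) (by have := cnorm_nonneg g (Ψ (b, y)) a; positivity)]
    linarith
  constructor
  · refine le_trans ?_ h1
    rw [EuclideanSpace.norm_sq_eq, Fin.sum_univ_four, Fin.sum_univ_two]
    simp only [ha0, ha1]
    have := sq_nonneg ‖a (u 2)‖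
    have := sq_nonneg ‖a (u 3)‖
    linarith
  · rw [hpn, Fin.sum_univ_four] at h2
    simp only [hp0, hp1, hp2, hp3, ha0, ha1, map_zero, zero_mul, add_zero] at h2
    rw [Fin.sum_univ_two]
    refine h2.trans ?_
    have := cnorm_nonneg gB b β
    calc 8 * ε * cnorm gB b β * _ ≤ 8 * ε * cnorm gB b β * (3 * cnorm g (Ψ (b, y)) a) := by gcongr
      _ = _ := by ring

end IsSemiFlatChart
end SemiFlat
end

noncomputable section
namespace SemiFlat

/-! ### Products of `C¹` functions and powers of the base density. -/

section Product

variable {n : ℕ} {M : Type*} [TopologicalSpace M] [ChartedSpace (EuclideanSpace ℝ (Fin n)) M]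
  [IsManifold (𝓡 n) ∞ M] {U : Set M}

theorem contMDiff_of_tsupport {φ : M → ℂ} (hU : IsOpen U) (h : ContMDiffOn (𝓡 n) 𝓘(ℝ, ℂ) 1 φ U)
    (hφ : tsupport φ ⊆ U) : ContMDiff (𝓡 n) 𝓘(ℝ, ℂ) 1 φ := by
  intro x
  by_cases hx : x ∈ tsupport φ
  · exact h.contMDiffAt (hU.mem_nhds (hφ hx))
  · exact contMDiffAt_const.congr_of_eventuallyEq (notMem_tsupport_iff_eventuallyEq.1 hx)

/-- The product of a compactly supported function with a function that is `C¹` on `U`. -/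
def C1c.mulOn (hU : IsOpen U) (c : M → ℝ) (hc : ContMDiffOn (𝓡 n) 𝓘(ℝ, ℝ) 1 c U) (w : C1c n U) :
    C1c n U :=
  ⟨fun x => c x • (w : M → ℂ) x, contMDiff_of_tsupport hU (hc.smul w.2.1.contMDiffOn)
      ((tsupport_smul_subset_right c (w : M → ℂ)).trans w.2.2.2),
    HasCompactSupport.smul_left (f := c) (f' := (w : M → ℂ)) w.2.2.1,
    (tsupport_smul_subset_right c (w : M → ℂ)).trans w.2.2.2⟩

theorem differential_smul_apply {c : M → ℝ} {f : M → ℂ} {x : M}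
    (hc : MDifferentiableAt (𝓡 n) 𝓘(ℝ, ℝ) c x) (hf : MDifferentiableAt (𝓡 n) 𝓘(ℝ, ℂ) f x)
    (ξ : TangentSpace (𝓡 n) x) :
    differential (fun y => c y • f y) x ξ =
      c x * differential f x ξ + f x * (realDifferential c x ξ : ℝ) := by
  have h1 : HasMFDerivAt (𝓡 n) 𝓘(ℝ, ℂ) (fun y => (c y : ℂ)) x
      (Complex.ofRealCLM.comp (realDifferential c x)) := by
    have h2 : HasMFDerivAt 𝓘(ℝ, ℝ) 𝓘(ℝ, ℂ) (fun z : ℝ => (z : ℂ)) (c x) Complex.ofRealCLM :=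
      hasMFDerivAt_iff_hasFDerivAt.2 Complex.ofRealCLM.hasFDerivAt
    exact h2.comp x hc.hasMFDerivAt
  have h2 : differential (fun y => (c y : ℂ)) x = _ := h1.mfderiv
  have h3 := DFunLike.congr_fun (differential_real_smul hc hf) ξ
  rw [h2] at h3
  exact h3

/-- The powers `A^{±1/2}` are written as exponentials of multiples of `log A`, so that their
derivatives involve exactly the logarithmic gradient of `A` that is bounded by assumption. -/
theorem mdifferentiableAt_exp_log {A : M → ℝ} {x : M}
    (hA : MDifferentiableAt (𝓡 n) 𝓘(ℝ, ℝ) (fun y => Real.log (A y)) x) (s : ℝ) :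
    MDifferentiableAt (𝓡 n) 𝓘(ℝ, ℝ) (fun y => Real.exp (s * Real.log (A y))) x ∧
    ∀ ξ : TangentSpace (𝓡 n) x, realDifferential (fun y => Real.exp (s * Real.log (A y))) x ξ =
      Real.exp (s * Real.log (A x)) * (s * realDifferential (fun y => Real.log (A y)) x ξ) := by
  have h1 : HasFDerivAt (fun t : ℝ => Real.exp (s * t))
      (Real.exp (s * Real.log (A x)) • (s • ContinuousLinearMap.id ℝ ℝ)) (Real.log (A x)) :=
    (((hasFDerivAt_id (𝕜 := ℝ) (Real.log (A x))).const_mul s)).exp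
  have h2 : HasMFDerivAt (𝓡 n) 𝓘(ℝ, ℝ) (fun y => Real.exp (s * Real.log (A y))) x
      ((Real.exp (s * Real.log (A x)) • (s • ContinuousLinearMap.id ℝ ℝ)).comp
        (realDifferential (fun y => Real.log (A y)) x)) :=
    HasMFDerivAt.comp (g := fun t : ℝ => Real.exp (s * t)) (f := fun y => Real.log (A y))
      x (hasMFDerivAt_iff_hasFDerivAt.2 h1) hA.hasMFDerivAt
  refine ⟨h2.mdifferentiableAt, fun ξ => ?_⟩
  have h3 : realDifferential (fun y => Real.exp (s * Real.log (A y))) x = _ := h2.mfderiv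
  rw [h3]
  rfl

theorem contMDiffOn_log {A : M → ℝ} (hA : ContMDiffOn (𝓡 n) 𝓘(ℝ, ℝ) 1 A U)
    (hpos : ∀ x ∈ U, 0 < A x) : ContMDiffOn (𝓡 n) 𝓘(ℝ, ℝ) 1 (fun x => Real.log (A x)) U :=
  fun x hx => ContMDiffAt.comp_contMDiffWithinAt (g := Real.log) (f := A) x
    (Real.contDiffAt_log.2 (hpos x hx).ne').contMDiffAt (hA x hx)

theorem contMDiffOn_exp_log {A : M → ℝ} (hA : ContMDiffOn (𝓡 n) 𝓘(ℝ, ℝ) 1 A U)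
    (hpos : ∀ x ∈ U, 0 < A x) (s : ℝ) :
    ContMDiffOn (𝓡 n) 𝓘(ℝ, ℝ) 1 (fun x => Real.exp (s * Real.log (A x))) U := by
  have h1 : ContDiff ℝ 1 fun t : ℝ => Real.exp (s * t) := by fun_prop
  exact h1.contMDiff.comp_contMDiffOn (contMDiffOn_log hA hpos)

theorem exp_half_log {a : ℝ} (ha : 0 < a) : Real.exp (1 / 2 * Real.log a) = Real.sqrt a := by
  rw [Real.sqrt_eq_rpow, Real.rpow_def_of_pos ha, mul_comm]

theorem exp_neg_half_log {a : ℝ} (ha : 0 < a) :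
    Real.exp (-(1 / 2) * Real.log a) = (Real.sqrt a)⁻¹ := by
  rw [neg_mul, Real.exp_neg, exp_half_log ha]

end Product

/-! ### Lift and average as maps between the `C¹` cores. -/

namespace TorusFibration

variable {S : Type*} [TopologicalSpace S] [ChartedSpace (EuclideanSpace ℝ (Fin 2)) S]
  [IsManifold (𝓡 2) ∞ S]
  {X : Type*} [TopologicalSpace X] [ChartedSpace (EuclideanSpace ℝ (Fin 4)) X]
  [IsManifold (𝓡 4) ∞ X] {gB : Metric 2 S} {B₀ : Set S} (T : TorusFibration gB B₀ X)

/-- The pull back of compactly supported functions on the base. -/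
def pullC1 (q : C1c 2 B₀) : C1c 4 T.total :=
  have hsupp : tsupport (fun x => (q : S → ℂ) (T.proj x)) ⊆ T.proj ⁻¹' tsupport (q : S → ℂ) :=
    closure_minimal (fun _ hx => subset_tsupport _ hx)
      ((isClosed_tsupport _).preimage T.continuous_proj)
  ⟨fun x => (q : S → ℂ) (T.proj x),
    ContMDiff.comp (g := (q : S → ℂ)) q.2.1 (T.proj_smooth.of_le (by norm_cast)),
    T.precompact.of_isClosed_subset (isClosed_tsupport _)
      ((hsupp.trans (preimage_mono q.2.2.2)).trans subset_closure),
    hsupp.trans (preimage_mono q.2.2.2)⟩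

variable [MeasurableSpace X] [BorelSpace X] [T2Space X] [T2Space S]

theorem integral_haar_eq_zero {f : X → ℂ} {b : S} (hb : b ∈ B₀)
    (hf : b ∉ T.proj '' tsupport f) : ∫ x, f x ∂T.haar b = 0 := by
  refine integral_eq_zero_of_ae ?_
  filter_upwards [T.ae_haar hb] with x hx
  by_contra h0
  exact hf ⟨x, subset_tsupport _ h0, hx.1⟩

/-- The fibre average of compactly supported functions on the total space. -/
def pushC1 (hB₀ : IsOpen B₀) (w : C1c 4 T.total) : C1c 2 B₀ :=
  have hK : IsCompact (T.proj '' tsupport (w : X → ℂ)) := w.2.2.1.isCompact.image T.continuous_proj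
  have hsupp : tsupport (B₀.indicator fun b => ∫ x, (w : X → ℂ) x ∂T.haar b) ⊆
      T.proj '' tsupport (w : X → ℂ) := by
    refine closure_minimal (fun b hb => ?_) hK.isClosed
    by_contra h0
    refine hb ?_
    by_cases hbB : b ∈ B₀
    · rw [indicator_of_mem hbB, T.integral_haar_eq_zero hbB h0]
    · rw [indicator_of_notMem hbB]
  have hKB : T.proj '' tsupport (w : X → ℂ) ⊆ B₀ := by
    rintro _ ⟨x, hx, rfl⟩
    exact w.2.2.2 hx
  ⟨B₀.indicator fun b => ∫ x, (w : X → ℂ) x ∂T.haar b,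
    contMDiff_of_tsupport hB₀ (fun b hb => by
      refine (((T.contMDiffAt_integral_haar hB₀ w.2.1.contMDiffOn hb).1).congr_of_eventuallyEq
        ?_).contMDiffWithinAt
      filter_upwards [hB₀.mem_nhds hb] with b' hb'
      exact indicator_of_mem hb' _) (hsupp.trans hKB),
    HasCompactSupport.of_support_subset_isCompact hK (subset_closure.trans hsupp),
    hsupp.trans hKB⟩

theorem pushC1_of_mem (hB₀ : IsOpen B₀) (w : C1c 4 T.total) {b : S} (hb : b ∈ B₀) :
    (T.pushC1 hB₀ w : S → ℂ) b = ∫ x, (w : X → ℂ) x ∂T.haar b :=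
  indicator_of_mem (s := B₀) hb fun b => ∫ x, (w : X → ℂ) x ∂T.haar b

theorem differential_pushC1 (hB₀ : IsOpen B₀) (w : C1c 4 T.total) {b : S} (hb : b ∈ B₀)
    (ξ : TangentSpace (𝓡 2) b) : differential (T.pushC1 hB₀ w : S → ℂ) b ξ =
      ∫ y in unitSquare, differential (w : X → ℂ) (T.chart b (b, y))
        (mfderiv ((𝓡 2).prod (𝓡 2)) (𝓡 4) (T.chart b) (b, y)
          ((ξ, 0) : EuclideanSpace ℝ (Fin 2) × Plane)) := by
  rw [← (T.contMDiffAt_integral_haar hB₀ w.2.1.contMDiffOn hb).2 ξ]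
  have h1 : (T.pushC1 hB₀ w : S → ℂ) =ᶠ[𝓝 b] fun b => ∫ x, (w : X → ℂ) x ∂T.haar b := by
    filter_upwards [hB₀.mem_nhds hb] with b' hb'
    exact T.pushC1_of_mem hB₀ w hb'
  exact DFunLike.congr_fun (differential_congr h1) ξ

theorem pushC1_apply (hB₀ : IsOpen B₀) (w : C1c 4 T.total) {b : S} (hb : b ∈ B₀) :
    (T.pushC1 hB₀ w : S → ℂ) b = ∫ y in unitSquare, (w : X → ℂ) (T.chart b (b, y)) := by
  refine (T.pushC1_of_mem hB₀ w hb).trans (T.integral_haar hb (T.mem_nbhd b hb) ?_)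
  exact T.aestronglyMeasurable_haar hB₀ w.2.1.continuous.continuousOn hb

variable [MeasurableSpace S] [BorelSpace S] [SecondCountableTopology S]
  [SecondCountableTopology X] {A : S → ℝ} {ρ : X → ℝ} {T}

/-- The normalized lift of `C¹` functions. -/
def IsDisintegration.liftC1 (h : T.IsDisintegration A ρ) (hB₀ : IsOpen B₀) (v : C1c 2 B₀) :
    C1c 4 T.total :=
  T.pullC1 (C1c.mulOn hB₀ _ (contMDiffOn_exp_log h.A_smooth h.A_pos (-(1 / 2))) v)

/-- The normalized fibre average of `C¹` functions. -/
def IsDisintegration.averageC1 (h : T.IsDisintegration A ρ) (hB₀ : IsOpen B₀)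
    (w : C1c 4 T.total) : C1c 2 B₀ :=
  C1c.mulOn hB₀ _ (contMDiffOn_exp_log h.A_smooth h.A_pos (1 / 2))
    (T.pushC1 hB₀ (C1c.mulOn (T.isOpen_total hB₀) ρ h.ρ_smooth w))

theorem IsDisintegration.liftC1_apply (h : T.IsDisintegration A ρ) (hB₀ : IsOpen B₀)
    (v : C1c 2 B₀) {x : X} (hx : x ∈ T.total) :
    (h.liftC1 hB₀ v : X → ℂ) x = ((Real.sqrt (A (T.proj x)))⁻¹ : ℝ) * (v : S → ℂ) (T.proj x) := by
  rw [← exp_neg_half_log (h.A_pos _ hx)]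
  rfl

theorem IsDisintegration.averageC1_apply (h : T.IsDisintegration A ρ) (hB₀ : IsOpen B₀)
    (w : C1c 4 T.total) {b : S} (hb : b ∈ B₀) :
    (h.averageC1 hB₀ w : S → ℂ) b =
      (Real.sqrt (A b) : ℂ) * ∫ x, (w : X → ℂ) x * (ρ x : ℂ) ∂T.haar b := by
  rw [← exp_half_log (h.A_pos _ hb)]
  refine congrArg (fun z : ℂ => (Real.exp (1 / 2 * Real.log (A b)) : ℂ) * z) ?_
  refine (T.pushC1_of_mem hB₀ _ hb).trans (integral_congr_ae (Eventually.of_forall fun x => ?_))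
  exact (Complex.real_smul (x := ρ x) (z := (w : X → ℂ) x)).trans (mul_comm _ _)

theorem IsDisintegration.toLp_liftC1 (h : T.IsDisintegration A ρ) (hB₀ : IsOpen B₀)
    (hB₀c : IsCompact (closure B₀)) (v : C1c 2 B₀) :
    C1c.toLp T.g T.total (h.liftC1 hB₀ v) =
      (h.isFibered T hB₀ hB₀c).lift (C1c.toLp gB B₀ v) := by
  have H := h.isFibered T hB₀ hB₀c
  refine Lp.ext ?_
  filter_upwards [C1c.toLp_coeFn T.g (h.liftC1 hB₀ v), H.coeFn_lift (C1c.toLp gB B₀ v),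
    H.quasiMeasurePreserving.ae (C1c.toLp_coeFn gB v),
    ae_restrict_mem (T.isOpen_total hB₀).measurableSet] with x h1 h2 h3 hx
  rw [h1, h2, h3]
  exact h.liftC1_apply hB₀ v hx

theorem IsDisintegration.toLp_averageC1 (h : T.IsDisintegration A ρ) (hB₀ : IsOpen B₀)
    (hB₀c : IsCompact (closure B₀)) (w : C1c 4 T.total) :
    C1c.toLp gB B₀ (h.averageC1 hB₀ w) =
      (h.isFibered T hB₀ hB₀c).lift.toContinuousLinearMap.adjoint (C1c.toLp T.g T.total w) := by
  have H := h.isFibered T hB₀ hB₀c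
  refine Lp.ext ?_
  filter_upwards [C1c.toLp_coeFn gB (h.averageC1 hB₀ w),
    H.coeFn_adjoint_lift (C1c.toLp T.g T.total w), H.ae_ae (C1c.toLp_coeFn T.g w),
    ae_restrict_mem hB₀.measurableSet] with b h1 h2 h3 hb
  rw [h1, h2, h.averageC1_apply hB₀ w hb, integral_congr_ae h3]
  exact congrArg _ (T.integral_fibreMeasure hB₀ h.continuousOn_ρ h.ρ_pos hb _).symm

/-- A lifted function is constant along fibres up to the weight, and `ρ` has fibre mean one. Off
`B₀` both sides vanish by the support condition. -/
theorem IsDisintegration.averageC1_liftC1 (h : T.IsDisintegration A ρ) (hB₀ : IsOpen B₀)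
    (v : C1c 2 B₀) : h.averageC1 hB₀ (h.liftC1 hB₀ v) = v := by
  ext b
  by_cases hb : b ∈ B₀
  · rw [h.averageC1_apply hB₀ _ hb]
    have h1 : ∫ x, (h.liftC1 hB₀ v : X → ℂ) x * (ρ x : ℂ) ∂T.haar b =
        ∫ x, ((Real.sqrt (A b))⁻¹ : ℝ) * (v : S → ℂ) b * (ρ x : ℂ) ∂T.haar b := by
      refine integral_congr_ae ?_
      filter_upwards [T.ae_haar hb] with x hx
      rw [h.liftC1_apply hB₀ v hx.2, hx.1]
    have h2 : (Real.sqrt (A b) : ℂ) ≠ 0 :=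
      Complex.ofReal_ne_zero.2 (Real.sqrt_pos.2 (h.A_pos b hb)).ne'
    rw [h1, integral_const_mul, integral_complex_ofReal, h.normalized b hb, Complex.ofReal_inv]
    field_simp
    simp
  · have h0 : ∀ u : C1c 2 B₀, (u : S → ℂ) b = 0 := fun u => by
      by_contra h0
      exact hb (u.2.2.2 (subset_tsupport _ h0))
    rw [h0, h0]

theorem IsDisintegration.differential_liftC1 (h : T.IsDisintegration A ρ) (hB₀ : IsOpen B₀)
    (v : C1c 2 B₀) {x : X} (hx : x ∈ T.total) (w : TangentSpace (𝓡 4) x) :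
    differential (h.liftC1 hB₀ v : X → ℂ) x w = ((Real.sqrt (A (T.proj x)))⁻¹ : ℝ) *
      (differential (v : S → ℂ) (T.proj x) (mfderiv (𝓡 4) (𝓡 2) T.proj x w) -
        1 / 2 * (v : S → ℂ) (T.proj x) * (realDifferential (fun b => Real.log (A b)) (T.proj x)
          (mfderiv (𝓡 4) (𝓡 2) T.proj x w) : ℝ)) := by
  have hA := ((contMDiffOn_log h.A_smooth h.A_pos).contMDiffAt (hB₀.mem_nhds hx)).mdifferentiableAt
    (by norm_num)
  obtain ⟨h1, h2⟩ := mdifferentiableAt_exp_log hA (-(1 / 2))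
  have h3 := differential_smul_apply h1 (C1c.mdifferentiableAt v (T.proj x))
    (mfderiv (𝓡 4) (𝓡 2) T.proj x w)
  have h4 := ((C1c.mdifferentiableAt (C1c.mulOn hB₀ _
    (contMDiffOn_exp_log h.A_smooth h.A_pos (-(1 / 2))) v) (T.proj x)).hasMFDerivAt.comp x
      ((T.proj_smooth.mdifferentiable (by simp) x).hasMFDerivAt)).mfderiv
  refine (DFunLike.congr_fun h4 w).trans (h3.trans ?_)
  rw [h2, exp_neg_half_log (h.A_pos _ hx)]
  push_cast
  ring

theorem IsDisintegration.differential_averageC1 (h : T.IsDisintegration A ρ) (hB₀ : IsOpen B₀)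
    (w : C1c 4 T.total) {b : S} (hb : b ∈ B₀) (ξ : TangentSpace (𝓡 2) b) :
    differential (h.averageC1 hB₀ w : S → ℂ) b ξ = (Real.sqrt (A b) : ℂ) *
      ((∫ y in unitSquare, differential (fun x => ρ x • (w : X → ℂ) x) (T.chart b (b, y))
        (mfderiv ((𝓡 2).prod (𝓡 2)) (𝓡 4) (T.chart b) (b, y)
          ((ξ, 0) : EuclideanSpace ℝ (Fin 2) × Plane))) +
        1 / 2 * (∫ y in unitSquare, ρ (T.chart b (b, y)) • (w : X → ℂ) (T.chart b (b, y))) *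
          (realDifferential (fun b => Real.log (A b)) b ξ : ℝ)) := by
  have hA := ((contMDiffOn_log h.A_smooth h.A_pos).contMDiffAt (hB₀.mem_nhds hb)).mdifferentiableAt
    (by norm_num)
  obtain ⟨h1, h2⟩ := mdifferentiableAt_exp_log hA (1 / 2)
  set w' := C1c.mulOn (T.isOpen_total hB₀) ρ h.ρ_smooth w
  have h3 := differential_smul_apply h1 (C1c.mdifferentiableAt (T.pushC1 hB₀ w') b) ξ
  refine h3.trans ?_
  rw [h2, exp_half_log (h.A_pos _ hb), T.differential_pushC1 hB₀ w' hb, T.pushC1_apply hB₀ w' hb]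
  push_cast
  change _ * (∫ y in unitSquare, differential (fun x => ρ x • (w : X → ℂ) x) (T.chart b (b, y))
        (mfderiv ((𝓡 2).prod (𝓡 2)) (𝓡 4) (T.chart b) (b, y)
          ((ξ, 0) : EuclideanSpace ℝ (Fin 2) × Plane))) +
          (∫ y in unitSquare, ρ (T.chart b (b, y)) • (w : X → ℂ) (T.chart b (b, y))) * _ = _
  ring

end TorusFibration

end SemiFlat
end

noncomputable section
namespace SemiFlat

/-! ### Pointwise estimate of the difference of the two Dirichlet integrands. -/

/-- The algebra behind the estimate, with `σ = √A`, `r = ρ`, `d` and `l` the components of `dv` and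
`d log A`, `a` and `k` the horizontal components of `dw` and `dρ`, and `I` the pairing of `d(I_t v)`
with `dw`. The leading terms `σ r conj(d) a` cancel, and what remains carries a factor `ε` or `δ`.
-/
theorem norm_integrand_le {σ r ε δ Nβ Nd Na : ℝ} {d a : Fin 2 → ℂ} {l k : Fin 2 → ℝ} {v w I : ℂ}
    (hσ : 0 < σ) (hr : 0 < r) (hε : 0 ≤ ε) (hδ : 0 ≤ δ) (hNa : 0 ≤ Na) (hNd : 0 ≤ Nd)
    (hI : ‖I - ∑ i, conj (((σ⁻¹ : ℝ) : ℂ) * (d i - 1 / 2 * v * (l i : ℂ))) * a i‖ ≤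
      24 * ε * (σ⁻¹ * Nβ) * Na)
    (hβ : Nβ ≤ Nd + ‖v‖) (hd : ∀ i, ‖d i‖ ≤ Nd) (ha : ‖a 0‖ + ‖a 1‖ ≤ 5 * Na)
    (hl : ∀ i, |l i| ≤ δ) (hk : ∀ i, |k i| ≤ 2 * δ * r) :
    ‖((σ ^ 2 : ℝ) : ℂ) * (I * r) - (σ : ℂ) * ∑ i, conj (d i) *
      ((r * a i + w * (k i : ℂ)) + 1 / 2 * (r * w) * (l i : ℂ))‖ ≤
      (24 * ε + 5 * δ) * (Nd + ‖v‖) * (σ * ((Na + ‖w‖) * r)) := by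
  have hσ' : (σ : ℂ) ≠ 0 := Complex.ofReal_ne_zero.2 hσ.ne'
  have key : ((σ ^ 2 : ℝ) : ℂ) * (I * r) - (σ : ℂ) * ∑ i, conj (d i) *
      ((r * a i + w * (k i : ℂ)) + 1 / 2 * (r * w) * (l i : ℂ)) =
      ((σ ^ 2 * r : ℝ) : ℂ) *
        (I - ∑ i, conj (((σ⁻¹ : ℝ) : ℂ) * (d i - 1 / 2 * v * (l i : ℂ))) * a i) -
      (σ : ℂ) * (∑ i, (1 / 2 * r * conj v * (l i : ℂ) * a i +
        conj (d i) * w * ((k i + 1 / 2 * l i * r : ℝ) : ℂ))) := by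
    simp only [Fin.sum_univ_two, map_mul, map_sub, Complex.conj_ofReal, map_div₀, map_one,
      map_ofNat]
    push_cast
    field_simp
    ring
  rw [key]
  have h1 : ‖((σ ^ 2 * r : ℝ) : ℂ) *
        (I - ∑ i, conj (((σ⁻¹ : ℝ) : ℂ) * (d i - 1 / 2 * v * (l i : ℂ))) * a i)‖ ≤
      σ * r * (24 * ε * (Nd + ‖v‖) * Na) := by
    rw [norm_mul, Complex.norm_real, Real.norm_of_nonneg (by positivity)]
    calc σ ^ 2 * r * _ ≤ σ ^ 2 * r * (24 * ε * (σ⁻¹ * (Nd + ‖v‖)) * Na) := by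
          refine mul_le_mul_of_nonneg_left (hI.trans ?_) (by positivity)
          gcongr
      _ = _ := by field_simp
  have h2 : ∀ i, ‖1 / 2 * r * conj v * (l i : ℂ) * a i +
        conj (d i) * w * ((k i + 1 / 2 * l i * r : ℝ) : ℂ)‖ ≤
      r * δ * (1 / 2 * ‖v‖ * ‖a i‖ + 5 / 2 * Nd * ‖w‖) := by
    intro i
    refine (norm_add_le _ _).trans ?_
    have h3 : ‖1 / 2 * r * conj v * (l i : ℂ) * a i‖ ≤ 1 / 2 * r * ‖v‖ * δ * ‖a i‖ := by
      simp only [norm_mul, Complex.norm_real, RCLike.norm_conj, Real.norm_eq_abs]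
      have : ‖(1 / 2 : ℂ)‖ = 1 / 2 := by simp
      rw [this, abs_of_pos hr]
      gcongr
      exact hl i
    have h4 : |k i + 1 / 2 * l i * r| ≤ 5 / 2 * δ * r := by
      have h5 := abs_le.1 (hk i)
      have h6 := abs_le.1 (hl i)
      have h7 : l i * r ≤ δ * r := mul_le_mul_of_nonneg_right h6.2 hr.le
      have h8 : -δ * r ≤ l i * r := mul_le_mul_of_nonneg_right h6.1 hr.le
      rw [abs_le]
      constructor <;> linarith
    have h5 : ‖conj (d i) * w * ((k i + 1 / 2 * l i * r : ℝ) : ℂ)‖ ≤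
        Nd * ‖w‖ * (5 / 2 * δ * r) := by
      rw [norm_mul, norm_mul, RCLike.norm_conj, Complex.norm_real, Real.norm_eq_abs]
      gcongr
      exact hd i
    linarith
  have h3 : ‖(σ : ℂ) * (∑ i, (1 / 2 * r * conj v * (l i : ℂ) * a i +
        conj (d i) * w * ((k i + 1 / 2 * l i * r : ℝ) : ℂ)))‖ ≤
      σ * (r * δ * (5 / 2 * ‖v‖ * Na + 5 * Nd * ‖w‖)) := by
    rw [norm_mul, Complex.norm_real, Real.norm_of_nonneg hσ.le]
    refine mul_le_mul_of_nonneg_left ((norm_sum_le _ _).trans ((Finset.sum_le_sum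
      fun i _ => h2 i).trans ?_)) hσ.le
    rw [Fin.sum_univ_two, ← mul_add]
    refine mul_le_mul_of_nonneg_left ?_ (by positivity)
    have := mul_le_mul_of_nonneg_left ha (norm_nonneg v)
    linarith
  refine (norm_sub_le _ _).trans ((add_le_add h1 h3).trans ?_)
  have hv := norm_nonneg v
  have hw := norm_nonneg w
  have e1 : σ * r * (24 * ε * (Nd + ‖v‖) * Na) + σ * (r * δ * (5 / 2 * ‖v‖ * Na + 5 * Nd * ‖w‖)) =
      σ * r * (24 * ε * (Nd + ‖v‖) * Na + δ * (5 / 2 * ‖v‖ * Na + 5 * Nd * ‖w‖)) := by ring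
  have e2 : (24 * ε + 5 * δ) * (Nd + ‖v‖) * (σ * ((Na + ‖w‖) * r)) =
      σ * r * (24 * ε * (Nd + ‖v‖) * (Na + ‖w‖) + δ * (5 * (Nd + ‖v‖) * (Na + ‖w‖))) := by ring
  rw [e1, e2]
  refine mul_le_mul_of_nonneg_left (add_le_add ?_ ?_) (by positivity)
  · gcongr
    linarith
  · refine mul_le_mul_of_nonneg_left ?_ hδ
    nlinarith [mul_nonneg hv hNa, mul_nonneg hv hw, mul_nonneg hNd hNa, mul_nonneg hNd hw]

namespace TorusFibration

variable {S : Type*} [TopologicalSpace S] [ChartedSpace (EuclideanSpace ℝ (Fin 2)) S]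
  [IsManifold (𝓡 2) ∞ S]
  {X : Type*} [TopologicalSpace X] [ChartedSpace (EuclideanSpace ℝ (Fin 4)) X]
  [IsManifold (𝓡 4) ∞ X] {gB : Metric 2 S} {B₀ : Set S} {T : TorusFibration gB B₀ X}
  [MeasurableSpace X] [BorelSpace X] [T2Space X] [T2Space S]
  [MeasurableSpace S] [BorelSpace S] [SecondCountableTopology S]
  [SecondCountableTopology X] {A : S → ℝ} {ρ : X → ℝ}

/-- Pointwise bound for the difference of the integrands of the Dirichlet forms. -/
theorem IsDisintegration.norm_integrand_le (h : T.IsDisintegration A ρ) (hB₀ : IsOpen B₀)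
    {ε δ : ℝ} (hε : 0 ≤ ε) (hε8 : ε ≤ 1 / 8) (hδ : 0 ≤ δ) (hδ2 : δ ≤ 1 / 2)
    (hg : ∀ x ∈ T.total, ∀ v w : TangentSpace (𝓡 4) x, |T.g.inner x v w - T.gRef x v w| ≤
      ε * Real.sqrt (T.gRef x v v) * Real.sqrt (T.gRef x w w))
    (hbd : T.DisintegrationBounds A ρ δ) (v : C1c 2 B₀) (w : C1c 4 T.total) {b : S} (hb : b ∈ B₀)
    (y : Plane) :
    ‖(A b : ℂ) * (covectorInner T.g (T.chart b (b, y))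
        (differential (h.liftC1 hB₀ v : X → ℂ) (T.chart b (b, y)))
        (differential (w : X → ℂ) (T.chart b (b, y))) * (ρ (T.chart b (b, y)) : ℂ)) -
      (Real.sqrt (A b) : ℂ) * ∑ i, conj (differential (v : S → ℂ) b (onFrame gB b i)) *
        (differential (fun x => ρ x • (w : X → ℂ) x) (T.chart b (b, y))
          (mfderiv ((𝓡 2).prod (𝓡 2)) (𝓡 4) (T.chart b) (b, y)
          ((onFrame gB b i, 0) : EuclideanSpace ℝ (Fin 2) × Plane)) +
        1 / 2 * (ρ (T.chart b (b, y)) • (w : X → ℂ) (T.chart b (b, y))) *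
          (realDifferential (fun b => Real.log (A b)) b (onFrame gB b i) : ℝ))‖ ≤
      (24 * ε + 5 * δ) * (cnorm gB b (differential (v : S → ℂ) b) + ‖(v : S → ℂ) b‖) *
        (Real.sqrt (A b) * ((cnorm T.g (T.chart b (b, y))
          (differential (w : X → ℂ) (T.chart b (b, y))) + ‖(w : X → ℂ) (T.chart b (b, y))‖) *
            ρ (T.chart b (b, y)))) := by
  have H := T.isSemiFlatChart b hb
  have hbU := T.mem_nbhd b hb
  have hx := T.chart_mem_total hb hbU y
  have hpx : T.proj (T.chart b (b, y)) = b := H.proj_eq b hbU y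
  have hproj : MDifferentiableAt (𝓡 4) (𝓡 2) T.proj (T.chart b (b, y)) :=
    T.proj_smooth.mdifferentiable (by simp) _
  have he := onFrame_inner gB b
  set e : Fin 2 → TangentSpace (𝓡 2) b := fun i => onFrame gB b i with he'
  set lam : TangentSpace (𝓡 2) b →L[ℝ] ℝ := realDifferential (fun b => Real.log (A b)) b with hlam
  set dv : TangentSpace (𝓡 2) b →L[ℝ] ℂ := differential (v : S → ℂ) b with hdv
  let lamC : TangentSpace (𝓡 2) b →L[ℝ] ℂ := Complex.ofRealCLM.comp lam
  let β₀ : TangentSpace (𝓡 2) b →L[ℝ] ℂ := dv + (-(1 / 2 * (v : S → ℂ) b)) • lamC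
  let β : TangentSpace (𝓡 2) b →L[ℝ] ℂ := (((Real.sqrt (A b))⁻¹ : ℝ) : ℂ) • β₀
  have hσ : 0 < Real.sqrt (A b) := Real.sqrt_pos.2 (h.A_pos b hb)
  have hlame : ∀ i, |lam (e i)| ≤ δ := fun i => by
    have := hbd.grad_log_A b hb (e i)
    have h1 : gB.inner b (e i) (e i) = 1 := by rw [he]; simp
    rwa [h1, Real.sqrt_one, mul_one] at this
  have hde : ∀ i, ‖dv (e i)‖ ≤ cnorm gB b dv := fun i => by
    have h1 := norm_covector_apply_le gB b dv (e i)
    have h2 : gB.inner b (e i) (e i) = 1 := by rw [he]; simp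
    rw [h2, mul_one] at h1
    exact (sq_le_sq₀ (norm_nonneg _) (cnorm_nonneg _ _ _)).1 h1
  have hlamC : cnorm gB b lamC ≤ 1 := by
    have h1 := cnorm_sq_eq_of_orthonormal gB b e he lamC
    have h2 : ∀ i, ‖lamC (e i)‖ ^ 2 ≤ (1 / 2) ^ 2 := fun i => by
      refine pow_le_pow_left₀ (norm_nonneg _) (le_trans (le_of_eq ?_) ((hlame i).trans hδ2)) 2
      exact Complex.norm_real _
    rw [Fin.sum_univ_two] at h1
    rw [← sq_le_sq₀ (cnorm_nonneg _ _ _) zero_le_one, h1]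
    linarith [h2 0, h2 1]
  have hβ₀ : cnorm gB b β₀ ≤ cnorm gB b dv + ‖(v : S → ℂ) b‖ := by
    refine (cnorm_add_le gB b _ _).trans (add_le_add le_rfl ?_)
    rw [cnorm_smul, norm_neg, norm_mul]
    have : ‖(1 / 2 : ℂ)‖ = 1 / 2 := by simp
    rw [this]
    nlinarith [norm_nonneg ((v : S → ℂ) b), cnorm_nonneg gB b lamC]
  have hβ : cnorm gB b β = (Real.sqrt (A b))⁻¹ * cnorm gB b β₀ := by
    rw [cnorm_smul, Complex.norm_real, Real.norm_of_nonneg (inv_nonneg.2 hσ.le)]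
  have hπ : ∀ u, differential (h.liftC1 hB₀ v : X → ℂ) (T.chart b (b, y)) u =
      β (mfderiv (𝓡 4) (𝓡 2) T.proj (T.chart b (b, y)) u) := by
    -- The chart point projects to `b` only up to a provable equality; generalizing over `b'` lets
    -- the formula at the projected point be transported to `b`.
    have h1 : ∀ b', T.proj (T.chart b (b, y)) = b' → ∀ u,
        differential (h.liftC1 hB₀ v : X → ℂ) (T.chart b (b, y)) u =
        ((Real.sqrt (A b'))⁻¹ : ℝ) * (differential (v : S → ℂ) b'
          (mfderiv (𝓡 4) (𝓡 2) T.proj (T.chart b (b, y)) u) -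
        1 / 2 * (v : S → ℂ) b' * (realDifferential (fun b => Real.log (A b)) b'
          (mfderiv (𝓡 4) (𝓡 2) T.proj (T.chart b (b, y)) u) : ℝ)) := by
      rintro _ rfl u
      exact h.differential_liftC1 hB₀ v hx u
    intro u
    refine (h1 b hpx u).trans (congrArg (fun z : ℂ => (((Real.sqrt (A b))⁻¹ : ℝ) : ℂ) * z) ?_)
    rw [sub_eq_add_neg, ← neg_mul]
    rfl
  obtain ⟨ha9, hI⟩ := H.covectorInner_near hbU y hproj T.g hε hε8 (hg _ hx) e he β _ hπ
    (differential (w : X → ℂ) (T.chart b (b, y))) _ (fun i => rfl)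
  set Na := cnorm T.g (T.chart b (b, y)) (differential (w : X → ℂ) (T.chart b (b, y))) with hNa
  have hNa0 : 0 ≤ Na := cnorm_nonneg _ _ _
  set a : Fin 2 → ℂ := fun i => differential (w : X → ℂ) (T.chart b (b, y))
    (mfderiv ((𝓡 2).prod (𝓡 2)) (𝓡 4) (T.chart b) (b, y)
      ((e i, 0) : EuclideanSpace ℝ (Fin 2) × Plane)) with ha
  set k : Fin 2 → ℝ := fun i => realDifferential ρ (T.chart b (b, y))
    (mfderiv ((𝓡 2).prod (𝓡 2)) (𝓡 4) (T.chart b) (b, y)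
      ((e i, 0) : EuclideanSpace ℝ (Fin 2) × Plane)) with hk
  -- From `δ ≤ 1/2`; it converts the bound `δ` for the horizontal derivative of `ρ` into `2 δ ρ`, so
  -- that every error term carries the density `ρ` of the fibre measure.
  have hr : 1 / 2 ≤ ρ (T.chart b (b, y)) := by
    have := (abs_le.1 (hbd.ρ_near_one _ hx)).1
    linarith
  have hk' : ∀ i, |k i| ≤ 2 * δ * ρ (T.chart b (b, y)) := fun i => by
    have h1 := hbd.grad_ρ _ hx (mfderiv ((𝓡 2).prod (𝓡 2)) (𝓡 4) (T.chart b) (b, y)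
      ((e i, 0) : EuclideanSpace ℝ (Fin 2) × Plane))
      (fun u hu => H.gRef_horizontal hbU y hproj (e i) u hu)
    have h2 := H.gRef_horizontal_self hbU y (e i)
    have h3 : gB.inner b (e i) (e i) = 1 := by rw [he]; simp
    rw [h3] at h2
    refine h1.trans ?_
    rw [h2, Real.sqrt_one, mul_one]
    nlinarith
  have haN : ‖a 0‖ + ‖a 1‖ ≤ 5 * Na := by
    rw [Fin.sum_univ_two] at ha9
    have h9 : ‖a 0‖ ^ 2 + ‖a 1‖ ^ 2 ≤ 9 * Na ^ 2 := ha9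
    refine (sq_le_sq₀ (by positivity) (by positivity)).1 ?_
    nlinarith [sq_nonneg (‖a 0‖ - ‖a 1‖), sq_nonneg Na]
  have hfin := SemiFlat.norm_integrand_le (σ := Real.sqrt (A b)) (r := ρ (T.chart b (b, y)))
    (ε := ε) (δ := δ) (Nβ := cnorm gB b β₀) (Nd := cnorm gB b dv) (Na := Na)
    (d := fun i => dv (e i)) (a := a) (l := fun i => lam (e i)) (k := k) (v := (v : S → ℂ) b)
    (w := (w : X → ℂ) (T.chart b (b, y))) hσ (by linarith) hε hδ hNa0 (cnorm_nonneg _ _ _)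
    (by
      rw [← hβ]
      refine le_of_eq_of_le (congrArg (fun z : ℂ => ‖covectorInner T.g (T.chart b (b, y))
        (differential (h.liftC1 hB₀ v : X → ℂ) (T.chart b (b, y)))
        (differential (w : X → ℂ) (T.chart b (b, y))) - z‖) ?_) hI
      refine Finset.sum_congr rfl fun i _ => ?_
      rw [sub_eq_add_neg, ← neg_mul]
      rfl)
    hβ₀ hde haN hlame hk'
  rw [Real.sq_sqrt (h.A_pos b hb).le] at hfin
  have hsm : ∀ i, differential (fun x => ρ x • (w : X → ℂ) x) (T.chart b (b, y))
          (mfderiv ((𝓡 2).prod (𝓡 2)) (𝓡 4) (T.chart b) (b, y)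
          ((e i, 0) : EuclideanSpace ℝ (Fin 2) × Plane)) =
      ρ (T.chart b (b, y)) * a i + (w : X → ℂ) (T.chart b (b, y)) * (k i : ℂ) := fun i =>
    differential_smul_apply ((h.ρ_smooth.contMDiffAt ((T.isOpen_total hB₀).mem_nhds
      hx)).mdifferentiableAt (by norm_num)) (C1c.mdifferentiableAt w _) _
  refine le_of_eq_of_le (congrArg _ (congrArg _ (congrArg _ (Finset.sum_congr rfl
    fun i _ => ?_)))) hfin
  rw [hsm i]
  rfl

end TorusFibration

end SemiFlat
end

noncomputable section
namespace SemiFlat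

open ProbabilityTheory

/-! ### Integration of the pointwise estimate: the Dirichlet forms are almost intertwined. -/

theorem integral_mul_le_sqrt_mul_sqrt {S : Type*} [MeasurableSpace S] {m : Measure S}
    {f g : S → ℝ} (hf : MemLp f 2 m) (hg : MemLp g 2 m) :
    ∫ b, f b * g b ∂m ≤ Real.sqrt (∫ b, f b ^ 2 ∂m) * Real.sqrt (∫ b, g b ^ 2 ∂m) := by
  have key : ∀ {u : S → ℝ} (hu : MemLp u 2 m), ‖hu.toLp u‖ = Real.sqrt (∫ b, u b ^ 2 ∂m) := by
    intro u hu
    rw [← Real.sqrt_sq (norm_nonneg (hu.toLp u)), ← real_inner_self_eq_norm_sq, L2.inner_def]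
    congr 1
    refine integral_congr_ae ?_
    filter_upwards [hu.coeFn_toLp] with b hb
    rw [hb, RCLike.inner_apply]
    simp [sq]
  have h1 := real_inner_le_norm (hf.toLp f) (hg.toLp g)
  rw [key hf, key hg, L2.inner_def] at h1
  refine le_of_eq_of_le (integral_congr_ae ?_) h1
  filter_upwards [hf.coeFn_toLp, hg.coeFn_toLp] with b h2 h3
  rw [h2, h3, RCLike.inner_apply]
  simp [mul_comm]

namespace IsFibered

variable {S X : Type*} [MeasurableSpace S] [MeasurableSpace X] {m : Measure S}
  {κ : Kernel S X} {a : S → ℝ} {p : X → S} {μ : Measure X} (H : IsFibered m κ a p μ)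
include H

theorem integrable_integral {f : X → ℂ} (hf : Integrable f μ) :
    Integrable (fun b => (a b : ℂ) * ∫ x, f x ∂κ b) m := by
  have h1 := hf
  rw [H.eq_bind, Measure.comp_eq_comp_const_apply] at h1
  have h2 := h1.integral_comp
  rw [Kernel.const_apply, integrable_withDensity_iff_integrable_smul₀' H.aemeasurable_ofReal
    (Eventually.of_forall fun _ => ENNReal.ofReal_lt_top)] at h2
  refine h2.congr ?_
  filter_upwards [H.pos] with b hb
  rw [ENNReal.toReal_ofReal hb.le]
  simp

/-- Cauchy–Schwarz on the base, followed by the contraction property of the fibre average applied to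
`W`. -/
theorem norm_integral_sub_le {f : X → ℂ} (hf : Integrable f μ) {q : S → ℂ} (hq : Integrable q m)
    {V : S → ℝ} (hV : MemLp V 2 m) {W : X → ℂ} (hW : MemLp W 2 μ) {K : ℝ} (hK : 0 ≤ K)
    (hb : ∀ᵐ b ∂m, ‖(a b : ℂ) * (∫ x, f x ∂κ b) - q b‖ ≤
      K * V b * ‖(Real.sqrt (a b) : ℂ) * ∫ x, W x ∂κ b‖) :
    ‖∫ x, f x ∂μ - ∫ b, q b ∂m‖ ≤
      K * (Real.sqrt (∫ b, V b ^ 2 ∂m) * Real.sqrt (∫ x, ‖W x‖ ^ 2 ∂μ)) := by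
  have hA := H.memLp_average hW
  rw [H.integral_eq hf, ← integral_sub (H.integrable_integral hf) hq]
  have h1 : Integrable (fun b => K * V b * ‖(Real.sqrt (a b) : ℂ) * ∫ x, W x ∂κ b‖) m := by
    have := (hV.integrable_mul hA.norm).const_mul K
    refine this.congr (Eventually.of_forall fun b => ?_)
    simp only [Pi.mul_apply]
    ring
  refine (norm_integral_le_of_norm_le h1 hb).trans ?_
  simp only [mul_assoc]
  rw [integral_const_mul]
  refine mul_le_mul_of_nonneg_left ?_ hK
  refine (integral_mul_le_sqrt_mul_sqrt hV hA.norm).trans ?_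
  refine mul_le_mul_of_nonneg_left (Real.sqrt_le_sqrt ?_) (Real.sqrt_nonneg _)
  have e1 := (memLp_two_iff_integrable_sq_norm hA.1).1 hA
  have e2 := (memLp_two_iff_integrable_sq_norm hW.1).1 hW
  rw [integral_eq_lintegral_of_nonneg_ae (Eventually.of_forall fun _ => sq_nonneg _) e1.1,
    integral_eq_lintegral_of_nonneg_ae (Eventually.of_forall fun _ => sq_nonneg _) e2.1]
  have h3 := e2.2.ne
  refine ENNReal.toReal_mono ?_ ?_
  · simpa only [Real.enorm_of_nonneg (sq_nonneg _)] using h3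
  · have := H.lintegral_average_le hW.1
    simpa only [ENNReal.ofReal_pow (norm_nonneg _), ofReal_norm] using this

end IsFibered

theorem integral_unitSquare_sum {D : Fin 2 → Plane → ℂ} {W : Plane → ℂ}
    (hD : ∀ i, Continuous (D i)) (hW : Continuous W) (σ : ℂ) (c l : Fin 2 → ℂ) :
    ∫ y in unitSquare, σ * ∑ i, c i * (D i y + 1 / 2 * W y * l i) =
      ∑ i, c i * (σ * ((∫ y in unitSquare, D i y) + 1 / 2 * (∫ y in unitSquare, W y) * l i)) := by
  have h1 : ∀ i, IntegrableOn (fun y => D i y + 1 / 2 * W y * l i) unitSquare := fun i =>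
    integrableOn_unitSquare (by have := hD i; fun_prop)
  rw [integral_const_mul, integral_finset_sum _ fun i _ => (h1 i).const_mul (c i), Finset.mul_sum]
  refine Finset.sum_congr rfl fun i _ => ?_
  rw [integral_const_mul, integral_add (integrableOn_unitSquare (hD i))
    (integrableOn_unitSquare (by fun_prop)), integral_mul_const, integral_const_mul]
  ring

namespace TorusFibration

variable {S : Type*} [TopologicalSpace S] [ChartedSpace (EuclideanSpace ℝ (Fin 2)) S]
  [IsManifold (𝓡 2) ∞ S]
  {X : Type*} [TopologicalSpace X] [ChartedSpace (EuclideanSpace ℝ (Fin 4)) X]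
  [IsManifold (𝓡 4) ∞ X] {gB : Metric 2 S} {B₀ : Set S} {T : TorusFibration gB B₀ X}
  [MeasurableSpace X] [BorelSpace X] [T2Space X] [T2Space S]
  [MeasurableSpace S] [BorelSpace S] [SecondCountableTopology S]
  [SecondCountableTopology X] {A : S → ℝ} {ρ : X → ℝ}

theorem continuous_chart {b : S} (hb : b ∈ B₀) : Continuous fun y => T.chart b (b, y) :=
  (T.isSemiFlatChart b hb).continuous_section (T.mem_nbhd b hb)

theorem IsDisintegration.continuous_ρ_chart (h : T.IsDisintegration A ρ) {b : S} (hb : b ∈ B₀) :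
    Continuous fun y => ρ (T.chart b (b, y)) :=
  h.continuousOn_ρ.comp_continuous (continuous_chart hb)
    fun y => T.chart_mem_total hb (T.mem_nbhd b hb) y

theorem IsDisintegration.integral_fibreKernel (h : T.IsDisintegration A ρ) (hB₀ : IsOpen B₀)
    {f : X → ℂ} (hf : Continuous f) {b : S} (hb : b ∈ B₀) :
    ∫ x, f x ∂T.fibreKernel hB₀ h.continuousOn_ρ b =
      ∫ y in unitSquare, f (T.chart b (b, y)) * (ρ (T.chart b (b, y)) : ℂ) := by
  refine (T.integral_fibreMeasure hB₀ h.continuousOn_ρ h.ρ_pos hb f).trans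
    (T.integral_haar hb (T.mem_nbhd b hb) (T.aestronglyMeasurable_haar hB₀ ?_ hb))
  exact hf.continuousOn.mul (Complex.continuous_ofReal.comp_continuousOn h.continuousOn_ρ)

/-- Both terms are integrals over the same unit square: the first by definition of the fibre
measure, the second because the differential of an average is the average of horizontal derivatives.
The pointwise bound is then integrated. -/
theorem IsDisintegration.norm_fibre_sub_le (h : T.IsDisintegration A ρ) (hB₀ : IsOpen B₀)
    {ε δ : ℝ} (hε : 0 ≤ ε) (hε8 : ε ≤ 1 / 8) (hδ : 0 ≤ δ) (hδ2 : δ ≤ 1 / 2)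
    (hg : ∀ x ∈ T.total, ∀ v w : TangentSpace (𝓡 4) x, |T.g.inner x v w - T.gRef x v w| ≤
      ε * Real.sqrt (T.gRef x v v) * Real.sqrt (T.gRef x w w))
    (hbd : T.DisintegrationBounds A ρ δ) (v : C1c 2 B₀) (w : C1c 4 T.total) {b : S}
    (hb : b ∈ B₀) :
    ‖(A b : ℂ) * (∫ x, covectorInner T.g x (differential (h.liftC1 hB₀ v : X → ℂ) x)
        (differential (w : X → ℂ) x) ∂T.fibreKernel hB₀ h.continuousOn_ρ b) -
      covectorInner gB b (differential (v : S → ℂ) b)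
        (differential (h.averageC1 hB₀ w : S → ℂ) b)‖ ≤
      (24 * ε + 5 * δ) * (cnorm gB b (differential (v : S → ℂ) b) + ‖(v : S → ℂ) b‖) *
        ‖(Real.sqrt (A b) : ℂ) * ∫ x, ((cnorm T.g x (differential (w : X → ℂ) x) +
          ‖(w : X → ℂ) x‖ : ℝ) : ℂ) ∂T.fibreKernel hB₀ h.continuousOn_ρ b‖ := by
  have hΨ := continuous_chart (T := T) hb
  have hρ := h.continuous_ρ_chart hb
  have hw : Continuous fun y => (w : X → ℂ) (T.chart b (b, y)) := w.2.1.continuous.comp hΨ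
  have hcv := (C1c.continuous_covectorInner T.g (h.liftC1 hB₀ v) w)
  have hW : Continuous fun x => cnorm T.g x (differential (w : X → ℂ) x) + ‖(w : X → ℂ) x‖ :=
    (C1c.continuous_cnorm T.g w).add w.2.1.continuous.norm
  have hD : ∀ i, Continuous fun y => differential (fun x => ρ x • (w : X → ℂ) x)
      (T.chart b (b, y)) (mfderiv ((𝓡 2).prod (𝓡 2)) (𝓡 4) (T.chart b) (b, y)
        ((onFrame gB b i, 0) : EuclideanSpace ℝ (Fin 2) × Plane)) := fun i =>
    T.continuous_differential_chart hB₀ (C1c.mulOn (T.isOpen_total hB₀) ρ h.ρ_smooth w).2.1.contMDiffOn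
      hb ((onFrame gB b i, 0) : EuclideanSpace ℝ (Fin 2) × Plane)
  have hρw : Continuous fun y => ρ (T.chart b (b, y)) • (w : X → ℂ) (T.chart b (b, y)) :=
    hρ.smul hw
  have e1 := h.integral_fibreKernel hB₀ hcv hb
  have e2 := h.integral_fibreKernel hB₀ (Complex.continuous_ofReal.comp hW) hb
  have e3 : covectorInner gB b (differential (v : S → ℂ) b)
        (differential (h.averageC1 hB₀ w : S → ℂ) b) =
      ∫ y in unitSquare, (Real.sqrt (A b) : ℂ) *
        ∑ i, conj (differential (v : S → ℂ) b (onFrame gB b i)) *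
        (differential (fun x => ρ x • (w : X → ℂ) x) (T.chart b (b, y))
          (mfderiv ((𝓡 2).prod (𝓡 2)) (𝓡 4) (T.chart b) (b, y)
          ((onFrame gB b i, 0) : EuclideanSpace ℝ (Fin 2) × Plane)) +
        1 / 2 * (ρ (T.chart b (b, y)) • (w : X → ℂ) (T.chart b (b, y))) *
          (realDifferential (fun b => Real.log (A b)) b (onFrame gB b i) : ℝ)) := by
    refine (covectorInner_eq_of_orthonormal gB b (fun i => onFrame gB b i) (onFrame_inner gB b)
      _ _).trans ((Finset.sum_congr rfl fun i _ => ?_).trans (integral_unitSquare_sum hD hρw _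
        (fun i => conj (differential (v : S → ℂ) b (onFrame gB b i)))
        (fun i => ((realDifferential (fun b => Real.log (A b)) b (onFrame gB b i) : ℝ) : ℂ))).symm)
    exact congrArg _ (h.differential_averageC1 hB₀ w hb (onFrame gB b i))
  rw [e1, e3, ← integral_const_mul, ← integral_sub]
  rotate_left
  · exact integrableOn_unitSquare (continuous_const.mul ((hcv.comp hΨ).mul
      (Complex.continuous_ofReal.comp hρ)))
  · refine integrableOn_unitSquare (continuous_const.mul (continuous_finset_sum _ fun i _ =>
      continuous_const.mul (((hD i).add ((continuous_const.mul hρw).mul continuous_const)))))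
  have e4 : ‖(Real.sqrt (A b) : ℂ) * ∫ x, ((cnorm T.g x (differential (w : X → ℂ) x) +
          ‖(w : X → ℂ) x‖ : ℝ) : ℂ) ∂T.fibreKernel hB₀ h.continuousOn_ρ b‖ =
      ∫ y in unitSquare, Real.sqrt (A b) * ((cnorm T.g (T.chart b (b, y))
          (differential (w : X → ℂ) (T.chart b (b, y))) + ‖(w : X → ℂ) (T.chart b (b, y))‖) *
            ρ (T.chart b (b, y))) := by
    have e5 : ∫ y in unitSquare, (((cnorm T.g (T.chart b (b, y))
          (differential (w : X → ℂ) (T.chart b (b, y))) + ‖(w : X → ℂ) (T.chart b (b, y))‖ : ℝ) : ℂ) *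
            (ρ (T.chart b (b, y)) : ℂ)) = ((∫ y in unitSquare, ((cnorm T.g (T.chart b (b, y))
          (differential (w : X → ℂ) (T.chart b (b, y))) + ‖(w : X → ℂ) (T.chart b (b, y))‖) *
            ρ (T.chart b (b, y))) : ℝ) : ℂ) := by
      rw [← integral_complex_ofReal]
      exact integral_congr_ae (Eventually.of_forall fun y => (Complex.ofReal_mul _ _).symm)
    rw [integral_const_mul, norm_mul, Complex.norm_real, Real.norm_of_nonneg (Real.sqrt_nonneg _)]
    refine congrArg _ ((congrArg _ (e2.trans e5)).trans ?_)
    rw [Complex.norm_real, Real.norm_of_nonneg]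
    refine integral_nonneg fun y => mul_nonneg (add_nonneg (cnorm_nonneg _ _ _) (norm_nonneg _))
      (h.ρ_pos _ (T.chart_mem_total hb (T.mem_nbhd b hb) y)).le
  rw [e4, ← integral_const_mul]
  refine norm_integral_le_of_norm_le ?_ (Eventually.of_forall fun y =>
    h.norm_integrand_le hB₀ hε hε8 hδ hδ2 hg hbd v w hb y)
  exact integrableOn_unitSquare (continuous_const.mul (continuous_const.mul
    ((hW.comp hΨ).mul hρ)))

end TorusFibration

section

variable {n : ℕ} {M : Type*} [TopologicalSpace M] [ChartedSpace (EuclideanSpace ℝ (Fin n)) M]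
  [IsManifold (𝓡 n) ∞ M] [T2Space M] [SecondCountableTopology M] [MeasurableSpace M] [BorelSpace M]
  {U : Set M}

theorem C1c.memLp_cnorm_add (g : Metric n M) (φ : C1c n U) :
    MemLp (fun x => cnorm g x (differential (φ : M → ℂ) x) + ‖(φ : M → ℂ) x‖) 2 (measureOn g U) ∧
    ∫ x, (cnorm g x (differential (φ : M → ℂ) x) + ‖(φ : M → ℂ) x‖) ^ 2 ∂(measureOn g U) ≤
      2 * ((dirichletForm g U φ φ).re + ‖C1c.toLp g U φ‖ ^ 2) := by
  have h1 : MemLp (fun x => cnorm g x (differential (φ : M → ℂ) x)) 2 (measureOn g U) := by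
    rw [memLp_two_iff_integrable_sq (C1c.continuous_cnorm g φ).aestronglyMeasurable]
    exact C1c.integrable_cnorm_sq g φ
  have h2 := (C1c.memLp g φ).norm
  have h3 : Integrable (fun x => ‖(φ : M → ℂ) x‖ ^ 2) (measureOn g U) :=
    (memLp_two_iff_integrable_sq_norm (C1c.memLp g φ).1).1 (C1c.memLp g φ)
  refine ⟨h1.add h2, ?_⟩
  rw [C1c.dirichletForm_self_re, C1c.norm_toLp_sq, ← integral_add (C1c.integrable_cnorm_sq g φ) h3,
    ← integral_const_mul]
  refine integral_mono (h1.add h2).integrable_sq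
    (((C1c.integrable_cnorm_sq g φ).add h3).const_mul 2) fun x => ?_
  simp only
  nlinarith [sq_nonneg (cnorm g x (differential (φ : M → ℂ) x) - ‖(φ : M → ℂ) x‖)]

end

namespace TorusFibration

variable {S : Type*} [TopologicalSpace S] [ChartedSpace (EuclideanSpace ℝ (Fin 2)) S]
  [IsManifold (𝓡 2) ∞ S]
  {X : Type*} [TopologicalSpace X] [ChartedSpace (EuclideanSpace ℝ (Fin 4)) X]
  [IsManifold (𝓡 4) ∞ X] {gB : Metric 2 S} {B₀ : Set S} {T : TorusFibration gB B₀ X}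
  [MeasurableSpace X] [BorelSpace X] [T2Space X] [T2Space S]
  [MeasurableSpace S] [BorelSpace S] [SecondCountableTopology S]
  [SecondCountableTopology X] {A : S → ℝ} {ρ : X → ℝ}

/-- The Dirichlet forms of the total space and of the base are almost intertwined by lifting and
averaging. -/
theorem IsDisintegration.norm_dirichletForm_sub_le (h : T.IsDisintegration A ρ) (hB₀ : IsOpen B₀)
    (hB₀c : IsCompact (closure B₀))
    {ε δ : ℝ} (hε : 0 ≤ ε) (hε8 : ε ≤ 1 / 8) (hδ : 0 ≤ δ) (hδ2 : δ ≤ 1 / 2)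
    (hg : ∀ x ∈ T.total, ∀ v w : TangentSpace (𝓡 4) x, |T.g.inner x v w - T.gRef x v w| ≤
      ε * Real.sqrt (T.gRef x v v) * Real.sqrt (T.gRef x w w))
    (hbd : T.DisintegrationBounds A ρ δ) (v : C1c 2 B₀) (w : C1c 4 T.total) :
    ‖dirichletForm T.g T.total (h.liftC1 hB₀ v) w - dirichletForm gB B₀ v (h.averageC1 hB₀ w)‖ ≤
      2 * (24 * ε + 5 * δ) *
        (Real.sqrt ((dirichletForm gB B₀ v v).re + ‖C1c.toLp gB B₀ v‖ ^ 2) *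
          Real.sqrt ((dirichletForm T.g T.total w w).re + ‖C1c.toLp T.g T.total w‖ ^ 2)) := by
  obtain ⟨hV, hV2⟩ := C1c.memLp_cnorm_add gB v
  obtain ⟨hW, hW2⟩ := C1c.memLp_cnorm_add T.g w
  have hW' : MemLp (fun x => ((cnorm T.g x (differential (w : X → ℂ) x) +
      ‖(w : X → ℂ) x‖ : ℝ) : ℂ)) 2 (measureOn T.g T.total) := hW.ofReal
  have hK : 0 ≤ 24 * ε + 5 * δ := by positivity
  have key := (h.isFibered T hB₀ hB₀c).norm_integral_sub_le
    (C1c.integrable_covectorInner T.g (h.liftC1 hB₀ v) w)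
    (C1c.integrable_covectorInner gB v (h.averageC1 hB₀ w)) hV hW' hK
    ((ae_restrict_mem hB₀.measurableSet).mono fun b hb =>
      h.norm_fibre_sub_le hB₀ hε hε8 hδ hδ2 hg hbd v w hb)
  have e1 : ∀ x, ‖((cnorm T.g x (differential (w : X → ℂ) x) + ‖(w : X → ℂ) x‖ : ℝ) : ℂ)‖ ^ 2 =
      (cnorm T.g x (differential (w : X → ℂ) x) + ‖(w : X → ℂ) x‖) ^ 2 := fun x => by
    rw [Complex.norm_real, Real.norm_eq_abs, sq_abs]
  simp only [e1] at key
  refine key.trans ?_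
  rw [mul_comm (2 : ℝ), mul_assoc]
  refine mul_le_mul_of_nonneg_left ?_ hK
  refine (mul_le_mul (Real.sqrt_le_sqrt hV2) (Real.sqrt_le_sqrt hW2) (Real.sqrt_nonneg _)
    (Real.sqrt_nonneg _)).trans_eq ?_
  rw [Real.sqrt_mul zero_le_two, Real.sqrt_mul zero_le_two, mul_mul_mul_comm,
    Real.mul_self_sqrt zero_le_two]

end TorusFibration

end SemiFlat
end

noncomputable section
namespace SemiFlat

/-! ### Almost intertwined forms have almost intertwined resolvents. -/

section Hilbert

universe u u' v v'

variable {V : Type u} {W : Type u'} {H : Type v} {G : Type v'} [AddCommGroup V] [Module ℂ V]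
  [AddCommGroup W] [Module ℂ W]
  [NormedAddCommGroup H] [InnerProductSpace ℂ H] [CompleteSpace H]
  [NormedAddCommGroup G] [InnerProductSpace ℂ G] [CompleteSpace G]
  {ιV : V →ₗ[ℂ] H} {ιW : W →ₗ[ℂ] G} {aV : V → V → ℂ} {aW : W → W → ℂ}

/-- If two forms are almost intertwined by an isometry and its adjoint, then so are their
resolvents. -/
theorem norm_res_sub_le (FV : FormCompletion ιV aV) (FW : FormCompletion ιW aW) {α κ : ℝ}
    (hκ : 0 ≤ κ) (hα : 0 < α)
    (boundV : ∀ v, α * ‖ιV v‖ ^ 2 ≤ (aV v v).re) (boundW : ∀ w, α * ‖ιW w‖ ^ 2 ≤ (aW w w).re)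
    (j : H →ₗᵢ[ℂ] G) (J : V → W) (P : W → V) (hJ : ∀ v, ιW (J v) = j (ιV v))
    (hP : ∀ w, ιV (P w) = j.toContinuousLinearMap.adjoint (ιW w)) (hPJ : ∀ v, P (J v) = v)
    (hcomp : ∀ v w, ‖aW (J v) w - aV v (P w)‖ ≤ κ * (‖FV.emb v‖ * ‖FW.emb w‖))
    (f : H) (v : V) :
    Real.sqrt α * ‖FW.res (j f) - j (FV.res f)‖ ≤
      (2 + 2 * κ) * ‖FV.ext.adjoint f - FV.emb v‖ + κ * ‖FV.emb v‖ := by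
  -- Comparing the forms at `w = J v`, where `P (J v) = v`, gives `x² ≤ y² + κ x y` for the two
  -- norms, and this forces `x ≤ (1 + κ) y`.
  have hJ1 : ∀ v, ‖FW.emb (J v)‖ ≤ (1 + κ) * ‖FV.emb v‖ := by
    intro v
    have h1 := hcomp v (J v)
    rw [hPJ, ← FW.inner_emb, ← FV.inner_emb, inner_self_eq_norm_sq_to_K,
      inner_self_eq_norm_sq_to_K] at h1
    have h2 : ‖FW.emb (J v)‖ ^ 2 - ‖FV.emb v‖ ^ 2 ≤ κ * (‖FV.emb v‖ * ‖FW.emb (J v)‖) := by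
      refine le_trans (le_trans (le_abs_self _) (le_of_eq ?_)) h1
      rw [← Real.norm_eq_abs, ← Complex.norm_real]
      push_cast
      rfl
    by_contra! h3
    have hx := norm_nonneg (FV.emb v)
    nlinarith [mul_nonneg hκ hx, mul_nonneg hx (norm_nonneg (FW.emb (J v)))]
  -- Comparing the forms at `v = P w` and using the bound for `J (P w)`; the constant is `(1 + κ) +
  -- κ`.
  have hP1 : ∀ w, ‖FV.emb (P w)‖ ≤ (1 + 2 * κ) * ‖FW.emb w‖ := by
    intro w
    have h1 := hcomp (P w) w
    rw [← FW.inner_emb, ← FV.inner_emb] at h1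
    have h2 : ‖FV.emb (P w)‖ ^ 2 ≤ (1 + 2 * κ) * ‖FW.emb w‖ * ‖FV.emb (P w)‖ := by
      have h3 : ‖(Inner.inner ℂ (FV.emb (P w)) (FV.emb (P w)) : ℂ)‖ = ‖FV.emb (P w)‖ ^ 2 := by
        rw [inner_self_eq_norm_sq_to_K]; simp
      rw [← h3]
      have h4 := norm_sub_norm_le (Inner.inner ℂ (FV.emb (P w)) (FV.emb (P w)) : ℂ)
        (Inner.inner ℂ (FW.emb (J (P w))) (FW.emb w))
      rw [norm_sub_rev] at h4
      have h5 := norm_inner_le_norm (𝕜 := ℂ) (FW.emb (J (P w))) (FW.emb w)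
      have h6 := mul_le_mul_of_nonneg_right (hJ1 (P w)) (norm_nonneg (FW.emb w))
      nlinarith
    rcases (norm_nonneg (FV.emb (P w))).eq_or_lt with h0 | h0
    · rw [← h0]; positivity
    · rw [sq] at h2
      exact le_of_mul_le_mul_right h2 h0
  set θ := ‖FV.ext.adjoint f - FV.emb v‖ with hθ
  -- The defect of `J v` as a solution of the lifted equation. Since `P` is the adjoint of `j` on
  -- the cores, pairing `z` with `w` gives the defect `ext* f - v` of the base paired with `P w`,
  -- minus the intertwining error of the forms. As `J` is defined on the core only, `ext* f` cannot
  -- be inserted for `v`, which is why `θ` appears.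
  set z := FW.ext.adjoint (j f) - FW.emb (J v) with hz
  have hθ0 : 0 ≤ θ := norm_nonneg _
  have hz1 : ∀ x, ‖(Inner.inner ℂ z x : ℂ)‖ ≤ ((1 + 2 * κ) * θ + κ * ‖FV.emb v‖) * ‖x‖ := by
    intro x
    refine FW.dense.induction_on x ?_ ?_
    · exact isClosed_le (by fun_prop) (by fun_prop)
    · intro w
      have h1 : (Inner.inner ℂ z (FW.emb w) : ℂ) =
          Inner.inner ℂ (FV.ext.adjoint f - FV.emb v) (FV.emb (P w)) -
            (aW (J v) w - aV v (P w)) := by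
        rw [hz, inner_sub_left, inner_sub_left, ContinuousLinearMap.adjoint_inner_left,
          ContinuousLinearMap.adjoint_inner_left, FW.ext_emb, FV.ext_emb, hP,
          ContinuousLinearMap.adjoint_inner_right, FW.inner_emb, FV.inner_emb]
        simp
      rw [h1]
      refine (norm_sub_le _ _).trans ((add_le_add (norm_inner_le_norm _ _) (hcomp v w)).trans ?_)
      have := mul_le_mul_of_nonneg_left (hP1 w) hθ0
      rw [← hθ]
      nlinarith
  have hz2 : ‖z‖ ≤ (1 + 2 * κ) * θ + κ * ‖FV.emb v‖ := by
    have h1 := hz1 z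
    rw [inner_self_eq_norm_sq_to_K] at h1
    have h2 : ‖z‖ * ‖z‖ ≤ ((1 + 2 * κ) * θ + κ * ‖FV.emb v‖) * ‖z‖ := by
      refine le_of_eq_of_le ?_ h1
      simp [sq]
    rcases (norm_nonneg z).eq_or_lt with h0 | h0
    · rw [← h0]; positivity
    · exact le_of_mul_le_mul_right h2 h0
  have hs : ∀ {a b : ℝ}, 0 ≤ b → α * a ^ 2 ≤ b ^ 2 → Real.sqrt α * a ≤ b := by
    intro a b hb hab
    refine le_of_sq_le_sq ?_ hb
    rw [mul_pow, Real.sq_sqrt hα.le]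
    exact hab
  have h3 := hs (norm_nonneg _) (FW.norm_ext_le boundW z)
  have h4 := hs (norm_nonneg _) (FV.norm_ext_le boundV (FV.ext.adjoint f - FV.emb v))
  have h5 : FW.res (j f) - j (FV.res f) =
      FW.ext z - j (FV.ext (FV.ext.adjoint f - FV.emb v)) := by
    rw [hz, map_sub, map_sub, map_sub, FW.ext_emb, hJ, FV.ext_emb]
    change FW.ext (FW.ext.adjoint (j f)) - j (FV.ext (FV.ext.adjoint f)) = _
    abel
  rw [h5]
  have h6 := norm_sub_le (FW.ext z) (j (FV.ext (FV.ext.adjoint f - FV.emb v)))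
  rw [j.norm_map] at h6
  have h7 := mul_le_mul_of_nonneg_left h6 (Real.sqrt_nonneg α)
  rw [mul_add] at h7
  linarith

end Hilbert

namespace IsFibered

open ProbabilityTheory

variable {S X : Type*} [MeasurableSpace S] [MeasurableSpace X] {m : Measure S}
  {κ : Kernel S X} {a : S → ℝ} {p : X → S} {μ : Measure X} (H : IsFibered m κ a p μ)

theorem norm_lift_le : ‖H.lift.toContinuousLinearMap‖ ≤ 1 :=
  H.lift.norm_toContinuousLinearMap_le

theorem norm_adjoint_lift_le : ‖H.lift.toContinuousLinearMap.adjoint‖ ≤ 1 := by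
  rw [LinearIsometryEquiv.norm_map]
  exact H.norm_lift_le

theorem adjoint_lift_lift (f : Lp ℂ 2 m) :
    H.lift.toContinuousLinearMap.adjoint (H.lift f) = f := by
  refine ext_inner_left ℂ fun v => ?_
  rw [ContinuousLinearMap.adjoint_inner_right]
  exact H.lift.inner_map_map v f

theorem integral_lift_mul (F : Lp ℂ 2 m) (u : Lp ℂ 2 μ) :
    ∫ x, H.lift F x * u x ∂μ =
      Inner.inner ℂ (starL2 m F) (H.lift.toContinuousLinearMap.adjoint u) := by
  have h1 := H.integral_conj_lift_mul (Lp.memLp F).star (Lp.memLp u)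
  rw [L2.inner_def]
  refine (integral_congr_ae ?_).trans (h1.trans (integral_congr_ae ?_))
  · filter_upwards [H.coeFn_lift F] with x hx
    rw [hx]
    simp
  · filter_upwards [starL2_coeFn m F, H.coeFn_adjoint_lift u] with b h2 h3
    rw [h2, h3, RCLike.inner_apply, mul_comm]
    rfl

end IsFibered

/-! ### The abstract comparison applied to lift and average. -/

namespace TorusFibration

variable {S : Type*} [TopologicalSpace S] [ChartedSpace (EuclideanSpace ℝ (Fin 2)) S]
  [IsManifold (𝓡 2) ∞ S]
  {X : Type*} [TopologicalSpace X] [ChartedSpace (EuclideanSpace ℝ (Fin 4)) X]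
  [IsManifold (𝓡 4) ∞ X] {gB : Metric 2 S} {B₀ : Set S} {T : TorusFibration gB B₀ X}
  [MeasurableSpace X] [BorelSpace X] [T2Space X] [T2Space S]
  [MeasurableSpace S] [BorelSpace S] [SecondCountableTopology S]
  [SecondCountableTopology X] {A : S → ℝ} {ρ : X → ℝ}

theorem DisintegrationBounds.mono {δ δ' : ℝ} (h : T.DisintegrationBounds A ρ δ) (hδ : δ ≤ δ') :
    T.DisintegrationBounds A ρ δ' where
  ρ_near_one x hx := (h.ρ_near_one x hx).trans hδ
  grad_log_A b hb ξ :=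
    (h.grad_log_A b hb ξ).trans (mul_le_mul_of_nonneg_right hδ (Real.sqrt_nonneg _))
  grad_ρ x hx v hv :=
    (h.grad_ρ x hx v hv).trans (mul_le_mul_of_nonneg_right hδ (Real.sqrt_nonneg _))

/-- The `α` terms cancel exactly, because the average is the adjoint of the lift. The factor `1 +
α⁻¹` converts the `H¹` norms, in which `L²` norms have weight one, to the form norms with weight
`α`. -/
theorem IsDisintegration.norm_form_sub_le (h : T.IsDisintegration A ρ) (hB₀ : IsOpen B₀)
    (hB₀c : IsCompact (closure B₀))
    {ε δ α : ℝ} (hε : 0 ≤ ε) (hε8 : ε ≤ 1 / 8) (hδ : 0 ≤ δ) (hδ2 : δ ≤ 1 / 2) (hα : 0 < α)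
    (hg : ∀ x ∈ T.total, ∀ v w : TangentSpace (𝓡 4) x, |T.g.inner x v w - T.gRef x v w| ≤
      ε * Real.sqrt (T.gRef x v v) * Real.sqrt (T.gRef x w w))
    (hbd : T.DisintegrationBounds A ρ δ)
    (FB : FormCompletion (C1c.toLp gB B₀) (C1c.form gB B₀ α))
    (FT : FormCompletion (C1c.toLp T.g T.total) (C1c.form T.g T.total α))
    (v : C1c 2 B₀) (w : C1c 4 T.total) :
    ‖C1c.form T.g T.total α (h.liftC1 hB₀ v) w - C1c.form gB B₀ α v (h.averageC1 hB₀ w)‖ ≤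
      2 * (24 * ε + 5 * δ) * (1 + α⁻¹) * (‖FB.emb v‖ * ‖FT.emb w‖) := by
  have h1 := h.norm_dirichletForm_sub_le hB₀ hB₀c hε hε8 hδ hδ2 hg hbd v w
  have h2 : C1c.form T.g T.total α (h.liftC1 hB₀ v) w - C1c.form gB B₀ α v (h.averageC1 hB₀ w) =
      dirichletForm T.g T.total (h.liftC1 hB₀ v) w -
        dirichletForm gB B₀ v (h.averageC1 hB₀ w) := by
    unfold C1c.form
    rw [h.toLp_liftC1 hB₀ hB₀c, h.toLp_averageC1 hB₀ hB₀c,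
      ContinuousLinearMap.adjoint_inner_right, LinearIsometry.coe_toContinuousLinearMap]
    ring
  have hs : ∀ {e q N : ℝ}, 0 ≤ e → 0 ≤ N → N ^ 2 = e + α * q ^ 2 →
      Real.sqrt (e + q ^ 2) ≤ Real.sqrt (1 + α⁻¹) * N := by
    intro e q N he hN hq
    rw [← Real.sqrt_sq hN, ← Real.sqrt_mul (by positivity), hq]
    refine Real.sqrt_le_sqrt ?_
    have e1 : (1 + α⁻¹) * (e + α * q ^ 2) = e + q ^ 2 + (α⁻¹ * e + α * q ^ 2) := by
      field_simp
      ring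
    rw [e1]
    have : 0 ≤ α⁻¹ * e + α * q ^ 2 := by positivity
    linarith
  rw [h2, mul_assoc _ (1 + α⁻¹)]
  refine h1.trans (mul_le_mul_of_nonneg_left ?_ (by positivity))
  have e1 := hs (C1c.dirichletForm_self_nonneg gB v) (norm_nonneg _) (FB.norm_emb_sq v)
  have e2 := hs (C1c.dirichletForm_self_nonneg T.g w) (norm_nonneg _) (FT.norm_emb_sq w)
  refine (mul_le_mul e1 e2 (Real.sqrt_nonneg _) (by positivity)).trans_eq ?_
  rw [mul_mul_mul_comm, Real.mul_self_sqrt (by positivity)]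

end TorusFibration

/-! ### Convergence of the resolvents along the family. -/

section Family

variable {S : Type*} [TopologicalSpace S] [ChartedSpace (EuclideanSpace ℝ (Fin 2)) S]
  [IsManifold (𝓡 2) ∞ S] [T2Space S] [MeasurableSpace S] [BorelSpace S]
  [SecondCountableTopology S] {gB : Metric 2 S} {B₀ : Set S}
  {ι : Type*} {l : Filter ι} {X : ι → Type*} [∀ t, TopologicalSpace (X t)] [∀ t, T2Space (X t)]
  [∀ t, SecondCountableTopology (X t)]
  [∀ t, ChartedSpace (EuclideanSpace ℝ (Fin 4)) (X t)] [∀ t, IsManifold (𝓡 4) ∞ (X t)]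
  [∀ t, MeasurableSpace (X t)] [∀ t, BorelSpace (X t)]
  {T : ∀ t, TorusFibration gB B₀ (X t)} {A : ι → S → ℝ} {ρ : ∀ t, X t → ℝ} {ε : ι → ℝ} {C : ℝ}

/-- Asymptotic intertwining of the resolvents. -/
theorem tendsto_norm_res_sub (hB₀ : IsOpen B₀) (hB₀c : IsCompact (closure B₀))
    (hε : ∀ t, 0 ≤ ε t) (hε0 : Tendsto ε l (𝓝 0))
    (hg : ∀ t, ∀ x ∈ (T t).total, ∀ v w : TangentSpace (𝓡 4) x,
      |(T t).g.inner x v w - (T t).gRef x v w| ≤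
      ε t * Real.sqrt ((T t).gRef x v v) * Real.sqrt ((T t).gRef x w w))
    (hdis : ∀ t, (T t).IsDisintegration (A t) (ρ t))
    (hbd : ∀ t, (T t).DisintegrationBounds (A t) (ρ t) (C * ε t)) {α : ℝ} (hα : 0 < α)
    (FB : FormCompletion (C1c.toLp gB B₀) (C1c.form gB B₀ α))
    (FT : ∀ t, FormCompletion (C1c.toLp (T t).g (T t).total) (C1c.form (T t).g (T t).total α))
    (f : L2 gB B₀) :
    Tendsto (fun t => ‖(FT t).res (((hdis t).isFibered (T t) hB₀ hB₀c).lift f) -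
      ((hdis t).isFibered (T t) hB₀ hB₀c).lift (FB.res f)‖) l (𝓝 0) := by
  set κ : ι → ℝ := fun t => 2 * (24 * ε t + 5 * (|C| * ε t)) * (1 + α⁻¹) with hκ
  have hκ0 : Tendsto κ l (𝓝 0) := by
    have h1 := ((((hε0.const_mul 24).add ((hε0.const_mul |C|).const_mul 5)).const_mul 2).mul_const
      (1 + α⁻¹))
    simpa using h1
  have hκn : ∀ t, 0 ≤ κ t := fun t => by
    have := hε t
    positivity
  have hev : ∀ᶠ t in l, ∀ v : C1c 2 B₀, Real.sqrt α *
      ‖(FT t).res (((hdis t).isFibered (T t) hB₀ hB₀c).lift f) -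
        ((hdis t).isFibered (T t) hB₀ hB₀c).lift (FB.res f)‖ ≤
      (2 + 2 * κ t) * ‖FB.ext.adjoint f - FB.emb v‖ + κ t * ‖FB.emb v‖ := by
    have h1 : ∀ᶠ t in l, ε t ≤ 1 / 8 := hε0.eventually_le_const (by norm_num)
    have h2 : ∀ᶠ t in l, |C| * ε t ≤ 1 / 2 := by
      have h3 : Tendsto (fun t => |C| * ε t) l (𝓝 0) := by simpa using hε0.const_mul |C|
      exact h3.eventually_le_const (by norm_num)
    filter_upwards [h1, h2] with t h1 h2 v
    exact norm_res_sub_le FB (FT t) (hκn t) hα (C1c.form_bound gB α) (C1c.form_bound (T t).g α)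
      ((hdis t).isFibered (T t) hB₀ hB₀c).lift ((hdis t).liftC1 hB₀) ((hdis t).averageC1 hB₀)
      ((hdis t).toLp_liftC1 hB₀ hB₀c) ((hdis t).toLp_averageC1 hB₀ hB₀c)
      ((hdis t).averageC1_liftC1 hB₀)
      ((hdis t).norm_form_sub_le hB₀ hB₀c (hε t) h1 (mul_nonneg (abs_nonneg C) (hε t)) h2 hα (hg t)
        ((hbd t).mono (mul_le_mul_of_nonneg_right (le_abs_self C) (hε t))) FB (FT t)) f v
  have hs : 0 < Real.sqrt α := Real.sqrt_pos.2 hα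
  rw [Metric.tendsto_nhds]
  intro e he
  -- The core element is fixed before `t` varies. The error bound then tends to twice the distance
  -- from `v` to `ext* f`, which is below `√α e` by this choice.
  obtain ⟨v, hv⟩ := FB.dense.exists_dist_lt (FB.ext.adjoint f)
    (show 0 < Real.sqrt α * e / 4 by positivity)
  rw [dist_eq_norm] at hv
  have hlim : Tendsto (fun t => (2 + 2 * κ t) * ‖FB.ext.adjoint f - FB.emb v‖ +
      κ t * ‖FB.emb v‖) l (𝓝 (2 * ‖FB.ext.adjoint f - FB.emb v‖)) := by
    have h1 := (((hκ0.const_mul 2).const_add 2).mul_const ‖FB.ext.adjoint f - FB.emb v‖).add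
      (hκ0.mul_const ‖FB.emb v‖)
    simpa using h1
  have hlt : 2 * ‖FB.ext.adjoint f - FB.emb v‖ < Real.sqrt α * e := by
    have := mul_pos hs he
    linarith
  filter_upwards [hev, hlim.eventually_lt_const hlt] with t h1 h2
  rw [Real.dist_eq, sub_zero, abs_norm]
  exact lt_of_mul_lt_mul_left ((h1 v).trans_lt h2) hs.le

end Family

end SemiFlat
end

noncomputable section
namespace SemiFlat

/-! ### Compressed resolvents, heat operators and kernel pairings. -/

section Family

variable {S : Type*} [TopologicalSpace S] [ChartedSpace (EuclideanSpace ℝ (Fin 2)) S]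
  [IsManifold (𝓡 2) ∞ S] [T2Space S] [MeasurableSpace S] [BorelSpace S]
  [SecondCountableTopology S] {gB : Metric 2 S} {B₀ : Set S}
  {ι : Type*} {l : Filter ι} {X : ι → Type*} [∀ t, TopologicalSpace (X t)] [∀ t, T2Space (X t)]
  [∀ t, SecondCountableTopology (X t)]
  [∀ t, ChartedSpace (EuclideanSpace ℝ (Fin 4)) (X t)] [∀ t, IsManifold (𝓡 4) ∞ (X t)]
  [∀ t, MeasurableSpace (X t)] [∀ t, BorelSpace (X t)]
  {T : ∀ t, TorusFibration gB B₀ (X t)} {A : ι → S → ℝ} {ρ : ∀ t, X t → ℝ} {ε : ι → ℝ} {C : ℝ}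

theorem isResolvent_resolventOp_of_isOpen {n : ℕ} {M : Type*} [TopologicalSpace M]
    [ChartedSpace (EuclideanSpace ℝ (Fin n)) M] [IsManifold (𝓡 n) ∞ M] [T2Space M]
    [SecondCountableTopology M] [MeasurableSpace M] [BorelSpace M] (g : Metric n M) {U : Set M}
    (hU : IsOpen U) {α : ℝ} (hα : 0 < α) : IsResolvent g U α (resolventOp g U α) := by
  obtain ⟨F⟩ := C1c.nonempty_formCompletion g U hα
  exact isResolvent_resolventOp (F.isResolvent (testFunctionsDense g hU) hα)

/-- Apply the contraction `P_t` to the intertwining estimate and use `P_t I_t = 1` on the base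
resolvent. -/
theorem tendsto_average_resolventOp (hB₀ : IsOpen B₀) (hB₀c : IsCompact (closure B₀))
    (hε : ∀ t, 0 ≤ ε t) (hε0 : Tendsto ε l (𝓝 0))
    (hg : ∀ t, ∀ x ∈ (T t).total, ∀ v w : TangentSpace (𝓡 4) x,
      |(T t).g.inner x v w - (T t).gRef x v w| ≤
      ε t * Real.sqrt ((T t).gRef x v v) * Real.sqrt ((T t).gRef x w w))
    (hdis : ∀ t, (T t).IsDisintegration (A t) (ρ t))
    (hbd : ∀ t, (T t).DisintegrationBounds (A t) (ρ t) (C * ε t)) {α : ℝ} (hα : 0 < α)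
    (f : L2 gB B₀) :
    Tendsto (fun t => (T t).average (A t) (ρ t)
      (resolventOp (T t).g (T t).total α ((T t).lift (A t) f))) l
      (𝓝 (resolventOp gB B₀ α f)) := by
  obtain ⟨FB⟩ := C1c.nonempty_formCompletion gB B₀ hα
  have FT := fun t => (C1c.nonempty_formCompletion (T t).g (T t).total hα).some
  have h := tendsto_norm_res_sub hB₀ hB₀c hε hε0 hg hdis hbd hα FB FT f
  rw [FB.resolventOp_eq (testFunctionsDense gB hB₀) hα, tendsto_iff_norm_sub_tendsto_zero]
  refine squeeze_zero (fun t => norm_nonneg _) (fun t => ?_) h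
  have H := (hdis t).isFibered (T t) hB₀ hB₀c
  rw [(FT t).resolventOp_eq (testFunctionsDense (T t).g ((T t).isOpen_total hB₀)) hα,
    (hdis t).lift_eq (T t) hB₀ hB₀c, (hdis t).average_eq (T t) hB₀ hB₀c,
    ← H.adjoint_lift_lift (FB.res f), ← map_sub]
  refine (ContinuousLinearMap.le_of_opNorm_le _ H.norm_adjoint_lift_le _).trans_eq ?_
  rw [one_mul, H.adjoint_lift_lift]

theorem tendstoUniformlyOn_average_heatOp (hB₀ : IsOpen B₀) (hB₀c : IsCompact (closure B₀))
    (hε : ∀ t, 0 ≤ ε t) (hε0 : Tendsto ε l (𝓝 0))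
    (hg : ∀ t, ∀ x ∈ (T t).total, ∀ v w : TangentSpace (𝓡 4) x,
      |(T t).g.inner x v w - (T t).gRef x v w| ≤
      ε t * Real.sqrt ((T t).gRef x v v) * Real.sqrt ((T t).gRef x w w))
    (hdis : ∀ t, (T t).IsDisintegration (A t) (ρ t))
    (hbd : ∀ t, (T t).DisintegrationBounds (A t) (ρ t) (C * ε t))
    (f : L2 gB B₀) {K : Set ℝ} (hK : IsCompact K) (hK0 : K ⊆ Ioi 0) :
    TendstoUniformlyOn (fun t τ => (T t).average (A t) (ρ t)
      (heatOp (T t).g (T t).total τ ((T t).lift (A t) f)))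
      (fun τ => heatOp gB B₀ τ f) l K := by
  obtain ⟨FB⟩ := C1c.nonempty_formCompletion gB B₀ one_pos
  have FT := fun t => (C1c.nonempty_formCompletion (T t).g (T t).total one_pos).some
  have h := tendsto_norm_res_sub hB₀ hB₀c hε hε0 hg hdis hbd one_pos FB FT
  have H := fun t => (hdis t).isFibered (T t) hB₀ hB₀c
  have key := tendstoUniformlyOn_expOfResolvent (l := l) (S := fun t => (FT t).res) (R := FB.res)
    (J := fun t => (H t).lift.toContinuousLinearMap)
    (P := fun t => (H t).lift.toContinuousLinearMap.adjoint)
    (fun t => (FT t).res_nonneg)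
    (fun t => (FT t).norm_res_le_one (C1c.form_bound (T t).g 1)) FB.res_nonneg
    (FB.norm_res_le_one (C1c.form_bound gB 1)) (fun t => (H t).norm_lift_le)
    (fun t => (H t).norm_adjoint_lift_le) (fun t => (H t).adjoint_lift_lift) h f hK hK0
  have e1 : ∀ t τ, (T t).average (A t) (ρ t)
      (heatOp (T t).g (T t).total τ ((T t).lift (A t) f)) =
      (H t).lift.toContinuousLinearMap.adjoint (expOfResolvent (FT t).res τ
        ((H t).lift.toContinuousLinearMap f)) := fun t τ => by
    rw [heatOp, (FT t).resolventOp_eq (testFunctionsDense (T t).g ((T t).isOpen_total hB₀)) one_pos,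
      (hdis t).lift_eq (T t) hB₀ hB₀c, (hdis t).average_eq (T t) hB₀ hB₀c]
    rfl
  have e2 : (fun τ => heatOp gB B₀ τ f) = fun τ => expOfResolvent FB.res τ f := by
    simp only [heatOp, FB.resolventOp_eq (testFunctionsDense gB hB₀) one_pos]
  rw [e2]
  exact key.congr (Eventually.of_forall fun t τ _ => (e1 t τ).symm)

/-- The kernel pairing is the bilinear pairing with the heat operator; moving the lift of `Φ` across
by adjointness leaves an inner product on the fixed space `L²(B₀)`, with `Φ` conjugated because the
pairing is bilinear. -/
theorem kernelPairing_lift {t : ι} (h : (T t).IsDisintegration (A t) (ρ t)) (hB₀ : IsOpen B₀)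
    (hB₀c : IsCompact (closure B₀)) {τ : ℝ} {K : X t → X t → ℝ}
    (hK : IsHeatKernel (T t).g (T t).total τ K) (Φ Ψ : L2 gB B₀) :
    kernelPairing (T t).g (T t).total K ((T t).lift (A t) Φ) ((T t).lift (A t) Ψ) =
      Inner.inner ℂ (starL2 _ Φ) ((T t).average (A t) (ρ t)
        (heatOp (T t).g (T t).total τ ((T t).lift (A t) Ψ))) := by
  refine (hK.2.2 _ _).symm.trans ?_
  rw [h.average_eq (T t) hB₀ hB₀c, ← IsFibered.integral_lift_mul, h.lift_eq (T t) hB₀ hB₀c Φ]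

theorem kernelPairing_eq_inner {n : ℕ} {M : Type*} [TopologicalSpace M]
    [ChartedSpace (EuclideanSpace ℝ (Fin n)) M] [IsManifold (𝓡 n) ∞ M] [MeasurableSpace M]
    {g : Metric n M} {U : Set M} {τ : ℝ} {K : M → M → ℝ}
    (hK : IsHeatKernel g U τ K) (Φ Ψ : L2 g U) :
    kernelPairing g U K Φ Ψ = Inner.inner ℂ (starL2 _ Φ) (heatOp g U τ Ψ) := by
  refine (hK.2.2 _ _).symm.trans ?_
  rw [L2.inner_def]
  refine integral_congr_ae ?_
  filter_upwards [starL2_coeFn _ Φ] with x hx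
  rw [hx, RCLike.inner_apply, Complex.conj_conj, mul_comm]

end Family

end SemiFlat
end

theorem mainTheorem5
    {B : Type*} [TopologicalSpace B] [T2Space B] [SecondCountableTopology B]
    [ChartedSpace (EuclideanSpace ℝ (Fin 2)) B] [IsManifold (𝓡 2) ∞ B]
    [MeasurableSpace B] [BorelSpace B]
    (D : Finset B)
    (gB : SemiFlat.Metric 2 (SemiFlat.regularLocus D))
    (B₀ : Set (SemiFlat.regularLocus D)) (hB₀ : IsOpen B₀) (hB₀c : IsCompact (closure B₀))
    (t₀ : ℝ) (ht₀ : 0 < t₀)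
    (X : Ioc (0 : ℝ) t₀ → Type*) [∀ t, TopologicalSpace (X t)] [∀ t, T2Space (X t)]
    [∀ t, SecondCountableTopology (X t)]
    [∀ t, ChartedSpace (EuclideanSpace ℝ (Fin 4)) (X t)] [∀ t, IsManifold (𝓡 4) ∞ (X t)]
    [∀ t, MeasurableSpace (X t)] [∀ t, BorelSpace (X t)]
    (T : ∀ t, SemiFlat.TorusFibration gB B₀ (X t))
    (s ε : Ioc (0 : ℝ) t₀ → ℝ)
    (hs : ∀ t, 0 < s t) (hs0 : Tendsto s (SemiFlat.toZero t₀) (𝓝 0))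
    (hε : ∀ t, 0 ≤ ε t) (hε0 : Tendsto ε (SemiFlat.toZero t₀) (𝓝 0))
    (hsf : ∀ t, (T t).SemiFlatControl (ε t) (s t))
    (c : ℝ) (hc : 0 < c) (hgap : ∀ t, (T t).VerticalGap (c * (s t)⁻¹ ^ 2))
    (A : Ioc (0 : ℝ) t₀ → SemiFlat.regularLocus D → ℝ) (ρ : ∀ t, X t → ℝ)
    (hdis : ∀ t, (T t).IsDisintegration (A t) (ρ t))
    (C : ℝ) (hbd : ∀ t, (T t).DisintegrationBounds (A t) (ρ t) (C * ε t)) :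
    -- the objects in the convergence statements are well defined
    ((∀ α : ℝ, 0 < α →
        SemiFlat.IsResolvent gB B₀ α (SemiFlat.resolventOp gB B₀ α) ∧
        ∀ t, SemiFlat.IsResolvent (T t).g (T t).total α
          (SemiFlat.resolventOp (T t).g (T t).total α)) ∧
      (∀ t, ∀ v : SemiFlat.L2 gB B₀,
        MemLp ((T t).liftFun (A t) v) 2 (SemiFlat.measureOn (T t).g (T t).total)) ∧
      (∀ t, ∀ u : SemiFlat.L2 (T t).g (T t).total,
        MemLp ((T t).averageFun (A t) (ρ t) u) 2 (SemiFlat.measureOn gB B₀)) ∧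
      (∀ τ : ℝ, 0 < τ → (∃ K, SemiFlat.IsHeatKernel gB B₀ τ K) ∧
        ∀ t, ∃ K, SemiFlat.IsHeatKernel (T t).g (T t).total τ K)) ∧
    -- strong convergence of the compressed resolvents
    (∀ α : ℝ, 0 < α → ∀ f : SemiFlat.L2 gB B₀,
      Tendsto (fun t => (T t).average (A t) (ρ t)
          (SemiFlat.resolventOp (T t).g (T t).total α ((T t).lift (A t) f)))
        (SemiFlat.toZero t₀) (𝓝 (SemiFlat.resolventOp gB B₀ α f))) ∧
    -- strong convergence of the compressed heat operators, uniformly on compact sets of times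
    (∀ f : SemiFlat.L2 gB B₀, ∀ J : Set ℝ, IsCompact J → J ⊆ Ioi 0 →
      TendstoUniformlyOn (fun t τ => (T t).average (A t) (ρ t)
          (SemiFlat.heatOp (T t).g (T t).total τ ((T t).lift (A t) f)))
        (fun τ => SemiFlat.heatOp gB B₀ τ f) (SemiFlat.toZero t₀) J) ∧
    -- convergence of the bilinear heat kernel pairings
    (∀ τ : ℝ, 0 < τ → ∀ (K : ∀ t, X t → X t → ℝ)
        (KB : SemiFlat.regularLocus D → SemiFlat.regularLocus D → ℝ),
      (∀ t, SemiFlat.IsHeatKernel (T t).g (T t).total τ (K t)) →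
      SemiFlat.IsHeatKernel gB B₀ τ KB →
      ∀ Φ Ψ : SemiFlat.L2 gB B₀,
        Tendsto (fun t => SemiFlat.kernelPairing (T t).g (T t).total (K t)
            ((T t).lift (A t) Φ) ((T t).lift (A t) Ψ))
          (SemiFlat.toZero t₀) (𝓝 (SemiFlat.kernelPairing gB B₀ KB Φ Ψ))) := by
  have hunif := SemiFlat.tendstoUniformlyOn_average_heatOp hB₀ hB₀c hε hε0 (fun t => (hsf t).1)
    hdis hbd
  refine ⟨⟨fun α hα => ⟨SemiFlat.isResolvent_resolventOp_of_isOpen gB hB₀ hα, fun t =>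
      SemiFlat.isResolvent_resolventOp_of_isOpen (T t).g ((T t).isOpen_total hB₀) hα⟩,
    fun t => (hdis t).memLp_liftFun (T t) hB₀ hB₀c,
    fun t => (hdis t).memLp_averageFun (T t) hB₀ hB₀c,
    fun τ hτ => ⟨SemiFlat.exists_isHeatKernel gB hB₀ hB₀c hτ, fun t =>
      SemiFlat.exists_isHeatKernel (T t).g ((T t).isOpen_total hB₀) (T t).precompact hτ⟩⟩,
    fun α hα f => SemiFlat.tendsto_average_resolventOp hB₀ hB₀c hε hε0 (fun t => (hsf t).1)
      hdis hbd hα f,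
    fun f J hJ hJ0 => hunif f hJ hJ0, fun τ hτ K KB hK hKB Φ Ψ => ?_⟩
  rw [SemiFlat.kernelPairing_eq_inner hKB]
  -- At a fixed time the uniform statement is applied to the compact set `{τ}`.
  refine (tendsto_const_nhds.inner ((hunif Ψ isCompact_singleton
    (singleton_subset_iff.2 hτ)).tendsto_at (mem_singleton τ))).congr fun t => ?_
  exact (SemiFlat.kernelPairing_lift (hdis t) hB₀ hB₀c (hK t) Φ Ψ).symm
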